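/- Fix $0<\delta<\frac{1}{2\sin(\pi/7)}-1$ and let $\mathscr V(r)=+\infty$ for $r<1$, $\mathscr V(r)=-1+\frac{r-1}{\delta}$ for $1\le r\le 1+\delta$, $\mathscr V(r)=0$ for $r>1+\delta$. For a finite set $X\subset\mathbb R^2$ put $\mathcal E(X)=\frac12\sum_{x\in X}\sum_{y\in X\setminus\{x\}}\mathscr V(|x-y|)$, and let $G(X)$ be the graph with vertex set $X$ whose edges (bonds) are the pairs $e=\{x,y\}\subset X$ with $1\le|x-y|\le1+\delta$, drawn as the segments $[x,y]$; write $|e|=|x-y|$, and say that $e$ lies on a set if $[x,y]$ is contained in it. Let $\mathsf{Ed}(X)$ be the set of bonds. A face of $X$ is a bounded, simply connected component of $\mathbb R^2\setminus\big(X\cup\bigcup_{\{x,y\}\in\mathsf{Ed}(X)}[x,y]\big)$; $\mathsf F(X)$ is the set of faces and $O(X)$ the union of their closures. A bond is a boundary edge if it lies on $\partial O(X)$ (set $\mathsf{Ed}^{\partial}$), an interior edge if it lies on the boundaries of two distinct faces, and an exterior wire edge if it lies on the boundary of no face (set $\mathsf{Ed}^{\mathrm{wire,ext}}$). Let $\partial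 X$ be the set of endpoints of the bonds in $\mathsf{Ed}^{\partial}\cup\mathsf{Ed}^{\mathrm{wire,ext}}$. Put $$\mathrm{Per}(X)=\sharp\mathsf{Ed}^{\partial}+2\,\sharp\mathsf{Ed}^{\mathrm{wire,ext}},\qquad \chi(X)=\sharp X-\sharp\mathsf{Ed}(X)+\sharp\mathsf F(X).$$ For a face $f$, let $\mathrm{Per}(f)$ be the number of bonds lying on $\partial\overline f$ plus twice the number of bonds lying on $\partial f$ but not on $\partial\overline f$. Put $$\mu(X)=\sum_{f\in\mathsf F(X),\ \mathrm{Per}(f)\neq3}(\mathrm{Per}(f)-3),\qquad \mathcal E_{\mathrm{el}}(X)=\frac12\sum_{\substack{x,y\in X\\ 1<|x-y|\le1+\delta}}\big(1+\mathscr V(|x-y|)\big),$$ $$\mathcal F(X)=\mathrm{Per}(X)+\mu(X)+3\chi(X)+\mathcal E_{\mathrm{el}}(X).$$ Let $X\subset\mathbb R^2$ be finite with $\mathcal E(X)<+\infty$, such that $G(X)$ is connected, $\partial O(X)$ is a simple closed polygon, and $X':=X\setminus\partial X$ is non-empty. Then $$\mathcal F(X)\ \ge\ \mathcal F(X')+6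 .$$ Moreover, if equality holds, then: 1. for every $x\in\partial X$, $\alpha(x)=\big(\sharp I^{\mathrm{inner}}(x)+\sharp I^{\mathrm{bdry}}(x)-1\big)\frac{\pi}{3}$, where $I^{\mathrm{inner}}(x)$ and $I^{\mathrm{bdry}}(x)$ are the sets of interior and of boundary edges with endpoint $x$, and $\alpha(x)$ is the inner angle of $O(X)$ at $x$, that is, the angle spanned by the boundary edges at $x$ and measured inside $O(X)$ (by convention $\alpha(x)=0$ if $x\notin O(X)$); 2. every bond $e$ with an endpoint in $\partial X$ has length $|e|=1$; 3. $\mu(X)=\mu(X')$. -/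

import Mathlib

open scoped Topology

namespace SoftDisc

noncomputable section

/-! The Euclidean plane is `ℂ` with its usual norm. A bond or edge is an unordered pair
of points, an element of `Sym2 ℂ`. -/

/-- The closed segment `[x, y]` carried by an unordered pair `{x, y}`. -/
def seg (e : Sym2 ℂ) : Set ℂ :=
  Sym2.lift ⟨fun x y : ℂ => segment ℝ x y, fun x y => segment_symm ℝ x y⟩ e

/-- The length `|x - y|` of an unordered pair `{x, y}`. -/
def len (e : Sym2 ℂ) : ℝ :=
  Sym2.lift ⟨fun x y : ℂ => dist x y, fun x y => dist_comm x y⟩ e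

/-! ### Graphs in the plane -/

/-- A finite graph whose vertices are points of the plane and whose edges are drawn as
straight segments. -/
structure PlaneGraph where
  /-- the set of vertices -/
  verts : Finset ℂ
  /-- the adjacency relation, as a simple graph on the whole plane -/
  graph : SimpleGraph ℂ
  /-- edges join vertices (together with the symmetry of adjacency) -/
  mem_of_adj : ∀ x y, graph.Adj x y → x ∈ verts

namespace PlaneGraph

variable (G : PlaneGraph)

/-- The set of edges. -/
def Ed : Set (Sym2 ℂ) := G.graph.edgeSet

/-- `G` is connected as a graph on its own vertices. -/
def Connected : Prop := (G.graph.induce (G.verts : Set ℂ)).Connected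

/-- The subset of the plane covered by the drawing: vertices and closed edges. -/
def drawing : Set ℂ := (G.verts : Set ℂ) ∪ ⋃ e ∈ G.Ed, seg e

/-- The faces: the bounded connected components of the complement of the drawing that are
simply connected. (They are open, since the drawing is closed.) -/
def faces : Set (Set ℂ) :=
  {f | (∃ z ∈ G.drawingᶜ, f = connectedComponentIn G.drawingᶜ z) ∧
    Bornology.IsBounded f ∧ IsSimplyConnected f}

/-- The union `O(G)` of the closures of all faces. -/
def O : Set ℂ := ⋃ f ∈ G.faces, closure f

/-- The Euler characteristic `♯ vertices - ♯ edges + ♯ faces`. -/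
def chi : ℤ := (G.verts.card : ℤ) - (G.Ed.ncard : ℤ) + (G.faces.ncard : ℤ)

/-- Interior edges: those that lie on the boundary of two distinct faces. -/
def EdInt : Set (Sym2 ℂ) :=
  {e ∈ G.Ed | ∃ f ∈ G.faces, ∃ g ∈ G.faces, f ≠ g ∧ seg e ⊆ frontier f ∧ seg e ⊆ frontier g}

/-- Exterior wire edges: those that do not lie on the boundary of any face. -/
def EdWireExt : Set (Sym2 ℂ) :=
  {e ∈ G.Ed | ∀ f ∈ G.faces, ¬ seg e ⊆ frontier f}

/-- Boundary edges: those that lie on the boundary of `O(G)`. -/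
def EdBd : Set (Sym2 ℂ) :=
  {e ∈ G.Ed | seg e ⊆ frontier G.O}

/-- The graph-perimeter of `G`. -/
def per : ℕ := G.EdBd.ncard + 2 * G.EdWireExt.ncard

/-- The edges that lie on the boundary of the closure of `f`. -/
def faceEdBd (f : Set ℂ) : Set (Sym2 ℂ) :=
  {e ∈ G.Ed | seg e ⊆ frontier (closure f)}

/-- The edges that lie on the boundary of `f` but not on the boundary of its closure. -/
def faceEdWireInt (f : Set ℂ) : Set (Sym2 ℂ) :=
  {e ∈ G.Ed | seg e ⊆ frontier f ∧ ¬ seg e ⊆ frontier (closure f)}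

/-- The graph-perimeter of a face `f`. -/
def facePer (f : Set ℂ) : ℕ := (G.faceEdBd f).ncard + 2 * (G.faceEdWireInt f).ncard

/-- The defect measure: the sum of `Per(f) - 3` over the non-triangular faces `f`. -/
def defect : ℤ := ∑ᶠ f ∈ {f ∈ G.faces | G.facePer f ≠ 3}, ((G.facePer f : ℤ) - 3)

open Classical in
/-- The boundary points: the endpoints of boundary edges and of exterior wire edges. -/
def bdry : Finset ℂ :=
  G.verts.filter fun x => ∃ y, s(x, y) ∈ G.EdBd ∪ G.EdWireExt

/-- The boundary edges that emanate from `x`. -/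
def IBdry (x : ℂ) : Set (Sym2 ℂ) := {e ∈ G.EdBd | x ∈ e}

/-- The interior edges that emanate from `x`. -/
def IInner (x : ℂ) : Set (Sym2 ℂ) := {e ∈ G.EdInt | x ∈ e}

/-- The inner angle at `x`: the angular measure of the set of directions in which one enters
`O(G)` when leaving `x`. At a vertex of a polygonal region this is the angle in `(0, 2π)`
that the two sides at that vertex span on the side of the region. -/
def innerAngle (x : ℂ) : ℝ :=
  (MeasureTheory.volume {θ : ℝ | θ ∈ Set.Ioc (-Real.pi) Real.pi ∧
    ∀ᶠ r : ℝ in 𝓝[>] 0, x + (r : ℂ) * Complex.exp ((θ : ℂ) * Complex.I) ∈ G.O}).toReal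

end PlaneGraph

/-- A polygon is simple if its vertices are distinct and two different sides have no point
in common, except for a vertex which is an endpoint of both of them. -/
def IsSimplePolygon {n : ℕ} (P : Polygon ℂ n) : Prop :=
  Function.Injective P.vertices ∧
    ∀ i j : Fin n, i ≠ j → P.edgeSet ℝ i ∩ P.edgeSet ℝ j ⊆
      {P i, P (finRotate n i)} ∩ {P j, P (finRotate n j)}

/-- The boundary of `O(G)` is a simple closed polygon. -/
def PlaneGraph.HasSimplePolygonalBoundary (G : PlaneGraph) : Prop :=
  ∃ n : ℕ, 3 ≤ n ∧ ∃ P : Polygon ℂ n, IsSimplePolygon P ∧ frontier G.O = P.boundary ℝ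

/-! ### The soft disc model -/

/-- The soft disc potential. -/
def V (δ r : ℝ) : EReal :=
  if r < 1 then ⊤ else if r ≤ 1 + δ then ((-1 + (r - 1) / δ : ℝ) : EReal) else 0

/-- The energy of a finite configuration. -/
def energy (δ : ℝ) (X : Finset ℂ) : EReal :=
  ((1 / 2 : ℝ) : EReal) * ∑ x ∈ X, ∑ y ∈ X.erase x, V δ (dist x y)

/-- The graph generated by `X`: two points are bonded if `1 ≤ |x - y| ≤ 1 + δ`. -/
def bondGraph (δ : ℝ) (X : Finset ℂ) : PlaneGraph where
  verts := X
  graph :=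
    { Adj := fun x y => x ∈ X ∧ y ∈ X ∧ x ≠ y ∧ 1 ≤ dist x y ∧ dist x y ≤ 1 + δ
      symm := ⟨fun x y h => ⟨h.2.1, h.1, h.2.2.1.symm, by
        rw [dist_comm y x]; exact h.2.2.2⟩⟩
      loopless := ⟨fun x h => h.2.2.1 rfl⟩ }
  mem_of_adj := fun _ _ h => h.1

open Classical in
/-- The elastic energy; the summands are finite real numbers, because `1 < |x - y|`. -/
def elastic (δ : ℝ) (X : Finset ℂ) : ℝ :=
  (1 / 2) * ∑ x ∈ X, ∑ y ∈ X.filter (fun y => 1 < dist x y ∧ dist x y ≤ 1 + δ),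
    (1 + V δ (dist x y)).toReal

/-- The shape part of the energy, `Per + μ + 3 χ + E_el`. -/
def shape (δ : ℝ) (X : Finset ℂ) : ℝ :=
  ((bondGraph δ X).per : ℝ) + ((bondGraph δ X).defect : ℝ) + 3 * ((bondGraph δ X).chi : ℝ)
    + elastic δ X

end

end SoftDisc

namespace SoftDisc

open Set Filter Topology

/-! ### Elementary geometry of bonds -/

/-! Every edge has two sides. Counting sides gives `Σ Per(f) + Per = 2 ♯Ed`, so the faces cancel in
`Per + μ + 3χ` and only `3 ♯X - ♯Ed` remains (`PlaneGraph.per_add_defect_add_chi`). The elastic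
energy turns each bond into its binding energy `b(e) = 1 - (|e| - 1)/δ`, a number in `[0, 1]`, and
the shape functional becomes `3 ♯X - Σ b(e)` (`shape_eq`). Removing `∂X` therefore lowers it by `3
♯∂X` minus the sum of `b(e)` over the bonds touching `∂X`. It remains to bound that sum by `3 ♯∂X -
6` (`touching_bound`).

Two bonds at a common vertex with binding energies `b` and `b'` enclose an angle of at least
`(π/6)(b + b')`, because their far ends have distance at least `1` (`gap_rigid`). At a vertex of
`∂O` with inner angle `φ`, packing the bonds that point into `O` shows that the sum of their binding
energies, the two boundary bonds taken with weight `1/2`, is at most `3φ/π` (`vertex_bound`). Over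
all vertices on `∂O` the numbers `π - φ` add up to `2π`, which produces the `-6`. In this sum a
boundary bond is counted once in total, and any other non-wire bond touching `∂X` at least once.
Exterior wires are bridges, and there are at most as many as vertices outside `O`
(`PlaneGraph.ncard_wire_le`). Each contributes at most `1`, whereas each such vertex allows `3`. Of
the bound on `δ` only `δ < 2/5` is used: bonds are shorter than `√2`, hence do not cross, and `2δ <
1`.

In the case of equality there are no points outside `O`, no wires, and every packing is tight: the
bonds at a boundary vertex have length `1` and consecutive ones enclose `π/3`. The faces at such a
vertex are unit equilateral triangles. Faces of perimeter different from `3` thus stay away from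
`∂X` and survive the removal unchanged, and the removal creates no new faces
(`faces_subset_of_remove`). This gives the equality of the defects.

Three facts of plane topology support the counting. An edge with the same component on both sides is
a bridge, since the angle under which the edge is seen jumps by `2π` across it
(`PlaneGraph.not_reachable_of_left_eq`). A bounded component of the complement of a connected
drawing is simply connected, because it is glued from convex cells along vertical segments
(`PlaneGraph.mem_faces_of_isBounded`); hence a wire has the unbounded component on both sides.
Finally, the exterior angles of a simple polygon add up to `2π`, by Hopf's argument with secants
(`SimpleLoop.sum_ext`, `SimpleLoop.Bounds.sum_ext_eq`). -/

lemma delta_lt {δ : ℝ} (hδ : δ < 1 / (2 * Real.sin (Real.pi / 7)) - 1) : δ < 2 / 5 := by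
  have h1 : (3.14 : ℝ) < Real.pi := Real.pi_gt_d2
  have h2 : Real.pi < 3.15 := Real.pi_lt_d2
  set x := Real.pi / 7 with hx
  have hx1 : 0.44 < x := by rw [hx]; linarith
  have hx2 : x < 0.45 := by rw [hx]; linarith
  have h3 : x - x ^ 3 / 6 < Real.sin x := Real.sin_gt_sub_cube (by linarith)
  have h4 : x ^ 3 < 0.45 ^ 3 := by gcongr
  have h5 : (0.4 : ℝ) < Real.sin x := by norm_num at h4 ⊢; linarith
  have h6 : 1 / (2 * Real.sin x) < 1.25 := by
    rw [div_lt_iff₀ (by linarith)]; linarith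
  linarith

/-- If two sides of lengths `1 + δ s` and `1 + δ t` enclose an angle `Δ` and the third side has
length at least `1`, then `Δ` is bounded below, strictly unless `s = t = 0`. -/
lemma gap_rigid {δ s t Δ : ℝ} (hδ₀ : 0 < δ) (hδ : δ < 2 / 5) (hs : 0 ≤ s) (hs1 : s ≤ 1)
    (ht : 0 ≤ t) (ht1 : t ≤ 1) (hΔ : 0 < Δ)
    (h : 1 ≤ (1 + δ * s) ^ 2 + (1 + δ * t) ^ 2
      - 2 * (1 + δ * s) * (1 + δ * t) * Real.cos Δ)
    (hle : Δ ≤ Real.pi / 6 * (1 - s) + Real.pi / 6 * (1 - t)) :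
    s = 0 ∧ t = 0 ∧ Δ = Real.pi / 3 := by
  have hpi := Real.pi_pos
  set σ := (s + t) / 2 with hσ
  have hσ0 : 0 ≤ σ := by rw [hσ]; linarith
  have hσ1 : σ ≤ 1 := by rw [hσ]; linarith
  have hle' : Δ ≤ Real.pi / 3 * (1 - σ) := by rw [hσ]; linarith
  have hcos : (1 + σ) / 2 ≤ Real.cos Δ := by
    have h1 : Real.cos (Real.pi / 3 * (1 - σ)) ≤ Real.cos Δ := by
      apply Real.cos_le_cos_of_nonneg_of_le_pi hΔ.le _ hle'
      nlinarith
    -- The cosine lies above its chord between `π/3` and `0`, where it takes the values `1/2` and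
    -- `1`; at `π/3 * (1 - σ)` the chord has height `(1 + σ)/2`.
    have h2 := strictConcaveOn_cos_Icc.concaveOn.2
      (show Real.pi / 3 ∈ Icc (-(Real.pi / 2)) (Real.pi / 2) from ⟨by linarith, by linarith⟩)
      (show (0 : ℝ) ∈ Icc (-(Real.pi / 2)) (Real.pi / 2) from ⟨by linarith, by linarith⟩)
      (show 0 ≤ 1 - σ by linarith) hσ0 (by ring)
    simp only [smul_eq_mul, Real.cos_pi_div_three, Real.cos_zero, mul_zero, add_zero] at h2
    rw [mul_comm (1 - σ) (Real.pi / 3)] at h2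
    linarith
  have hab : 1 ≤ (1 + δ * s) * (1 + δ * t) := by
    have := mul_nonneg hδ₀.le hs
    have := mul_nonneg hδ₀.le ht
    nlinarith
  have key : (1 + δ * s) * (1 + δ * t) * (1 + σ) ≤
      (1 + δ * s) ^ 2 + (1 + δ * t) ^ 2 - 1 := by
    have := mul_le_mul_of_nonneg_left hcos (by linarith : 0 ≤ (1 + δ * s) * (1 + δ * t))
    nlinarith
  -- With `p = δ s` and `q = δ t` the right side exceeds the left by `p q (3 + p + q)`. Combined
  -- with `key`, this bounds `σ` times the product of the two lengths by `2δ` times itself, and `2δ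
  -- < 1` forces `σ = 0`.
  have key2 : (1 + δ * s) ^ 2 + (1 + δ * t) ^ 2 - 1 - (1 + δ * s) * (1 + δ * t) ≤
      2 * δ * σ * ((1 + δ * s) * (1 + δ * t)) := by
    have h1 : 0 ≤ (δ * s) * (δ * t) := by positivity
    have h2 : 2 * δ * σ = δ * s + δ * t := by rw [hσ]; ring
    rw [h2]
    have h3 : 0 ≤ (δ * s + δ * t) * ((δ * s) * (δ * t)) := by positivity
    nlinarith
  have hσz : σ = 0 := by
    by_contra hne
    have hpos : 0 < σ := lt_of_le_of_ne hσ0 (Ne.symm hne)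
    have : σ * ((1 + δ * s) * (1 + δ * t)) * (1 - 2 * δ) ≤ 0 := by linarith
    have h4 : 0 < σ * ((1 + δ * s) * (1 + δ * t)) * (1 - 2 * δ) := by
      apply mul_pos (mul_pos hpos (by linarith)); linarith
    linarith
  have hs0 : s = 0 := by rw [hσ] at hσz; linarith
  have ht0 : t = 0 := by rw [hσ] at hσz; linarith
  refine ⟨hs0, ht0, ?_⟩
  subst hs0; subst ht0
  have hc : Real.cos Δ ≤ 1 / 2 := by norm_num at h; linarith
  have h5 : Δ ≤ Real.pi / 3 := by linarith
  by_contra hne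
  have : Real.cos (Real.pi / 3) < Real.cos Δ :=
    Real.cos_lt_cos_of_nonneg_of_le_pi hΔ.le (by linarith) (lt_of_le_of_ne h5 hne)
  rw [Real.cos_pi_div_three] at this
  linarith

lemma dist_sq (z w : ℂ) : dist z w ^ 2 = (z.re - w.re) ^ 2 + (z.im - w.im) ^ 2 := by
  rw [Complex.dist_eq, Complex.sq_norm, Complex.normSq_apply]
  simp; ring

/-- Stewart's theorem. It bounds from below the distance from a vertex to an inner point of a bond.
-/
lemma stewart {c d p : ℂ} {t : ℝ} (q : ℂ) (hp : p = c + t * (d - c)) :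
    (1 - t) * dist q c ^ 2 + t * dist q d ^ 2 = dist q p ^ 2 + t * (1 - t) * dist c d ^ 2 := by
  subst hp
  simp only [dist_sq]
  simp
  ring

lemma mem_segment_iff {a b z : ℂ} :
    z ∈ segment ℝ a b ↔ ∃ t : ℝ, 0 ≤ t ∧ t ≤ 1 ∧ z = a + t * (b - a) := by
  rw [segment_eq_image']
  constructor
  · rintro ⟨t, ht, rfl⟩
    exact ⟨t, ht.1, ht.2, by simp⟩
  · rintro ⟨t, h0, h1, rfl⟩
    exact ⟨t, ⟨h0, h1⟩, by simp⟩

/-- Two segments of length less than `√2` whose endpoints have mutual distances at least `1`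
do not meet. -/
lemma disjoint_segments {a b c d : ℂ} (hab : dist a b < 1.4) (hcd : dist c d < 1.4)
    (hac : 1 ≤ dist a c) (had : 1 ≤ dist a d) (hbc : 1 ≤ dist b c) (hbd : 1 ≤ dist b d) :
    Disjoint (segment ℝ a b) (segment ℝ c d) := by
  rw [Set.disjoint_left]
  intro p hp hp'
  have hsum := dist_add_dist_of_mem_segment hp
  obtain ⟨t, h0, h1, ht⟩ := mem_segment_iff.1 hp'
  have A := stewart a ht
  have B := stewart b ht
  have hcd2 : dist c d ^ 2 < 1.96 := by
    have := dist_nonneg (x := c) (y := d)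
    nlinarith
  have hcd0 := sq_nonneg (dist c d)
  have htt : t * (1 - t) ≤ 1 / 4 := by nlinarith [sq_nonneg (t - 1 / 2)]
  have htt0 : 0 ≤ t * (1 - t) := mul_nonneg h0 (by linarith)
  -- By Stewart's theorem a common point would have squared distance at least `1 - 0.49` from both
  -- `a` and `b`, so distance more than `0.7`, contradicting `dist a b < 1.4`.
  have hprod : t * (1 - t) * dist c d ^ 2 ≤ 0.49 := by nlinarith
  have sq : ∀ r : ℝ, 1 ≤ r → 1 ≤ r ^ 2 := fun r hr => by nlinarith
  have A2 : 0.51 ≤ dist a p ^ 2 := by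
    have := mul_le_mul_of_nonneg_left (sq _ hac) (sub_nonneg.2 h1)
    have := mul_le_mul_of_nonneg_left (sq _ had) h0
    linarith
  have B2 : 0.51 ≤ dist b p ^ 2 := by
    have := mul_le_mul_of_nonneg_left (sq _ hbc) (sub_nonneg.2 h1)
    have := mul_le_mul_of_nonneg_left (sq _ hbd) h0
    linarith
  have A3 : 0.7 < dist a p := by
    have := dist_nonneg (x := a) (y := p)
    nlinarith
  have B3 : 0.7 < dist b p := by
    have := dist_nonneg (x := b) (y := p)
    nlinarith
  rw [dist_comm p b] at hsum
  linarith

lemma endpoint_of_mem_segment {a b v : ℂ} (hab : dist a b < 2) (ha : v ≠ a → 1 ≤ dist v a)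
    (hb : v ≠ b → 1 ≤ dist v b) (hv : v ∈ segment ℝ a b) : v = a ∨ v = b := by
  by_contra hne
  push Not at hne
  have hsum := dist_add_dist_of_mem_segment hv
  have := ha hne.1
  have := hb hne.2
  rw [dist_comm a v] at hsum
  linarith

/-! ### Planar graphs -/

/-- Two distinct edges meet only at common endpoints, and vertices lie only on the edges that they
are endpoints of. -/
structure PlaneGraph.IsPlanar (G : PlaneGraph) : Prop where
  inter : ∀ e ∈ G.Ed, ∀ e' ∈ G.Ed, e ≠ e' → ∀ z ∈ seg e, z ∈ seg e' → z ∈ e ∧ z ∈ e'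
  vert : ∀ v ∈ G.verts, ∀ e ∈ G.Ed, v ∈ seg e → v ∈ e

@[simp] lemma seg_mk (a b : ℂ) : seg s(a, b) = segment ℝ a b := rfl

@[simp] lemma len_mk (a b : ℂ) : len s(a, b) = dist a b := rfl

/-- Distinct points of the configuration have distance at least `1`. -/
def Separated (X : Finset ℂ) : Prop := ∀ x ∈ X, ∀ y ∈ X, x ≠ y → 1 ≤ dist x y

lemma Separated.mono {X Y : Finset ℂ} (h : Separated X) (hY : Y ⊆ X) : Separated Y :=
  fun x hx y hy => h x (hY hx) y (hY hy)

lemma bondGraph_adj {δ : ℝ} {X : Finset ℂ} {x y : ℂ} :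
    (bondGraph δ X).graph.Adj x y ↔
      x ∈ X ∧ y ∈ X ∧ x ≠ y ∧ 1 ≤ dist x y ∧ dist x y ≤ 1 + δ := Iff.rfl

/-- Two segments from `a` that share a further point lie on one ray, and the shorter one ends on the
longer one. -/
lemma shared_endpoint {a b c p : ℂ} (hpb : p ∈ segment ℝ a b) (hpc : p ∈ segment ℝ a c)
    (hpa : p ≠ a) : c ∈ segment ℝ a b ∨ b ∈ segment ℝ a c := by
  obtain ⟨s, hs0, hs1, hs⟩ := mem_segment_iff.1 hpb
  obtain ⟨t, ht0, ht1, ht⟩ := mem_segment_iff.1 hpc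
  have hs' : s ≠ 0 := by rintro rfl; apply hpa; rw [hs]; simp
  have ht' : t ≠ 0 := by rintro rfl; apply hpa; rw [ht]; simp
  have hsp : 0 < s := lt_of_le_of_ne hs0 hs'.symm
  have htp : 0 < t := lt_of_le_of_ne ht0 ht'.symm
  have hst : (s : ℂ) * (b - a) = t * (c - a) := by
    have := hs.symm.trans ht
    exact add_left_cancel this
  have hsC : (s : ℂ) ≠ 0 := by exact_mod_cast hs'
  have htC : (t : ℂ) ≠ 0 := by exact_mod_cast ht'
  rcases le_total s t with h | h
  · left
    refine mem_segment_iff.2 ⟨s / t, by positivity, (div_le_one htp).2 h, ?_⟩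
    push_cast
    field_simp
    linear_combination -hst
  · right
    refine mem_segment_iff.2 ⟨t / s, by positivity, (div_le_one hsp).2 h, ?_⟩
    push_cast
    field_simp
    linear_combination hst

lemma bondGraph_isPlanar {δ : ℝ} (hδ : δ < 2 / 5) {X : Finset ℂ} (hX : Separated X) :
    (bondGraph δ X).IsPlanar := by
  have vert : ∀ v ∈ X, ∀ e ∈ (bondGraph δ X).Ed, v ∈ seg e → v ∈ e := by
    intro v hv e he hve
    induction e using Sym2.ind with
    | _ a b =>
      obtain ⟨ha, hb, -, -, hab⟩ := he
      rw [Sym2.mem_iff]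
      exact endpoint_of_mem_segment (by linarith) (hX v hv a ha) (hX v hv b hb) hve
  have share : ∀ a b c, s(a, b) ∈ (bondGraph δ X).Ed → s(a, c) ∈ (bondGraph δ X).Ed →
      b ≠ c → ∀ z ∈ segment ℝ a b, z ∈ segment ℝ a c → z = a := by
    intro a b c hb hc hbc z hzb hzc
    by_contra hne
    rcases shared_endpoint hzb hzc hne with h | h
    · have := vert c hc.2.1 _ hb h
      rw [Sym2.mem_iff] at this
      rcases this with h | h
      · exact hc.2.2.1 h.symm
      · exact hbc h.symm
    · have := vert b hb.2.1 _ hc h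
      rw [Sym2.mem_iff] at this
      rcases this with h | h
      · exact hb.2.2.1 h.symm
      · exact hbc h
  refine ⟨?_, vert⟩
  intro e he e' he' hne z hz hz'
  induction e using Sym2.ind with
  | _ a b =>
  induction e' using Sym2.ind with
  | _ c d =>
  have he0 := he
  have he0' := he'
  obtain ⟨ha, hb, hab', -, hab⟩ := he0
  obtain ⟨hc, hd, hcd', -, hcd⟩ := he0'
  simp only [seg_mk] at hz hz'
  simp only [Sym2.mem_iff]
  by_cases hac : a = c
  · subst hac
    have : z = a := share a b d he he' (by rintro rfl; exact hne rfl) z hz hz'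
    simp [this]
  by_cases had : a = d
  · subst had
    rw [Sym2.eq_swap] at he'
    rw [segment_symm] at hz'
    have : z = a := share a b c he he' (by rintro rfl; exact hne Sym2.eq_swap) z hz hz'
    simp [this]
  by_cases hbc : b = c
  · subst hbc
    rw [Sym2.eq_swap] at he
    rw [segment_symm] at hz
    have : z = b := share b a d he he' (by rintro rfl; exact hne Sym2.eq_swap) z hz hz'
    simp [this]
  by_cases hbd : b = d
  · subst hbd
    rw [Sym2.eq_swap] at he he'
    rw [segment_symm] at hz hz'
    have : z = b := share b a c he he' (by rintro rfl; exact hne rfl) z hz hz'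
    simp [this]
  exact absurd hz' (Set.disjoint_left.1 (disjoint_segments (by linarith) (by linarith)
    (hX a ha c hc hac) (hX a ha d hd had) (hX b hb c hc hbc) (hX b hb d hd hbd)) hz)

lemma separated_of_energy_lt_top {δ : ℝ} {X : Finset ℂ} (h : energy δ X < ⊤) : Separated X := by
  intro x hx y hy hxy
  by_contra hlt
  push Not at hlt
  -- In `EReal` a summand `⊥` would absorb `⊤`. As `V` never equals `⊥`, a single pair at distance
  -- less than `1` makes the energy `⊤`.
  have hV : ∀ r, V δ r ≠ ⊥ := by
    intro r
    unfold V
    split_ifs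
    · simp
    · exact EReal.coe_ne_bot _
    · simp
  have hbot : ∀ (s : Finset ℂ) (f : ℂ → EReal), (∀ i ∈ s, f i ≠ ⊥) → ∑ i ∈ s, f i ≠ ⊥ := by
    intro s f hf
    induction s using Finset.induction_on with
    | empty => simp
    | insert a s ha ih =>
      rw [Finset.sum_insert ha]
      rw [Ne, EReal.add_eq_bot_iff, not_or]
      exact ⟨hf a (by simp), ih fun i hi => hf i (by simp [hi])⟩
  have htop : ∀ (s : Finset ℂ) (f : ℂ → EReal) (i : ℂ), i ∈ s → (∀ i ∈ s, f i ≠ ⊥) →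
      f i = ⊤ → ∑ i ∈ s, f i = ⊤ := by
    intro s f i hi hf hfi
    rw [← Finset.add_sum_erase s f hi, hfi]
    exact EReal.top_add_of_ne_bot (hbot _ _ fun j hj => hf j (Finset.mem_of_mem_erase hj))
  have h1 : ∑ y ∈ X.erase x, V δ (dist x y) = ⊤ := by
    refine htop _ _ y (by simp [hy, Ne.symm hxy]) (fun _ _ => hV _) ?_
    unfold V
    rw [if_pos hlt]
  have h2 : ∑ x ∈ X, ∑ y ∈ X.erase x, V δ (dist x y) = ⊤ :=
    htop _ _ x hx (fun _ _ => hbot _ _ fun _ _ => hV _) h1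
  unfold energy at h
  rw [h2, EReal.coe_mul_top_of_pos (by norm_num)] at h
  exact lt_irrefl _ h

end SoftDisc

namespace SoftDisc

open Set Filter Topology

/-! ### Thin rhombi around segments -/

/-- The affine coordinate in which `a` is `0` and `b` is `1`. -/
noncomputable def coord (a b z : ℂ) : ℂ := (z - a) / (b - a)

/-- The open rhombus with diagonal `[a, b]` and slope `η`. -/
def rhomb (a b : ℂ) (η : ℝ) : Set ℂ :=
  {z | |(coord a b z).im| < η * (coord a b z).re ∧ |(coord a b z).im| < η * (1 - (coord a b z).re)}

/-- The open half of the rhombus on the left of the oriented segment from `a` to `b`. -/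
def half (a b : ℂ) (η : ℝ) : Set ℂ :=
  {z | 0 < (coord a b z).im ∧ (coord a b z).im < η * (coord a b z).re ∧
    (coord a b z).im < η * (1 - (coord a b z).re)}

lemma convex_halfPlane (c d : ℂ) : Convex ℝ {z : ℂ | 0 < (c * z + d).re} := by
  intro x hx y hy s t hs ht hst
  simp only [mem_ofPred_eq] at *
  have : (c * (s • x + t • y) + d).re = s * (c * x + d).re + t * (c * y + d).re := by
    simp
    linear_combination (-d.re) * hst
  rw [this]
  rcases eq_or_lt_of_le hs with h | h
  · have : t = 1 := by linarith
    rw [← h, this]; simpa using hy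
  · have := mul_pos h hx
    have := mul_nonneg ht hy.le
    linarith

lemma isOpen_halfPlane (c d : ℂ) : IsOpen {z : ℂ | 0 < (c * z + d).re} :=
  isOpen_lt continuous_const (by fun_prop)

/-- Each of the three conditions says that an affine function of `z` has positive real part, so
convexity and openness reduce to half-planes. -/
lemma half_eq (a b : ℂ) (η : ℝ) : half a b η =
    {z | 0 < ((-Complex.I / (b - a)) * z + Complex.I * a / (b - a)).re} ∩
    ({z | 0 < (((η + Complex.I) / (b - a)) * z + - (η + Complex.I) * a / (b - a)).re} ∩
    {z | 0 < (((-η + Complex.I) / (b - a)) * z + (η - (-η + Complex.I) * a / (b - a))).re}) := by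
  have h1 : ∀ z, ((-Complex.I / (b - a)) * z + Complex.I * a / (b - a)).re = (coord a b z).im := by
    intro z
    have : (-Complex.I / (b - a)) * z + Complex.I * a / (b - a) = -Complex.I * coord a b z := by
      unfold coord; ring
    rw [this]; simp
  have h2 : ∀ z, (((η + Complex.I) / (b - a)) * z + - (η + Complex.I) * a / (b - a)).re =
      η * (coord a b z).re - (coord a b z).im := by
    intro z
    have : ((η + Complex.I) / (b - a)) * z + - (η + Complex.I) * a / (b - a) =
      (η + Complex.I) * coord a b z := by
      unfold coord; ring
    rw [this]; simp
  have h3 : ∀ z, (((-η + Complex.I) / (b - a)) * z + (η - (-η + Complex.I) * a / (b - a))).re =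
      η * (1 - (coord a b z).re) - (coord a b z).im := by
    intro z
    have : ((-η + Complex.I) / (b - a)) * z + (η - (-η + Complex.I) * a / (b - a)) =
      η + (-η + Complex.I) * coord a b z := by
      unfold coord; ring
    rw [this]; simp; ring
  ext z
  simp only [half, mem_ofPred_eq, mem_inter_iff, h1, h2, h3, sub_pos]

lemma convex_half (a b : ℂ) (η : ℝ) : Convex ℝ (half a b η) := by
  rw [half_eq]
  exact (convex_halfPlane _ _).inter ((convex_halfPlane _ _).inter (convex_halfPlane _ _))

lemma isOpen_half (a b : ℂ) (η : ℝ) : IsOpen (half a b η) := by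
  rw [half_eq]
  exact (isOpen_halfPlane _ _).inter ((isOpen_halfPlane _ _).inter (isOpen_halfPlane _ _))

lemma coord_swap {a b : ℂ} (hab : a ≠ b) (z : ℂ) : coord b a z = 1 - coord a b z := by
  unfold coord
  have h1 : b - a ≠ 0 := sub_ne_zero.2 hab.symm
  have h2 : a - b ≠ 0 := sub_ne_zero.2 hab
  rw [← neg_sub b a, div_neg, eq_sub_iff_add_eq, ← sub_eq_neg_add, ← sub_div, div_eq_one_iff_eq h1]
  ring

lemma coord_point {a b : ℂ} (hab : a ≠ b) (w : ℂ) : coord a b (a + w * (b - a)) = w := by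
  unfold coord
  have h1 : b - a ≠ 0 := sub_ne_zero.2 hab.symm
  field_simp
  ring

lemma eq_of_coord {a b : ℂ} (hab : a ≠ b) (z : ℂ) : z = a + coord a b z * (b - a) := by
  unfold coord
  have h1 : b - a ≠ 0 := sub_ne_zero.2 hab.symm
  field_simp
  ring

lemma continuous_coord (a b : ℂ) : Continuous (coord a b) := by
  unfold coord; fun_prop

lemma rhomb_swap {a b : ℂ} (hab : a ≠ b) (η : ℝ) : rhomb b a η = rhomb a b η := by
  ext z
  simp only [rhomb, mem_ofPred_eq, coord_swap hab]
  simp [and_comm]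

lemma isOpen_rhomb (a b : ℂ) (η : ℝ) : IsOpen (rhomb a b η) := by
  have := continuous_coord a b
  have h1 : IsOpen {z | |(coord a b z).im| < η * (coord a b z).re} :=
    isOpen_lt (by fun_prop) (by fun_prop)
  have h2 : IsOpen {z | |(coord a b z).im| < η * (1 - (coord a b z).re)} :=
    isOpen_lt (by fun_prop) (by fun_prop)
  exact h1.inter h2

lemma mem_openSegment_iff_coord {a b z : ℂ} (hab : a ≠ b) :
    z ∈ openSegment ℝ a b ↔
      (coord a b z).im = 0 ∧ 0 < (coord a b z).re ∧ (coord a b z).re < 1 := by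
  rw [openSegment_eq_image']
  constructor
  · rintro ⟨t, ht, rfl⟩
    have : coord a b (a + t • (b - a)) = t := by
      rw [Complex.real_smul, coord_point hab]
    simp only [this]
    exact ⟨by simp, by simpa using ht.1, by simpa using ht.2⟩
  · rintro ⟨h1, h2, h3⟩
    refine ⟨(coord a b z).re, ⟨h2, h3⟩, ?_⟩
    have : ((coord a b z).re : ℂ) = coord a b z := by
      apply Complex.ext <;> simp [h1]
    simp only [Complex.real_smul, this]
    exact (eq_of_coord hab z).symm

/-- The sign of the imaginary part of the coordinate separates the two open halves from the
diagonal; reversing the segment exchanges the halves. -/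
lemma mem_rhomb_iff {a b : ℂ} (hab : a ≠ b) {η : ℝ} (hη : 0 < η) (z : ℂ) :
    z ∈ rhomb a b η ↔ z ∈ half a b η ∨ z ∈ half b a η ∨ z ∈ openSegment ℝ a b := by
  rw [mem_openSegment_iff_coord hab]
  simp only [rhomb, half, mem_ofPred_eq, coord_swap hab]
  simp only [Complex.sub_im, Complex.one_im, zero_sub, Complex.sub_re, Complex.one_re, sub_sub_cancel]
  rcases lt_trichotomy (coord a b z).im 0 with h | h | h
  · rw [abs_of_neg h]
    constructor
    · rintro ⟨h1, h2⟩
      exact Or.inr (Or.inl ⟨by linarith, h2, h1⟩)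
    · rintro (h1 | h1 | h1)
      · linarith [h1.1]
      · exact ⟨h1.2.2, h1.2.1⟩
      · linarith [h1.1]
  · rw [h, abs_zero, mul_pos_iff_of_pos_left hη, mul_pos_iff_of_pos_left hη, sub_pos]
    simp
  · rw [abs_of_pos h]
    constructor
    · rintro ⟨h1, h2⟩
      exact Or.inl ⟨h, h1, h2⟩
    · rintro (h1 | h1 | h1)
      · exact h1.2
      · linarith [h1.1]
      · linarith [h1.1]

lemma half_subset_rhomb (a b : ℂ) (η : ℝ) : half a b η ⊆ rhomb a b η := by
  rintro z ⟨h1, h2, h3⟩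
  simp only [rhomb, mem_ofPred_eq, abs_of_pos h1]
  exact ⟨h2, h3⟩

lemma openSegment_subset_rhomb {a b : ℂ} (hab : a ≠ b) {η : ℝ} (hη : 0 < η) :
    openSegment ℝ a b ⊆ rhomb a b η := fun z hz =>
  (mem_rhomb_iff hab hη z).2 (Or.inr (Or.inr hz))

lemma rhomb_re {a b z : ℂ} {η : ℝ} (hη : 0 < η) (hz : z ∈ rhomb a b η) :
    0 < (coord a b z).re ∧ (coord a b z).re < 1 := by
  have h1 := (abs_nonneg _).trans_lt hz.1
  have h2 := (abs_nonneg _).trans_lt hz.2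
  rw [mul_pos_iff_of_pos_left hη] at h1 h2
  exact ⟨h1, by linarith⟩

lemma half_mono {a b : ℂ} {η η' : ℝ} (hη : 0 < η) (h : η ≤ η') : half a b η ⊆ half a b η' := by
  intro z hz
  have hr := rhomb_re hη (half_subset_rhomb _ _ _ hz)
  obtain ⟨h1, h2, h3⟩ := hz
  refine ⟨h1, h2.trans_le ?_, h3.trans_le ?_⟩
  · exact mul_le_mul_of_nonneg_right h hr.1.le
  · exact mul_le_mul_of_nonneg_right h (by linarith)

lemma rhomb_mono {a b : ℂ} {η η' : ℝ} (hη : 0 < η) (h : η ≤ η') :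
    rhomb a b η ⊆ rhomb a b η' := by
  intro z hz
  have hr := rhomb_re hη hz
  obtain ⟨h2, h3⟩ := hz
  refine ⟨h2.trans_le ?_, h3.trans_le ?_⟩
  · exact mul_le_mul_of_nonneg_right h hr.1.le
  · exact mul_le_mul_of_nonneg_right h (by linarith)

/-- Points of the half rhombus near a point of the open segment. -/
lemma eventually_mem_half {a b : ℂ} (hab : a ≠ b) {η s : ℝ} (hη : 0 < η) (hs : 0 < s)
    (hs1 : s < 1) :
    ∀ᶠ t : ℝ in 𝓝[>] 0, a + (s + t * Complex.I) * (b - a) ∈ half a b η := by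
  have h1 : ∀ᶠ t : ℝ in 𝓝[>] 0, t < η * s :=
    (eventually_lt_nhds (mul_pos hη hs)).filter_mono nhdsWithin_le_nhds
  have h2 : ∀ᶠ t : ℝ in 𝓝[>] 0, t < η * (1 - s) :=
    (eventually_lt_nhds (mul_pos hη (by linarith))).filter_mono nhdsWithin_le_nhds
  filter_upwards [h1, h2, self_mem_nhdsWithin] with t ht1 ht2 ht0
  simp only [half, mem_ofPred_eq, coord_point hab]
  simpa using ⟨ht0, ht1, ht2⟩

lemma half_nonempty {a b : ℂ} (hab : a ≠ b) {η : ℝ} (hη : 0 < η) : (half a b η).Nonempty := by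
  obtain ⟨t, ht⟩ := (eventually_mem_half hab hη (s := 1 / 2) (by norm_num) (by norm_num)).exists
  exact ⟨_, ht⟩

lemma openSegment_subset_closure_half {a b : ℂ} (hab : a ≠ b) {η : ℝ} (hη : 0 < η) :
    openSegment ℝ a b ⊆ closure (half a b η) := by
  intro z hz
  rw [mem_openSegment_iff_coord hab] at hz
  have h := eventually_mem_half hab hη hz.2.1 hz.2.2
  have hz' : z = a + ((coord a b z).re + (0 : ℝ) * Complex.I) * (b - a) := by
    conv_lhs => rw [eq_of_coord hab z]
    congr 2
    refine Complex.ext ?_ ?_ <;> simp [hz.1]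
  have hc : Tendsto (fun t : ℝ => a + ((coord a b z).re + t * Complex.I) * (b - a)) (𝓝[>] 0)
      (𝓝 z) := by
    have : Continuous (fun t : ℝ => a + ((coord a b z).re + t * Complex.I) * (b - a)) := by
      fun_prop
    have h3 := this.tendsto 0
    rw [← hz'] at h3
    exact h3.mono_left nhdsWithin_le_nhds
  exact mem_closure_of_tendsto hc h

lemma segment_subset_closure_half {a b : ℂ} (hab : a ≠ b) {η : ℝ} (hη : 0 < η) :
    segment ℝ a b ⊆ closure (half a b η) := by
  rw [← closure_openSegment]
  exact closure_minimal (openSegment_subset_closure_half hab hη) isClosed_closure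

/-- In the coordinate with `a = 0` and `b = 1`, the point `d` has a value `κ` off the positive real
axis, since otherwise the segments would overlap. If `κ` has positive real part, the slope of `κ` is
thin enough; otherwise every slope is. -/
lemma rhomb_disjoint_segment_shared {a b d : ℂ} (hab : a ≠ b)
    (h : ∀ z ∈ segment ℝ a b, z ∈ segment ℝ a d → z = a ∨ z = b) :
    ∃ η > 0, Disjoint (rhomb a b η) (segment ℝ a d) := by
  have hba : b - a ≠ 0 := sub_ne_zero.2 hab.symm
  set κ := coord a b d with hκ
  have hd : d - a = κ * (b - a) := by
    rw [hκ]; unfold coord; field_simp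
  have hpt : ∀ l : ℝ, coord a b (a + l * (d - a)) = l * κ := by
    intro l
    rw [hd, ← mul_assoc, coord_point hab]
  have hnot : ¬ (κ.im = 0 ∧ 0 < κ.re) := by
    rintro ⟨h1, h2⟩
    -- Chosen so that `l ≤ 1` and `l * κ.re ≤ 1/2`: the point with parameter `l` on `[a, d]` is then
    -- an inner point of `[a, b]`.
    set l : ℝ := min 1 (1 / κ.re) / 2 with hl
    have hl0 : 0 < l := by rw [hl]; positivity
    have hl1 : l ≤ 1 := by
      have := min_le_left 1 (1 / κ.re)
      rw [hl]; linarith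
    have hl2 : l * κ.re ≤ 1 / 2 := by
      have := min_le_right 1 (1 / κ.re)
      have h3 : l ≤ (1 / κ.re) / 2 := by rw [hl]; linarith
      calc l * κ.re ≤ (1 / κ.re) / 2 * κ.re := by gcongr
        _ = 1 / 2 := by field_simp
    have hκr : κ = (κ.re : ℂ) := by apply Complex.ext <;> simp [h1]
    have hp : a + l * (d - a) = a + ((l * κ.re : ℝ) : ℂ) * (b - a) := by
      rw [hd, hκr]; push_cast; simp; ring
    have hlk : 0 < l * κ.re := mul_pos hl0 h2
    have := h (a + l * (d - a)) (mem_segment_iff.2 ⟨l * κ.re, hlk.le, by linarith, hp⟩)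
      (mem_segment_iff.2 ⟨l, hl0.le, hl1, rfl⟩)
    rw [hp] at this
    rcases this with h3 | h3
    · have h4 : ((l * κ.re : ℝ) : ℂ) * (b - a) = 0 := by simpa using h3
      rcases mul_eq_zero.1 h4 with h5 | h5
      · rw [Complex.ofReal_eq_zero] at h5
        exact hlk.ne' h5
      · exact hba h5
    · have h4 : (((l * κ.re : ℝ) : ℂ) - 1) * (b - a) = 0 := by linear_combination h3
      rcases mul_eq_zero.1 h4 with h5 | h5
      · have h6 : ((l * κ.re : ℝ) : ℂ) = ((1 : ℝ) : ℂ) := by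
          rw [sub_eq_zero.1 h5]; simp
        rw [Complex.ofReal_inj] at h6
        linarith
      · exact hba h5
  by_cases hσ : 0 < κ.re
  · have hτ : κ.im ≠ 0 := fun h0 => hnot ⟨h0, hσ⟩
    refine ⟨|κ.im| / κ.re, by positivity, ?_⟩
    rw [Set.disjoint_left]
    rintro z hz hz'
    obtain ⟨l, hl0, hl1, rfl⟩ := mem_segment_iff.1 hz'
    have := hz.1
    rw [hpt] at this
    simp only [Complex.re_ofReal_mul, Complex.im_ofReal_mul, abs_mul, abs_of_nonneg hl0] at this
    have h2 : |κ.im| / κ.re * (l * κ.re) = l * |κ.im| := by field_simp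
    linarith
  · refine ⟨1, one_pos, ?_⟩
    rw [Set.disjoint_left]
    rintro z hz hz'
    obtain ⟨l, hl0, hl1, rfl⟩ := mem_segment_iff.1 hz'
    have := (rhomb_re one_pos hz).1
    rw [hpt, Complex.re_ofReal_mul] at this
    push Not at hσ
    have := mul_nonpos_of_nonneg_of_nonpos hl0 hσ
    linarith

/-- Disjoint compact segments have disjoint `ε`-neighbourhoods, and the rhombus of slope `ε / ‖b -
a‖` stays within distance `ε` of its diagonal. -/
lemma rhomb_disjoint_segment_of_disjoint {a b c d : ℂ} (hab : a ≠ b)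
    (h : Disjoint (segment ℝ a b) (segment ℝ c d)) :
    ∃ η > 0, Disjoint (rhomb a b η) (segment ℝ c d) := by
  have hcomp : ∀ x y : ℂ, IsCompact (segment ℝ x y) := fun x y => by
    rw [segment_eq_image']
    exact isCompact_Icc.image (by fun_prop)
  obtain ⟨ε, hε, hdis⟩ := h.exists_thickenings (hcomp a b) (hcomp c d).isClosed
  have hnorm : 0 < ‖b - a‖ := norm_pos_iff.2 (sub_ne_zero.2 hab.symm)
  have hη : 0 < ε / ‖b - a‖ := by positivity
  refine ⟨ε / ‖b - a‖, hη, ?_⟩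
  rw [Set.disjoint_left] at hdis ⊢
  intro z hz hz'
  refine hdis ?_ (Metric.self_subset_thickening hε _ hz')
  rw [Metric.mem_thickening_iff]
  have hr := rhomb_re hη hz
  refine ⟨a + ((coord a b z).re : ℂ) * (b - a),
    mem_segment_iff.2 ⟨_, hr.1.le, hr.2.le, rfl⟩, ?_⟩
  have h1 : z - (a + ((coord a b z).re : ℂ) * (b - a)) =
      ((coord a b z).im * Complex.I) * (b - a) := by
    set w := coord a b z with hw
    have h2 : z = a + w * (b - a) := eq_of_coord hab z
    have h3 : w = w.re + w.im * Complex.I := (Complex.re_add_im w).symm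
    rw [h2]
    linear_combination (b - a) * h3
  rw [dist_eq_norm, h1, norm_mul, norm_mul, Complex.norm_I, mul_one, Complex.norm_real,
    Real.norm_eq_abs]
  have h2 := hz.1
  have h3 : ε / ‖b - a‖ * (coord a b z).re ≤ ε / ‖b - a‖ * 1 := by gcongr; exact hr.2.le
  calc |(coord a b z).im| * ‖b - a‖ < ε / ‖b - a‖ * ‖b - a‖ := by gcongr; linarith
    _ = ε := by field_simp

/-- A segment that meets `[a, b]` only in common endpoints misses all thin rhombi around `[a, b]`. -/
lemma eventually_rhomb_disjoint_segment {a b c d : ℂ} (hab : a ≠ b)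
    (h : ∀ z ∈ segment ℝ a b, z ∈ segment ℝ c d → (z = a ∨ z = b) ∧ (z = c ∨ z = d)) :
    ∀ᶠ η in 𝓝[>] (0 : ℝ), Disjoint (rhomb a b η) (segment ℝ c d) := by
  suffices H : ∃ η > 0, Disjoint (rhomb a b η) (segment ℝ c d) by
    obtain ⟨η, hη, hd⟩ := H
    filter_upwards [Ioc_mem_nhdsGT hη] with η' hη'
    exact hd.mono_left (rhomb_mono hη'.1 hη'.2)
  by_cases hdis : Disjoint (segment ℝ a b) (segment ℝ c d)
  · exact rhomb_disjoint_segment_of_disjoint hab hdis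
  rw [Set.not_disjoint_iff] at hdis
  obtain ⟨p, hp, hp'⟩ := hdis
  obtain ⟨h1, h2⟩ := h p hp hp'
  wlog hpa : p = a generalizing a b
  · have hpb : p = b := h1.resolve_left hpa
    have := this (a := b) (b := a) hab.symm (fun z hz hz' => by
      rw [segment_symm] at hz
      exact ⟨(h z hz hz').1.symm, (h z hz hz').2⟩) (by rwa [segment_symm]) h1.symm hpb
    simpa only [rhomb_swap hab] using this
  wlog hpc : p = c generalizing c d
  · have hpd : p = d := h2.resolve_left hpc
    rw [segment_symm] at hp'
    have := this (c := d) (d := c) hp' h2.symm (fun z hz hz' => by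
      rw [segment_symm] at hz'
      exact ⟨(h z hz hz').1, (h z hz hz').2.symm⟩) hpd
    simpa only [segment_symm ℝ d c] using this
  subst hpa
  subst hpc
  exact rhomb_disjoint_segment_shared hab (fun z hz hz' => (h z hz hz').1)

end SoftDisc

/-! ### Drawings, their complementary components and the sides of an edge -/

namespace SoftDisc

open Set Filter Topology

/-- Off the frontier of `s` the space splits into two disjoint open sets, the interior and the
exterior of `s`, and a connected set stays in one of them. Most containments of regions below are
obtained this way. -/
lemma IsPreconnected.subset_of_disjoint_frontier {α : Type*} [TopologicalSpace α] {s t : Set α}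
    (ht : IsPreconnected t) (hd : Disjoint t (frontier s)) (hne : (t ∩ s).Nonempty) : t ⊆ s := by
  have hcov : t ⊆ interior s ∪ (closure s)ᶜ := by
    intro z hz
    by_cases h : z ∈ closure s
    · left
      by_contra hi
      exact Set.disjoint_left.1 hd hz ⟨h, hi⟩
    · exact Or.inr h
  rcases isPreconnected_iff_subset_of_disjoint.1 ht _ _ isOpen_interior
    isClosed_closure.isOpen_compl hcov (by
      ext z
      simp only [mem_inter_iff, mem_compl_iff, mem_empty_iff_false, iff_false]
      rintro ⟨-, h1, h2⟩
      exact h2 (interior_subset_closure h1)) with h | h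
  · exact h.trans interior_subset
  · obtain ⟨z, hz, hzs⟩ := hne
    exact absurd (subset_closure hzs) (h hz)

lemma isCompact_segment (x y : ℂ) : IsCompact (segment ℝ x y) := by
  rw [segment_eq_image']
  exact isCompact_Icc.image (by fun_prop)

lemma segment_endpoint_or {a b z : ℂ} (h : z ∈ segment ℝ a b) :
    z = a ∨ z = b ∨ z ∈ openSegment ℝ a b := by
  rw [← insert_endpoints_openSegment] at h
  simpa using h

namespace PlaneGraph

variable {G : PlaneGraph}

lemma adj_mem_left {a b : ℂ} (h : G.graph.Adj a b) : a ∈ G.verts := G.mem_of_adj a b h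

lemma adj_mem_right {a b : ℂ} (h : G.graph.Adj a b) : b ∈ G.verts := G.mem_of_adj b a h.symm

lemma mk_mem_Ed {a b : ℂ} : s(a, b) ∈ G.Ed ↔ G.graph.Adj a b := Iff.rfl

variable (G) in
lemma finite_Ed : G.Ed.Finite := by
  refine ((G.verts ×ˢ G.verts).image fun p => s(p.1, p.2)).finite_toSet.subset ?_
  intro e he
  induction e using Sym2.ind with
  | _ a b =>
    rw [Finset.mem_coe, Finset.mem_image]
    exact ⟨(a, b), Finset.mem_product.2 ⟨adj_mem_left he, adj_mem_right he⟩, rfl⟩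

lemma isCompact_seg (e : Sym2 ℂ) : IsCompact (seg e) := by
  induction e using Sym2.ind with
  | _ a b => exact isCompact_segment a b

variable (G) in
lemma isCompact_drawing : IsCompact G.drawing :=
  G.verts.finite_toSet.isCompact.union (G.finite_Ed.isCompact_biUnion fun e _ => isCompact_seg e)

variable (G) in
lemma isOpen_compl_drawing : IsOpen G.drawingᶜ := G.isCompact_drawing.isClosed.isOpen_compl

lemma segment_subset_drawing {a b : ℂ} (h : G.graph.Adj a b) : segment ℝ a b ⊆ G.drawing :=
  fun _ hz => Or.inr (mem_biUnion (t := seg) (x := s(a, b)) h hz)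

lemma mem_drawing_iff {z : ℂ} :
    z ∈ G.drawing ↔ z ∈ G.verts ∨ ∃ a b, G.graph.Adj a b ∧ z ∈ openSegment ℝ a b := by
  constructor
  · rintro (h | h)
    · exact Or.inl h
    · simp only [mem_iUnion] at h
      obtain ⟨e, he, hz⟩ := h
      induction e using Sym2.ind with
      | _ a b =>
        rcases segment_endpoint_or hz with rfl | rfl | h
        · exact Or.inl (adj_mem_left he)
        · exact Or.inl (adj_mem_right he)
        · exact Or.inr ⟨a, b, he, h⟩
  · rintro (h | ⟨a, b, hab, h⟩)
    · exact Or.inl h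
    · exact segment_subset_drawing hab (openSegment_subset_segment ℝ a b h)

/-! #### Components of the complement -/

variable (G) in
/-- The connected components of the complement of the drawing. -/
def comps : Set (Set ℂ) := {f | ∃ z ∈ G.drawingᶜ, f = connectedComponentIn G.drawingᶜ z}

lemma faces_subset_comps : G.faces ⊆ G.comps := fun _ hf => hf.1

lemma comps_isOpen {f : Set ℂ} (hf : f ∈ G.comps) : IsOpen f := by
  obtain ⟨z, -, rfl⟩ := hf
  exact G.isOpen_compl_drawing.connectedComponentIn

lemma comps_isPreconnected {f : Set ℂ} (hf : f ∈ G.comps) : IsPreconnected f := by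
  obtain ⟨z, -, rfl⟩ := hf
  exact isPreconnected_connectedComponentIn

lemma comps_subset {f : Set ℂ} (hf : f ∈ G.comps) : f ⊆ G.drawingᶜ := by
  obtain ⟨z, -, rfl⟩ := hf
  exact connectedComponentIn_subset _ _

lemma comps_nonempty {f : Set ℂ} (hf : f ∈ G.comps) : f.Nonempty := by
  obtain ⟨z, hz, rfl⟩ := hf
  exact ⟨z, mem_connectedComponentIn hz⟩

lemma comps_maximal {f s : Set ℂ} (hf : f ∈ G.comps) (hs : IsPreconnected s)
    (hsD : s ⊆ G.drawingᶜ) (hne : (s ∩ f).Nonempty) : s ⊆ f := by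
  obtain ⟨z, hz, rfl⟩ := hf
  obtain ⟨w, hw, hwf⟩ := hne
  rw [connectedComponentIn_eq hwf]
  exact hs.subset_connectedComponentIn hw hsD

lemma comps_eq {f g : Set ℂ} (hf : f ∈ G.comps) (hg : g ∈ G.comps) (hne : (f ∩ g).Nonempty) :
    f = g :=
  (comps_maximal hg (comps_isPreconnected hf) (comps_subset hf) hne).antisymm
    (comps_maximal hf (comps_isPreconnected hg) (comps_subset hg) (by rwa [inter_comm]))

lemma exists_comp {z : ℂ} (hz : z ∉ G.drawing) : ∃ f ∈ G.comps, z ∈ f :=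
  ⟨_, ⟨z, hz, rfl⟩, mem_connectedComponentIn hz⟩

lemma frontier_comp_subset {f : Set ℂ} (hf : f ∈ G.comps) : frontier f ⊆ G.drawing := by
  intro z hz
  by_contra hzD
  obtain ⟨g, hg, hzg⟩ := exists_comp hzD
  obtain ⟨w, hwg, hwf⟩ := mem_closure_iff.1 hz.1 g (comps_isOpen hg) hzg
  have : g = f := comps_eq hg hf ⟨w, hwg, hwf⟩
  subst this
  exact hz.2 ((comps_isOpen hg).interior_eq.symm ▸ hzg)

/-- The component containing `f` avoids the drawing, hence the frontier of `f`, and so cannot leave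
`f`. -/
lemma comp_eq_of_open_preconnected {f : Set ℂ} (hne : f.Nonempty)
    (hc : IsPreconnected f) (hfD : f ⊆ G.drawingᶜ) (hfr : frontier f ⊆ G.drawing) :
    f ∈ G.comps := by
  obtain ⟨z, hz⟩ := hne
  obtain ⟨g, hg, hzg⟩ := exists_comp (hfD hz)
  have h1 : f ⊆ g := comps_maximal hg hc hfD ⟨z, hz, hzg⟩
  have h2 : g ⊆ f := by
    refine IsPreconnected.subset_of_disjoint_frontier (comps_isPreconnected hg) ?_ ⟨z, hzg, hz⟩
    rw [Set.disjoint_left]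
    intro w hw hwf
    exact comps_subset hg hw (hfr hwf)
  rwa [h1.antisymm h2]

/-! #### The two sides of an edge -/

variable (G) in
/-- The open rhombus of slope `η` around `[a, b]` meets the drawing only in the open segment. -/
def Thin (a b : ℂ) (η : ℝ) : Prop :=
  0 < η ∧ ∀ z ∈ rhomb a b η, z ∈ G.drawing → z ∈ openSegment ℝ a b

lemma Thin.symm {a b : ℂ} {η : ℝ} (hab : a ≠ b) (h : G.Thin a b η) : G.Thin b a η :=
  ⟨h.1, fun z hz hzD => by
    rw [rhomb_swap hab] at hz
    rw [openSegment_symm]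
    exact h.2 z hz hzD⟩

/-- Finitely many vertices and edges have to be avoided, and each is missed by all sufficiently thin
rhombi. A vertex `v` is treated as the degenerate segment `[v, v]`. -/
lemma exists_thin (hG : G.IsPlanar) {a b : ℂ} (hab : G.graph.Adj a b) : ∃ η, G.Thin a b η := by
  have h1 : ∀ᶠ η in 𝓝[>] (0 : ℝ), ∀ v ∈ (G.verts : Set ℂ), Disjoint (rhomb a b η) (segment ℝ v v) := by
    rw [eventually_all_finite G.verts.finite_toSet]
    intro v hv
    refine eventually_rhomb_disjoint_segment hab.ne ?_
    intro z hz hz'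
    rw [segment_same, mem_singleton_iff] at hz'
    subst hz'
    have := hG.vert z hv s(a, b) hab hz
    exact ⟨Sym2.mem_iff.1 this, Or.inl rfl⟩
  have h2 : ∀ᶠ η in 𝓝[>] (0 : ℝ), ∀ e ∈ G.Ed, e ≠ s(a, b) → Disjoint (rhomb a b η) (seg e) := by
    rw [eventually_all_finite G.finite_Ed]
    intro e he
    by_cases hee : e = s(a, b)
    · exact Eventually.of_forall fun _ h => absurd hee h
    · induction e using Sym2.ind with
      | _ c d =>
        have : ∀ᶠ η in 𝓝[>] (0 : ℝ), Disjoint (rhomb a b η) (segment ℝ c d) := by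
          refine eventually_rhomb_disjoint_segment hab.ne ?_
          intro z hz hz'
          have := hG.inter _ (mk_mem_Ed.2 hab) _ he (Ne.symm hee) z hz hz'
          exact ⟨Sym2.mem_iff.1 this.1, Sym2.mem_iff.1 this.2⟩
        filter_upwards [this] with η h _ using h
  obtain ⟨η, h1, h2, h0⟩ := (h1.and (h2.and self_mem_nhdsWithin)).exists
  refine ⟨η, h0, ?_⟩
  rintro z hz (hzD | hzD)
  · exact absurd (left_mem_segment ℝ z z) (Set.disjoint_left.1 (h1 z hzD) hz)
  · simp only [mem_iUnion] at hzD
    obtain ⟨e, he, hze⟩ := hzD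
    by_cases hee : e = s(a, b)
    · subst hee
      rcases segment_endpoint_or hze with rfl | rfl | h
      · exact absurd (left_mem_segment ℝ z z)
          (Set.disjoint_left.1 (h1 z (adj_mem_left hab)) hz)
      · exact absurd (left_mem_segment ℝ z z)
          (Set.disjoint_left.1 (h1 z (adj_mem_right hab)) hz)
      · exact h
    · exact absurd hze (Set.disjoint_left.1 (h2 e he hee) hz)

variable (G) in
/-- The component of the complement of the drawing on the left of the oriented edge `(a, b)`. -/
def left (a b : ℂ) : Set ℂ :=
  {z | ∃ η, G.Thin a b η ∧ ∃ w ∈ half a b η, z ∈ connectedComponentIn G.drawingᶜ w}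

lemma openSegment_half_disjoint {a b z : ℂ} {η : ℝ} (hab : a ≠ b) (hz : z ∈ half a b η) :
    z ∉ openSegment ℝ a b := by
  rw [mem_openSegment_iff_coord hab]
  intro h
  exact hz.1.ne' h.1

lemma Thin.half_subset {a b : ℂ} {η : ℝ} (hab : a ≠ b) (h : G.Thin a b η) :
    half a b η ⊆ G.drawingᶜ := fun z hz hzD =>
  openSegment_half_disjoint hab hz (h.2 z (half_subset_rhomb _ _ _ hz) hzD)

/-- Neither the slope nor the point matters: the half rhombus of the smaller of two slopes lies in
both halves, and halves are connected. -/
lemma left_eq {a b w : ℂ} {η : ℝ} (hab : a ≠ b) (h : G.Thin a b η) (hw : w ∈ half a b η) :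
    G.left a b = connectedComponentIn G.drawingᶜ w := by
  have key : ∀ η', G.Thin a b η' → ∀ w' ∈ half a b η',
      connectedComponentIn G.drawingᶜ w' = connectedComponentIn G.drawingᶜ w := by
    intro η' h' w' hw'
    obtain ⟨p, hp⟩ := half_nonempty hab (lt_min h.1 h'.1)
    have hm : 0 < min η η' := lt_min h.1 h'.1
    have h1 : p ∈ connectedComponentIn G.drawingᶜ w :=
      (convex_half a b η).isPreconnected.subset_connectedComponentIn hw (h.half_subset hab)
        (half_mono hm (min_le_left _ _) hp)
    have h2 : p ∈ connectedComponentIn G.drawingᶜ w' :=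
      (convex_half a b η').isPreconnected.subset_connectedComponentIn hw' (h'.half_subset hab)
        (half_mono hm (min_le_right _ _) hp)
    rw [connectedComponentIn_eq h1, connectedComponentIn_eq h2]
  ext z
  constructor
  · rintro ⟨η', h', w', hw', hz⟩
    rwa [key η' h' w' hw'] at hz
  · intro hz
    exact ⟨η, h, w, hw, hz⟩

lemma left_mem_comps (hG : G.IsPlanar) {a b : ℂ} (hab : G.graph.Adj a b) :
    G.left a b ∈ G.comps := by
  obtain ⟨η, h⟩ := exists_thin hG hab
  obtain ⟨w, hw⟩ := half_nonempty hab.ne h.1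
  exact ⟨w, h.half_subset hab.ne hw, left_eq hab.ne h hw⟩

lemma half_subset_left {a b : ℂ} {η : ℝ} (hab : a ≠ b) (h : G.Thin a b η) :
    half a b η ⊆ G.left a b := by
  intro w hw
  rw [left_eq hab h hw]
  exact mem_connectedComponentIn (h.half_subset hab hw)

lemma eq_left_of_inter_half (hG : G.IsPlanar) {a b : ℂ} {η : ℝ} (hab : G.graph.Adj a b)
    (h : G.Thin a b η) {f : Set ℂ} (hf : f ∈ G.comps) (hne : (f ∩ half a b η).Nonempty) :
    f = G.left a b :=
  comps_eq hf (left_mem_comps hG hab) (hne.mono (inter_subset_inter_right _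
    (half_subset_left hab.ne h)))

/-- Membership of points of an open edge in the closure of a union of components. -/
lemma openSegment_closure_sUnion (hG : G.IsPlanar) {a b : ℂ} (hab : G.graph.Adj a b)
    {F : Set (Set ℂ)} (hF : F ⊆ G.comps) {z : ℂ} (hz : z ∈ openSegment ℝ a b) :
    (z ∈ closure (⋃₀ F) ↔ G.left a b ∈ F ∨ G.left b a ∈ F) ∧
    (z ∈ interior (closure (⋃₀ F)) ↔ G.left a b ∈ F ∧ G.left b a ∈ F) := by
  obtain ⟨η, h⟩ := exists_thin hG hab
  have h' := h.symm hab.ne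
  have hr : rhomb a b η ∈ 𝓝 z := (isOpen_rhomb a b η).mem_nhds
    (openSegment_subset_rhomb hab.ne h.1 hz)
  have key : ∀ a b, G.graph.Adj a b → G.Thin a b η → z ∈ openSegment ℝ a b → G.left a b ∈ F →
      z ∈ closure (⋃₀ F) := by
    intro a b hab h hz hL
    exact closure_mono ((half_subset_left hab.ne h).trans (subset_sUnion_of_mem hL))
      (openSegment_subset_closure_half hab.ne h.1 hz)
  have key2 : ∀ a b, G.graph.Adj a b → G.Thin a b η → z ∈ openSegment ℝ a b →
      z ∈ interior (closure (⋃₀ F)) → G.left a b ∈ F := by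
    intro a b hab h hz hi
    obtain ⟨w, hw, hwh⟩ := mem_closure_iff.1 (openSegment_subset_closure_half hab.ne h.1 hz) _
      isOpen_interior hi
    obtain ⟨p, hp, f, hf, hpf⟩ := mem_closure_iff.1 (interior_subset hw) _
      (isOpen_half a b η) hwh
    rwa [← eq_left_of_inter_half hG hab h (hF hf) ⟨p, hpf, hp⟩]
  have hz' : z ∈ openSegment ℝ b a := by rwa [openSegment_symm]
  have part1 : z ∈ closure (⋃₀ F) ↔ G.left a b ∈ F ∨ G.left b a ∈ F := by
    constructor
    · intro hzc
      obtain ⟨p, hp, f, hf, hpf⟩ := mem_closure_iff.1 hzc _ (isOpen_rhomb a b η)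
        (openSegment_subset_rhomb hab.ne h.1 hz)
      have hpD := comps_subset (hF hf) hpf
      rcases (mem_rhomb_iff hab.ne h.1 p).1 hp with h1 | h1 | h1
      · left; rwa [← eq_left_of_inter_half hG hab h (hF hf) ⟨p, hpf, h1⟩]
      · right; rwa [← eq_left_of_inter_half hG hab.symm h' (hF hf) ⟨p, hpf, h1⟩]
      · exact absurd (segment_subset_drawing hab (openSegment_subset_segment ℝ a b h1)) hpD
    · rintro (h1 | h1)
      · exact key a b hab h hz h1
      · exact key b a hab.symm h' hz' h1
  refine ⟨part1, ?_, ?_⟩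
  · intro hi
    exact ⟨key2 a b hab h hz hi, key2 b a hab.symm h' hz' hi⟩
  · rintro ⟨h1, h2⟩
    rw [mem_interior_iff_mem_nhds]
    refine mem_of_superset hr ?_
    intro p hp
    rcases (mem_rhomb_iff hab.ne h.1 p).1 hp with h3 | h3 | h3
    · exact subset_closure ⟨_, h1, half_subset_left hab.ne h h3⟩
    · exact subset_closure ⟨_, h2, half_subset_left hab.ne.symm h' h3⟩
    · exact closure_mono ((half_subset_left hab.ne h).trans (subset_sUnion_of_mem h1))
        (openSegment_subset_closure_half hab.ne h.1 h3)

/-- This turns frontiers into combinatorics: an edge bounds a union of components exactly when one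
of its two sides belongs to the union and the other does not. It is applied to the set of all faces,
which gives `O`, and to a single component. -/
lemma segment_subset_frontier_closure_sUnion (hG : G.IsPlanar) {a b : ℂ}
    (hab : G.graph.Adj a b) {F : Set (Set ℂ)} (hF : F ⊆ G.comps) :
    segment ℝ a b ⊆ frontier (closure (⋃₀ F)) ↔
      (G.left a b ∈ F ∨ G.left b a ∈ F) ∧ ¬ (G.left a b ∈ F ∧ G.left b a ∈ F) := by
  constructor
  · intro h
    have hm : midpoint ℝ a b ∈ openSegment ℝ a b := by
      rw [openSegment_eq_image_lineMap]
      exact ⟨1 / 2, by norm_num, by simp [midpoint]⟩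
    obtain ⟨h1, h2⟩ := openSegment_closure_sUnion hG hab hF hm
    have := h (openSegment_subset_segment ℝ a b hm)
    rw [frontier, closure_closure, Set.mem_sdiff, h1, h2] at this
    exact this
  · intro h
    rw [← closure_openSegment]
    refine closure_minimal ?_ isClosed_frontier
    intro z hz
    obtain ⟨h1, h2⟩ := openSegment_closure_sUnion hG hab hF hz
    rw [frontier, closure_closure, Set.mem_sdiff, h1, h2]
    exact h

lemma segment_subset_frontier_comp (hG : G.IsPlanar) {a b : ℂ}
    (hab : G.graph.Adj a b) {f : Set ℂ} (hf : f ∈ G.comps) :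
    segment ℝ a b ⊆ frontier f ↔ f = G.left a b ∨ f = G.left b a := by
  have hF : ({f} : Set (Set ℂ)) ⊆ G.comps := by simpa using hf
  constructor
  · intro h
    have hm : midpoint ℝ a b ∈ openSegment ℝ a b := by
      rw [openSegment_eq_image_lineMap]
      exact ⟨1 / 2, by norm_num, by simp [midpoint]⟩
    obtain ⟨h1, -⟩ := openSegment_closure_sUnion hG hab hF hm
    have := (h (openSegment_subset_segment ℝ a b hm)).1
    rw [sUnion_singleton] at h1
    rw [h1] at this
    simpa [eq_comm] using this
  · intro h
    rw [← closure_openSegment]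
    refine closure_minimal ?_ isClosed_frontier
    intro z hz
    obtain ⟨h1, -⟩ := openSegment_closure_sUnion hG hab hF hz
    rw [sUnion_singleton] at h1
    rw [(comps_isOpen hf).frontier_eq, Set.mem_sdiff, h1]
    refine ⟨by simpa [eq_comm] using h, fun hzf => comps_subset hf hzf ?_⟩
    exact segment_subset_drawing hab (openSegment_subset_segment ℝ a b hz)

lemma segment_subset_frontier_closure_comp (hG : G.IsPlanar) {a b : ℂ}
    (hab : G.graph.Adj a b) {f : Set ℂ} (hf : f ∈ G.comps) :
    segment ℝ a b ⊆ frontier (closure f) ↔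
      (f = G.left a b ∨ f = G.left b a) ∧ ¬ (f = G.left a b ∧ f = G.left b a) := by
  have := segment_subset_frontier_closure_sUnion hG hab (F := {f}) (by simpa using hf)
  rw [sUnion_singleton] at this
  rw [this]
  simp [eq_comm]

/-! #### Bounded components -/

/-- A component beside no edge would have only vertices on its frontier. The complement of a finite
set is connected in the plane, so the component would contain all of it and be unbounded. -/
lemma exists_left_eq_of_isBounded {f : Set ℂ} (hG : G.IsPlanar) (hf : f ∈ G.comps)
    (hb : Bornology.IsBounded f) : ∃ a b, G.graph.Adj a b ∧ f = G.left a b := by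
  by_contra hcon
  push Not at hcon
  have hfr : frontier f ⊆ G.verts := by
    intro z hz
    rcases mem_drawing_iff.1 (frontier_comp_subset hf hz) with h | ⟨a, b, hab, h⟩
    · exact h
    · exfalso
      obtain ⟨h1, -⟩ := openSegment_closure_sUnion hG hab (F := {f}) (by simpa using hf) h
      rw [sUnion_singleton] at h1
      rcases h1.1 hz.1 with h2 | h2
      · exact hcon a b hab h2.symm
      · exact hcon b a hab.symm h2.symm
  have hc : IsPreconnected ((G.verts : Set ℂ)ᶜ) :=
    (G.verts.countable_toSet.isConnected_compl_of_one_lt_rank (by simp)).isPreconnected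
  obtain ⟨z, hz⟩ := comps_nonempty hf
  have hsub : (G.verts : Set ℂ)ᶜ ⊆ f := by
    refine IsPreconnected.subset_of_disjoint_frontier hc ?_ ⟨z, ?_, hz⟩
    · exact disjoint_compl_left.mono_right hfr
    · intro hzv
      exact comps_subset hf hz (Or.inl hzv)
  have h1 : Bornology.IsBounded ((G.verts : Set ℂ)ᶜ) := hb.subset hsub
  have h2 : Bornology.IsBounded (univ : Set ℂ) := by
    rw [← union_compl_self (G.verts : Set ℂ)]
    exact G.verts.finite_toSet.isBounded.union h1
  exact NormedSpace.unbounded_univ ℝ ℂ h2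

lemma finite_faces (hG : G.IsPlanar) : G.faces.Finite := by
  refine ((G.verts ×ˢ G.verts).image fun p => G.left p.1 p.2).finite_toSet.subset ?_
  intro f hf
  obtain ⟨a, b, hab, rfl⟩ := exists_left_eq_of_isBounded hG hf.1 hf.2.1
  rw [Finset.mem_coe, Finset.mem_image]
  exact ⟨(a, b), Finset.mem_product.2 ⟨adj_mem_left hab, adj_mem_right hab⟩, rfl⟩

lemma O_eq (hG : G.IsPlanar) : G.O = closure (⋃₀ G.faces) := by
  unfold O
  rw [sUnion_eq_biUnion, (finite_faces hG).closure_biUnion]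

lemma isClosed_O (hG : G.IsPlanar) : IsClosed G.O := by
  rw [O_eq hG]; exact isClosed_closure

lemma isBounded_O (hG : G.IsPlanar) : Bornology.IsBounded G.O := by
  unfold O
  rw [Bornology.isBounded_biUnion (finite_faces hG)]
  exact fun f hf => hf.2.1.closure

lemma closure_face_subset_O {f : Set ℂ} (hf : f ∈ G.faces) : closure f ⊆ G.O :=
  subset_biUnion_of_mem (u := fun f => closure f) hf

lemma face_subset_O {f : Set ℂ} (hf : f ∈ G.faces) : f ⊆ G.O :=
  subset_closure.trans (closure_face_subset_O hf)

lemma comp_disjoint_O (hG : G.IsPlanar) {f : Set ℂ} (hf : f ∈ G.comps) (hff : f ∉ G.faces) :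
    Disjoint f G.O := by
  rw [O_eq hG, Set.disjoint_left]
  intro z hz hzO
  obtain ⟨w, hw, g, hg, hwg⟩ := mem_closure_iff.1 hzO f (comps_isOpen hf) hz
  have := comps_eq hf hg.1 ⟨w, hw, hwg⟩
  exact hff (this ▸ hg)

lemma frontier_O_subset (hG : G.IsPlanar) : frontier G.O ⊆ G.drawing := by
  intro z hz
  by_contra hzD
  obtain ⟨f, hf, hzf⟩ := exists_comp hzD
  by_cases hff : f ∈ G.faces
  · exact hz.2 (mem_interior.2 ⟨f, face_subset_O hff, comps_isOpen hf, hzf⟩)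
  · obtain ⟨w, hw, hwO⟩ := mem_closure_iff.1 hz.1 f (comps_isOpen hf) hzf
    exact Set.disjoint_left.1 (comp_disjoint_O hG hf hff) hw hwO

/-- A boundary edge has exactly one side that is a face. The next two lemmas say that an exterior
wire has none and that an interior edge has two distinct ones; an edge with the same face on both
sides belongs to none of the three classes. -/
lemma mem_EdBd_iff (hG : G.IsPlanar) {a b : ℂ} (hab : G.graph.Adj a b) :
    s(a, b) ∈ G.EdBd ↔ (G.left a b ∈ G.faces ∨ G.left b a ∈ G.faces) ∧
      ¬ (G.left a b ∈ G.faces ∧ G.left b a ∈ G.faces) := by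
  rw [← segment_subset_frontier_closure_sUnion hG hab faces_subset_comps, ← O_eq hG]
  exact ⟨fun h => h.2, fun h => ⟨hab, h⟩⟩

lemma mem_EdWireExt_iff (hG : G.IsPlanar) {a b : ℂ} (hab : G.graph.Adj a b) :
    s(a, b) ∈ G.EdWireExt ↔ G.left a b ∉ G.faces ∧ G.left b a ∉ G.faces := by
  constructor
  · rintro ⟨-, h⟩
    refine ⟨fun hl => h _ hl ?_, fun hl => h _ hl ?_⟩
    · exact (segment_subset_frontier_comp hG hab hl.1).2 (Or.inl rfl)
    · exact (segment_subset_frontier_comp hG hab hl.1).2 (Or.inr rfl)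
  · rintro ⟨h1, h2⟩
    refine ⟨hab, fun f hf hs => ?_⟩
    rcases (segment_subset_frontier_comp hG hab hf.1).1 hs with rfl | rfl
    · exact h1 hf
    · exact h2 hf

lemma mem_EdInt_iff (hG : G.IsPlanar) {a b : ℂ} (hab : G.graph.Adj a b) :
    s(a, b) ∈ G.EdInt ↔ G.left a b ∈ G.faces ∧ G.left b a ∈ G.faces ∧
      G.left a b ≠ G.left b a := by
  constructor
  · rintro ⟨-, f, hf, g, hg, hfg, h1, h2⟩
    rcases (segment_subset_frontier_comp hG hab hf.1).1 h1 with rfl | rfl <;>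
    rcases (segment_subset_frontier_comp hG hab hg.1).1 h2 with rfl | rfl
    · exact absurd rfl hfg
    · exact ⟨hf, hg, hfg⟩
    · exact ⟨hg, hf, hfg.symm⟩
    · exact absurd rfl hfg
  · rintro ⟨h1, h2, h3⟩
    exact ⟨hab, _, h1, _, h2, h3, (segment_subset_frontier_comp hG hab h1.1).2 (Or.inl rfl),
      (segment_subset_frontier_comp hG hab h2.1).2 (Or.inr rfl)⟩

lemma mem_faceEdBd_iff (hG : G.IsPlanar) {a b : ℂ} (hab : G.graph.Adj a b) {f : Set ℂ}
    (hf : f ∈ G.comps) : s(a, b) ∈ G.faceEdBd f ↔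
      (f = G.left a b ∨ f = G.left b a) ∧ ¬ (f = G.left a b ∧ f = G.left b a) := by
  rw [← segment_subset_frontier_closure_comp hG hab hf]
  exact ⟨fun h => h.2, fun h => ⟨hab, h⟩⟩

lemma mem_faceEdWireInt_iff (hG : G.IsPlanar) {a b : ℂ} (hab : G.graph.Adj a b) {f : Set ℂ}
    (hf : f ∈ G.comps) : s(a, b) ∈ G.faceEdWireInt f ↔
      f = G.left a b ∧ f = G.left b a := by
  constructor
  · rintro ⟨-, h1, h2⟩
    rw [seg_mk, segment_subset_frontier_comp hG hab hf] at h1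
    rw [seg_mk, segment_subset_frontier_closure_comp hG hab hf] at h2
    tauto
  · intro h
    refine ⟨hab, ?_, ?_⟩
    · rw [seg_mk, segment_subset_frontier_comp hG hab hf]; tauto
    · rw [seg_mk, segment_subset_frontier_closure_comp hG hab hf]; tauto

/-- The sum of the perimeters of the faces. -/
lemma sum_facePer (hG : G.IsPlanar) :
    ∑ f ∈ (finite_faces hG).toFinset, (G.facePer f : ℤ) + (G.per : ℤ) = 2 * (G.Ed.ncard : ℤ) := by
  classical
  set E := G.finite_Ed.toFinset with hE
  set Fs := (finite_faces hG).toFinset with hFs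
  have card : ∀ S : Set (Sym2 ℂ), S ⊆ G.Ed → (S.ncard : ℤ) = ∑ e ∈ E, if e ∈ S then 1 else 0 := by
    intro S hS
    rw [Finset.sum_boole]
    have : S = ((E.filter fun e => e ∈ S : Finset (Sym2 ℂ)) : Set (Sym2 ℂ)) := by
      ext e
      simp only [hE, Finset.coe_filter, Set.Finite.mem_toFinset, mem_ofPred_eq]
      exact ⟨fun h => ⟨hS h, h⟩, fun h => h.2⟩
    conv_lhs => rw [this]
    rw [Set.ncard_coe_finset]
  have hEd : (G.Ed.ncard : ℤ) = ∑ e ∈ E, 1 := by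
    rw [Set.ncard_eq_toFinset_card _ G.finite_Ed]; simp [hE]
  have hper : (G.per : ℤ) = ∑ e ∈ E, ((if e ∈ G.EdBd then 1 else 0) +
      2 * (if e ∈ G.EdWireExt then 1 else 0)) := by
    unfold per
    push_cast
    rw [card _ (fun e he => he.1), card _ (fun e he => he.1), Finset.sum_add_distrib,
      Finset.mul_sum]
  have hface : ∀ f ∈ Fs, (G.facePer f : ℤ) = ∑ e ∈ E, ((if e ∈ G.faceEdBd f then 1 else 0) +
      2 * (if e ∈ G.faceEdWireInt f then 1 else 0)) := by
    intro f _
    unfold facePer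
    push_cast
    rw [card _ (fun e he => he.1), card _ (fun e he => he.1), Finset.sum_add_distrib,
      Finset.mul_sum]
  rw [Finset.sum_congr rfl hface, Finset.sum_comm, hper, hEd, Finset.mul_sum,
    ← Finset.sum_add_distrib]
  refine Finset.sum_congr rfl fun e he => ?_
  rw [hE, Set.Finite.mem_toFinset] at he
  induction e using Sym2.ind with
  | _ a b =>
    have hab : G.graph.Adj a b := he
    -- The weights `1` and `2` in `facePer` count how many of the two sides of the edge are `f`.
    have h1 : ∀ f ∈ Fs, ((if s(a, b) ∈ G.faceEdBd f then (1 : ℤ) else 0) +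
        2 * (if s(a, b) ∈ G.faceEdWireInt f then 1 else 0)) =
        (if f = G.left a b then 1 else 0) + (if f = G.left b a then 1 else 0) := by
      intro f hf
      rw [hFs, Set.Finite.mem_toFinset] at hf
      rw [if_congr (mem_faceEdBd_iff hG hab hf.1) rfl rfl,
        if_congr (mem_faceEdWireInt_iff hG hab hf.1) rfl rfl]
      by_cases h1 : f = G.left a b <;> by_cases h2 : f = G.left b a <;> simp only [h1, h2] <;> simp
      · rw [if_pos (h1.symm.trans h2)]
        simp [← h1, ← h2]
      · simp [← h1, h2]
      · simp [h1, ← h2]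
    rw [Finset.sum_congr rfl h1, Finset.sum_add_distrib, Finset.sum_ite_eq',
      Finset.sum_ite_eq', if_congr (mem_EdBd_iff hG hab) rfl rfl,
      if_congr (mem_EdWireExt_iff hG hab) rfl rfl]
    simp only [hFs, Set.Finite.mem_toFinset]
    -- The sides that are faces number `0`, `1` or `2`, and `per` supplies the missing `2`, `1` or
    -- `0`.
    by_cases h1 : G.left a b ∈ G.faces <;> by_cases h2 : G.left b a ∈ G.faces <;> simp [h1, h2]

/-- Faces of perimeter `3` contribute nothing to the defect, so it may be summed over all faces. Its
`-3` per face cancels the faces in `3 χ`, and the double count `sum_facePer` removes the perimeters.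
-/
lemma per_add_defect_add_chi (hG : G.IsPlanar) :
    (G.per : ℤ) + G.defect + 3 * G.chi = 3 * G.verts.card - G.Ed.ncard := by
  have hdef : G.defect = ∑ f ∈ (finite_faces hG).toFinset, ((G.facePer f : ℤ) - 3) := by
    unfold defect
    rw [finsum_mem_eq_finite_toFinset_sum _ ((finite_faces hG).subset fun f hf => hf.1)]
    refine Finset.sum_subset ?_ ?_
    · intro f hf
      rw [Set.Finite.mem_toFinset] at hf ⊢
      exact hf.1
    · intro f hf hf'
      rw [Set.Finite.mem_toFinset] at hf hf'
      have : G.facePer f = 3 := by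
        by_contra hne
        exact hf' ⟨hf, hne⟩
      rw [this]; norm_num
  have h := sum_facePer hG
  rw [hdef, Finset.sum_sub_distrib]
  unfold chi
  rw [Set.ncard_eq_toFinset_card _ (finite_faces hG)]
  simp only [Finset.sum_const, nsmul_eq_mul]
  linarith

end PlaneGraph

end SoftDisc

namespace SoftDisc

open Set Filter Topology

/-! ### Separation by polygonal arcs -/

/-- On `K` the angle under which one sees the pair `a`, `b` has a continuous lift. -/
def ArgLift (K : Set ℂ) (a b : ℂ) : Prop :=
  ∃ g : ℂ → ℝ, ContinuousOn g K ∧ ∀ z ∈ K,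
    (g z : Real.Angle) = (Complex.arg (z - a) : Real.Angle) - (Complex.arg (z - b) : Real.Angle)

lemma ArgLift.refl (K : Set ℂ) (a : ℂ) : ArgLift K a a :=
  ⟨fun _ => 0, continuousOn_const, fun z _ => by simp⟩

lemma ArgLift.trans {K : Set ℂ} {a b c : ℂ} (h1 : ArgLift K a b) (h2 : ArgLift K b c) :
    ArgLift K a c := by
  obtain ⟨g, hg, hg'⟩ := h1
  obtain ⟨k, hk, hk'⟩ := h2
  refine ⟨fun z => g z + k z, hg.add hk, fun z hz => ?_⟩
  rw [Real.Angle.coe_add, hg' z hz, hk' z hz]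
  abel

/-- The quotient is a nonpositive real, or has denominator `0`, only on the segment. Hence its
principal argument is continuous off the segment. -/
lemma div_mem_slitPlane {a b z : ℂ} (hz : z ∉ segment ℝ a b) :
    (z - a) / (z - b) ∈ Complex.slitPlane := by
  by_contra hcon
  rw [Complex.mem_slitPlane_iff_not_le_zero, not_not] at hcon
  have hb : z - b ≠ 0 := by
    rw [sub_ne_zero]; rintro rfl; exact hz (right_mem_segment ℝ _ _)
  obtain ⟨h1, h2⟩ := Complex.le_def.1 hcon
  set w := (z - a) / (z - b) with hw
  have hwr : w = (w.re : ℂ) := by apply Complex.ext <;> simp [h2]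
  simp only [Complex.zero_re] at h1
  have hz2 : z - a = w.re * (z - b) := by
    rw [← hwr, hw]; field_simp
  apply hz
  have hpos : 0 < 1 - w.re := by linarith
  have hposC : (1 - (w.re : ℂ)) ≠ 0 := by
    have : ((1 - w.re : ℝ) : ℂ) ≠ 0 := by exact_mod_cast hpos.ne'
    simpa using this
  refine mem_segment_iff.2 ⟨-w.re / (1 - w.re), by apply div_nonneg <;> linarith, ?_, ?_⟩
  · rw [div_le_one hpos]; linarith
  · push_cast
    field_simp
    linear_combination hz2

lemma continuousOn_arg_div {a b : ℂ} {K : Set ℂ} (h : Disjoint K (segment ℝ a b)) :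
    ContinuousOn (fun z => Complex.arg ((z - a) / (z - b))) K := by
  intro z hz
  have hzs := Set.disjoint_left.1 h hz
  have hb : z - b ≠ 0 := by
    rw [sub_ne_zero]; rintro rfl; exact hzs (right_mem_segment ℝ _ _)
  have h1 : ContinuousAt (fun z => (z - a) / (z - b)) z :=
    (continuousAt_id.sub continuousAt_const).div (continuousAt_id.sub continuousAt_const) hb
  exact (ContinuousAt.comp (f := fun z => (z - a) / (z - b))
    (Complex.continuousAt_arg (div_mem_slitPlane hzs)) h1).continuousWithinAt

lemma arg_div_coe {a b z : ℂ} (ha : z ≠ a) (hb : z ≠ b) :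
    (Complex.arg ((z - a) / (z - b)) : Real.Angle) =
      (Complex.arg (z - a) : Real.Angle) - (Complex.arg (z - b) : Real.Angle) :=
  Complex.arg_div_coe_angle (sub_ne_zero.2 ha) (sub_ne_zero.2 hb)

lemma ArgLift.of_segment {a b : ℂ} {K : Set ℂ} (h : Disjoint K (segment ℝ a b)) :
    ArgLift K a b := by
  refine ⟨_, continuousOn_arg_div h, fun z hz => arg_div_coe ?_ ?_⟩
  · rintro rfl; exact Set.disjoint_left.1 h hz (left_mem_segment ℝ _ _)
  · rintro rfl; exact Set.disjoint_left.1 h hz (right_mem_segment ℝ _ _)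

lemma ArgLift.of_reachable {H : SimpleGraph ℂ} {K : Set ℂ} {a b : ℂ} (h : H.Reachable a b)
    (hK : ∀ x y, H.Adj x y → Disjoint K (segment ℝ x y)) : ArgLift K a b := by
  obtain ⟨p⟩ := h
  induction p with
  | nil => exact ArgLift.refl K _
  | cons hadj _ ih => exact (ArgLift.of_segment (hK _ _ hadj)).trans ih

/-- Across the segment from `0` to `1` the principal viewing angle jumps by `2π`, from `-π` above to
`π` below. -/
lemma tendsto_arg_side {s : ℝ} (hs : 0 < s) (hs1 : s < 1) :
    Tendsto (fun t : ℝ => Complex.arg ((s + t * Complex.I) / (s + t * Complex.I - 1)))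
      (𝓝[>] 0) (𝓝 (-Real.pi)) ∧
    Tendsto (fun t : ℝ => Complex.arg ((s + t * Complex.I) / (s + t * Complex.I - 1)))
      (𝓝[<] 0) (𝓝 Real.pi) := by
  set w : ℝ → ℂ := fun t => (s + t * Complex.I) / (s + t * Complex.I - 1) with hw
  have hne : ((s : ℂ) + (0 : ℝ) * Complex.I - 1) ≠ 0 := by
    intro h
    have := congrArg Complex.re h
    simp at this
    linarith
  have hc : ContinuousAt w 0 := by
    apply ContinuousAt.div
    · fun_prop
    · fun_prop
    · exact hne
  have hw0 : w 0 = ((s / (s - 1) : ℝ) : ℂ) := by simp [hw]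
  have hre : (w 0).re < 0 := by
    rw [hw0, Complex.ofReal_re]
    exact div_neg_of_pos_of_neg hs (by linarith)
  have him : (w 0).im = 0 := by rw [hw0, Complex.ofReal_im]
  have himt : ∀ t : ℝ, (w t).im = -t / ((s - 1) ^ 2 + t ^ 2) := by
    intro t
    simp only [hw, Complex.div_im, Complex.normSq_apply]
    simp
    have : (s - 1) ^ 2 + t ^ 2 ≠ 0 := by nlinarith [sq_nonneg t]
    have : (s - 1) * (s - 1) + t * t ≠ 0 := by nlinarith [sq_nonneg t]
    field_simp
    ring
  have hden : ∀ t : ℝ, 0 < (s - 1) ^ 2 + t ^ 2 := fun t => by nlinarith [sq_nonneg t]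
  constructor
  · refine (Complex.tendsto_arg_nhdsWithin_im_neg_of_re_neg_of_im_zero hre him).comp ?_
    refine tendsto_nhdsWithin_iff.2 ⟨hc.tendsto.mono_left nhdsWithin_le_nhds, ?_⟩
    filter_upwards [self_mem_nhdsWithin] with t ht
    show (w t).im < 0
    rw [himt]
    exact div_neg_of_neg_of_pos (neg_lt_zero.2 ht) (hden t)
  · have h1 := (Complex.continuousWithinAt_arg_of_re_neg_of_im_zero hre him).tendsto
    have h2 : Complex.arg (w 0) = Real.pi := by
      rw [hw0]; rw [hw0, Complex.ofReal_re] at hre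
      exact Complex.arg_ofReal_of_neg hre
    rw [h2] at h1
    refine h1.comp ?_
    refine tendsto_nhdsWithin_iff.2 ⟨hc.tendsto.mono_left nhdsWithin_le_nhds, ?_⟩
    filter_upwards [self_mem_nhdsWithin] with t ht
    show 0 ≤ (w t).im
    rw [himt]
    exact div_nonneg (neg_nonneg.2 (le_of_lt ht)) (hden t).le

/-- A connected set off the segment `[a, b]` cannot reach both sides of it if the angle under which
one sees `a`, `b` lifts continuously. -/
lemma not_both_sides {a b : ℂ} (hab : a ≠ b) {K K' : Set ℂ} {s : ℝ} (hs : 0 < s) (hs1 : s < 1)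
    (hK : IsPreconnected K) (hKs : Disjoint K (segment ℝ a b)) (hK'o : IsOpen K')
    (hKK' : K ⊆ K') (hz : a + s * (b - a) ∈ K') (hL : ArgLift K' a b)
    (hp : ∀ᶠ t : ℝ in 𝓝[>] 0, a + (s + t * Complex.I) * (b - a) ∈ K)
    (hm : ∀ᶠ t : ℝ in 𝓝[<] 0, a + (s + t * Complex.I) * (b - a) ∈ K) : False := by
  obtain ⟨g, hg, hg'⟩ := hL
  -- The difference between the principal viewing angle and its lift takes values in `2πℤ`, so it is
  -- constant on the connected set `K`. Since `g` is continuous at the crossing point, the jump by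
  -- `2π` of the principal angle contradicts this.
  set h : ℂ → ℝ := fun z => Complex.arg ((z - a) / (z - b)) - g z with hh
  have hcont : ContinuousOn h K := (continuousOn_arg_div hKs).sub (hg.mono hKK')
  have hmaps : MapsTo h K (AddSubgroup.zmultiples (2 * Real.pi) : Set ℝ) := by
    intro z hz
    have hzs := Set.disjoint_left.1 hKs hz
    have h1 : ((h z : ℝ) : Real.Angle) = 0 := by
      rw [hh, Real.Angle.coe_sub, hg' z (hKK' hz), arg_div_coe, sub_self]
      · rintro rfl; exact hzs (left_mem_segment ℝ _ _)
      · rintro rfl; exact hzs (right_mem_segment ℝ _ _)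
    exact (QuotientAddGroup.eq_zero_iff _).1 h1
  have hconst : ∀ z ∈ K, ∀ w ∈ K, h z = h w := fun z hz w hw =>
    hK.constant_of_mapsTo (T := (AddSubgroup.zmultiples (2 * Real.pi) : Set ℝ))
      ⟨inferInstanceAs (DiscreteTopology (AddSubgroup.zmultiples (2 * Real.pi)))⟩ hcont hmaps hz hw
  set p : ℝ → ℂ := fun t => a + (s + t * Complex.I) * (b - a) with hpdef
  have hba : b - a ≠ 0 := sub_ne_zero.2 hab.symm
  have hratio : ∀ t : ℝ, (p t - a) / (p t - b) =
      (s + t * Complex.I) / (s + t * Complex.I - 1) := by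
    intro t
    have h1 : p t - a = (s + t * Complex.I) * (b - a) := by simp [hpdef]
    have h2 : p t - b = (s + t * Complex.I - 1) * (b - a) := by simp only [hpdef]; ring
    rw [h1, h2, mul_div_mul_right _ _ hba]
  have hp0 : p 0 = a + s * (b - a) := by simp [hpdef]
  have hpc : Continuous p := by fun_prop
  have hgc : Tendsto (fun t => g (p t)) (𝓝 0) (𝓝 (g (p 0))) := by
    have h1 : ContinuousAt g (p 0) := hg.continuousAt (hK'o.mem_nhds (by rwa [hp0]))
    exact h1.tendsto.comp hpc.continuousAt.tendsto
  obtain ⟨t1, ht1⟩ := hp.exists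
  have lim1 : Tendsto (fun t => h (p t)) (𝓝[>] 0) (𝓝 (-Real.pi - g (p 0))) := by
    simp only [hh, hratio]
    exact (tendsto_arg_side hs hs1).1.sub (hgc.mono_left nhdsWithin_le_nhds)
  have lim2 : Tendsto (fun t => h (p t)) (𝓝[<] 0) (𝓝 (Real.pi - g (p 0))) := by
    simp only [hh, hratio]
    exact (tendsto_arg_side hs hs1).2.sub (hgc.mono_left nhdsWithin_le_nhds)
  have e1 : -Real.pi - g (p 0) = h (p t1) := by
    refine tendsto_nhds_unique lim1 (tendsto_const_nhds.congr' ?_)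
    filter_upwards [hp] with t ht
    exact hconst _ ht1 _ ht
  have e2 : Real.pi - g (p 0) = h (p t1) := by
    refine tendsto_nhds_unique lim2 (tendsto_const_nhds.congr' ?_)
    filter_upwards [hm] with t ht
    exact hconst _ ht1 _ ht
  have := Real.pi_pos
  linarith

namespace PlaneGraph

variable {G : PlaneGraph}

/-- If both sides of an edge are the same component, the edge is a bridge. -/
lemma not_reachable_of_left_eq (hG : G.IsPlanar) {a b : ℂ} (hab : G.graph.Adj a b)
    (h : G.left a b = G.left b a) : ¬ (G.graph.deleteEdges {s(a, b)}).Reachable a b := by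
  intro hr
  obtain ⟨η, hη⟩ := exists_thin hG hab
  have hη' := hη.symm hab.ne
  -- The union of the remaining edges. A path from `a` to `b` along them provides a lift of the
  -- angle off `W`, and this open set contains the midpoint of `[a, b]`.
  set W : Set ℂ := ⋃ e ∈ G.Ed \ {s(a, b)}, seg e with hW
  have hWc : IsClosed W :=
    (G.finite_Ed.subset sdiff_subset).isClosed_biUnion fun e _ => (isCompact_seg e).isClosed
  have hWD : W ⊆ G.drawing := by
    refine subset_trans ?_ subset_union_right
    exact biUnion_subset_biUnion_left sdiff_subset
  have hcomp := left_mem_comps hG hab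
  have hz0 : a + ((1 / 2 : ℝ) : ℂ) * (b - a) ∈ openSegment ℝ a b := by
    rw [mem_openSegment_iff_coord hab.ne, coord_point hab.ne]
    norm_num
  refine not_both_sides hab.ne (K := G.left a b) (K' := Wᶜ) (s := 1 / 2) (by norm_num)
    (by norm_num) (comps_isPreconnected hcomp) ?_ hWc.isOpen_compl ?_ ?_ ?_ ?_ ?_
  · rw [Set.disjoint_left]
    exact fun z hz hzs => comps_subset hcomp hz (segment_subset_drawing hab hzs)
  · exact (comps_subset hcomp).trans (compl_subset_compl.2 hWD)
  · intro hzW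
    simp only [hW, mem_iUnion] at hzW
    obtain ⟨e, he, hze⟩ := hzW
    have := (hG.inter _ he.1 _ (mk_mem_Ed.2 hab) he.2 _ hze
      (openSegment_subset_segment ℝ a b hz0)).2
    rw [mem_openSegment_iff_coord hab.ne] at hz0
    rcases Sym2.mem_iff.1 this with h1 | h1
    · rw [h1] at hz0; simp [coord] at hz0
    · have hba : b - a ≠ 0 := sub_ne_zero.2 hab.ne.symm
      rw [h1] at hz0; simp [coord, div_self hba] at hz0
  · refine ArgLift.of_reachable hr fun x y hxy => ?_
    rw [SimpleGraph.deleteEdges_adj] at hxy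
    rw [Set.disjoint_left]
    intro z hz hzs
    exact hz (mem_biUnion (t := seg) (x := s(x, y)) ⟨hxy.1, hxy.2⟩ hzs)
  · filter_upwards [eventually_mem_half hab.ne hη.1 (s := 1 / 2) (by norm_num) (by norm_num)]
      with t ht
    exact half_subset_left hab.ne hη ht
  · rw [h]
    have h2 := eventually_mem_half hab.ne.symm hη'.1 (s := 1 / 2) (by norm_num) (by norm_num)
    have h3 : Tendsto (fun t : ℝ => -t) (𝓝[<] 0) (𝓝[>] 0) := by
      have := tendsto_neg_nhdsLT (a := (0 : ℝ))
      simpa using this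
    filter_upwards [h3.eventually h2] with t ht
    convert half_subset_left hab.ne.symm hη' ht using 1
    push_cast
    ring

end PlaneGraph

end SoftDisc

namespace SoftDisc

open Set Filter Topology

/-! ### Gluing contractible planar sets -/

/-- A weak deformation retraction suffices: points of `A` may move as long as they stay in `A`. The
inclusion is then a homotopy equivalence. -/
lemma contractible_of_deformation {A B : Set ℂ} (hAB : A ⊆ B) (H : ℝ → ℂ → ℂ)
    (hc : ContinuousOn (fun p : ℝ × ℂ => H p.1 p.2) (Icc 0 1 ×ˢ B))
    (h0 : ∀ z ∈ B, H 0 z = z) (hB : ∀ t ∈ Icc (0 : ℝ) 1, ∀ z ∈ B, H t z ∈ B)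
    (hA : ∀ t ∈ Icc (0 : ℝ) 1, ∀ z ∈ A, H t z ∈ A) (h1 : ∀ z ∈ B, H 1 z ∈ A)
    (hcontr : ContractibleSpace A) : ContractibleSpace B := by
  have one : (1 : ℝ) ∈ Icc (0 : ℝ) 1 := ⟨zero_le_one, le_rfl⟩
  have hc1 : Continuous fun z : B => H 1 z := by
    have : Continuous fun z : B => ((1 : ℝ), (z : ℂ)) := by fun_prop
    exact hc.comp_continuous this fun z => ⟨one, z.2⟩
  have hcB : Continuous fun p : unitInterval × B => H p.1 p.2 := by
    have : Continuous fun p : unitInterval × B => ((p.1 : ℝ), (p.2 : ℂ)) := by fun_prop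
    exact hc.comp_continuous this fun p => ⟨p.1.2, p.2.2⟩
  have hcA : Continuous fun p : unitInterval × A => H p.1 p.2 := by
    have : Continuous fun p : unitInterval × A => ((p.1 : ℝ), (p.2 : ℂ)) := by fun_prop
    exact hc.comp_continuous this fun p => ⟨p.1.2, hAB p.2.2⟩
  let F : C(B, A) := ⟨fun z => ⟨H 1 z, h1 z z.2⟩, hc1.subtype_mk _⟩
  let J : C(A, B) := ⟨fun z => ⟨z, hAB z.2⟩, by fun_prop⟩
  let e : ContinuousMap.HomotopyEquiv B A :=
    { toFun := F
      invFun := J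
      left_inv := ⟨(ContinuousMap.Homotopy.symm
        { toFun := fun p => ⟨H p.1 p.2, hB p.1 p.1.2 p.2 p.2.2⟩
          continuous_toFun := hcB.subtype_mk _
          map_zero_left := fun z => Subtype.ext (by simpa using h0 z z.2)
          map_one_left := fun z => Subtype.ext (by simp [F, J]) })⟩
      right_inv := ⟨(ContinuousMap.Homotopy.symm
        { toFun := fun p => ⟨H p.1 p.2, hA p.1 p.1.2 p.2 p.2.2⟩
          continuous_toFun := hcA.subtype_mk _
          map_zero_left := fun z => Subtype.ext (by simpa using h0 z (hAB z.2))
          map_one_left := fun z => Subtype.ext (by simp [F, J]) })⟩ }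
  exact e.contractibleSpace

/-- The open vertical segment over the interval `(α, β)`. -/
def vert (c α β : ℝ) : Set ℂ := {z | z.re = c ∧ α < z.im ∧ z.im < β}

/-- Every point is pushed towards `p` with a speed `ε` that vanishes on `V \ S` and is positive on
`I`. By convexity of `S` this moves `I` into `S` and keeps `V` inside `V`. -/
lemma contractible_union_segment {V S I : Set ℂ} {p : ℂ} (hS : IsOpen S) (hSc : Convex ℝ S)
    (hSV : S ⊆ V) (hp : p ∈ S) (hIS : I ⊆ closure S) (hI : Disjoint I (closure (V \ S)))
    (hV : ContractibleSpace V) : ContractibleSpace (V ∪ I : Set ℂ) := by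
  -- The truncated distance to `V \ S`. The empty set needs its own case because `infDist` to it is
  -- `0` by convention.
  obtain ⟨ε, hεc, hε0, hε1, hεz, hεp⟩ : ∃ ε : ℂ → ℝ, Continuous ε ∧ (∀ z, 0 ≤ ε z) ∧
      (∀ z, ε z ≤ 1) ∧ (∀ z ∈ V \ S, ε z = 0) ∧ ∀ z ∈ I, 0 < ε z := by
    rcases (V \ S).eq_empty_or_nonempty with he | hne
    · exact ⟨fun _ => 1, continuous_const, by simp, by simp, by simp [he], by simp⟩
    · refine ⟨fun z => min 1 (Metric.infDist z (V \ S)), by fun_prop,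
        fun z => le_min zero_le_one Metric.infDist_nonneg, fun z => min_le_left _ _, ?_, ?_⟩
      · intro z hz
        simp [Metric.infDist_zero_of_mem hz]
      · intro z hz
        refine lt_min one_pos ?_
        rw [← Metric.infDist_closure]
        exact (isClosed_closure.notMem_iff_infDist_pos hne.closure).1
          (Set.disjoint_left.1 hI hz)
  have hmem : ∀ z ∈ closure S, ∀ l : ℝ, 0 < l → l < 1 → z + l * (p - z) ∈ S := by
    intro z hz l hl hl1
    have := hSc.combo_closure_interior_mem_interior hz (hS.interior_eq.symm ▸ hp)
      (sub_nonneg.2 hl1.le) hl (by ring)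
    rw [hS.interior_eq] at this
    convert this using 1
    simp; ring
  have hl : ∀ t ∈ Icc (0 : ℝ) 1, ∀ z, 0 ≤ t * ε z / 2 ∧ t * ε z / 2 < 1 := by
    intro t ht z
    have := mul_le_mul ht.2 (hε1 z) (hε0 z) zero_le_one
    exact ⟨div_nonneg (mul_nonneg ht.1 (hε0 z)) (by norm_num), by linarith⟩
  refine contractible_of_deformation (A := V) subset_union_left
    (fun t z => z + ((t * ε z / 2 : ℝ) : ℂ) * (p - z)) ?_ ?_ ?_ ?_ ?_ hV
  · apply Continuous.continuousOn
    fun_prop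
  · intro z _; simp
  · rintro t ht z (hz | hz)
    · by_cases hzS : z ∈ S
      · rcases (hl t ht z).1.eq_or_lt with h | h
        · simp only [← h]; simp [hz]
        · exact Or.inl (hSV (hmem z (subset_closure hzS) _ h (hl t ht z).2))
      · simp [hεz z ⟨hz, hzS⟩, hz]
    · rcases (hl t ht z).1.eq_or_lt with h | h
      · simp only [← h]; simp [hz]
      · exact Or.inl (hSV (hmem z (hIS hz) _ h (hl t ht z).2))
  · rintro t ht z hz
    by_cases hzS : z ∈ S
    · rcases (hl t ht z).1.eq_or_lt with h | h
      · simp only [← h]; simp [hz]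
      · exact hSV (hmem z (subset_closure hzS) _ h (hl t ht z).2)
    · simp [hεz z ⟨hz, hzS⟩, hz]
  · rintro z (hz | hz)
    · by_cases hzS : z ∈ S
      · rcases (hl 1 ⟨zero_le_one, le_rfl⟩ z).1.eq_or_lt with h | h
        · simp only [← h]; simp [hz]
        · exact hSV (hmem z (subset_closure hzS) _ h (hl 1 ⟨zero_le_one, le_rfl⟩ z).2)
      · simp [hεz z ⟨hz, hzS⟩, hz]
    · have h : 0 < 1 * ε z / 2 := by have := hεp z hz; linarith
      exact hSV (hmem z (hIS hz) _ h (hl 1 ⟨zero_le_one, le_rfl⟩ z).2)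

/-- The retraction to the vertical segment over `(α, β)`. -/
noncomputable def clampVert (c α β : ℝ) (z : ℂ) : ℂ :=
  c + (max (α + min |z.re - c| ((β - α) / 2)) (min z.im (β - min |z.re - c| ((β - α) / 2))) : ℝ)
    * Complex.I

/-- Off the line the target interval is shortened at both ends by the distance to the line, capped
at half its length. The image therefore stays in the open segment, while on the segment itself
nothing moves. -/
lemma clampVert_mem {c α β : ℝ} (hαβ : α < β) {z : ℂ} (hz : z.re ≠ c) :
    clampVert c α β z ∈ vert c α β := by
  have h1 : 0 < |z.re - c| := abs_pos.2 (sub_ne_zero.2 hz)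
  set d := min |z.re - c| ((β - α) / 2) with hd
  have hd0 : 0 < d := lt_min h1 (by linarith)
  have hd1 : d ≤ (β - α) / 2 := min_le_right _ _
  refine ⟨by simp [clampVert], ?_, ?_⟩
  · simp only [clampVert, Complex.add_im, Complex.ofReal_im, Complex.mul_im, Complex.ofReal_re,
      Complex.I_im, Complex.I_re, mul_one, mul_zero, add_zero, zero_add, ← hd]
    exact lt_of_lt_of_le (by linarith) (le_max_left _ _)
  · simp only [clampVert, Complex.add_im, Complex.ofReal_im, Complex.mul_im, Complex.ofReal_re,
      Complex.I_im, Complex.I_re, mul_one, mul_zero, add_zero, zero_add, ← hd]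
    refine max_lt (by linarith) (lt_of_le_of_lt (min_le_right _ _) (by linarith))

lemma clampVert_eq {c α β : ℝ} {z : ℂ} (hz : z ∈ vert c α β) : clampVert c α β z = z := by
  obtain ⟨h1, h2, h3⟩ := hz
  have h4 : min |z.re - c| ((β - α) / 2) = 0 := by
    rw [h1, sub_self, abs_zero, min_eq_left]; linarith
  unfold clampVert
  rw [h4, add_zero, sub_zero, min_eq_left h3.le, max_eq_right h2.le]
  apply Complex.ext <;> simp [h1]

lemma continuous_clampVert (c α β : ℝ) : Continuous (clampVert c α β) := by
  unfold clampVert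
  fun_prop

/-- Glue two open planar sets along a vertical segment. -/
lemma contractible_glue {V S T : Set ℂ} {c α β : ℝ} {p : ℂ} (hαβ : α < β) (hV : IsOpen V)
    (hS : IsOpen S) (hSc : Convex ℝ S) (hSV : S ⊆ V) (hp : p ∈ S)
    (hIS : vert c α β ⊆ closure S) (hI : Disjoint (vert c α β) (closure (V \ S)))
    (hT : IsOpen T) (hTc : Convex ℝ T) (hIT : vert c α β ⊆ closure T)
    (hTre : ∀ z ∈ T, z.re ≠ c) (hTV : Disjoint V T)
    (hcV : ContractibleSpace V) : ContractibleSpace (V ∪ vert c α β ∪ T : Set ℂ) := by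
  classical
  have h1 := contractible_union_segment hS hSc hSV hp hIS hI hcV
  have hmem : ∀ z ∈ T, ∀ t ∈ Icc (0 : ℝ) 1,
      z + t * (clampVert c α β z - z) ∈ vert c α β ∪ T := by
    intro z hz t ht
    have hr := clampVert_mem hαβ (hTre z hz)
    rcases ht.2.eq_or_lt with h | h
    · left; rw [h]; simpa using hr
    · right
      have := hTc.combo_interior_closure_mem_interior (hT.interior_eq.symm ▸ hz) (hIT hr)
        (sub_pos.2 h) ht.1 (by ring)
      rw [hT.interior_eq] at this
      convert this using 1
      simp; ring
  have hcl := continuous_clampVert c α β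
  -- Only `T` moves, along straight lines to its clamped images. On the segment the moving and the
  -- resting branch agree, which makes the homotopy continuous there; elsewhere one branch applies
  -- in a whole neighbourhood, as `V` and `T` are open and disjoint.
  refine contractible_of_deformation (A := V ∪ vert c α β) subset_union_left
    (fun t z => if z ∈ T then z + t * (clampVert c α β z - z) else z) ?_ ?_ ?_ ?_ ?_ h1
  · rintro ⟨t, z⟩ ⟨ht, hz⟩
    have hf : Continuous (fun q : ℝ × ℂ => q.2 + q.1 * (clampVert c α β q.2 - q.2)) := by
      fun_prop
    have hg : Continuous (fun q : ℝ × ℂ => q.2) := continuous_snd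
    apply ContinuousAt.continuousWithinAt
    rcases hz with (hz | hz) | hz
    · refine hg.continuousAt.congr ?_
      have : ∀ᶠ q : ℝ × ℂ in 𝓝 (t, z), q.2 ∈ V :=
        continuousAt_snd.eventually (hV.mem_nhds hz)
      filter_upwards [this] with q hq
      rw [if_neg (Set.disjoint_left.1 hTV hq)]
    · have hzT : z ∉ T := fun h => hTre z h hz.1
      have e1 : Tendsto (fun q : ℝ × ℂ => q.2 + q.1 * (clampVert c α β q.2 - q.2)) (𝓝 (t, z))
          (𝓝 z) := by
        have := hf.tendsto (t, z)
        simpa [clampVert_eq hz] using this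
      have e2 : Tendsto (fun q : ℝ × ℂ => q.2) (𝓝 (t, z)) (𝓝 z) := hg.tendsto (t, z)
      unfold ContinuousAt
      simp only [if_neg hzT]
      exact e1.if' e2
    · refine hf.continuousAt.congr ?_
      have : ∀ᶠ q : ℝ × ℂ in 𝓝 (t, z), q.2 ∈ T :=
        continuousAt_snd.eventually (hT.mem_nhds hz)
      filter_upwards [this] with q hq
      rw [if_pos hq]
  · intro z _; simp
  · intro t ht z hz
    by_cases hzT : z ∈ T
    · rw [if_pos hzT]
      rcases hmem z hzT t ht with h | h
      · exact Or.inl (Or.inr h)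
      · exact Or.inr h
    · rwa [if_neg hzT]
  · intro t ht z hz
    have hzT : z ∉ T := by
      rcases hz with hz | hz
      · exact Set.disjoint_left.1 hTV hz
      · exact fun h => hTre z h hz.1
    rwa [if_neg hzT]
  · intro z hz
    by_cases hzT : z ∈ T
    · rw [if_pos hzT]
      right
      simpa using clampVert_mem hαβ (hTre z hzT)
    · rw [if_neg hzT]
      rcases hz with hz | hz
      · exact hz
      · exact absurd hz hzT

/-! ### Vertical intervals in bounded open sets -/

lemma exists_exit {W : Set ℝ} (hW : IsOpen W) {y₀ y₁ : ℝ} (h0 : y₀ ∈ W) (h01 : y₀ < y₁)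
    (h1 : y₁ ∉ W) : ∃ β, y₀ < β ∧ β ∉ W ∧ ∀ y, y₀ ≤ y → y < β → y ∈ W := by
  set A : Set ℝ := Ici y₀ ∩ Wᶜ with hA
  have hne : A.Nonempty := ⟨y₁, h01.le, h1⟩
  have hbdd : BddBelow A := ⟨y₀, fun y hy => hy.1⟩
  have hcl : IsClosed A := isClosed_Ici.inter hW.isClosed_compl
  have hmem := hcl.csInf_mem hne hbdd
  refine ⟨sInf A, lt_of_le_of_ne hmem.1 ?_, hmem.2, ?_⟩
  · intro h
    exact hmem.2 (h ▸ h0)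
  · intro y hy hlt
    by_contra hyW
    exact absurd (csInf_le hbdd ⟨hy, hyW⟩) (not_le.2 hlt)

lemma exists_vert {U : Set ℂ} (hU : IsOpen U) (hb : Bornology.IsBounded U) {z : ℂ} (hz : z ∈ U) :
    ∃ α β, α < z.im ∧ z.im < β ∧ (⟨z.re, α⟩ : ℂ) ∈ frontier U ∧ (⟨z.re, β⟩ : ℂ) ∈ frontier U ∧
      vert z.re α β ⊆ U := by
  -- The sign `s` treats the upward and the downward exit at once.
  have key : ∀ s : ℝ, (s = 1 ∨ s = -1) → ∃ β, z.im < β ∧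
      (⟨z.re, z.im + s * (β - z.im)⟩ : ℂ) ∈ frontier U ∧
      ∀ y, z.im ≤ y → y < β → (⟨z.re, z.im + s * (y - z.im)⟩ : ℂ) ∈ U := by
    intro s hs
    have hcont : Continuous fun y : ℝ => (⟨z.re, z.im + s * (y - z.im)⟩ : ℂ) := by
      have : (fun y : ℝ => (⟨z.re, z.im + s * (y - z.im)⟩ : ℂ)) =
          fun y : ℝ => (z.re : ℂ) + ((z.im + s * (y - z.im) : ℝ) : ℂ) * Complex.I := by
        ext y; apply Complex.ext <;> simp
      rw [this]; fun_prop
    obtain ⟨R, hR⟩ := hb.exists_norm_le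
    have hs2 : s * s = 1 := by rcases hs with rfl | rfl <;> norm_num
    have hW : IsOpen {y : ℝ | (⟨z.re, z.im + s * (y - z.im)⟩ : ℂ) ∈ U} := hU.preimage hcont
    obtain ⟨β, h1, h2, h3⟩ := exists_exit hW (y₀ := z.im) (y₁ := z.im + (|R| + |z.im| + 1))
      (by simpa using hz)
      (lt_add_of_pos_right _ (by positivity)) (by
        intro h
        have h4 := hR _ h
        have h5 := (Complex.abs_im_le_norm _).trans h4
        simp only at h5
        have h6 : |s * (|R| + |z.im| + 1)| = |R| + |z.im| + 1 := by
          rw [abs_mul, abs_of_pos (by positivity : 0 < |R| + |z.im| + 1)]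
          rcases hs with rfl | rfl <;> simp
        have h7 : |s * (|R| + |z.im| + 1)| ≤ |z.im + s * (|R| + |z.im| + 1)| + |z.im| := by
          calc |s * (|R| + |z.im| + 1)| = |(z.im + s * (|R| + |z.im| + 1)) - z.im| := by ring_nf
            _ ≤ _ := abs_sub _ _
        have h8 : z.im + (|R| + |z.im| + 1) - z.im = |R| + |z.im| + 1 := by ring
        rw [h8] at h5
        have := le_abs_self R
        linarith)
    refine ⟨β, h1, ⟨?_, ?_⟩, h3⟩
    · refine mem_closure_of_tendsto (b := 𝓝[<] β)
        ((hcont.tendsto β).mono_left nhdsWithin_le_nhds) ?_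
      filter_upwards [Ioo_mem_nhdsLT h1] with y hy
      exact h3 y hy.1.le hy.2
    · rw [hU.interior_eq]; exact h2
  obtain ⟨β, hβ, hβf, hβU⟩ := key 1 (Or.inl rfl)
  obtain ⟨γ, hγ, hγf, hγU⟩ := key (-1) (Or.inr rfl)
  refine ⟨z.im + -1 * (γ - z.im), β, by linarith, hβ, hγf, ?_, ?_⟩
  · convert hβf using 2; ring
  · rintro w ⟨h1, h2, h3⟩
    rcases le_total z.im w.im with h | h
    · convert hβU w.im h h3 using 1
      apply Complex.ext <;> simp [h1]
    · convert hγU (2 * z.im - w.im) (by linarith) (by linarith) using 1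
      apply Complex.ext
      · simp [h1]
      · simp; ring

end SoftDisc

/-! ### The decomposition of a component into convex cells -/

namespace SoftDisc

open Set Filter Topology

/-- Twice the signed area of the triangle `a b z`. -/
def cross (a b z : ℂ) : ℝ := (b.re - a.re) * (z.im - a.im) - (b.im - a.im) * (z.re - a.re)

lemma continuous_cross (a b : ℂ) : Continuous (cross a b) := by
  unfold cross; fun_prop

lemma mem_segment_of_cross_eq_zero {a b z : ℂ} (h1 : a.re < z.re) (h2 : z.re < b.re)
    (h : cross a b z = 0) : z ∈ segment ℝ a b := by
  have hpos : 0 < b.re - a.re := by linarith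
  refine mem_segment_iff.2 ⟨(z.re - a.re) / (b.re - a.re), by apply div_nonneg <;> linarith, ?_, ?_⟩
  · rw [div_le_one hpos]; linarith
  · apply Complex.ext
    · simp only [Complex.add_re, Complex.re_ofReal_mul, Complex.sub_re]
      field_simp
      ring
    · simp only [Complex.add_im, Complex.im_ofReal_mul, Complex.sub_im]
      unfold cross at h
      field_simp
      linarith

lemma cross_eq_zero_of_mem_segment {a b z : ℂ} (h : z ∈ segment ℝ a b) : cross a b z = 0 := by
  obtain ⟨t, -, -, rfl⟩ := mem_segment_iff.1 h
  simp [cross]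
  ring

lemma cross_combo (a b z w : ℂ) (t : ℝ) :
    cross a b (z + t * (w - z)) = (1 - t) * cross a b z + t * cross a b w := by
  simp [cross]
  ring

namespace PlaneGraph

variable {G : PlaneGraph}

variable (G) in
/-- The abscissae of the vertices. -/
noncomputable def abscissae : Finset ℝ := G.verts.image Complex.re

variable (G) in
/-- The oriented edge `(a, b)` runs from left to right strictly over the abscissa of `z`, and `z`
lies above it. -/
def Above (p : ℂ × ℂ) (z : ℂ) : Prop :=
  G.graph.Adj p.1 p.2 ∧ p.1.re < z.re ∧ z.re < p.2.re ∧ 0 < cross p.1 p.2 z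

open Classical in
variable (G) in
/-- The vertices to the left of `z` and the edges below `z`. -/
noncomputable def sig (z : ℂ) : Finset ℝ × Finset (ℂ × ℂ) :=
  (G.abscissae.filter fun c => c < z.re, (G.verts ×ˢ G.verts).filter fun p => G.Above p z)

lemma sig_eq_iff {z w : ℂ} : G.sig z = G.sig w ↔
    (∀ c ∈ G.abscissae, (c < z.re ↔ c < w.re)) ∧
    ∀ p ∈ G.verts ×ˢ G.verts, (G.Above p z ↔ G.Above p w) := by
  classical
  unfold sig
  simp only [Prod.mk.injEq, Finset.ext_iff, Finset.mem_filter, and_congr_right_iff]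

lemma re_mem_abscissae {a : ℂ} (ha : a ∈ G.verts) : a.re ∈ G.abscissae :=
  Finset.mem_image_of_mem _ ha

/-- Points off the drawing with the same signature can be joined within the signature class. -/
lemma sig_segment {z w p : ℂ} (hz : z ∉ G.drawing) (hw : w ∉ G.drawing)
    (hzr : z.re ∉ G.abscissae) (hwr : w.re ∉ G.abscissae) (h : G.sig z = G.sig w)
    (hp : p ∈ segment ℝ z w) :
    p ∉ G.drawing ∧ p.re ∉ G.abscissae ∧ G.sig p = G.sig z := by
  obtain ⟨hs1, hs2⟩ := sig_eq_iff.1 h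
  obtain ⟨t, h0, h1, rfl⟩ := mem_segment_iff.1 hp
  have hre : (z + t * (w - z)).re = (1 - t) * z.re + t * w.re := by simp; ring
  have conv : ∀ x y : ℝ, 0 < x → 0 < y → 0 < (1 - t) * x + t * y := by
    intro x y hx hy
    rcases h1.eq_or_lt with h | h
    · rw [h]; simpa using hy
    · have := mul_pos (sub_pos.2 h) hx
      have := mul_nonneg h0 hy.le
      linarith
  have hlt : ∀ c ∈ G.abscissae, (c < z.re ∧ c < w.re ∧ c < (z + t * (w - z)).re) ∨
      (z.re < c ∧ w.re < c ∧ (z + t * (w - z)).re < c) := by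
    intro c hc
    rw [hre]
    have hzc : z.re ≠ c := fun h => hzr (h ▸ hc)
    have hwc : w.re ≠ c := fun h => hwr (h ▸ hc)
    rcases lt_or_gt_of_ne hzc with h | h
    · have h' : w.re < c := lt_of_le_of_ne (not_lt.1 fun h'' => h.not_gt ((hs1 c hc).2 h'')) hwc
      have := conv _ _ (sub_pos.2 h) (sub_pos.2 h')
      right; exact ⟨h, h', by linarith⟩
    · have h' := (hs1 c hc).1 h
      have := conv _ _ (sub_pos.2 h) (sub_pos.2 h')
      left; exact ⟨h, h', by linarith⟩
  have hcr : ∀ a b, G.graph.Adj a b → a.re < z.re → z.re < b.re →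
      (0 < cross a b z ∧ 0 < cross a b (z + t * (w - z))) ∨
      (cross a b z < 0 ∧ cross a b (z + t * (w - z)) < 0) := by
    intro a b hab hza hzb
    have hwa : a.re < w.re := (hs1 _ (re_mem_abscissae (adj_mem_left hab))).1 hza
    have hwb : w.re < b.re := by
      rcases hlt _ (re_mem_abscissae (adj_mem_right hab)) with h | h
      · exact absurd h.1 hzb.not_gt
      · exact h.2.1
    have hz0 : cross a b z ≠ 0 := fun h =>
      hz (segment_subset_drawing hab (mem_segment_of_cross_eq_zero hza hzb h))
    have hw0 : cross a b w ≠ 0 := fun h =>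
      hw (segment_subset_drawing hab (mem_segment_of_cross_eq_zero hwa hwb h))
    have h2 := hs2 (a, b) (Finset.mem_product.2 ⟨adj_mem_left hab, adj_mem_right hab⟩)
    rw [cross_combo]
    rcases lt_or_gt_of_ne hz0 with h | h
    · have h' : cross a b w < 0 := by
        refine lt_of_le_of_ne (not_lt.1 fun h'' => ?_) hw0
        exact h.not_gt (h2.2 ⟨hab, hwa, hwb, h''⟩).2.2.2
      have := conv _ _ (neg_pos.2 h) (neg_pos.2 h')
      right; exact ⟨h, by linarith⟩
    · have h' : 0 < cross a b w := (h2.1 ⟨hab, hza, hzb, h⟩).2.2.2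
      left; exact ⟨h, conv _ _ h h'⟩
  refine ⟨?_, ?_, ?_⟩
  · intro hpD
    rcases mem_drawing_iff.1 hpD with hv | ⟨a, b, hab, hpab⟩
    · rcases hlt _ (re_mem_abscissae hv) with h | h
      · exact lt_irrefl _ h.2.2
      · exact lt_irrefl _ h.2.2
    · wlog hle : a.re ≤ b.re generalizing a b
      · exact this b a hab.symm (by rwa [openSegment_symm]) (le_of_not_ge hle)
      have hpc := cross_eq_zero_of_mem_segment (openSegment_subset_segment ℝ a b hpab)
      have hbet : a.re ≤ (z + t * (w - z)).re ∧ (z + t * (w - z)).re ≤ b.re := by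
        obtain ⟨s, hs0, hs1, hs⟩ := mem_segment_iff.1 (openSegment_subset_segment ℝ a b hpab)
        rw [hs]
        simp only [Complex.add_re, Complex.re_ofReal_mul, Complex.sub_re]
        constructor <;> nlinarith
      have hza : a.re < z.re := by
        rcases hlt _ (re_mem_abscissae (adj_mem_left hab)) with h | h
        · exact h.1
        · exact absurd h.2.2 hbet.1.not_gt
      have hzb : z.re < b.re := by
        rcases hlt _ (re_mem_abscissae (adj_mem_right hab)) with h | h
        · exact absurd h.2.2 hbet.2.not_gt
        · exact h.1
      rcases hcr a b hab hza hzb with h | h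
      · exact h.2.ne' hpc
      · exact h.2.ne hpc
  · intro hc
    rcases hlt _ hc with h | h
    · exact lt_irrefl _ h.2.2
    · exact lt_irrefl _ h.2.2
  · have key1 : ∀ c ∈ G.abscissae, (c < (z + t * (w - z)).re ↔ c < z.re) := by
      intro c hc
      rcases hlt c hc with h | h
      · simp only [h.1, h.2.2]
      · simp only [h.1.not_gt, h.2.2.not_gt]
    have key2 : ∀ c ∈ G.abscissae, ((z + t * (w - z)).re < c ↔ z.re < c) := by
      intro c hc
      rcases hlt c hc with h | h
      · simp only [h.1.not_gt, h.2.2.not_gt]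
      · simp only [h.1, h.2.2]
    rw [sig_eq_iff]
    refine ⟨key1, ?_⟩
    rintro ⟨a, b⟩ hp
    obtain ⟨ha, hb⟩ := Finset.mem_product.1 hp
    unfold Above
    simp only
    rw [key1 _ (re_mem_abscissae ha), key2 _ (re_mem_abscissae hb)]
    refine and_congr_right fun hab => and_congr_right fun h3 => and_congr_right fun h4 => ?_
    rcases hcr a b hab h3 h4 with h | h
    · simp only [h.1, h.2]
    · simp only [h.1.not_gt, h.2.not_gt]

lemma eventually_pos_iff {f : ℂ → ℝ} (hf : Continuous f) {z : ℂ} (hz : f z ≠ 0) :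
    ∀ᶠ w in 𝓝 z, (0 < f w ↔ 0 < f z) := by
  rcases lt_or_gt_of_ne hz with h | h
  · filter_upwards [hf.continuousAt.eventually_lt continuousAt_const h] with w hw
    simp only [h.not_gt, hw.not_gt]
  · filter_upwards [continuousAt_const.eventually_lt hf.continuousAt h] with w hw
    simp only [h, hw]

lemma eventually_sig_eq {z : ℂ} (hz : z ∉ G.drawing) (hzr : z.re ∉ G.abscissae) :
    ∀ᶠ w in 𝓝 z, w.re ∉ G.abscissae ∧ G.sig w = G.sig z := by
  have h1 : ∀ᶠ w in 𝓝 z, w.re ∉ G.abscissae :=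
    Complex.continuous_re.continuousAt.eventually
      (G.abscissae.finite_toSet.isClosed.isOpen_compl.mem_nhds hzr)
  have hlt : ∀ c ∈ G.abscissae, ∀ᶠ w in 𝓝 z, (c < w.re ↔ c < z.re) := by
    intro c hc
    have := eventually_pos_iff (f := fun w => w.re - c) (z := z) (by fun_prop)
      (sub_ne_zero.2 fun h => hzr (h ▸ hc))
    simpa only [sub_pos] using this
  have hgt : ∀ c ∈ G.abscissae, ∀ᶠ w in 𝓝 z, (w.re < c ↔ z.re < c) := by
    intro c hc
    have := eventually_pos_iff (f := fun w => c - w.re) (z := z) (by fun_prop)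
      (sub_ne_zero.2 fun h => hzr (h ▸ hc))
    simpa only [sub_pos] using this
  have h2 : ∀ᶠ w in 𝓝 z, ∀ c ∈ G.abscissae, (c < w.re ↔ c < z.re) := by
    rw [Finset.eventually_all]; exact hlt
  have h3 : ∀ᶠ w in 𝓝 z, ∀ p ∈ G.verts ×ˢ G.verts, (G.Above p w ↔ G.Above p z) := by
    rw [Finset.eventually_all]
    rintro ⟨a, b⟩ hp
    obtain ⟨ha, hb⟩ := Finset.mem_product.1 hp
    have e1 := hlt _ (re_mem_abscissae ha)
    have e2 := hgt _ (re_mem_abscissae hb)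
    by_cases hc : G.graph.Adj a b ∧ a.re < z.re ∧ z.re < b.re
    · have hne : cross a b z ≠ 0 := fun h =>
        hz (segment_subset_drawing hc.1 (mem_segment_of_cross_eq_zero hc.2.1 hc.2.2 h))
      filter_upwards [e1, e2, eventually_pos_iff (continuous_cross a b) hne] with w h1 h2 h3
      unfold Above
      simp only
      rw [h1, h2, h3]
    · filter_upwards [e1, e2] with w h1 h2
      unfold Above
      simp only
      rw [h1, h2]
      tauto
  filter_upwards [h1, h2, h3] with w h1 h2 h3
  exact ⟨h1, sig_eq_iff.2 ⟨h2, h3⟩⟩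

/-- The part of `U` with signature `σ`. -/
def cell (G : PlaneGraph) (U : Set ℂ) (σ : Finset ℝ × Finset (ℂ × ℂ)) : Set ℂ :=
  {z ∈ U | z.re ∉ G.abscissae ∧ G.sig z = σ}

lemma isOpen_cell {U : Set ℂ} (hU : U ∈ G.comps) (σ) : IsOpen (G.cell U σ) := by
  rw [isOpen_iff_mem_nhds]
  rintro z ⟨hz, hzr, hs⟩
  filter_upwards [(comps_isOpen hU).mem_nhds hz, eventually_sig_eq (comps_subset hU hz) hzr]
    with w h1 h2
  exact ⟨h1, h2.1, h2.2.trans hs⟩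

/-- A segment between two points of equal signature crosses neither an abscissa nor an edge, so it
stays in the same component with the same signature. -/
lemma convex_cell {U : Set ℂ} (hU : U ∈ G.comps) (σ) : Convex ℝ (G.cell U σ) := by
  rw [convex_iff_segment_subset]
  rintro z ⟨hz, hzr, hzs⟩ w ⟨hw, hwr, hws⟩
  have key := fun p hp => sig_segment (p := p) (comps_subset hU hz) (comps_subset hU hw) hzr hwr
    (hzs.trans hws.symm) hp
  have hsub : segment ℝ z w ⊆ U := comps_maximal hU (convex_segment z w).isPreconnected
    (fun p hp => (key p hp).1) ⟨z, left_mem_segment ℝ z w, hz⟩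
  intro p hp
  exact ⟨hsub hp, (key p hp).2.1, (key p hp).2.2.trans hzs⟩

/-- Every point of `U` over an abscissa has a cell on its left and a cell on its right. -/
lemma exists_sides {U : Set ℂ} (hU : U ∈ G.comps) :
    ∃ l r : ℂ → Finset ℝ × Finset (ℂ × ℂ), ∀ z ∈ U, z.re ∈ G.abscissae → l z ≠ r z ∧
      ∃ ε > 0, Metric.ball z ε ⊆ U ∧ ∀ w ∈ Metric.ball z ε,
        (w.re < z.re → w ∈ G.cell U (l z)) ∧ (z.re < w.re → w ∈ G.cell U (r z)) ∧
        (w.re = z.re → l w = l z ∧ r w = r z) := by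
  have hUo := comps_isOpen hU
  have base : ∀ z ∈ U, ∃ ε > 0, Metric.ball z ε ⊆ U ∧
      ∀ w ∈ Metric.ball z ε, w.re ≠ z.re → w.re ∉ G.abscissae := by
    intro z hz
    have h1 : ∀ᶠ w in 𝓝 z, w.re ∉ (G.abscissae.erase z.re : Finset ℝ) :=
      Complex.continuous_re.continuousAt.eventually
        ((G.abscissae.erase z.re).finite_toSet.isClosed.isOpen_compl.mem_nhds (by simp))
    obtain ⟨ε, hε, h⟩ := Metric.mem_nhds_iff.1 (inter_mem (hUo.mem_nhds hz) h1)
    refine ⟨ε, hε, fun w hw => (h hw).1, fun w hw hne hc => (h hw).2 ?_⟩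
    exact Finset.mem_erase.2 ⟨hne, hc⟩
  choose! ε hε hball hre using base
  have hmemL : ∀ z t, z ∈ U → |t| < ε z → z + (t : ℂ) ∈ Metric.ball z (ε z) := by
    intro z t hz ht
    rw [Metric.mem_ball, dist_eq_norm]
    simpa using ht
  -- On a convex part of the ball that avoids the vertical line through `z` the signature is locally
  -- constant, hence constant.
  have conn : ∀ z ∈ U, ∀ H : Set ℂ, Convex ℝ H → H ⊆ Metric.ball z (ε z) →
      (∀ w ∈ H, w.re ≠ z.re) → ∀ w ∈ H, ∀ w' ∈ H, G.sig w = G.sig w' := by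
    intro z hz H hH hHb hHr w hw w' hw'
    let _ : TopologicalSpace (Finset ℝ × Finset (ℂ × ℂ)) := ⊥
    have : DiscreteTopology (Finset ℝ × Finset (ℂ × ℂ)) := ⟨rfl⟩
    refine hH.isPreconnected.constant (f := G.sig) ?_ hw hw'
    intro p hp
    apply ContinuousAt.continuousWithinAt
    have hev := eventually_sig_eq (comps_subset hU (hball z hz (hHb hp)))
      (hre z hz p (hHb hp) (hHr p hp))
    exact (continuousAt_const (y := G.sig p)).congr (hev.mono fun q hq => hq.2.symm)
  have hcl : ∀ z : ℂ, Convex ℝ (Metric.ball z (ε z) ∩ {w | w.re < z.re}) := fun z =>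
    (convex_ball z _).inter ((convex_Iio z.re).linear_preimage Complex.reLm)
  have hcr : ∀ z : ℂ, Convex ℝ (Metric.ball z (ε z) ∩ {w | z.re < w.re}) := fun z =>
    (convex_ball z _).inter ((convex_Ioi z.re).linear_preimage Complex.reLm)
  have hle : ∀ z ∈ U, ∀ w ∈ Metric.ball z (ε z), w.re < z.re → ∀ w' ∈ Metric.ball z (ε z),
      w'.re < z.re → G.sig w = G.sig w' := fun z hz w hw h w' hw' h' =>
    conn z hz _ (hcl z) inter_subset_left (fun p hp => (show p.re < z.re from hp.2).ne) w ⟨hw, h⟩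
      w' ⟨hw', h'⟩
  have hri : ∀ z ∈ U, ∀ w ∈ Metric.ball z (ε z), z.re < w.re → ∀ w' ∈ Metric.ball z (ε z),
      z.re < w'.re → G.sig w = G.sig w' := fun z hz w hw h w' hw' h' =>
    conn z hz _ (hcr z) inter_subset_left (fun p hp => (show z.re < p.re from hp.2).ne') w ⟨hw, h⟩
      w' ⟨hw', h'⟩
  have nb : ∀ z ∈ U, ∀ t : ℝ, 0 < t → t < ε z → (z + ((-t : ℝ) : ℂ) ∈ Metric.ball z (ε z) ∧
      (z + ((-t : ℝ) : ℂ)).re < z.re) ∧ (z + ((t : ℝ) : ℂ) ∈ Metric.ball z (ε z) ∧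
      z.re < (z + ((t : ℝ) : ℂ)).re) := by
    intro z hz t ht ht'
    refine ⟨⟨hmemL z _ hz (by rwa [abs_neg, abs_of_pos ht]), by simpa using ht⟩,
      hmemL z _ hz (by rwa [abs_of_pos ht]), by simpa using ht⟩
  -- `l` and `r` read the signature half a radius to the left and to the right. For a point `w` of
  -- the ball on the same vertical line, a step shorter than both available radii compares the
  -- values at `w` with those at `z`.
  refine ⟨fun z => G.sig (z + ((-(ε z / 2) : ℝ) : ℂ)), fun z => G.sig (z + ((ε z / 2 : ℝ) : ℂ)),
    fun z hz hzc => ?_⟩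
  have hεz := hε z hz
  have nbz := nb z hz (ε z / 2) (by linarith) (by linarith)
  refine ⟨?_, ε z, hεz, hball z hz, fun w hw => ⟨fun h => ?_, fun h => ?_, fun h => ?_⟩⟩
  · intro heq
    have := (sig_eq_iff.1 heq).1 z.re hzc
    exact nbz.1.2.not_gt (this.2 nbz.2.2)
  · exact ⟨hball z hz hw, hre z hz w hw h.ne, hle z hz w hw h _ nbz.1.1 nbz.1.2⟩
  · exact ⟨hball z hz hw, hre z hz w hw h.ne', hri z hz w hw h _ nbz.2.1 nbz.2.2⟩
  · have hwU := hball z hz hw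
    have hεw := hε w hwU
    have hd : 0 < ε z - dist w z := sub_pos.2 hw
    set t := min (ε w) (ε z - dist w z) / 2 with ht
    have ht0 : 0 < t := half_pos (lt_min hεw hd)
    have ht1 : t < ε w := by
      have := min_le_left (ε w) (ε z - dist w z); linarith
    have ht2 : t < ε z - dist w z := by
      have := min_le_right (ε w) (ε z - dist w z); linarith
    have nbw := nb w hwU (ε w / 2) (by linarith) (by linarith)
    have nbt := nb w hwU t ht0 ht1
    have inz : ∀ s : ℝ, |s| = t → w + (s : ℂ) ∈ Metric.ball z (ε z) := by
      intro s hs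
      rw [Metric.mem_ball]
      calc dist (w + (s : ℂ)) z ≤ dist (w + (s : ℂ)) w + dist w z := dist_triangle _ _ _
        _ = t + dist w z := by rw [dist_eq_norm]; simp [hs]
        _ < ε z := by linarith
    beta_reduce
    constructor
    · rw [hle w hwU _ nbw.1.1 nbw.1.2 _ nbt.1.1 nbt.1.2]
      exact hle z hz _ (inz _ (by rw [abs_neg, abs_of_pos ht0])) (by simp [h, ht0]) _ nbz.1.1 nbz.1.2
    · rw [hri w hwU _ nbw.2.1 nbw.2.2 _ nbt.2.1 nbt.2.2]
      exact hri z hz _ (inz _ (by rw [abs_of_pos ht0])) (by simp [h, ht0]) _ nbz.2.1 nbz.2.2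

lemma reachable_of_connected (hc : G.Connected) {a b : ℂ} (ha : a ∈ G.verts) (hb : b ∈ G.verts) :
    G.graph.Reachable a b := by
  have := hc.preconnected ⟨a, ha⟩ ⟨b, hb⟩
  exact this.map (SimpleGraph.Embedding.induce (G := G.graph) (G.verts : Set ℂ)).toHom

/-- Any two points of a connected drawing are joined by a polygonal path inside it, and angle lifts
add up along the path. -/
lemma argLift_drawing (hc : G.Connected) {a b : ℂ} (ha : a ∈ G.drawing) (hb : b ∈ G.drawing) :
    ArgLift G.drawingᶜ a b := by
  have disj : ∀ x y, G.graph.Adj x y → Disjoint G.drawingᶜ (segment ℝ x y) := fun x y hxy =>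
    disjoint_compl_left.mono_right (segment_subset_drawing hxy)
  have key : ∀ a ∈ G.drawing, ∃ v ∈ G.verts, segment ℝ a v ⊆ G.drawing := by
    intro a ha
    rcases mem_drawing_iff.1 ha with h | ⟨x, y, hxy, h⟩
    · exact ⟨a, h, by simpa using ha⟩
    · refine ⟨x, adj_mem_left hxy, subset_trans ?_ (segment_subset_drawing hxy)⟩
      exact (convex_segment x y).segment_subset (openSegment_subset_segment ℝ x y h)
        (left_mem_segment ℝ x y)
  obtain ⟨v, hv, hav⟩ := key a ha
  obtain ⟨w, hw, hbw⟩ := key b hb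
  refine (ArgLift.of_segment (disjoint_compl_left.mono_right hav)).trans
    ((ArgLift.of_reachable (reachable_of_connected hc hv hw) disj).trans
    (ArgLift.of_segment (disjoint_compl_left.mono_right ?_)))
  rwa [segment_symm]

end PlaneGraph

end SoftDisc

/-! ### Bounded components of the complement of a connected drawing are simply connected -/

namespace SoftDisc

open Set Filter Topology

namespace PlaneGraph

variable {G : PlaneGraph}

/-- The functions `l` and `r` give the cells on the left and right of points over abscissae. -/
def Sided (G : PlaneGraph) (U : Set ℂ) (l r : ℂ → Finset ℝ × Finset (ℂ × ℂ)) : Prop :=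
  ∀ z ∈ U, z.re ∈ G.abscissae → l z ≠ r z ∧
    ∃ ε > 0, Metric.ball z ε ⊆ U ∧ ∀ w ∈ Metric.ball z ε,
      (w.re < z.re → w ∈ G.cell U (l z)) ∧ (z.re < w.re → w ∈ G.cell U (r z)) ∧
      (w.re = z.re → l w = l z ∧ r w = r z)

/-- The union of the cells with signature in `𝒮`, glued along the vertical segments between
them. -/
def region (G : PlaneGraph) (U : Set ℂ) (l r : ℂ → Finset ℝ × Finset (ℂ × ℂ))
    (𝒮 : Set (Finset ℝ × Finset (ℂ × ℂ))) : Set ℂ :=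
  {z ∈ U | (z.re ∉ G.abscissae ∧ G.sig z ∈ 𝒮) ∨ (z.re ∈ G.abscissae ∧ l z ∈ 𝒮 ∧ r z ∈ 𝒮)}

variable {U : Set ℂ} {l r : ℂ → Finset ℝ × Finset (ℂ × ℂ)}
  {𝒮 : Set (Finset ℝ × Finset (ℂ × ℂ))}

lemma cell_subset_region {σ} (hσ : σ ∈ 𝒮) : G.cell U σ ⊆ G.region U l r 𝒮 :=
  fun _ hz => ⟨hz.1, Or.inl ⟨hz.2.1, hz.2.2 ▸ hσ⟩⟩

lemma Sided.isOpen_region (hs : G.Sided U l r) (hU : U ∈ G.comps) :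
    IsOpen (G.region U l r 𝒮) := by
  rw [isOpen_iff_mem_nhds]
  rintro z ⟨hz, ⟨hzr, h⟩ | ⟨hzr, h1, h2⟩⟩
  · exact mem_of_superset ((isOpen_cell hU (G.sig z)).mem_nhds ⟨hz, hzr, rfl⟩)
      (cell_subset_region h)
  · obtain ⟨-, ε, hε, hb, hw⟩ := hs z hz hzr
    refine mem_of_superset (Metric.ball_mem_nhds z hε) fun w hwb => ?_
    obtain ⟨ha, hb', hc⟩ := hw w hwb
    rcases lt_trichotomy w.re z.re with h | h | h
    · exact cell_subset_region h1 (ha h)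
    · obtain ⟨e1, e2⟩ := hc h
      exact ⟨hb hwb, Or.inr ⟨by rwa [h], by rwa [e1], by rwa [e2]⟩⟩
    · exact cell_subset_region h2 (hb' h)

lemma tendsto_shift (z : ℂ) (c : ℝ) : Tendsto (fun t : ℝ => z + ((t * c : ℝ) : ℂ)) (𝓝[>] 0) (𝓝 z) := by
  have h : Continuous fun t : ℝ => z + ((t * c : ℝ) : ℂ) := by fun_prop
  have := h.tendsto 0
  rw [zero_mul, Complex.ofReal_zero, add_zero] at this
  exact this.mono_left nhdsWithin_le_nhds

lemma Sided.eventually (hs : G.Sided U l r) {z : ℂ} (hz : z ∈ U) (hzr : z.re ∈ G.abscissae)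
    {c : ℝ} (hc : 0 < c) :
    (∀ᶠ t : ℝ in 𝓝[>] 0, z + ((t * -c : ℝ) : ℂ) ∈ G.cell U (l z)) ∧
    (∀ᶠ t : ℝ in 𝓝[>] 0, z + ((t * c : ℝ) : ℂ) ∈ G.cell U (r z)) := by
  obtain ⟨-, ε, hε, hb, hw⟩ := hs z hz hzr
  constructor
  · filter_upwards [(tendsto_shift z (-c)).eventually (Metric.ball_mem_nhds z hε),
      self_mem_nhdsWithin] with t ht ht0
    refine (hw _ ht).1 ?_
    have := mul_pos (show 0 < t from ht0) hc
    simp [this]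
  · filter_upwards [(tendsto_shift z c).eventually (Metric.ball_mem_nhds z hε),
      self_mem_nhdsWithin] with t ht ht0
    refine (hw _ ht).2.1 ?_
    have := mul_pos (show 0 < t from ht0) hc
    simp [this]

lemma Sided.mem_closure (hs : G.Sided U l r) {z : ℂ} (hz : z ∈ U) (hzr : z.re ∈ G.abscissae) :
    z ∈ closure (G.cell U (l z)) ∧ z ∈ closure (G.cell U (r z)) :=
  ⟨mem_closure_of_tendsto (tendsto_shift z (-1)) (hs.eventually hz hzr one_pos).1,
    mem_closure_of_tendsto (tendsto_shift z 1) (hs.eventually hz hzr one_pos).2⟩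

lemma Sided.constant_on_vert (hs : G.Sided U l r) {c α β : ℝ} (hc : c ∈ G.abscissae)
    (hI : vert c α β ⊆ U) {z w : ℂ} (hz : z ∈ vert c α β) (hw : w ∈ vert c α β) :
    l z = l w ∧ r z = r w := by
  have hconv : Convex ℝ (vert c α β) := by
    have h1 : vert c α β = (Complex.reLm ⁻¹' {c}) ∩ (Complex.imLm ⁻¹' Ioo α β) := by
      ext z; simp [vert]
    rw [h1]
    exact ((convex_singleton c).linear_preimage _).inter ((convex_Ioo α β).linear_preimage _)
  let _ : TopologicalSpace (Finset ℝ × Finset (ℂ × ℂ)) := ⊥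
  have : DiscreteTopology (Finset ℝ × Finset (ℂ × ℂ)) := ⟨rfl⟩
  have key : ∀ p ∈ vert c α β, ∀ᶠ q in 𝓝[vert c α β] p, l q = l p ∧ r q = r p := by
    intro p hp
    obtain ⟨-, ε, hε, hb, hw⟩ := hs p (hI hp) (by rwa [hp.1])
    filter_upwards [mem_nhdsWithin_of_mem_nhds (Metric.ball_mem_nhds p hε), self_mem_nhdsWithin]
      with q hq hqI
    exact (hw q hq).2.2 (hqI.1.trans hp.1.symm)
  constructor
  · refine hconv.isPreconnected.constant (f := l) (fun p hp => ?_) hz hw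
    exact (continuousWithinAt_const (b := l p)).congr_of_eventuallyEq
      ((key p hp).mono fun q hq => hq.1) rfl
  · refine hconv.isPreconnected.constant (f := r) (fun p hp => ?_) hz hw
    exact (continuousWithinAt_const (b := r p)).congr_of_eventuallyEq
      ((key p hp).mono fun q hq => hq.2) rfl

/-- The new cell meets the old region along one vertical segment only, the maximal one through `z₀`.
A second contact would yield a connected set in `U` that avoids this segment and reaches both of its
sides. But the ends of the segment lie on the connected drawing, so the angle under which it is seen
lifts, contradicting `not_both_sides`. What remains is `contractible_glue`. -/
lemma Sided.contractible_insert (hs : G.Sided U l r) (hconn : G.Connected)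
    (hU : U ∈ G.comps) (hb : Bornology.IsBounded U)
    (hcS : ContractibleSpace (G.region U l r 𝒮)) {z₀ : ℂ} (hz₀ : z₀ ∈ U)
    (hz₀r : z₀.re ∈ G.abscissae) {σ τ} (hσ : σ ∈ 𝒮) (hτ : τ ∉ 𝒮)
    (hside : (l z₀ = σ ∧ r z₀ = τ) ∨ (l z₀ = τ ∧ r z₀ = σ)) :
    ContractibleSpace (G.region U l r (insert τ 𝒮)) := by
  obtain ⟨α, β, hα, hβ, hαf, hβf, hI⟩ := exists_vert (comps_isOpen hU) hb hz₀
  have hαβ : α < β := hα.trans hβ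
  set c := z₀.re with hc
  set V := G.region U l r 𝒮 with hV
  have hVo : IsOpen V := hs.isOpen_region hU
  have hz₀I : z₀ ∈ vert c α β := ⟨hc.symm, hα, hβ⟩
  have sidesI : ∀ z ∈ vert c α β, (l z = σ ∧ r z = τ) ∨ (l z = τ ∧ r z = σ) := by
    intro z hz
    obtain ⟨e1, e2⟩ := hs.constant_on_vert hz₀r hI hz hz₀I
    rwa [e1, e2]
  have closI : ∀ z ∈ U, z.re ∈ G.abscissae → ∀ ρ, (l z = ρ ∨ r z = ρ) →
      z ∈ closure (G.cell U ρ) := by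
    rintro z hz hzr ρ (rfl | rfl)
    · exact (hs.mem_closure hz hzr).1
    · exact (hs.mem_closure hz hzr).2
  have hIV : ∀ z ∈ vert c α β, z ∉ V := by
    rintro z hz ⟨-, h | h⟩
    · exact h.1 (by rw [hz.1]; exact hz₀r)
    · rcases sidesI z hz with h' | h'
      · exact hτ (h'.2 ▸ h.2.2)
      · exact hτ (h'.1 ▸ h.2.1)
  have hTV : Disjoint V (G.cell U τ) := by
    rw [Set.disjoint_left]
    rintro z ⟨-, h | h⟩ ⟨-, h1, h2⟩
    · exact hτ (h2 ▸ h.2)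
    · exact h1 h.1
  have hTre : ∀ z ∈ G.cell U τ, z.re ≠ c := fun z hz h => hz.2.1 (by rw [h]; exact hz₀r)
  obtain ⟨p, hp⟩ : (G.cell U σ).Nonempty := closure_nonempty_iff.1
    ⟨z₀, closI z₀ hz₀ hz₀r σ (by tauto)⟩
  have hVpre : IsPreconnected V := by
    have : ConnectedSpace V := inferInstance
    exact isPreconnected_iff_preconnectedSpace.2 inferInstance
  have hlr := (hs z₀ hz₀ hz₀r).1
  -- points glued between `V` and the new cell lie on the segment through `z₀`
  have glue : ∀ w ∈ U, w.re ∈ G.abscissae → (l w = τ ∧ r w ∈ 𝒮 ∨ r w = τ ∧ l w ∈ 𝒮) →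
      w ∈ vert c α β := by
    intro w hw hwr hwτ
    by_contra hwI
    set a : ℂ := ⟨c, α⟩ with ha
    set b : ℂ := ⟨c, β⟩ with hbdef
    have hab : a ≠ b := fun h => hαβ.ne (congrArg Complex.im h)
    have haD : a ∈ G.drawing := frontier_comp_subset hU hαf
    have hbD : b ∈ G.drawing := frontier_comp_subset hU hβf
    have hba : b - a = ((β - α : ℝ) : ℂ) * Complex.I := by
      apply Complex.ext <;> simp [ha, hbdef]
    have hseg : ∀ z ∈ segment ℝ a b, z = a ∨ z = b ∨ z ∈ vert c α β := by
      intro z hz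
      rcases segment_endpoint_or hz with h | h | h
      · exact Or.inl h
      · exact Or.inr (Or.inl h)
      · right; right
        rw [openSegment_eq_image'] at h
        obtain ⟨t, ⟨ht0, ht1⟩, rfl⟩ := h
        have h1 : 0 < t * (β - α) := mul_pos ht0 (by linarith)
        have h2 : t * (β - α) < β - α := by
          have : 0 < β - α := by linarith
          nlinarith
        refine ⟨?_, ?_, ?_⟩
        · simp [ha, hbdef]
        · simp [ha, hbdef, h1]
        · simp only [ha, hbdef, Complex.add_im, Complex.smul_im, Complex.sub_im, smul_eq_mul]
          linarith
    have hwV : w ∈ closure V := by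
      rcases hwτ with ⟨-, h⟩ | ⟨-, h⟩
      · exact closure_mono (cell_subset_region h) (closI w hw hwr _ (Or.inr rfl))
      · exact closure_mono (cell_subset_region h) (closI w hw hwr _ (Or.inl rfl))
    have hwT : w ∈ closure (G.cell U τ) := closI w hw hwr τ (by tauto)
    have hK1 : IsPreconnected (V ∪ {w}) :=
      hVpre.subset_closure subset_union_left (union_subset subset_closure (by simpa using hwV))
    have hK2 : IsPreconnected (G.cell U τ ∪ {w}) :=
      (convex_cell hU τ).isPreconnected.subset_closure subset_union_left
        (union_subset subset_closure (by simpa using hwT))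
    have hK : IsPreconnected ((V ∪ {w}) ∪ (G.cell U τ ∪ {w})) :=
      hK1.union w (by simp) (by simp) hK2
    have hKU : (V ∪ {w}) ∪ (G.cell U τ ∪ {w}) ⊆ U := by
      rintro z ((h | h) | (h | h))
      · exact h.1
      · exact h ▸ hw
      · exact h.1
      · exact h ▸ hw
    set s : ℝ := (z₀.im - α) / (β - α) with hsdef
    have hba' : 0 < β - α := by linarith
    have hs0 : 0 < s := div_pos (by linarith) hba'
    have hs1 : s < 1 := by rw [hsdef, div_lt_one hba']; linarith
    -- Since `b - a` is a positive multiple of `I`, moving to the left of the oriented segment is a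
    -- horizontal move towards smaller abscissae.
    have hpt : ∀ t : ℝ, a + (s + t * Complex.I) * (b - a) = z₀ + ((t * -(β - α) : ℝ) : ℂ) := by
      intro t
      have hsm : s * (β - α) = z₀.im - α := by rw [hsdef]; field_simp
      rw [hba]
      apply Complex.ext
      · simp [ha, hc]
        ring
      · simp [ha, hc, hsm]
    have hcells : ∀ ρ, (ρ = σ ∨ ρ = τ) → G.cell U ρ ⊆ (V ∪ {w}) ∪ (G.cell U τ ∪ {w}) := by
      rintro ρ (rfl | rfl)
      · exact (cell_subset_region hσ).trans (subset_union_left.trans subset_union_left)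
      · exact subset_union_left.trans subset_union_right
    have hev := hs.eventually hz₀ hz₀r hba'
    refine not_both_sides hab (K := (V ∪ {w}) ∪ (G.cell U τ ∪ {w})) (K' := G.drawingᶜ) hs0 hs1 hK
      ?_ G.isOpen_compl_drawing (hKU.trans (comps_subset hU)) ?_ (argLift_drawing hconn haD hbD)
      ?_ ?_
    · rw [Set.disjoint_left]
      intro z hz hzs
      have hzD := comps_subset hU (hKU hz)
      rcases hseg z hzs with rfl | rfl | h
      · exact hzD haD
      · exact hzD hbD
      · rcases hz with (hz | hz) | (hz | hz)
        · exact hIV z h hz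
        · exact hwI (hz ▸ h)
        · exact hTre z hz h.1
        · exact hwI (hz ▸ h)
    · have := hpt 0
      simp only [Complex.ofReal_zero, zero_mul, add_zero] at this
      rw [this]
      exact comps_subset hU hz₀
    · filter_upwards [hev.1] with t ht
      rw [hpt]
      exact hcells _ (by tauto) ht
    · have h3 : Tendsto (fun t : ℝ => -t) (𝓝[<] 0) (𝓝[>] 0) := by
        have := tendsto_neg_nhdsLT (a := (0 : ℝ))
        simpa using this
      filter_upwards [h3.eventually hev.2] with t ht
      rw [hpt]
      have e : t * -(β - α) = -t * (β - α) := by ring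
      rw [e]
      exact hcells _ (by tauto) ht
  have heq : G.region U l r (insert τ 𝒮) = V ∪ vert c α β ∪ G.cell U τ := by
    ext w
    constructor
    · rintro ⟨hw, ⟨hwr, h | h⟩ | ⟨hwr, h1, h2⟩⟩
      · exact Or.inr ⟨hw, hwr, h⟩
      · exact Or.inl (Or.inl ⟨hw, Or.inl ⟨hwr, h⟩⟩)
      · left
        have hne := (hs w hw hwr).1
        rcases h1 with h1 | h1 <;> rcases h2 with h2 | h2
        · exact absurd (h1.trans h2.symm) hne
        · exact Or.inr (glue w hw hwr (Or.inl ⟨h1, h2⟩))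
        · exact Or.inr (glue w hw hwr (Or.inr ⟨h2, h1⟩))
        · exact Or.inl ⟨hw, Or.inr ⟨hwr, h1, h2⟩⟩
    · rintro ((⟨hw, h⟩ | h) | h)
      · exact ⟨hw, h.imp (fun h => ⟨h.1, Or.inr h.2⟩) fun h => ⟨h.1, Or.inr h.2.1, Or.inr h.2.2⟩⟩
      · refine ⟨hI h, Or.inr ⟨by rw [h.1]; exact hz₀r, ?_⟩⟩
        rcases sidesI w h with h' | h'
        · exact ⟨Or.inr (h'.1 ▸ hσ), Or.inl h'.2⟩
        · exact ⟨Or.inl h'.1, Or.inr (h'.2 ▸ hσ)⟩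
      · exact cell_subset_region (mem_insert τ 𝒮) h
  rw [heq]
  refine contractible_glue (S := G.cell U σ) hαβ hVo (isOpen_cell hU σ) (convex_cell hU σ)
    (cell_subset_region hσ) hp ?_ ?_ (isOpen_cell hU τ) (convex_cell hU τ) ?_ hTre hTV hcS
  · intro z hz
    exact closI z (hI hz) (by rw [hz.1]; exact hz₀r) σ (by have := sidesI z hz; tauto)
  · rw [Set.disjoint_left]
    intro z hz hzc
    have hzr : z.re ∈ G.abscissae := by rw [hz.1]; exact hz₀r
    obtain ⟨-, ε, hε, hb, hw⟩ := hs z (hI hz) hzr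
    obtain ⟨w, hwb, hwV, hwS⟩ := mem_closure_iff.1 hzc _ Metric.isOpen_ball
      (Metric.mem_ball_self hε)
    obtain ⟨h1, h2, h3⟩ := hw w hwb
    have nτ : w ∉ G.cell U τ := Set.disjoint_left.1 hTV hwV
    rcases lt_trichotomy w.re z.re with h | h | h
    · have := h1 h
      rcases sidesI z hz with h' | h'
      · rw [h'.1] at this; exact hwS this
      · rw [h'.1] at this; exact nτ this
    · obtain ⟨e1, e2⟩ := h3 h
      rcases hwV.2 with h4 | h4
      · exact h4.1 (by rw [h]; exact hzr)
      · rw [e1, e2] at h4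
        rcases sidesI z hz with h' | h'
        · exact hτ (h'.2 ▸ h4.2.2)
        · exact hτ (h'.1 ▸ h4.2.1)
    · have := h2 h
      rcases sidesI z hz with h' | h'
      · rw [h'.2] at this; exact nτ this
      · rw [h'.2] at this; exact hwS this
  · intro z hz
    exact closI z (hI hz) (by rw [hz.1]; exact hz₀r) τ (by have := sidesI z hz; tauto)

/-- The bounded components of the complement of a connected drawing are simply connected. -/
lemma mem_faces_of_isBounded (hconn : G.Connected) (hU : U ∈ G.comps)
    (hb : Bornology.IsBounded U) : U ∈ G.faces := by
  refine ⟨hU, hb, ?_⟩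
  obtain ⟨l, r, hs⟩ := exists_sides hU
  have hs : G.Sided U l r := hs
  have hUo := comps_isOpen hU
  set Λ : Set (Finset ℝ × Finset (ℂ × ℂ)) :=
    ((G.abscissae.powerset ×ˢ (G.verts ×ˢ G.verts).powerset :
      Finset (Finset ℝ × Finset (ℂ × ℂ))) : Set (Finset ℝ × Finset (ℂ × ℂ))) with hΛ
  have hsigΛ : ∀ z, G.sig z ∈ Λ := by
    intro z
    classical
    simp only [hΛ, Finset.coe_product, Set.mem_prod, Finset.mem_coe, Finset.mem_powerset]
    exact ⟨Finset.filter_subset _ _, Finset.filter_subset _ _⟩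
  have hΛfin : Λ.Finite := Finset.finite_toSet _
  -- There are finitely many signatures, so among the sets of signatures with contractible region
  -- there is a maximal one. It turns out to give all of `U`.
  set 𝒞 : Set (Set (Finset ℝ × Finset (ℂ × ℂ))) :=
    {𝒮 | 𝒮 ⊆ Λ ∧ ContractibleSpace (G.region U l r 𝒮)} with h𝒞
  have h𝒞fin : 𝒞.Finite := hΛfin.finite_subsets.subset fun 𝒮 h => h.1
  have cellmem : ∀ z ∈ U, z.re ∈ G.abscissae → l z ∈ Λ ∧ r z ∈ Λ := by
    intro z hz hzr
    obtain ⟨h1, h2⟩ := hs.mem_closure hz hzr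
    obtain ⟨p, hp⟩ := closure_nonempty_iff.1 ⟨z, h1⟩
    obtain ⟨q, hq⟩ := closure_nonempty_iff.1 ⟨z, h2⟩
    exact ⟨hp.2.2 ▸ hsigΛ p, hq.2.2 ▸ hsigΛ q⟩
  have hne : 𝒞.Nonempty := by
    obtain ⟨z, hz⟩ := comps_nonempty hU
    obtain ⟨σ, p, hp⟩ : ∃ σ, (G.cell U σ).Nonempty := by
      by_cases hzr : z.re ∈ G.abscissae
      · exact ⟨_, closure_nonempty_iff.1 ⟨z, (hs.mem_closure hz hzr).1⟩⟩
      · exact ⟨G.sig z, z, hz, hzr, rfl⟩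
    refine ⟨{σ}, by simpa using hp.2.2 ▸ hsigΛ p, ?_⟩
    -- A single cell is a region by itself: the two sides of a vertical segment carry different
    -- signatures, so no segment is added.
    have : G.region U l r {σ} = G.cell U σ := by
      ext w
      constructor
      · rintro ⟨hw, ⟨hwr, h⟩ | ⟨hwr, h1, h2⟩⟩
        · exact ⟨hw, hwr, h⟩
        · exact absurd ((h1 : l w = σ).trans (h2 : r w = σ).symm) (hs w hw hwr).1
      · exact fun h => cell_subset_region (mem_singleton σ) h
    rw [this]
    exact (convex_cell hU σ).contractibleSpace ⟨p, hp⟩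
  obtain ⟨𝒮, hmax⟩ := h𝒞fin.exists_maximal hne
  obtain ⟨hSΛ, hcS⟩ := hmax.prop
  -- Otherwise the connected set `U` contains a frontier point of the region. It must lie over an
  -- abscissa with exactly one of its two cells in the region, and the other cell could be added.
  have hfull : U ⊆ G.region U l r 𝒮 := by
    have hVne : (U ∩ G.region U l r 𝒮).Nonempty := by
      have : Nonempty (G.region U l r 𝒮) := inferInstance
      obtain ⟨z, hz⟩ := this
      exact ⟨z, hz.1, hz⟩
    refine IsPreconnected.subset_of_disjoint_frontier (comps_isPreconnected hU) ?_ hVne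
    rw [Set.disjoint_left]
    intro z hz hzf
    rw [(hs.isOpen_region hU).frontier_eq] at hzf
    obtain ⟨hzc, hzn⟩ := hzf
    by_cases hzr : z.re ∈ G.abscissae
    · obtain ⟨-, ε, hε, hbU, hw⟩ := hs z hz hzr
      obtain ⟨w, hwb, hwV⟩ := mem_closure_iff.1 hzc _ Metric.isOpen_ball
        (Metric.mem_ball_self hε)
      obtain ⟨h1, h2, h3⟩ := hw w hwb
      have hor : l z ∈ 𝒮 ∨ r z ∈ 𝒮 := by
        rcases lt_trichotomy w.re z.re with h | h | h
        · have := h1 h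
          rcases hwV.2 with h4 | h4
          · left; exact this.2.2 ▸ h4.2
          · exact absurd h4.1 this.2.1
        · obtain ⟨e1, e2⟩ := h3 h
          rcases hwV.2 with h4 | h4
          · exact absurd (by rw [h]; exact hzr) h4.1
          · left; exact e1 ▸ h4.2.1
        · have := h2 h
          rcases hwV.2 with h4 | h4
          · right; exact this.2.2 ▸ h4.2
          · exact absurd h4.1 this.2.1
      have hnand : ¬ (l z ∈ 𝒮 ∧ r z ∈ 𝒮) := fun h => hzn ⟨hz, Or.inr ⟨hzr, h⟩⟩
      obtain ⟨σ, τ, hσ, hτ, hside, hτΛ⟩ : ∃ σ τ, σ ∈ 𝒮 ∧ τ ∉ 𝒮 ∧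
          ((l z = σ ∧ r z = τ) ∨ (l z = τ ∧ r z = σ)) ∧ τ ∈ Λ := by
        rcases hor with h | h
        · exact ⟨l z, r z, h, fun h' => hnand ⟨h, h'⟩, Or.inl ⟨rfl, rfl⟩, (cellmem z hz hzr).2⟩
        · exact ⟨r z, l z, h, fun h' => hnand ⟨h', h⟩, Or.inr ⟨rfl, rfl⟩, (cellmem z hz hzr).1⟩
      have hnew : insert τ 𝒮 ∈ 𝒞 := ⟨insert_subset hτΛ hSΛ,
        hs.contractible_insert hconn hU hb hcS hz hzr hσ hτ hside⟩
      exact hτ (hmax.le_of_ge hnew (subset_insert τ 𝒮) (mem_insert τ 𝒮))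
    · have hcz := (isOpen_cell hU (G.sig z)).mem_nhds ⟨hz, hzr, rfl⟩
      obtain ⟨w, hw, hwV⟩ := mem_closure_iff_nhds.1 hzc _ hcz
      rcases hwV.2 with h4 | h4
      · exact hzn ⟨hz, Or.inl ⟨hzr, hw.2.2 ▸ h4.2⟩⟩
      · exact hw.2.1 h4.1
  have heq : G.region U l r 𝒮 = U := subset_antisymm (fun z hz => hz.1) hfull
  rw [heq] at hcS
  exact SimplyConnectedSpace.ofContractible U

end PlaneGraph

end SoftDisc

namespace SoftDisc

open Set Filter Topology

/-! ### The turning number of a simple closed polygon -/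

/-- Both arguments lie in `(-π/2, π/2)`, so their difference is already a principal value. -/
lemma arg_div_of_re_pos {x y : ℂ} (hx : 0 < x.re) (hy : 0 < y.re) :
    Complex.arg (y / x) = Complex.arg y - Complex.arg x := by
  have hx0 : x ≠ 0 := by rintro rfl; simp at hx
  have hy0 : y ≠ 0 := by rintro rfl; simp at hy
  have h1 := abs_lt.1 (Complex.abs_arg_lt_pi_div_two_iff.2 (Or.inl hx))
  have h2 := abs_lt.1 (Complex.abs_arg_lt_pi_div_two_iff.2 (Or.inl hy))
  have h3 : ((Complex.arg (y / x) : ℝ) : Real.Angle) = ((Complex.arg y - Complex.arg x : ℝ) : Real.Angle) := by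
    rw [Complex.arg_div_coe_angle hy0 hx0, Real.Angle.coe_sub]
  have h4 := congrArg Real.Angle.toReal h3
  rw [Complex.arg_coe_angle_toReal_eq_arg, Real.Angle.toReal_coe_eq_self_iff.2] at h4
  · exact h4
  · constructor <;> linarith

lemma arg_div_of_halfPlane {c u v : ℂ} (hu : 0 < (c * u).re) (hv : 0 < (c * v).re) :
    Complex.arg (v / u) = Complex.arg (c * v) - Complex.arg (c * u) := by
  have hc : c ≠ 0 := by rintro rfl; simp at hu
  rw [← arg_div_of_re_pos hu hv, mul_div_mul_left _ _ hc]

/-- Four vectors in an open half-plane have consistent mutual angles. -/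
lemma arg_cell {c A B C E : ℂ} (hA : 0 < (c * A).re) (hB : 0 < (c * B).re)
    (hC : 0 < (c * C).re) (hE : 0 < (c * E).re) :
    Complex.arg (C / A) + Complex.arg (E / C) = Complex.arg (B / A) + Complex.arg (E / B) := by
  rw [arg_div_of_halfPlane hA hC, arg_div_of_halfPlane hC hE, arg_div_of_halfPlane hA hB,
    arg_div_of_halfPlane hB hE]
  ring

/-- A separating real functional has the form `z ↦ (n * z).re`. All secants from one segment to the
other thus point into one half-plane. -/
lemma exists_halfPlane_of_disjoint {a b c d : ℂ} (h : Disjoint (segment ℝ a b) (segment ℝ c d)) :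
    ∃ n : ℂ, ∀ x ∈ segment ℝ a b, ∀ y ∈ segment ℝ c d, 0 < (n * (y - x)).re := by
  obtain ⟨f, u, v, h1, h2, h3⟩ := geometric_hahn_banach_compact_closed (convex_segment a b)
    (isCompact_segment a b) (convex_segment c d) (isCompact_segment c d).isClosed h
  have hf : ∀ z : ℂ, f z = (((f 1 : ℂ) - (f Complex.I : ℂ) * Complex.I) * z).re := by
    intro z
    have hz : z = z.re • (1 : ℂ) + z.im • Complex.I := by
      apply Complex.ext <;> simp
    conv_lhs => rw [hz, map_add, map_smul, map_smul]
    simp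
    ring
  refine ⟨(f 1 : ℂ) - (f Complex.I : ℂ) * Complex.I, fun x hx y hy => ?_⟩
  have : (((f 1 : ℂ) - (f Complex.I : ℂ) * Complex.I) * (y - x)).re = f (y - x) := (hf _).symm
  rw [this, map_sub]
  have := h1 x hx
  have := h3 y hy
  linarith

/-- After division by `A` the directions are `1`, `1 + ρ` and `ρ`. Rotating by minus half the
argument of `ρ` puts all three into the right half-plane, where arguments subtract. -/
lemma arg_triangle {A E : ℂ} (hA : A ≠ 0) (h : E / A ∈ Complex.slitPlane) :
    Complex.arg ((A + E) / A) + Complex.arg (E / (A + E)) = Complex.arg (E / A) := by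
  set ρ := E / A with hρ
  have hE : E = ρ * A := by rw [hρ]; field_simp
  have hρ0 : ρ ≠ 0 := Complex.slitPlane_ne_zero h
  have harg : |Complex.arg ρ / 2| < Real.pi / 2 := by
    have h1 := Complex.slitPlane_arg_ne_pi h
    have h2 := Complex.neg_pi_lt_arg ρ
    have h3 := lt_of_le_of_ne (Complex.arg_le_pi ρ) h1
    rw [abs_lt]; constructor <;> linarith
  have hcos : 0 < Real.cos (Complex.arg ρ / 2) := Real.cos_pos_of_mem_Ioo (abs_lt.1 harg)
  set c := Complex.exp (-(Complex.arg ρ / 2 : ℝ) * Complex.I) with hc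
  have hc1 : (c * 1).re = Real.cos (Complex.arg ρ / 2) := by
    rw [mul_one, hc, ← Complex.ofReal_neg, Complex.exp_ofReal_mul_I_re, Real.cos_neg]
  have hc2 : (c * ρ).re = ‖ρ‖ * Real.cos (Complex.arg ρ / 2) := by
    conv_lhs => rw [← Complex.norm_mul_exp_arg_mul_I ρ]
    have : c * (‖ρ‖ * Complex.exp (Complex.arg ρ * Complex.I)) =
        ‖ρ‖ * Complex.exp ((Complex.arg ρ / 2 : ℝ) * Complex.I) := by
      rw [hc, mul_left_comm, ← Complex.exp_add]
      congr 2
      push_cast; ring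
    rw [this, Complex.re_ofReal_mul, Complex.exp_ofReal_mul_I_re]
  have h1 : 0 < (c * 1).re := by rw [hc1]; exact hcos
  have h2 : 0 < (c * ρ).re := by rw [hc2]; exact mul_pos (norm_pos_iff.2 hρ0) hcos
  have h3 : 0 < (c * (1 + ρ)).re := by
    rw [mul_add, Complex.add_re]; linarith
  have e1 : (A + E) / A = (1 + ρ) / 1 := by rw [hE]; field_simp
  have e2 : E / (A + E) = ρ / (1 + ρ) := by
    rw [hE, show A + ρ * A = (1 + ρ) * A by ring, mul_div_mul_right _ _ hA]
  have e3 : Complex.arg ρ = Complex.arg (ρ / 1) := by rw [div_one]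
  rw [e1, e2, e3, arg_div_of_halfPlane h1 h3, arg_div_of_halfPlane h3 h2,
    arg_div_of_halfPlane h1 h2]
  ring

/-- A negative real quotient means that the second side runs back along the first, and then one of
`a`, `c` is a second common point. -/
lemma turn_mem_slitPlane {a b c : ℂ} (hab : a ≠ b) (hbc : b ≠ c)
    (h : ∀ z ∈ segment ℝ a b, z ∈ segment ℝ b c → z = b) :
    (c - b) / (b - a) ∈ Complex.slitPlane := by
  by_contra hcon
  rw [Complex.mem_slitPlane_iff_not_le_zero, not_not] at hcon
  obtain ⟨h1, h2⟩ := Complex.le_def.1 hcon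
  have hba : b - a ≠ 0 := sub_ne_zero.2 hab.symm
  set w := (c - b) / (b - a) with hw
  simp only [Complex.zero_re] at h1
  have hwr : w = (w.re : ℂ) := by apply Complex.ext <;> simp [h2]
  have hcb : c - b = (-w.re : ℝ) * (a - b) := by
    have : c - b = w * (b - a) := by rw [hw]; field_simp
    rw [this, hwr]; push_cast; simp; ring
  have hc : c = b + ((-w.re : ℝ) : ℂ) * (a - b) := by rw [← hcb]; ring
  have hw0 : 0 < -w.re := by
    rcases eq_or_lt_of_le (neg_nonneg.2 h1) with h | h
    · rw [← h] at hc; simp at hc; exact absurd hc.symm hbc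
    · exact h
  rcases le_total (-w.re) 1 with h3 | h3
  · have hcs : c ∈ segment ℝ a b := by
      rw [segment_symm]; exact mem_segment_iff.2 ⟨_, hw0.le, h3, hc⟩
    exact hbc (h c hcs (right_mem_segment ℝ _ _)).symm
  · have has : a ∈ segment ℝ b c := by
      refine mem_segment_iff.2 ⟨(-w.re)⁻¹, by positivity, inv_le_one_of_one_le₀ h3, ?_⟩
      rw [hcb, ← mul_assoc, ← Complex.ofReal_mul, inv_mul_cancel₀ hw0.ne']
      simp
    exact hab (h a (left_mem_segment ℝ _ _) has)

/-- A closed polygon, as a periodic sequence of vertices, without self-intersections. -/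
structure SimpleLoop (n : ℕ) (p : ℤ → ℂ) : Prop where
  three_le : 3 ≤ n
  periodic : ∀ k, p (k + n) = p k
  inj : ∀ i j, p i = p j → i ≡ j [ZMOD n]
  inter : ∀ i j, ¬ i ≡ j [ZMOD n] → ∀ z ∈ segment ℝ (p i) (p (i + 1)),
    z ∈ segment ℝ (p j) (p (j + 1)) → (z = p i ∨ z = p (i + 1)) ∧ (z = p j ∨ z = p (j + 1))

namespace SimpleLoop

variable {n : ℕ} {p : ℤ → ℂ}

lemma not_modEq {n : ℕ} {i j : ℤ} (h1 : i < j) (h2 : j < i + n) : ¬ i ≡ j [ZMOD n] := by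
  intro h
  obtain ⟨k, hk⟩ := h.dvd
  have h3 : (0 : ℤ) < n * k := by linarith
  have h4 : (n : ℤ) * k < n * 1 := by linarith
  have h5 : 0 < k := by
    by_contra hk0
    push Not at hk0
    have : (n : ℤ) * k ≤ 0 := mul_nonpos_of_nonneg_of_nonpos (by positivity) hk0
    linarith
  have h6 : (n : ℤ) * 1 ≤ n * k := by
    apply mul_le_mul_of_nonneg_left _ (by positivity)
    linarith
  linarith

lemma ne_of_lt (h : SimpleLoop n p) {i j : ℤ} (h1 : i < j) (h2 : j < i + n) : p i ≠ p j :=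
  fun e => not_modEq h1 h2 (h.inj i j e)

lemma disjoint_edges (h : SimpleLoop n p) {i j : ℤ} (h1 : i + 1 < j) (h2 : j + 1 < i + n) :
    Disjoint (segment ℝ (p i) (p (i + 1))) (segment ℝ (p j) (p (j + 1))) := by
  rw [Set.disjoint_left]
  intro z hz hz'
  obtain ⟨e1, e2⟩ := h.inter i j (not_modEq (by linarith) (by linarith)) z hz hz'
  rcases e1 with e1 | e1 <;> rcases e2 with e2 | e2
  · exact h.ne_of_lt (by linarith) (by linarith) (e1.symm.trans e2)
  · exact h.ne_of_lt (by linarith) (by linarith) (e1.symm.trans e2)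
  · exact h.ne_of_lt (by linarith) (by linarith) (e1.symm.trans e2)
  · exact h.ne_of_lt (by linarith) (by linarith) (e1.symm.trans e2)

lemma three_le' (h : SimpleLoop n p) : (3 : ℤ) ≤ n := by exact_mod_cast h.three_le

lemma adjacent_edges (h : SimpleLoop n p) (i : ℤ) {z : ℂ}
    (hz : z ∈ segment ℝ (p i) (p (i + 1))) (hz' : z ∈ segment ℝ (p (i + 1)) (p (i + 2))) :
    z = p (i + 1) := by
  have h3 := h.three_le'
  have e : i + 2 = i + 1 + 1 := by ring
  rw [e] at hz'
  obtain ⟨e1, e2⟩ := h.inter i (i + 1) (not_modEq (by linarith) (by linarith)) z hz hz'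
  rcases e1 with e1 | e1
  · rcases e2 with e2 | e2
    · exact e2
    · exact absurd (e1.symm.trans e2) (h.ne_of_lt (by linarith) (by linarith))
  · exact e1

lemma ne_succ (h : SimpleLoop n p) (i : ℤ) : p i ≠ p (i + 1) := by
  have h3 := h.three_le'
  exact h.ne_of_lt (by linarith) (by linarith)

lemma turn (h : SimpleLoop n p) (i : ℤ) :
    (p (i + 2) - p (i + 1)) / (p (i + 1) - p i) ∈ Complex.slitPlane := by
  refine turn_mem_slitPlane (h.ne_succ i) ?_ fun z hz hz' => h.adjacent_edges i hz hz'
  have := h.ne_succ (i + 1)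
  rwa [show i + 1 + 1 = i + 2 by ring] at this

/-- The exterior angle at the vertex `i + 1`. -/
noncomputable def ext (p : ℤ → ℂ) (i : ℤ) : ℝ :=
  Complex.arg ((p (i + 2) - p (i + 1)) / (p (i + 1) - p i))

lemma shift (h : SimpleLoop n p) (m : ℤ) : SimpleLoop n fun k => p (k + m) where
  three_le := h.three_le
  periodic k := by
    rw [show k + n + m = k + m + n by ring]; exact h.periodic _
  inj i j e := (Int.ModEq.add_right_cancel' m (h.inj _ _ e))
  inter i j hij z hz hz' := by
    rw [show i + 1 + m = i + m + 1 by ring] at *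
    rw [show j + 1 + m = j + m + 1 by ring] at *
    exact h.inter (i + m) (j + m) (fun e => hij (Int.ModEq.add_right_cancel' m e)) z hz hz'

lemma periodic_mul (h : SimpleLoop n p) (k m : ℤ) : p (k + m * n) = p k := by
  induction m using Int.induction_on with
  | zero => simp
  | succ m ih =>
    rw [show k + ((m : ℤ) + 1) * n = k + m * n + n by ring, h.periodic, ih]
  | pred m ih =>
    rw [← ih, show k + -(m : ℤ) * n = k + (-m - 1) * n + n by ring, h.periodic]

lemma congr_modEq (h : SimpleLoop n p) {i j : ℤ} (hij : i ≡ j [ZMOD n]) : p i = p j := by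
  obtain ⟨k, hk⟩ := hij.dvd
  rw [show j = i + k * n by linarith, h.periodic_mul]

lemma reverse (h : SimpleLoop n p) : SimpleLoop n fun k => p (-k) where
  three_le := h.three_le
  periodic k := by
    rw [show -k = -(k + n) + n by ring, h.periodic]
  inj i j e := by simpa using (h.inj _ _ e).neg
  inter i j hij z hz hz' := by
    have e1 : ∀ i : ℤ, -i = -(i + 1) + 1 := fun i => by ring
    rw [segment_symm, e1 i] at hz
    rw [segment_symm, e1 j] at hz'
    have := h.inter (-(i + 1)) (-(j + 1)) (fun e => hij (by
      have := e.neg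
      simp only [neg_neg] at this
      exact Int.ModEq.add_right_cancel' 1 this)) z hz hz'
    rw [← e1 i, ← e1 j] at this
    exact ⟨this.1.symm, this.2.symm⟩

/-- Moving the secants from row `i` to row `i + 1`. -/
lemma row_transfer (h : SimpleLoop n p) (i : ℤ) (m : ℕ) (hm : (m : ℤ) + 2 < n) :
    ∑ k ∈ Finset.range (m + 1), Complex.arg ((p (i + k + 2) - p i) / (p (i + k + 1) - p i)) +
      Complex.arg ((p (i + m + 2) - p (i + 1)) / (p (i + m + 2) - p i)) =
    ext p i + ∑ k ∈ Finset.range m,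
      Complex.arg ((p (i + k + 3) - p (i + 1)) / (p (i + k + 2) - p (i + 1))) := by
  induction m with
  | zero =>
    simp only [zero_add, Finset.range_one, Finset.sum_singleton, Nat.cast_zero, add_zero,
      Finset.range_zero, Finset.sum_empty]
    have := arg_triangle (A := p (i + 1) - p i) (E := p (i + 2) - p (i + 1))
      (sub_ne_zero.2 (h.ne_succ i).symm) (h.turn i)
    rw [show p (i + 1) - p i + (p (i + 2) - p (i + 1)) = p (i + 2) - p i by ring] at this
    exact this
  | succ m ih =>
    push_cast at hm
    have ih := ih (by linarith)
    rw [Finset.sum_range_succ (n := m + 1), Finset.sum_range_succ (fun k : ℕ =>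
      Complex.arg ((p (i + k + 3) - p (i + 1)) / (p (i + k + 2) - p (i + 1)))) m]
    -- The four secants between the ends of two non-adjacent edges lie in a common half-plane, so
    -- the turning around this elementary square of index pairs is zero.
    obtain ⟨c, hc⟩ := exists_halfPlane_of_disjoint
      (h.disjoint_edges (i := i) (j := i + m + 2) (by linarith) (by linarith))
    have hl := left_mem_segment ℝ (p i) (p (i + 1))
    have hr := right_mem_segment ℝ (p i) (p (i + 1))
    have hl' := left_mem_segment ℝ (p (i + m + 2)) (p (i + m + 2 + 1))
    have hr' := right_mem_segment ℝ (p (i + m + 2)) (p (i + m + 2 + 1))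
    have key := arg_cell (hc _ hl _ hl') (hc _ hr _ hl') (hc _ hl _ hr') (hc _ hr _ hr')
    push_cast
    rw [show i + ((m : ℤ) + 1) + 2 = i + m + 2 + 1 by ring,
      show i + ((m : ℤ) + 1) + 1 = i + m + 2 by ring, show i + (m : ℤ) + 3 = i + m + 2 + 1 by ring]
    linarith

/-- **Hopf's Umlaufsatz** for polygons, with a base vertex `p 0` at which the polygon lies in an
open half-plane. -/
lemma sum_ext (h : SimpleLoop n p) {c : ℂ} (hc : ∀ k : ℤ, 0 < k → k < n → 0 < (c * (p k - p 0)).re) :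
    ∑ k ∈ Finset.range n, ext p k =
      2 * (Complex.arg (c * (p (n - 1) - p 0)) - Complex.arg (c * (p 1 - p 0))) + 2 * ext p (-1) := by
  obtain ⟨m, rfl⟩ : ∃ m, n = m + 3 := ⟨n - 3, by have := h.three_le; omega⟩
  push_cast at hc ⊢
  have pn : p ((m : ℤ) + 3) = p 0 := by
    have := h.periodic 0
    push_cast at this
    rwa [zero_add] at this
  -- the row of secants from the base vertex
  have row0 : ∑ k ∈ Finset.range (m + 1), Complex.arg ((p (0 + k + 2) - p 0) / (p (0 + k + 1) - p 0))
      = Complex.arg (c * (p (m + 2) - p 0)) - Complex.arg (c * (p 1 - p 0)) := by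
    have : ∀ k ∈ Finset.range (m + 1),
        Complex.arg ((p (0 + k + 2) - p 0) / (p (0 + k + 1) - p 0)) =
        Complex.arg (c * (p (((k + 1 : ℕ) : ℤ) + 1) - p 0)) - Complex.arg (c * (p ((k : ℤ) + 1) - p 0)) := by
      intro k hk
      have hk' : (k : ℤ) < m + 1 := by exact_mod_cast Finset.mem_range.1 hk
      rw [arg_div_of_halfPlane (c := c)]
      · push_cast
        rw [show (0 : ℤ) + k + 2 = k + 1 + 1 by ring, show (0 : ℤ) + k + 1 = k + 1 by ring]
      · exact hc _ (by linarith) (by linarith)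
      · exact hc _ (by linarith) (by linarith)
    rw [Finset.sum_congr rfl this,
      Finset.sum_range_sub (fun k => Complex.arg (c * (p ((k : ℤ) + 1) - p 0)))]
    push_cast
    rw [show (m : ℤ) + 1 + 1 = m + 2 by ring]
  -- the row sums
  set S : ℕ → ℝ := fun i => ∑ k ∈ Finset.range (m + 1 - i),
    Complex.arg ((p ((i : ℤ) + 1 + k + 2) - p ((i : ℤ) + 1)) / (p ((i : ℤ) + 1 + k + 1) - p ((i : ℤ) + 1)))
    with hS
  -- Hopf's homotopy in discrete form. Secants are indexed by pairs of vertices: moving from one row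
  -- to the next costs the exterior angle and a term of the last column, whose secants end at `p 0`
  -- and are measured in its half-plane. Summation over the rows telescopes.
  have hrow : ∀ i ∈ Finset.range (m + 1), ext p ((i + 1 : ℕ) : ℤ) = S i - S (i + 1) +
      (Complex.arg (c * (p (((i + 1 : ℕ) : ℤ) + 1) - p 0)) - Complex.arg (c * (p ((i : ℤ) + 1) - p 0))) := by
    intro i hi
    have hi' : i < m + 1 := Finset.mem_range.1 hi
    obtain ⟨d, hd⟩ : ∃ d, m = i + d := ⟨m - i, by omega⟩
    have ht := h.row_transfer ((i : ℤ) + 1) d (by push_cast; rw [hd]; push_cast; linarith)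
    simp only [hS]
    rw [show m + 1 - i = d + 1 by omega, show m + 1 - (i + 1) = d by omega]
    have hm3 : (i : ℤ) + 1 + d + 2 = m + 3 := by rw [hd]; push_cast; ring
    rw [hm3, pn] at ht
    have hcol : Complex.arg ((p 0 - p ((i : ℤ) + 1 + 1)) / (p 0 - p ((i : ℤ) + 1))) =
        Complex.arg (c * (p ((i : ℤ) + 1 + 1) - p 0)) - Complex.arg (c * (p ((i : ℤ) + 1) - p 0)) := by
      rw [← neg_sub (p ((i : ℤ) + 1 + 1)), ← neg_sub (p ((i : ℤ) + 1)), neg_div_neg_eq]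
      exact arg_div_of_halfPlane (hc _ (by linarith) (by rw [hd]; push_cast; linarith))
        (hc _ (by linarith) (by rw [hd]; push_cast; linarith))
    rw [hcol] at ht
    have hsum : ∑ k ∈ Finset.range d, Complex.arg ((p ((i : ℤ) + 1 + k + 3) - p ((i : ℤ) + 1 + 1)) /
        (p ((i : ℤ) + 1 + k + 2) - p ((i : ℤ) + 1 + 1))) =
        ∑ k ∈ Finset.range d, Complex.arg ((p (((i + 1 : ℕ) : ℤ) + 1 + k + 2) - p (((i + 1 : ℕ) : ℤ) + 1)) /
        (p (((i + 1 : ℕ) : ℤ) + 1 + k + 1) - p (((i + 1 : ℕ) : ℤ) + 1))) := by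
      refine Finset.sum_congr rfl fun k _ => ?_
      push_cast
      rw [show (i : ℤ) + 1 + 1 + k + 2 = i + 1 + k + 3 by ring,
        show (i : ℤ) + 1 + 1 + k + 1 = i + 1 + k + 2 by ring]
    rw [hsum] at ht
    push_cast at ht ⊢
    linarith
  have htot : ∑ i ∈ Finset.range (m + 1), ext p ((i + 1 : ℕ) : ℤ) = S 0 +
      (Complex.arg (c * (p (m + 2) - p 0)) - Complex.arg (c * (p 1 - p 0))) := by
    rw [Finset.sum_congr rfl hrow, Finset.sum_add_distrib,
      Finset.sum_range_sub (fun k => Complex.arg (c * (p ((k : ℤ) + 1) - p 0))),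
      Finset.sum_range_sub' S]
    have : S (m + 1) = 0 := by simp [hS]
    rw [this]
    push_cast
    rw [show (m : ℤ) + 1 + 1 = m + 2 by ring, sub_zero]
  have hfirst := h.row_transfer 0 m (by push_cast; linarith)
  rw [row0] at hfirst
  have hS0 : S 0 = ∑ k ∈ Finset.range m, Complex.arg ((p (0 + k + 3) - p (0 + 1)) / (p (0 + k + 2) - p (0 + 1)))
      + Complex.arg ((p 0 - p 1) / (p (m + 2) - p 1)) := by
    simp only [hS]
    rw [show m + 1 - 0 = m + 1 by omega, Finset.sum_range_succ]
    push_cast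
    congr 1
    · refine Finset.sum_congr rfl fun k _ => ?_
      rw [show (1 : ℤ) + k + 2 = 0 + k + 3 by ring, show (1 : ℤ) + k + 1 = 0 + k + 2 by ring]
    · rw [show (1 : ℤ) + m + 2 = m + 3 by ring, pn, show (1 : ℤ) + m + 1 = m + 2 by ring]
  have pm1 : p (-1) = p ((m : ℤ) + 2) := by
    have := h.periodic (-1)
    push_cast at this
    rw [← this]
    congr 1; ring
  -- The triangle formed by the last, the base and the first vertex closes the index triangle and
  -- yields the exterior angle at the base vertex.
  have hlast : Complex.arg ((p (m + 2) - p 1) / (p (m + 2) - p 0)) +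
      Complex.arg ((p 0 - p 1) / (p (m + 2) - p 1)) = ext p (-1) := by
    have hturn := h.turn (-1)
    have e : ext p (-1) = Complex.arg ((p 0 - p 1) / (p (m + 2) - p 0)) := by
      unfold ext
      rw [pm1]
      norm_num
      rw [← neg_sub (p 0) (p 1), ← neg_sub (p (m + 2)) (p 0), neg_div_neg_eq]
    rw [pm1] at hturn
    norm_num at hturn
    rw [← neg_sub (p 0) (p 1), ← neg_sub (p (m + 2)) (p 0), neg_div_neg_eq] at hturn
    have hne : p (m + 2) - p 0 ≠ 0 := by
      intro h0
      have := hc (m + 2) (by linarith) (by linarith)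
      rw [h0] at this; simp at this
    have := arg_triangle (A := p (m + 2) - p 0) (E := p 0 - p 1) hne hturn
    rw [show p (↑m + 2) - p 0 + (p 0 - p 1) = p (↑m + 2) - p 1 by ring] at this
    rw [e, this]
  have hextm1 : ext p ((m : ℤ) + 2) = ext p (-1) := by
    unfold ext
    have e1 := h.periodic 0
    have e2 := h.periodic 1
    push_cast at e1 e2
    rw [pm1, show (m : ℤ) + 2 + 2 = 1 + (m + 3) by ring, e2,
      show (m : ℤ) + 2 + 1 = 0 + (m + 3) by ring, e1]
    norm_num
  rw [Finset.sum_range_succ, Finset.sum_range_succ']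
  push_cast at htot ⊢
  rw [htot, hextm1, hS0, show (m : ℤ) + 3 - 1 = m + 2 by ring]
  simp only [zero_add] at hfirst ⊢
  linarith

end SimpleLoop

end SoftDisc

namespace SoftDisc

open Set Filter Topology

/-! ### Directed angles in `[0, 2π)` -/

/-- The angle in `[0, 2π)` from `u` to `w`. -/
noncomputable def ang (u w : ℂ) : ℝ :=
  if 0 ≤ Complex.arg (w / u) then Complex.arg (w / u) else Complex.arg (w / u) + 2 * Real.pi

lemma ang_nonneg (u w : ℂ) : 0 ≤ ang u w := by
  unfold ang
  split_ifs with h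
  · exact h
  · linarith [Complex.neg_pi_lt_arg (w / u), Real.pi_pos]

lemma ang_lt (u w : ℂ) : ang u w < 2 * Real.pi := by
  unfold ang
  split_ifs with h
  · linarith [Complex.arg_le_pi (w / u), Real.pi_pos]
  · linarith

lemma exp_add_two_pi (x : ℝ) : Complex.exp (((x + 2 * Real.pi : ℝ) : ℂ) * Complex.I) =
    Complex.exp ((x : ℂ) * Complex.I) := by
  rw [Complex.ofReal_add, add_mul, Complex.exp_add]
  have : (((2 * Real.pi : ℝ)) : ℂ) * Complex.I = 2 * Real.pi * Complex.I := by push_cast; ring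
  rw [this, Complex.exp_two_pi_mul_I, mul_one]

lemma exp_ang (u w : ℂ) : Complex.exp ((ang u w : ℂ) * Complex.I) =
    Complex.exp ((Complex.arg (w / u) : ℂ) * Complex.I) := by
  unfold ang
  split_ifs with h
  · rfl
  · exact exp_add_two_pi _

lemma ang_spec {u : ℂ} (hu : u ≠ 0) (w : ℂ) :
    w = (‖w / u‖ : ℂ) * (u * Complex.exp ((ang u w : ℂ) * Complex.I)) := by
  rw [exp_ang, mul_left_comm, Complex.norm_mul_exp_arg_mul_I]
  field_simp

lemma exp_injOn {x y : ℝ} (hx : 0 ≤ x) (hx' : x < 2 * Real.pi) (hy : 0 ≤ y) (hy' : y < 2 * Real.pi)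
    (h : Complex.exp ((x : ℂ) * Complex.I) = Complex.exp ((y : ℂ) * Complex.I)) : x = y := by
  rw [Complex.exp_eq_exp_iff_exists_int] at h
  obtain ⟨n, hn⟩ := h
  have h1 : (x : ℂ) = y + n * (2 * Real.pi) := by
    have := congrArg (fun z => z * (-Complex.I)) hn
    simp only [add_mul, mul_assoc] at this
    simpa [mul_assoc, mul_comm, mul_left_comm] using this
  have h2 : x = y + n * (2 * Real.pi) := by exact_mod_cast h1
  have hn0 : n = 0 := by
    have hp := Real.pi_pos
    have a1 : (n : ℝ) < 1 := by
      by_contra hc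
      push Not at hc
      nlinarith
    have a2 : (-1 : ℝ) < n := by
      by_contra hc
      push Not at hc
      nlinarith
    have a3 : n < 1 := by exact_mod_cast a1
    have a4 : -1 < n := by exact_mod_cast a2
    omega
  rw [h2, hn0]; simp

lemma ang_eq {u : ℂ} (hu : u ≠ 0) {ρ θ : ℝ} (hρ : 0 < ρ) (h0 : 0 ≤ θ) (h1 : θ < 2 * Real.pi) :
    ang u ((ρ : ℂ) * (u * Complex.exp ((θ : ℂ) * Complex.I))) = θ := by
  refine exp_injOn (ang_nonneg _ _) (ang_lt _ _) h0 h1 ?_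
  rw [exp_ang]
  have : (ρ : ℂ) * (u * Complex.exp ((θ : ℂ) * Complex.I)) / u =
      ρ * Complex.exp ((θ : ℂ) * Complex.I) := by field_simp
  rw [this]
  have h2 := Complex.norm_mul_exp_arg_mul_I (ρ * Complex.exp ((θ : ℂ) * Complex.I))
  have h3 : ‖(ρ : ℂ) * Complex.exp ((θ : ℂ) * Complex.I)‖ = ρ := by
    rw [norm_mul, Complex.norm_exp_ofReal_mul_I, mul_one, Complex.norm_real, Real.norm_eq_abs,
      abs_of_pos hρ]
  rw [h3] at h2
  exact mul_left_cancel₀ (Complex.ofReal_ne_zero.2 hρ.ne') h2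

lemma norm_div_pos {u w : ℂ} (hu : u ≠ 0) (hw : w ≠ 0) : 0 < ‖w / u‖ :=
  norm_pos_iff.2 (div_ne_zero hw hu)

lemma ang_mul {u w ζ : ℂ} (hu : u ≠ 0) (hw : w ≠ 0) (hζ : ζ ≠ 0)
    (h0 : 0 ≤ ang u w + Complex.arg ζ) (h1 : ang u w + Complex.arg ζ < 2 * Real.pi) :
    ang u (ζ * w) = ang u w + Complex.arg ζ := by
  have : ζ * w = ((‖ζ‖ * ‖w / u‖ : ℝ) : ℂ) *
      (u * Complex.exp (((ang u w + Complex.arg ζ : ℝ) : ℂ) * Complex.I)) := by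
    conv_lhs => rw [ang_spec hu w, ← Complex.norm_mul_exp_arg_mul_I ζ]
    rw [Complex.ofReal_add, add_mul, Complex.exp_add]
    push_cast
    ring
  rw [this, ang_eq hu (mul_pos (norm_pos_iff.2 hζ) (norm_div_pos hu hw)) h0 h1]

lemma ang_real_mul {u : ℂ} (hu : u ≠ 0) {t : ℝ} (ht : 0 < t) (w : ℂ) : ang u (t * w) = ang u w := by
  rcases eq_or_ne w 0 with rfl | hw
  · simp
  have := ang_mul hu hw (Complex.ofReal_ne_zero.2 ht.ne')
  rw [Complex.arg_ofReal_of_nonneg ht.le, add_zero] at this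
  exact this (ang_nonneg _ _) (ang_lt _ _)

lemma ang_self {u : ℂ} (hu : u ≠ 0) : ang u u = 0 := by
  unfold ang; rw [div_self hu]; simp

lemma ang_neg_self {u : ℂ} (hu : u ≠ 0) : ang u (-u) = Real.pi := by
  unfold ang; rw [neg_div, div_self hu]; simp [Real.pi_pos.le]

lemma ang_eq_iff {u v w : ℂ} (hu : u ≠ 0) (hv : v ≠ 0) (hw : w ≠ 0) :
    ang u w = ang u v ↔ w = ((‖w‖ / ‖v‖ : ℝ) : ℂ) * v := by
  constructor
  · intro h
    have h1 := ang_spec hu w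
    have h2 := ang_spec hu v
    rw [h] at h1
    set E := u * Complex.exp ((ang u v : ℂ) * Complex.I)
    have h3 : (‖v / u‖ : ℂ) ≠ 0 := Complex.ofReal_ne_zero.2 (norm_div_pos hu hv).ne'
    have hE : E = (‖v / u‖ : ℂ)⁻¹ * v := by
      rw [eq_inv_mul_iff_mul_eq₀ h3]; exact h2.symm
    have h4 : ‖w‖ / ‖v‖ = ‖w / u‖ * ‖v / u‖⁻¹ := by
      have := norm_ne_zero_iff.2 hu
      rw [norm_div, norm_div]
      field_simp
    rw [h4]
    push_cast
    rw [mul_assoc, ← hE]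
    exact h1
  · intro h
    rw [h]
    exact ang_real_mul hu (div_pos (norm_pos_iff.2 hw) (norm_pos_iff.2 hv)) _

/-- Close to `z`, lying on an edge from `z` is a condition on the direction alone. -/
lemma add_mem_segment_iff {z u v w : ℂ} (hu : u ≠ 0) (hv : v ≠ 0) (hw : w ≠ 0) (hle : ‖w‖ ≤ ‖v‖) :
    z + w ∈ segment ℝ z (z + v) ↔ ang u w = ang u v := by
  rw [mem_segment_iff]
  constructor
  · rintro ⟨t, h0, h1, h⟩
    rw [add_sub_cancel_left, add_right_inj] at h
    rcases eq_or_lt_of_le h0 with rfl | h0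
    · simp at h; exact absurd h hw
    · rw [h]; exact ang_real_mul hu h0 _
  · intro h
    refine ⟨‖w‖ / ‖v‖, by positivity, div_le_one_of_le₀ hle (norm_nonneg _), ?_⟩
    rw [add_sub_cancel_left, ← (ang_eq_iff hu hv hw).1 h]

/-! ### Sectors -/

/-- The open sector at `z` of radius `r` and of the angles between `α` and `β` relative to `u`. -/
def sector (z u : ℂ) (r α β : ℝ) : Set ℂ :=
  {y | y ≠ z ∧ ‖y - z‖ < r ∧ α < ang u (y - z) ∧ ang u (y - z) < β}

lemma isPreconnected_sector {u : ℂ} (hu : u ≠ 0) (z : ℂ) (r : ℝ) {α β : ℝ} (hα : 0 ≤ α)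
    (hβ : β ≤ 2 * Real.pi) : IsPreconnected (sector z u r α β) := by
  have hpos : 0 < ‖u‖ := norm_pos_iff.2 hu
  have : sector z u r α β = (fun q : ℝ × ℝ =>
      z + (q.1 : ℂ) * (u * Complex.exp ((q.2 : ℂ) * Complex.I))) '' (Ioo 0 (r / ‖u‖) ×ˢ Ioo α β) := by
    ext y
    simp only [sector, mem_ofPred_eq, mem_image, mem_prod, mem_Ioo, Prod.exists]
    constructor
    · rintro ⟨h1, h2, h3, h4⟩
      have hw : y - z ≠ 0 := sub_ne_zero.2 h1
      refine ⟨_, _, ⟨⟨norm_div_pos hu hw, ?_⟩, h3, h4⟩, ?_⟩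
      · rw [norm_div]
        exact div_lt_div_of_pos_right h2 hpos
      · rw [← ang_spec hu]; ring
    · rintro ⟨ρ, θ, ⟨⟨h1, h2⟩, h3, h4⟩, rfl⟩
      rw [add_sub_cancel_left, ang_eq hu h1 (by linarith) (by linarith)]
      refine ⟨?_, ?_, h3, h4⟩
      · intro h
        rw [add_eq_left] at h
        have : (ρ : ℂ) ≠ 0 := Complex.ofReal_ne_zero.2 h1.ne'
        exact mul_ne_zero this (mul_ne_zero hu (Complex.exp_ne_zero _)) h
      · rw [norm_mul, norm_mul, Complex.norm_exp_ofReal_mul_I, mul_one, Complex.norm_real,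
          Real.norm_eq_abs, abs_of_pos h1]
        exact (lt_div_iff₀ hpos).1 h2
  rw [this]
  refine (isPreconnected_Ioo.prod isPreconnected_Ioo).image _ (Continuous.continuousOn ?_)
  fun_prop

/-- Near its boundary point `z` the set `O` is the sector of opening `φ` on the left of `u`. -/
structure IsSector (O : Set ℂ) (z u : ℂ) (φ : ℝ) : Prop where
  ne : u ≠ 0
  pos : 0 < φ
  lt : φ < 2 * Real.pi
  ev : ∃ r > 0, ∀ w : ℂ, w ≠ 0 → ‖w‖ < r →
    ((z + w ∈ O ↔ ang u w ≤ φ) ∧ (z + w ∈ frontier O ↔ ang u w = 0 ∨ ang u w = φ))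

lemma exists_dir {u : ℂ} (hu : u ≠ 0) {r θ : ℝ} (hr : 0 < r) (h0 : 0 ≤ θ) (h1 : θ < 2 * Real.pi) :
    ∃ w : ℂ, w ≠ 0 ∧ ‖w‖ < r ∧ ang u w = θ := by
  have hpos : 0 < ‖u‖ := norm_pos_iff.2 hu
  have hρ : 0 < r / (2 * ‖u‖) := by positivity
  refine ⟨((r / (2 * ‖u‖) : ℝ) : ℂ) * (u * Complex.exp ((θ : ℂ) * Complex.I)), ?_, ?_,
    ang_eq hu hρ h0 h1⟩
  · exact mul_ne_zero (Complex.ofReal_ne_zero.2 hρ.ne') (mul_ne_zero hu (Complex.exp_ne_zero _))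
  · rw [norm_mul, norm_mul, Complex.norm_exp_ofReal_mul_I, mul_one, Complex.norm_real,
      Real.norm_eq_abs, abs_of_pos hρ]
    field_simp
    norm_num

/-- Each of the two open sectors cut out by the rays misses the frontier, so it lies inside or
outside `O`. One is inside by hypothesis. If the other were too, a whole punctured disc would lie in
`O` and the rays would not be frontier. -/
lemma isSector_of_frontier {O : Set ℂ} (hO : IsClosed O) {z u : ℂ} {φ r : ℝ} (hu : u ≠ 0)
    (h0 : 0 < φ) (h1 : φ < 2 * Real.pi) (hr : 0 < r)
    (hF : ∀ w : ℂ, w ≠ 0 → ‖w‖ < r → (z + w ∈ frontier O ↔ ang u w = 0 ∨ ang u w = φ))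
    (hne : (sector z u r 0 φ ∩ O).Nonempty) : IsSector O z u φ := by
  have hd : ∀ α β, 0 ≤ α → β ≤ 2 * Real.pi → (∀ θ, α < θ → θ < β → ¬ (θ = 0 ∨ θ = φ)) →
      (sector z u r α β ∩ O).Nonempty → sector z u r α β ⊆ O := by
    intro α β hα hβ hφ hne
    refine IsPreconnected.subset_of_disjoint_frontier (isPreconnected_sector hu z r hα hβ) ?_ hne
    rw [Set.disjoint_left]
    rintro y ⟨hy1, hy2, hy3, hy4⟩ hyF
    have := (hF (y - z) (sub_ne_zero.2 hy1) hy2).1 (by rwa [add_sub_cancel])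
    exact hφ _ hy3 hy4 this
  have hS1 := hd 0 φ le_rfl h1.le (fun θ a b => by rintro (c | c) <;> linarith) hne
  have hray : ∀ w : ℂ, w ≠ 0 → ‖w‖ < r → (ang u w = 0 ∨ ang u w = φ) → z + w ∈ O := fun w hw hwr h =>
    hO.frontier_subset ((hF w hw hwr).2 h)
  have hS2 : ∀ y ∈ sector z u r φ (2 * Real.pi), y ∉ O := by
    intro y hy hyO
    have hS2 := hd φ (2 * Real.pi) h0.le le_rfl (fun θ a b => by rintro (c | c) <;> linarith)
      ⟨y, hy, hyO⟩
    obtain ⟨w, hw, hwr, hwa⟩ := exists_dir hu hr le_rfl (by positivity : (0 : ℝ) < 2 * Real.pi)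
    have hint : z + w ∈ interior O := by
      refine mem_interior.2 ⟨Metric.ball z r ∩ {z}ᶜ, ?_, Metric.isOpen_ball.inter isOpen_compl_singleton,
        ?_, ?_⟩
      · rintro y ⟨hyr, hyz⟩
        have hyz' : y - z ≠ 0 := sub_ne_zero.2 hyz
        have hyr' : ‖y - z‖ < r := by rwa [Metric.mem_ball, dist_eq_norm] at hyr
        rcases eq_or_lt_of_le (ang_nonneg u (y - z)) with h | h
        · have := hray (y - z) hyz' hyr' (Or.inl h.symm)
          rwa [add_sub_cancel] at this
        · rcases lt_trichotomy (ang u (y - z)) φ with h' | h' | h'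
          · exact hS1 ⟨hyz, hyr', h, h'⟩
          · have := hray (y - z) hyz' hyr' (Or.inr h')
            rwa [add_sub_cancel] at this
          · exact hS2 ⟨hyz, hyr', h', ang_lt _ _⟩
      · rw [Metric.mem_ball, dist_eq_norm, add_sub_cancel_left]; exact hwr
      · intro h; exact hw (by simpa using h)
    exact ((hF w hw hwr).2 (Or.inl hwa)).2 hint
  refine ⟨hu, h0, h1, r, hr, fun w hw hwr => ⟨⟨fun h => ?_, fun h => ?_⟩, hF w hw hwr⟩⟩
  · by_contra hlt
    push Not at hlt
    exact hS2 (z + w) ⟨by simpa using hw, by simpa using hwr, by simpa using hlt,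
      by simpa using ang_lt u w⟩ h
  · rcases eq_or_lt_of_le (ang_nonneg u w) with h' | h'
    · exact hray w hw hwr (Or.inl h'.symm)
    · rcases eq_or_lt_of_le h with h'' | h''
      · exact hray w hw hwr (Or.inr h'')
      · exact hS1 ⟨by simpa using hw, by simpa using hwr, by simpa using h', by simpa using h''⟩

/-- Two opposite frontier directions must be the two sides of the sector. It removes the points of
open edges from angle sums. -/
lemma IsSector.eq_pi {O : Set ℂ} {z u v : ℂ} {φ : ℝ} (h : IsSector O z u φ) (hv : v ≠ 0)
    (hev : ∀ᶠ t : ℝ in 𝓝[>] 0, z + t * v ∈ frontier O ∧ z + t * (-v) ∈ frontier O) : φ = Real.pi := by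
  obtain ⟨r, hr, hO⟩ := h.ev
  have hsmall : ∀ᶠ t : ℝ in 𝓝[>] 0, t * ‖v‖ < r := by
    have : Tendsto (fun t : ℝ => t * ‖v‖) (𝓝[>] 0) (𝓝 (0 * ‖v‖)) :=
      ((continuous_id.mul continuous_const).tendsto 0).mono_left nhdsWithin_le_nhds
    rw [zero_mul] at this
    exact this.eventually_lt_const hr
  obtain ⟨t, ⟨h1, h2⟩, h3, h4⟩ := (hev.and (hsmall.and self_mem_nhdsWithin)).exists
  have ht : (0 : ℝ) < t := h4
  have htc : (t : ℂ) ≠ 0 := Complex.ofReal_ne_zero.2 ht.ne'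
  have hn : ∀ v' : ℂ, ‖v'‖ = ‖v‖ → ‖(t : ℂ) * v'‖ < r := by
    intro v' hv'
    rw [norm_mul, hv', Complex.norm_real, Real.norm_eq_abs, abs_of_pos ht]; exact h3
  have e1 := (hO (t * v) (mul_ne_zero htc hv) (hn v rfl)).2.1 h1
  have e2 := (hO (t * -v) (mul_ne_zero htc (neg_ne_zero.2 hv)) (hn _ (norm_neg v))).2.1 h2
  rw [ang_real_mul h.ne ht] at e1 e2
  have hp := h.pos
  have hl := h.lt
  have hpi := Real.pi_pos
  have k1 : ang u v = 0 → ang u (-v) = Real.pi := by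
    intro e
    have := ang_mul h.ne hv (ζ := -1) (by norm_num) (by rw [e, Complex.arg_neg_one]; linarith)
      (by rw [e, Complex.arg_neg_one]; linarith)
    rwa [neg_one_mul, e, Complex.arg_neg_one, zero_add] at this
  have k2 : ang u (-v) = 0 → ang u v = Real.pi := by
    intro e
    have := ang_mul h.ne (neg_ne_zero.2 hv) (ζ := -1) (by norm_num)
      (by rw [e, Complex.arg_neg_one]; linarith) (by rw [e, Complex.arg_neg_one]; linarith)
    rwa [neg_one_mul, neg_neg, e, Complex.arg_neg_one, zero_add] at this
  rcases e1 with e1 | e1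
  · have := k1 e1
    rcases e2 with e2 | e2 <;> linarith
  · rcases e2 with e2 | e2
    · have := k2 e2; linarith
    · exfalso
      have h5 := ang_spec h.ne v
      have h6 := ang_spec h.ne (-v)
      rw [e1] at h5
      rw [e2] at h6
      have hnn : ‖-v / u‖ = ‖v / u‖ := by rw [neg_div, norm_neg]
      rw [hnn, ← h5] at h6
      have : v = 0 := self_eq_neg.1 h6.symm
      exact hv this

/-- The measure of the directions that point into `O` from `z`. -/
noncomputable def angleIn (O : Set ℂ) (z : ℂ) : ℝ :=
  (MeasureTheory.volume {θ : ℝ | θ ∈ Set.Ioc (-Real.pi) Real.pi ∧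
    ∀ᶠ r : ℝ in 𝓝[>] 0, z + (r : ℂ) * Complex.exp ((θ : ℂ) * Complex.I) ∈ O}).toReal

lemma IsSector.eventually_mem_iff {O : Set ℂ} {z u v : ℂ} {φ : ℝ} (h : IsSector O z u φ) (hv : v ≠ 0) :
    (∀ᶠ r : ℝ in 𝓝[>] 0, z + (r : ℂ) * v ∈ O) ↔ ang u v ≤ φ := by
  obtain ⟨r, hr, hO⟩ := h.ev
  have hsmall : ∀ᶠ t : ℝ in 𝓝[>] 0, (z + t * v ∈ O ↔ ang u v ≤ φ) := by
    have : Tendsto (fun t : ℝ => t * ‖v‖) (𝓝[>] 0) (𝓝 (0 * ‖v‖)) :=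
      ((continuous_id.mul continuous_const).tendsto 0).mono_left nhdsWithin_le_nhds
    rw [zero_mul] at this
    filter_upwards [this.eventually_lt_const hr, self_mem_nhdsWithin] with t ht ht0
    have ht0 : (0 : ℝ) < t := ht0
    rw [← ang_real_mul h.ne ht0]
    refine (hO _ (mul_ne_zero (Complex.ofReal_ne_zero.2 ht0.ne') hv) ?_).1
    rwa [norm_mul, Complex.norm_real, Real.norm_eq_abs, abs_of_pos ht0]
  constructor
  · intro h'
    obtain ⟨t, h1, h2⟩ := (h'.and hsmall).exists
    exact h2.1 h1
  · intro h'
    filter_upwards [hsmall] with t ht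
    exact ht.2 h'

/-- The set of inward directions is `2π`-periodic, so the period `(-π, π]` may be replaced by the
one starting at `β = arg u`. There the set is `(β, β + φ]` together with the endpoint `β + 2π`,
which has measure zero. -/
lemma IsSector.angleIn_eq {O : Set ℂ} {z u : ℂ} {φ : ℝ} (h : IsSector O z u φ) :
    angleIn O z = φ := by
  unfold angleIn
  set A : Set ℝ := {θ | ang u (Complex.exp ((θ : ℂ) * Complex.I)) ≤ φ} with hA
  have hset : {θ : ℝ | θ ∈ Set.Ioc (-Real.pi) Real.pi ∧
      ∀ᶠ r : ℝ in 𝓝[>] 0, z + (r : ℂ) * Complex.exp ((θ : ℂ) * Complex.I) ∈ O} =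
      A ∩ Ioc (-Real.pi) (-Real.pi + 2 * Real.pi) := by
    ext θ
    rw [mem_ofPred_eq, h.eventually_mem_iff (Complex.exp_ne_zero _), hA,
      show -Real.pi + 2 * Real.pi = Real.pi by ring]
    exact and_comm
  have hA' : ∀ θ : ℝ, ∀ m : ℤ, (θ + m * (2 * Real.pi) ∈ A ↔ θ ∈ A) := by
    intro θ m
    simp only [hA, mem_ofPred_eq]
    have : Complex.exp (((θ + m * (2 * Real.pi) : ℝ) : ℂ) * Complex.I) =
        Complex.exp ((θ : ℂ) * Complex.I) := by
      rw [Complex.exp_eq_exp_iff_exists_int]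
      exact ⟨m, by push_cast; ring⟩
    rw [this]
  have hup : 0 < ‖u‖ := norm_pos_iff.2 h.ne
  set β := Complex.arg u with hβ
  have hin : ∀ θ : ℝ, 0 ≤ θ → θ < 2 * Real.pi → (β + θ ∈ A ↔ θ ≤ φ) := by
    intro θ h0 h1
    simp only [hA, mem_ofPred_eq]
    have : Complex.exp (((β + θ : ℝ) : ℂ) * Complex.I) =
        ((‖u‖⁻¹ : ℝ) : ℂ) * (u * Complex.exp ((θ : ℂ) * Complex.I)) := by
      conv_rhs => rw [← Complex.norm_mul_exp_arg_mul_I u]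
      rw [Complex.ofReal_add, add_mul, Complex.exp_add, ← hβ, mul_assoc, ← mul_assoc, ← Complex.ofReal_mul,
        norm_mul, Complex.norm_real, Complex.norm_exp_ofReal_mul_I, mul_one, norm_norm,
        inv_mul_cancel₀ hup.ne', Complex.ofReal_one, one_mul]
    rw [this, ang_eq h.ne (inv_pos.2 hup) h0 h1]
  have hI : A ∩ Ioc β (β + 2 * Real.pi) = Ioc β (β + φ) ∪ {β + 2 * Real.pi} := by
    ext θ
    simp only [mem_inter_iff, mem_Ioc, mem_union, mem_singleton_iff]
    have hp := h.pos
    have hl := h.lt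
    constructor
    · rintro ⟨h1, h2, h3⟩
      rcases eq_or_lt_of_le h3 with h3 | h3
      · exact Or.inr h3
      · have := (hin (θ - β) (by linarith) (by linarith)).1 (by rwa [add_sub_cancel])
        exact Or.inl ⟨h2, by linarith⟩
    · rintro (⟨h1, h2⟩ | rfl)
      · have := (hin (θ - β) (by linarith) (by linarith)).2 (by linarith)
        rw [add_sub_cancel] at this
        exact ⟨this, h1, by linarith⟩
      · refine ⟨?_, by linarith, le_rfl⟩
        have := (hA' β 1).2 (by have := (hin 0 le_rfl (by linarith)).2 hp.le; rwa [add_zero] at this)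
        simpa using this
  have hmeas : MeasureTheory.volume (A ∩ Ioc (-Real.pi) (-Real.pi + 2 * Real.pi)) =
      MeasureTheory.volume (A ∩ Ioc β (β + 2 * Real.pi)) := by
    have hT : (0 : ℝ) < 2 * Real.pi := by positivity
    have f1 := isAddFundamentalDomain_Ioc hT (-Real.pi) MeasureTheory.volume
    have f2 := isAddFundamentalDomain_Ioc hT β MeasureTheory.volume
    refine f1.measure_set_eq f2 ?_ ?_
    · have hmang : Measurable fun θ : ℝ => ang u (Complex.exp ((θ : ℂ) * Complex.I)) := by
        unfold ang
        have hm : Measurable fun θ : ℝ => Complex.arg (Complex.exp ((θ : ℂ) * Complex.I) / u) :=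
          Complex.measurable_arg.comp (by fun_prop)
        exact Measurable.ite (measurableSet_le measurable_const hm) hm (hm.add_const _)
      exact measurableSet_le hmang measurable_const
    · rintro ⟨g, hg⟩
      obtain ⟨m, rfl⟩ := AddSubgroup.mem_zmultiples_iff.1 hg
      ext θ
      simp only [mem_preimage]
      have := hA' θ m
      rwa [add_comm, ← zsmul_eq_mul] at this
  rw [hset, hmeas, hI, MeasureTheory.measure_union (by
    rw [Set.disjoint_singleton_right, mem_Ioc]
    intro h'; linarith [h.lt, h'.2]) (measurableSet_singleton _)]
  simp [h.pos.le]

end SoftDisc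

/-! ### Points beside an edge, and the sectors and angle sum of a simple loop -/

namespace SoftDisc

open Set Filter Topology

lemma ang_mul_of_neg {u w ζ : ℂ} (hu : u ≠ 0) (hw : w ≠ 0) (hζ : ζ ≠ 0)
    (h1 : ang u w + Complex.arg ζ < 0) :
    ang u (ζ * w) = ang u w + Complex.arg ζ + 2 * Real.pi := by
  have : ζ * w = ((‖ζ‖ * ‖w / u‖ : ℝ) : ℂ) *
      (u * Complex.exp (((ang u w + Complex.arg ζ + 2 * Real.pi : ℝ) : ℂ) * Complex.I)) := by
    rw [exp_add_two_pi]
    conv_lhs => rw [ang_spec hu w, ← Complex.norm_mul_exp_arg_mul_I ζ]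
    rw [Complex.ofReal_add, add_mul, Complex.exp_add]
    push_cast
    ring
  rw [this, ang_eq hu (mul_pos (norm_pos_iff.2 hζ) (norm_div_pos hu hw))]
  · linarith [ang_nonneg u w, Complex.neg_pi_lt_arg ζ, Real.pi_pos]
  · linarith

lemma eventually_arg_small {s ε : ℝ} (hs : 0 < s) (hε : 0 < ε) :
    ∀ᶠ t : ℝ in 𝓝[>] 0, 0 < Complex.arg (s + t * Complex.I) ∧
      Complex.arg (s + t * Complex.I) < ε ∧
      Complex.arg (s - t * Complex.I) = - Complex.arg (s + t * Complex.I) := by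
  have hc : ContinuousAt (fun t : ℝ => Complex.arg (s + t * Complex.I)) 0 := by
    refine (Complex.continuousAt_arg ?_).comp (f := fun t : ℝ => (s : ℂ) + t * Complex.I) (by fun_prop)
    simp [Complex.mem_slitPlane_iff, hs]
  have h0 : Complex.arg (s + ((0 : ℝ) : ℂ) * Complex.I) = 0 := by
    simp [Complex.arg_ofReal_of_nonneg hs.le]
  have hlt : ∀ᶠ t : ℝ in 𝓝[>] 0, Complex.arg (s + t * Complex.I) < ε := by
    refine Filter.Tendsto.eventually_lt_const (v := 0) hε ?_
    have := hc.tendsto.mono_left (nhdsWithin_le_nhds (s := Ioi 0))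
    rwa [h0] at this
  filter_upwards [hlt, self_mem_nhdsWithin] with t ht ht0
  have ht0 : (0 : ℝ) < t := ht0
  refine ⟨?_, ht, ?_⟩
  · refine lt_of_le_of_ne (Complex.arg_nonneg_iff.2 (by simp [ht0.le])) ?_
    intro h
    have := (Complex.arg_eq_zero_iff.1 h.symm).2
    simp at this
    exact ht0.ne' this
  · have : (s : ℂ) - t * Complex.I = (starRingEnd ℂ) (s + t * Complex.I) := by
      simp [sub_eq_add_neg]
    rw [this, Complex.arg_conj, if_neg]
    intro h
    have := (Complex.arg_eq_pi_iff.1 h).1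
    simp at this
    linarith

lemma eventually_small_norm {c : ℂ} {s r : ℝ} (h : s * ‖c‖ < r) (hs : 0 < s) :
    ∀ᶠ t : ℝ in 𝓝[>] 0, ‖((s : ℂ) + t * Complex.I) * c‖ < r ∧ ‖((s : ℂ) - t * Complex.I) * c‖ < r := by
  have h1 : Tendsto (fun t : ℝ => ‖((s : ℂ) + t * Complex.I) * c‖) (𝓝[>] 0) (𝓝 ‖((s : ℂ) + (0 : ℝ) * Complex.I) * c‖) :=
    (Continuous.tendsto (by fun_prop) _).mono_left nhdsWithin_le_nhds
  have h2 : Tendsto (fun t : ℝ => ‖((s : ℂ) - t * Complex.I) * c‖) (𝓝[>] 0) (𝓝 ‖((s : ℂ) - (0 : ℝ) * Complex.I) * c‖) :=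
    (Continuous.tendsto (by fun_prop) _).mono_left nhdsWithin_le_nhds
  have e : ‖(s : ℂ) * c‖ < r := by
    rwa [norm_mul, Complex.norm_real, Real.norm_eq_abs, abs_of_pos hs]
  exact (h1.eventually_lt_const (by simpa using e)).and (h2.eventually_lt_const (by simpa using e))

lemma exists_scale (c : ℂ) {r : ℝ} (hr : 0 < r) : ∃ s : ℝ, 0 < s ∧ s < 1 ∧ s * ‖c‖ < r := by
  have h : ∀ᶠ s : ℝ in 𝓝[>] 0, s * ‖c‖ < r := by
    have : Tendsto (fun t : ℝ => t * ‖c‖) (𝓝[>] 0) (𝓝 (0 * ‖c‖)) :=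
      ((continuous_id.mul continuous_const).tendsto 0).mono_left nhdsWithin_le_nhds
    rw [zero_mul] at this
    exact this.eventually_lt_const hr
  obtain ⟨s, h1, h2, h3⟩ := (h.and (Ioo_mem_nhdsGT (zero_lt_one' ℝ))).exists
  exact ⟨s, h2, h3, h1⟩

/-- Just counterclockwise of the direction of `v` lies the left half of `[z, z + v]`. -/
lemma exists_half_sector {z u v : ℂ} {r η β : ℝ} (hu : u ≠ 0) (hv : v ≠ 0) (hr : 0 < r) (hη : 0 < η)
    (hβ : ang u v < β) : (sector z u r (ang u v) β ∩ half z (z + v) η).Nonempty := by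
  obtain ⟨s, hs, hs1, hsr⟩ := exists_scale v hr
  have hzv : z ≠ z + v := fun h => hv (by simpa using h)
  have hlt := ang_lt u v
  obtain ⟨t, h1, h2, ⟨h3, h4, -⟩, h5⟩ := ((eventually_mem_half hzv hη hs hs1).and
    ((eventually_small_norm hsr hs).and ((eventually_arg_small hs
      (ε := min (β - ang u v) (2 * Real.pi - ang u v)) (by simp [hβ, hlt])).and self_mem_nhdsWithin))).exists
  rw [add_sub_cancel_left] at h1
  have hζ : (s : ℂ) + t * Complex.I ≠ 0 := by
    intro h
    have := congrArg Complex.re h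
    simp at this; exact hs.ne' this
  have h6 := lt_min_iff.1 h4
  have ha := ang_mul hu hv hζ (by linarith [ang_nonneg u v]) (by linarith)
  refine ⟨_, ⟨?_, ?_, ?_, ?_⟩, h1⟩
  · intro h; rw [add_eq_left] at h; exact mul_ne_zero hζ hv h
  · rw [add_sub_cancel_left]; exact h2.1
  · rw [add_sub_cancel_left, ha]; linarith
  · rw [add_sub_cancel_left, ha]; linarith

lemma half_point_rev {z v : ℂ} {s t η : ℝ}
    (h : z + v + ((1 - s : ℝ) + t * Complex.I) * (z - (z + v)) ∈ half (z + v) z η) :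
    z + ((s : ℂ) - t * Complex.I) * v ∈ half (z + v) z η := by
  convert h using 1
  push_cast
  ring

/-- Just clockwise of the direction of `v` lies the right half of `[z, z + v]`. -/
lemma exists_half_sector_rev {z u v : ℂ} {r η α : ℝ} (hu : u ≠ 0) (hv : v ≠ 0) (hr : 0 < r)
    (hη : 0 < η) (h0 : 0 < ang u v) (hα : α < ang u v) :
    (sector z u r α (ang u v) ∩ half (z + v) z η).Nonempty := by
  obtain ⟨s, hs, hs1, hsr⟩ := exists_scale v hr
  have hzv : z + v ≠ z := fun h => hv (by simpa using h)
  have hlt := ang_lt u v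
  obtain ⟨t, h1, h2, ⟨h3, h4, h4'⟩, h5⟩ := ((eventually_mem_half hzv hη (s := 1 - s)
    (by linarith) (by linarith)).and
    ((eventually_small_norm hsr hs).and ((eventually_arg_small hs
      (ε := min (ang u v - α) (ang u v)) (by simp [hα, h0])).and self_mem_nhdsWithin))).exists
  have h1 := half_point_rev h1
  have hζ : (s : ℂ) - t * Complex.I ≠ 0 := by
    intro h
    have := congrArg Complex.re h
    simp at this; exact hs.ne' this
  have h6 := lt_min_iff.1 h4
  have ha := ang_mul hu hv hζ (by rw [h4']; linarith) (by rw [h4']; linarith)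
  refine ⟨_, ⟨?_, ?_, ?_, ?_⟩, h1⟩
  · intro h; rw [add_eq_left] at h; exact mul_ne_zero hζ hv h
  · rw [add_sub_cancel_left]; exact h2.2
  · rw [add_sub_cancel_left, ha, h4']; linarith
  · rw [add_sub_cancel_left, ha, h4']; linarith

lemma exists_half_sector_zero {z u v : ℂ} {r η α : ℝ} (hu : u ≠ 0) (hv : v ≠ 0) (hr : 0 < r)
    (hη : 0 < η) (h0 : ang u v = 0) (hα : α < 2 * Real.pi) :
    (sector z u r α (2 * Real.pi) ∩ half (z + v) z η).Nonempty := by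
  obtain ⟨s, hs, hs1, hsr⟩ := exists_scale v hr
  have hzv : z + v ≠ z := fun h => hv (by simpa using h)
  obtain ⟨t, h1, h2, ⟨h3, h4, h4'⟩, h5⟩ := ((eventually_mem_half hzv hη (s := 1 - s)
    (by linarith) (by linarith)).and
    ((eventually_small_norm hsr hs).and ((eventually_arg_small hs
      (ε := 2 * Real.pi - α) (by linarith)).and self_mem_nhdsWithin))).exists
  have h1 := half_point_rev h1
  have hζ : (s : ℂ) - t * Complex.I ≠ 0 := by
    intro h
    have := congrArg Complex.re h
    simp at this; exact hs.ne' this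
  have ha := ang_mul_of_neg hu hv hζ (by rw [h4']; linarith)
  refine ⟨_, ⟨?_, ?_, ?_, ?_⟩, h1⟩
  · intro h; rw [add_eq_left] at h; exact mul_ne_zero hζ hv h
  · rw [add_sub_cancel_left]; exact h2.2
  · rw [add_sub_cancel_left, ha, h4']; linarith
  · rw [add_sub_cancel_left, ha, h4']; linarith

lemma IsSector.exists_sector {O : Set ℂ} {z u : ℂ} {φ : ℝ} (h : IsSector O z u φ) :
    ∃ r > 0, sector z u r 0 φ ⊆ O ∧ Disjoint (sector z u r φ (2 * Real.pi)) O := by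
  obtain ⟨r, hr, hO⟩ := h.ev
  refine ⟨r, hr, ?_, ?_⟩
  · rintro y ⟨h1, h2, h3, h4⟩
    have := (hO (y - z) (sub_ne_zero.2 h1) h2).1.2 h4.le
    rwa [add_sub_cancel] at this
  · rw [Set.disjoint_left]
    rintro y ⟨h1, h2, h3, h4⟩ hy
    have := (hO (y - z) (sub_ne_zero.2 h1) h2).1.1 (by rwa [add_sub_cancel])
    linarith

/-- A set whose frontier near `z` consists of two segments. -/
lemma isSector_of_segments {O : Set ℂ} (hO : IsClosed O) {z v₁ v₂ : ℂ} (h1 : v₁ ≠ 0) (h2 : v₂ ≠ 0)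
    (h0 : 0 < ang v₁ v₂)
    (hF : ∀ᶠ y in 𝓝 z, y ∈ frontier O ↔ y ∈ segment ℝ z (z + v₁) ∨ y ∈ segment ℝ z (z + v₂))
    (hne : ∀ r > 0, (sector z v₁ r 0 (ang v₁ v₂) ∩ O).Nonempty) :
    IsSector O z v₁ (ang v₁ v₂) := by
  obtain ⟨ε, hε, hball⟩ := Metric.eventually_nhds_iff.1 hF
  set r := min ε (min ‖v₁‖ ‖v₂‖) with hr
  have hrpos : 0 < r := lt_min hε (lt_min (norm_pos_iff.2 h1) (norm_pos_iff.2 h2))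
  refine isSector_of_frontier hO h1 h0 (ang_lt _ _) hrpos (fun w hw hwr => ?_) (hne r hrpos)
  have hw1 := lt_min_iff.1 hwr
  have hw2 := lt_min_iff.1 hw1.2
  rw [hball (by rw [dist_eq_norm, add_sub_cancel_left]; exact hw1.1),
    add_mem_segment_iff h1 h1 hw hw2.1.le, add_mem_segment_iff h1 h2 hw hw2.2.le, ang_self h1]

namespace SimpleLoop

variable {n : ℕ} {p : ℤ → ℂ}

lemma segment_congr (h : SimpleLoop n p) {i j : ℤ} (hij : i ≡ j [ZMOD n]) :
    segment ℝ (p i) (p (i + 1)) = segment ℝ (p j) (p (j + 1)) := by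
  rw [h.congr_modEq hij, h.congr_modEq (hij.add_right 1)]

lemma exists_nat_modEq (h : SimpleLoop n p) (k : ℤ) : ∃ i ∈ Finset.range n, (k ≡ (i : ℤ) [ZMOD n]) := by
  have h3 := h.three_le'
  have h0 : (0 : ℤ) ≤ k % n := Int.emod_nonneg _ (by linarith)
  have h1 : k % n < n := Int.emod_lt_of_pos _ (by linarith)
  refine ⟨(k % n).toNat, ?_, ?_⟩
  · rw [Finset.mem_range]; omega
  · rw [Int.toNat_of_nonneg h0]; exact (Int.mod_modEq k n).symm

lemma eventually_segment (h : SimpleLoop n p) (z : ℂ) :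
    ∀ᶠ y in 𝓝 z, ∀ k : ℤ, y ∈ segment ℝ (p k) (p (k + 1)) → z ∈ segment ℝ (p k) (p (k + 1)) := by
  have : ∀ᶠ y in 𝓝 z, ∀ i ∈ Finset.range n, y ∈ segment ℝ (p i) (p (i + 1)) →
      z ∈ segment ℝ (p (i : ℤ)) (p (i + 1)) := by
    rw [Filter.eventually_all_finset]
    intro i _
    by_cases hz : z ∈ segment ℝ (p (i : ℤ)) (p (i + 1))
    · exact Eventually.of_forall fun _ _ => hz
    · filter_upwards [(isCompact_segment _ _).isClosed.isOpen_compl.mem_nhds hz] with y hy hy'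
      exact absurd hy' hy
  filter_upwards [this] with y hy k hk
  obtain ⟨i, hi, hki⟩ := h.exists_nat_modEq k
  rw [h.segment_congr hki] at hk ⊢
  exact hy i hi hk

lemma vertex_mem_segment (h : SimpleLoop n p) {k j : ℤ} (hz : p (k + 1) ∈ segment ℝ (p j) (p (j + 1))) :
    j ≡ k [ZMOD n] ∨ j ≡ k + 1 [ZMOD n] := by
  by_cases hjk : k ≡ j [ZMOD n]
  · exact Or.inl hjk.symm
  · right
    rcases (h.inter k j hjk _ (right_mem_segment ℝ _ _) hz).2 with e | e
    · exact (h.inj _ _ e).symm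
    · exact absurd (Int.ModEq.add_right_cancel' 1 (h.inj _ _ e)) hjk

lemma open_mem_segment (h : SimpleLoop n p) {k j : ℤ} {z : ℂ}
    (hz : z ∈ openSegment ℝ (p k) (p (k + 1))) (hz' : z ∈ segment ℝ (p j) (p (j + 1))) :
    j ≡ k [ZMOD n] := by
  by_contra hjk
  have hk := h.ne_succ k
  rcases (h.inter k j (fun e => hjk e.symm) _ (openSegment_subset_segment ℝ _ _ hz) hz').1 with e | e
  · rw [e] at hz
    exact hk (left_mem_openSegment_iff.1 hz)
  · rw [e] at hz
    exact hk (right_mem_openSegment_iff.1 hz)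

/-- `O` is the closed, regular, bounded set enclosed by the loop. -/
structure Bounds (n : ℕ) (p : ℤ → ℂ) (O : Set ℂ) : Prop where
  loop : SimpleLoop n p
  closed : IsClosed O
  bdd : Bornology.IsBounded O
  regular : O ⊆ closure (interior O)
  frontier_eq : frontier O = ⋃ k : ℤ, segment ℝ (p k) (p (k + 1))

variable {O : Set ℂ}

lemma Bounds.exists_thin (h : Bounds n p O) (k : ℤ) : ∃ η > 0, ∀ z ∈ rhomb (p k) (p (k + 1)) η,
    z ∈ frontier O → z ∈ openSegment ℝ (p k) (p (k + 1)) := by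
  have hk := h.loop.ne_succ k
  have h1 : ∀ᶠ η in 𝓝[>] (0 : ℝ), ∀ i ∈ (Finset.range n).filter (fun i : ℕ => ¬ k ≡ (i : ℤ) [ZMOD n]),
      Disjoint (rhomb (p k) (p (k + 1)) η) (segment ℝ (p (i : ℤ)) (p (i + 1))) := by
    rw [Filter.eventually_all_finset]
    intro i hi
    refine eventually_rhomb_disjoint_segment hk fun z hz hz' => ?_
    exact h.loop.inter k i (Finset.mem_filter.1 hi).2 z hz hz'
  have h2 : ∀ v : ℂ, (v = p k ∨ v = p (k + 1)) → ∀ᶠ η in 𝓝[>] (0 : ℝ),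
      Disjoint (rhomb (p k) (p (k + 1)) η) (segment ℝ v v) := by
    intro v hv
    refine eventually_rhomb_disjoint_segment hk fun z hz hz' => ?_
    rw [segment_same, mem_singleton_iff] at hz'
    exact ⟨hz' ▸ hv, Or.inl hz'⟩
  obtain ⟨η, a1, a2, a3, a4⟩ := (h1.and ((h2 _ (Or.inl rfl)).and ((h2 _ (Or.inr rfl)).and
    self_mem_nhdsWithin))).exists
  refine ⟨η, a4, fun z hz hzF => ?_⟩
  rw [h.frontier_eq] at hzF
  obtain ⟨j, hj⟩ := mem_iUnion.1 hzF
  obtain ⟨i, hi, hji⟩ := h.loop.exists_nat_modEq j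
  rw [h.loop.segment_congr hji] at hj
  by_cases hki : k ≡ (i : ℤ) [ZMOD n]
  · rw [← h.loop.segment_congr hki] at hj
    rcases segment_endpoint_or hj with e | e | e
    · exact absurd (by rw [e]; exact left_mem_segment ℝ _ _) (Set.disjoint_left.1 a2 hz)
    · exact absurd (by rw [e]; exact left_mem_segment ℝ _ _) (Set.disjoint_left.1 a3 hz)
    · exact e
  · exact absurd hj (Set.disjoint_left.1 (a1 i (Finset.mem_filter.2 ⟨hi, hki⟩)) hz)

/-- The points close to the edge `k` on its left side belong to `O`. -/
def OnLeft (p : ℤ → ℂ) (O : Set ℂ) (k : ℤ) : Prop :=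
  ∀ η > 0, (half (p k) (p (k + 1)) η ∩ O).Nonempty

lemma Bounds.half_subset (h : Bounds n p O) {k : ℤ} {η : ℝ}
    (hη : ∀ z ∈ rhomb (p k) (p (k + 1)) η, z ∈ frontier O → z ∈ openSegment ℝ (p k) (p (k + 1)))
    (hne : (half (p k) (p (k + 1)) η ∩ O).Nonempty) : half (p k) (p (k + 1)) η ⊆ O := by
  refine IsPreconnected.subset_of_disjoint_frontier (convex_half _ _ _).isPreconnected ?_ hne
  rw [Set.disjoint_left]
  intro z hz hzF
  exact PlaneGraph.openSegment_half_disjoint (h.loop.ne_succ k) hz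
    (hη z (SoftDisc.half_subset_rhomb _ _ _ hz) hzF)

lemma Bounds.onLeft_of_exists (h : Bounds n p O) {k : ℤ} {η : ℝ} (hpos : 0 < η)
    (hη : ∀ z ∈ rhomb (p k) (p (k + 1)) η, z ∈ frontier O → z ∈ openSegment ℝ (p k) (p (k + 1)))
    (hne : (half (p k) (p (k + 1)) η ∩ O).Nonempty) : OnLeft p O k := by
  intro η' hη'
  have hsub := h.half_subset hη hne
  obtain ⟨z, hz⟩ := SoftDisc.half_nonempty (h.loop.ne_succ k) (lt_min hpos hη')
  exact ⟨z, half_mono (lt_min hpos hη') (min_le_right _ _) hz,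
    hsub (half_mono (lt_min hpos hη') (min_le_left _ _) hz)⟩

/-- The angle on the left at a vertex is the supplement of the exterior angle. It is positive
because the loop does not turn straight back. -/
lemma ang_eq_pi_sub_ext (h : SimpleLoop n p) (k : ℤ) :
    ang (p (k + 2) - p (k + 1)) (p k - p (k + 1)) = Real.pi - ext p k ∧ 0 < Real.pi - ext p k := by
  have ht := h.turn k
  set e := p (k + 1) - p k with he
  set u := p (k + 2) - p (k + 1) with hu
  have hu0 : u ≠ 0 := by
    have := h.ne_succ (k + 1)
    rw [show k + 1 + 1 = k + 2 by ring] at this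
    exact sub_ne_zero.2 this.symm
  have he0 : e ≠ 0 := sub_ne_zero.2 (h.ne_succ k).symm
  have hext : ext p k = Complex.arg (u / e) := rfl
  have h1 := Complex.slitPlane_arg_ne_pi ht
  have h2 := Complex.neg_pi_lt_arg (u / e)
  have h3 := lt_of_le_of_ne (Complex.arg_le_pi (u / e)) h1
  have hv : p k - p (k + 1) = ((‖u / e‖⁻¹ : ℝ) : ℂ) *
      (u * Complex.exp (((Real.pi - ext p k : ℝ) : ℂ) * Complex.I)) := by
    have hexp : Complex.exp (((Real.pi - ext p k : ℝ) : ℂ) * Complex.I) =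
        -(Complex.exp ((ext p k : ℂ) * Complex.I))⁻¹ := by
      push_cast
      rw [sub_mul, Complex.exp_sub, Complex.exp_pi_mul_I, neg_div, one_div]
    have h4 := Complex.norm_mul_exp_arg_mul_I (u / e)
    rw [← hext] at h4
    have h5 : ((‖u / e‖⁻¹ : ℝ) : ℂ) * (Complex.exp ((ext p k : ℂ) * Complex.I))⁻¹ = e / u := by
      rw [Complex.ofReal_inv, ← mul_inv, h4, inv_div]
    rw [hexp, show p k - p (k + 1) = -e by rw [he]; ring]
    have : ((‖u / e‖⁻¹ : ℝ) : ℂ) * (u * -(Complex.exp ((ext p k : ℂ) * Complex.I))⁻¹) =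
      - (u * (((‖u / e‖⁻¹ : ℝ) : ℂ) * (Complex.exp ((ext p k : ℂ) * Complex.I))⁻¹)) := by ring
    rw [this, h5]
    field_simp
  have h6 : 0 < Real.pi - ext p k := by rw [hext]; linarith
  refine ⟨?_, h6⟩
  rw [hv, ang_eq hu0 (inv_pos.2 (norm_div_pos he0 hu0)) h6.le]
  rw [hext]; linarith

lemma Bounds.frontier_vertex (h : Bounds n p O) (k : ℤ) : ∀ᶠ y in 𝓝 (p (k + 1)),
    y ∈ frontier O ↔ y ∈ segment ℝ (p (k + 1)) (p (k + 1) + (p (k + 2) - p (k + 1))) ∨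
      y ∈ segment ℝ (p (k + 1)) (p (k + 1) + (p k - p (k + 1))) := by
  filter_upwards [h.loop.eventually_segment (p (k + 1))] with y hy
  rw [add_sub_cancel, add_sub_cancel, h.frontier_eq, mem_iUnion, segment_symm ℝ (p (k + 1)) (p k)]
  constructor
  · rintro ⟨j, hj⟩
    rcases h.loop.vertex_mem_segment (hy j hj) with e | e
    · rw [h.loop.segment_congr e] at hj
      exact Or.inr hj
    · rw [h.loop.segment_congr e, show k + 1 + 1 = k + 2 by ring] at hj
      exact Or.inl hj
  · rintro (hj | hj)
    · exact ⟨k + 1, by rwa [show k + 1 + 1 = k + 2 by ring]⟩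
    · exact ⟨k, hj⟩

lemma Bounds.isSector_of_nonempty (h : Bounds n p O) (k : ℤ)
    (hne : ∀ r > 0, (sector (p (k + 1)) (p (k + 2) - p (k + 1)) r 0 (Real.pi - ext p k) ∩ O).Nonempty) :
    IsSector O (p (k + 1)) (p (k + 2) - p (k + 1)) (Real.pi - ext p k) := by
  have hv := h.loop.ang_eq_pi_sub_ext k
  have hu0 : p (k + 2) - p (k + 1) ≠ 0 := by
    have := h.loop.ne_succ (k + 1)
    rw [show k + 1 + 1 = k + 2 by ring] at this
    exact sub_ne_zero.2 this.symm
  rw [← hv.1] at hne ⊢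
  exact isSector_of_segments h.closed hu0 (sub_ne_zero.2 (h.loop.ne_succ k))
    (by rw [hv.1]; exact hv.2) (h.frontier_vertex k) hne

/-- The sector on the left at a vertex touches the left halves of both adjacent edges. Hence "`O`
lies on the left" passes from each edge to the next all around the loop. -/
lemma Bounds.isSector_iff (h : Bounds n p O) (k : ℤ) :
    (IsSector O (p (k + 1)) (p (k + 2) - p (k + 1)) (Real.pi - ext p k) ↔ OnLeft p O k) ∧
    (IsSector O (p (k + 1)) (p (k + 2) - p (k + 1)) (Real.pi - ext p k) ↔ OnLeft p O (k + 1)) := by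
  have hv := h.loop.ang_eq_pi_sub_ext k
  have hv0 : p k - p (k + 1) ≠ 0 := sub_ne_zero.2 (h.loop.ne_succ k)
  have hu0 : p (k + 2) - p (k + 1) ≠ 0 := by
    have := h.loop.ne_succ (k + 1)
    rw [show k + 1 + 1 = k + 2 by ring] at this
    exact sub_ne_zero.2 this.symm
  have k1 : ∀ r > 0, ∀ η > 0, (sector (p (k + 1)) (p (k + 2) - p (k + 1)) r 0 (Real.pi - ext p k) ∩
      half (p k) (p (k + 1)) η).Nonempty := by
    intro r hr η hη
    have := exists_half_sector_rev (z := p (k + 1)) (α := 0) hu0 hv0 hr hη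
      (by rw [hv.1]; exact hv.2) (by rw [hv.1]; exact hv.2)
    rwa [hv.1, add_sub_cancel] at this
  have k2 : ∀ r > 0, ∀ η > 0, (sector (p (k + 1)) (p (k + 2) - p (k + 1)) r 0 (Real.pi - ext p k) ∩
      half (p (k + 1)) (p (k + 2)) η).Nonempty := by
    intro r hr η hη
    have := exists_half_sector (z := p (k + 1)) (β := Real.pi - ext p k) hu0 hu0 hr hη
      (by rw [ang_self hu0]; exact hv.2)
    rwa [ang_self hu0, add_sub_cancel] at this
  constructor
  · constructor
    · intro hs
      obtain ⟨r, hr, hr1, -⟩ := hs.exists_sector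
      obtain ⟨η, hη, hthin⟩ := h.exists_thin k
      obtain ⟨z, hz1, hz2⟩ := k1 r hr η hη
      exact h.onLeft_of_exists hη hthin ⟨z, hz2, hr1 hz1⟩
    · intro hl
      refine h.isSector_of_nonempty k fun r hr => ?_
      obtain ⟨η, hη, hthin⟩ := h.exists_thin k
      obtain ⟨z, hz1, hz2⟩ := k1 r hr η hη
      exact ⟨z, hz1, h.half_subset hthin (hl η hη) hz2⟩
  · constructor
    · intro hs
      obtain ⟨r, hr, hr1, -⟩ := hs.exists_sector
      obtain ⟨η, hη, hthin⟩ := h.exists_thin (k + 1)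
      obtain ⟨z, hz1, hz2⟩ := k2 r hr η hη
      refine h.onLeft_of_exists hη hthin ⟨z, ?_, hr1 hz1⟩
      rwa [show k + 1 + 1 = k + 2 by ring]
    · intro hl
      refine h.isSector_of_nonempty k fun r hr => ?_
      obtain ⟨η, hη, hthin⟩ := h.exists_thin (k + 1)
      obtain ⟨z, hz1, hz2⟩ := k2 r hr η hη
      refine ⟨z, hz1, h.half_subset hthin (hl η hη) ?_⟩
      rwa [show k + 1 + 1 = k + 2 by ring]

lemma Bounds.onLeft_iff (h : Bounds n p O) (k : ℤ) : OnLeft p O k ↔ OnLeft p O 0 := by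
  have step : ∀ k, OnLeft p O (k + 1) ↔ OnLeft p O k := fun k =>
    (h.isSector_iff k).2.symm.trans (h.isSector_iff k).1
  induction k using Int.induction_on with
  | zero => rfl
  | succ m ih => exact (step _).trans ih
  | pred m ih =>
    have := step (-(m : ℤ) - 1)
    rw [sub_add_cancel] at this
    exact this.symm.trans ih

lemma Bounds.shift (h : Bounds n p O) (m : ℤ) : Bounds n (fun k => p (k + m)) O where
  loop := h.loop.shift m
  closed := h.closed
  bdd := h.bdd
  regular := h.regular
  frontier_eq := by
    rw [h.frontier_eq]
    ext z
    simp only [mem_iUnion]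
    constructor
    · rintro ⟨k, hk⟩
      exact ⟨k - m, by rwa [show k - m + m = k by ring, show k - m + 1 + m = k + 1 by ring]⟩
    · rintro ⟨k, hk⟩
      exact ⟨k + m, by rwa [show k + m + 1 = k + 1 + m by ring]⟩

lemma Bounds.reverse (h : Bounds n p O) : Bounds n (fun k => p (-k)) O where
  loop := h.loop.reverse
  closed := h.closed
  bdd := h.bdd
  regular := h.regular
  frontier_eq := by
    rw [h.frontier_eq]
    ext z
    simp only [mem_iUnion]
    constructor
    · rintro ⟨k, hk⟩
      refine ⟨-k - 1, ?_⟩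
      rwa [segment_symm, show -(-k - 1 + 1) = k by ring, show -(-k - 1) = k + 1 by ring]
    · rintro ⟨k, hk⟩
      refine ⟨-k - 1, ?_⟩
      rwa [segment_symm, show -k - 1 + 1 = -k by ring, show -k - 1 = -(k + 1) by ring]

/-- By regularity there are interior points of `O` near the midpoint of the edge from `p 0` to `p
1`. They lie on one of its sides, and reversal of the loop exchanges the sides. -/
lemma Bounds.onLeft_or (h : Bounds n p O) : OnLeft p O 0 ∨ OnLeft (fun k => p (-k)) O 0 := by
  obtain ⟨η, hη, hthin⟩ := h.exists_thin 0
  obtain ⟨η', hη', hthin'⟩ := h.reverse.exists_thin (-1)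
  have h01 := h.loop.ne_succ 0
  rw [zero_add] at h01
  have hpos := lt_min hη hη'
  have hm : midpoint ℝ (p 0) (p 1) ∈ openSegment ℝ (p 0) (p 1) := by
    rw [openSegment_eq_image']
    refine ⟨1 / 2, by norm_num, ?_⟩
    simp [midpoint, AffineMap.lineMap_apply]
    ring
  have hsegF : openSegment ℝ (p 0) (p 1) ⊆ frontier O := by
    rw [h.frontier_eq]
    exact fun z hz => mem_iUnion.2 ⟨0, by simpa using openSegment_subset_segment ℝ _ _ hz⟩
  have hmO := h.regular (h.closed.frontier_subset (hsegF hm))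
  obtain ⟨y, hy1, hy2⟩ := mem_closure_iff.1 hmO _ (isOpen_rhomb (p 0) (p 1) (min η η'))
    (SoftDisc.openSegment_subset_rhomb h01 hpos hm)
  rcases (SoftDisc.mem_rhomb_iff h01 hpos y).1 hy1 with e | e | e
  · left
    refine h.onLeft_of_exists hη hthin ⟨y, ?_, interior_subset hy2⟩
    rw [zero_add]
    exact half_mono hpos (min_le_left _ _) e
  · right
    rw [← h.reverse.onLeft_iff (-1)]
    refine h.reverse.onLeft_of_exists hη' hthin' ⟨y, ?_, interior_subset hy2⟩
    have := half_mono hpos (min_le_right _ _) e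
    simpa using this
  · exact absurd hy2 (hsegF e).2

lemma Bounds.isSector_vertex (h : Bounds n p O) (hl : OnLeft p O 0) (k : ℤ) :
    IsSector O (p (k + 1)) (p (k + 2) - p (k + 1)) (Real.pi - ext p k) :=
  (h.isSector_iff k).1.2 ((h.onLeft_iff k).2 hl)

lemma Bounds.isSector_edge (h : Bounds n p O) (hl : OnLeft p O 0) {k : ℤ} {z : ℂ}
    (hz : z ∈ openSegment ℝ (p k) (p (k + 1))) :
    IsSector O z (p (k + 1) - z) Real.pi := by
  have hk := h.loop.ne_succ k
  obtain ⟨s, hs0, hs1, hs⟩ : ∃ s : ℝ, 0 < s ∧ s < 1 ∧ z = p k + s * (p (k + 1) - p k) := by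
    rw [openSegment_eq_image'] at hz
    obtain ⟨s, hs, rfl⟩ := hz
    exact ⟨s, hs.1, hs.2, by simp⟩
  have hd : p (k + 1) - p k ≠ 0 := sub_ne_zero.2 hk.symm
  have e1 : p (k + 1) - z = ((1 - s : ℝ) : ℂ) * (p (k + 1) - p k) := by rw [hs]; push_cast; ring
  have e2 : p k - z = ((s / (1 - s) : ℝ) : ℂ) * -(p (k + 1) - z) := by
    have : (1 : ℂ) - s ≠ 0 := by
      have : (1 : ℝ) - s ≠ 0 := by linarith
      exact_mod_cast this
    rw [e1, hs]; push_cast; field_simp; ring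
  have h1 : p (k + 1) - z ≠ 0 := by
    rw [e1]; exact mul_ne_zero (Complex.ofReal_ne_zero.2 (by linarith)) hd
  have hang : ang (p (k + 1) - z) (p k - z) = Real.pi := by
    rw [e2, ang_real_mul h1 (div_pos hs0 (by linarith)), ang_neg_self h1]
  have h2 : p k - z ≠ 0 := by
    rw [e2]; exact mul_ne_zero (Complex.ofReal_ne_zero.2 (div_pos hs0 (by linarith)).ne')
      (neg_ne_zero.2 h1)
  rw [← hang]
  refine isSector_of_segments h.closed h1 h2 (by rw [hang]; exact Real.pi_pos) ?_ fun r hr => ?_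
  · filter_upwards [h.loop.eventually_segment z] with y hy
    rw [add_sub_cancel, add_sub_cancel, h.frontier_eq, mem_iUnion]
    have hunion : segment ℝ (p k) (p (k + 1)) = segment ℝ z (p (k + 1)) ∪ segment ℝ z (p k) := by
      have := openSegment_subset_segment ℝ _ _ hz
      rw [segment_symm ℝ z (p k), union_comm]
      apply Set.Subset.antisymm
      · intro y hy
        obtain ⟨t, ht0, ht1, ht⟩ := mem_segment_iff.1 hy
        rcases le_total t s with hts | hts
        · left
          refine mem_segment_iff.2 ⟨t / s, by positivity, div_le_one_of_le₀ hts hs0.le, ?_⟩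
          have : (s : ℂ) ≠ 0 := Complex.ofReal_ne_zero.2 hs0.ne'
          rw [ht, hs]; push_cast; field_simp; ring
        · right
          refine mem_segment_iff.2 ⟨(t - s) / (1 - s), div_nonneg (by linarith) (by linarith),
            div_le_one_of_le₀ (by linarith) (by linarith), ?_⟩
          have : (1 : ℂ) - s ≠ 0 := by
            have : (1 : ℝ) - s ≠ 0 := by linarith
            exact_mod_cast this
          rw [e1, ht, hs]; push_cast; field_simp; ring
      · exact union_subset ((convex_segment _ _).segment_subset (left_mem_segment ℝ _ _) this)
          ((convex_segment _ _).segment_subset this (right_mem_segment ℝ _ _))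
    rw [← mem_union, ← hunion]
    constructor
    · rintro ⟨j, hj⟩
      rwa [h.loop.segment_congr (h.loop.open_mem_segment hz (hy j hj))] at hj
    · exact fun hj => ⟨k, hj⟩
  · obtain ⟨η, hη, hthin⟩ := h.exists_thin k
    have hhalf := h.half_subset hthin ((h.onLeft_iff k).2 hl η hη)
    obtain ⟨t, ht1, ht2, ht3⟩ : ∃ t : ℝ, 0 < t ∧ t * ‖p (k + 1) - p k‖ < r ∧
        p k + (s + t * Complex.I) * (p (k + 1) - p k) ∈ half (p k) (p (k + 1)) η := by
      have hsm : ∀ᶠ s : ℝ in 𝓝[>] 0, s * ‖p (k + 1) - p k‖ < r := by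
        have : Tendsto (fun t : ℝ => t * ‖p (k + 1) - p k‖) (𝓝[>] 0) (𝓝 (0 * ‖p (k + 1) - p k‖)) :=
          ((continuous_id.mul continuous_const).tendsto 0).mono_left nhdsWithin_le_nhds
        rw [zero_mul] at this
        exact this.eventually_lt_const hr
      obtain ⟨t, a, b, c⟩ := ((eventually_mem_half hk hη hs0 hs1).and (hsm.and self_mem_nhdsWithin)).exists
      exact ⟨t, c, b, a⟩
    have hsub : p k + (s + t * Complex.I) * (p (k + 1) - p k) - z =
        t * (Complex.I * (p (k + 1) - p k)) := by rw [hs]; ring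
    refine ⟨_, ⟨?_, ?_, ?_, ?_⟩, hhalf ht3⟩
    · intro he
      rw [← sub_eq_zero, hsub] at he
      exact mul_ne_zero (Complex.ofReal_ne_zero.2 ht1.ne') (mul_ne_zero Complex.I_ne_zero hd) he
    · rw [hsub, norm_mul, norm_mul, Complex.norm_I, one_mul, Complex.norm_real, Real.norm_eq_abs,
        abs_of_pos ht1]
      exact ht2
    all_goals
      have hA : ang (p (k + 1) - z) (Complex.I * (p (k + 1) - p k)) = Real.pi / 2 := by
        have h4 : p (k + 1) - p k = (((1 - s)⁻¹ : ℝ) : ℂ) * (p (k + 1) - z) := by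
          rw [e1, ← mul_assoc, ← Complex.ofReal_mul, inv_mul_cancel₀ (by linarith)]; simp
        have h5 : ang (p (k + 1) - z) (p (k + 1) - p k) = 0 := by
          rw [h4, ang_real_mul h1 (inv_pos.2 (by linarith)), ang_self h1]
        rw [ang_mul h1 hd Complex.I_ne_zero, h5, Complex.arg_I, zero_add] <;>
          rw [h5, Complex.arg_I] <;> linarith [Real.pi_pos]
      rw [hsub, ang_real_mul h1 ht1, hA]
      linarith [Real.pi_pos]

/-- At a vertex of maximal norm all other vertices lie in an open half-plane, so `sum_ext` applies,
and its value is `2π` once the inner angle there is known to be less than `π`. -/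
lemma Bounds.sum_ext_eq (h : Bounds n p O) (hl : OnLeft p O 0) (hmax : ∀ k, ‖p k‖ ≤ ‖p 0‖) :
    ∑ k ∈ Finset.range n, ext p k = 2 * Real.pi := by
  have h3 := h.loop.three_le'
  -- Multiplication by `c` turns the inward radial direction at `p 0` into the positive real
  -- direction; maximality of the norm then gives the half-plane condition.
  set c : ℂ := -(starRingEnd ℂ) (p 0) with hcdef
  have hpos : ∀ k : ℤ, p k ≠ p 0 → 0 < (c * (p k - p 0)).re := by
    intro k hk
    have h1 : 2 * (c * (p k - p 0)).re = ‖p 0‖ ^ 2 - ‖p k‖ ^ 2 + ‖p k - p 0‖ ^ 2 := by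
      rw [← Complex.normSq_eq_norm_sq, ← Complex.normSq_eq_norm_sq, ← Complex.normSq_eq_norm_sq]
      simp only [Complex.normSq_apply, hcdef, Complex.mul_re, Complex.neg_re, Complex.neg_im,
        Complex.conj_re, Complex.conj_im, Complex.sub_re, Complex.sub_im]
      ring
    have h2 : ‖p k‖ ^ 2 ≤ ‖p 0‖ ^ 2 := pow_le_pow_left₀ (norm_nonneg _) (hmax k) 2
    have h4 : 0 < ‖p k - p 0‖ ^ 2 := by
      have := norm_pos_iff.2 (sub_ne_zero.2 hk)
      positivity
    linarith
  have hne : ∀ k : ℤ, 0 < k → k < n → p k ≠ p 0 := fun k a b =>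
    (h.loop.ne_of_lt a (by linarith)).symm
  have hsum := h.loop.sum_ext (c := c) fun k a b => hpos k (hne k a b)
  have pm1 : p (-1) = p (n - 1) := by
    rw [← h.loop.periodic (-1)]; congr 1
  have hA := hpos (n - 1) (hne _ (by linarith) (by linarith))
  have hE := hpos 1 (hne _ (by linarith) (by linarith))
  have hΔ := arg_div_of_halfPlane hE hA
  have hang := (h.loop.ang_eq_pi_sub_ext (-1)).1
  have hsec := h.isSector_vertex hl (-1)
  norm_num at hang hsec
  rw [pm1] at hang
  rw [← hΔ] at hsum
  unfold ang at hang
  -- If the inner angle is the principal difference, the formula gives `2π` directly. In the other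
  -- case the outward radial direction at `p 0` points into `O`; the ray misses the frontier, which
  -- lies in the disc of radius `‖p 0‖`, so `O` would be unbounded.
  split_ifs at hang with hcase
  · linarith
  exfalso
  push Not at hcase
  have h0 : p 0 ≠ 0 := by
    intro h0
    have := hmax 1
    rw [h0, norm_zero, norm_le_zero_iff] at this
    exact hne 1 (by linarith) (by linarith) (this.trans h0.symm)
  have hc0 : c ≠ 0 := by rw [hcdef]; simpa using h0
  have hu0 : p 1 - p 0 ≠ 0 := by
    intro h'; rw [h'] at hE; simp at hE
  set β := Complex.arg (c * (p 1 - p 0)) with hβ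
  have hβ1 := abs_lt.1 (Complex.abs_arg_lt_pi_div_two_iff.2 (Or.inl hE))
  have hA1 := abs_lt.1 (Complex.abs_arg_lt_pi_div_two_iff.2 (Or.inl hA))
  have hpi := Real.pi_pos
  have hcp : c * p 0 = -((‖p 0‖ ^ 2 : ℝ) : ℂ) := by
    rw [hcdef, neg_mul, ← Complex.normSq_eq_norm_sq, Complex.normSq_eq_conj_mul_self]
  have hnorm : 0 < ‖c * (p 1 - p 0)‖ := norm_pos_iff.2 (mul_ne_zero hc0 hu0)
  have hρ : 0 < ‖p 0‖ ^ 2 / ‖c * (p 1 - p 0)‖ := by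
    have := norm_pos_iff.2 h0
    positivity
  have hrep : p 0 = ((‖p 0‖ ^ 2 / ‖c * (p 1 - p 0)‖ : ℝ) : ℂ) *
      ((p 1 - p 0) * Complex.exp (((Real.pi - β : ℝ) : ℂ) * Complex.I)) := by
    apply mul_left_cancel₀ hc0
    have h5 := Complex.norm_mul_exp_arg_mul_I (c * (p 1 - p 0))
    rw [← hβ] at h5
    have h6 : Complex.exp (((Real.pi - β : ℝ) : ℂ) * Complex.I) * Complex.exp ((β : ℂ) * Complex.I) = -1 := by
      rw [← Complex.exp_add, ← Complex.exp_pi_mul_I]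
      congr 1; push_cast; ring
    have h7 : c * (((‖p 0‖ ^ 2 / ‖c * (p 1 - p 0)‖ : ℝ) : ℂ) *
      ((p 1 - p 0) * Complex.exp (((Real.pi - β : ℝ) : ℂ) * Complex.I))) =
      ((‖p 0‖ ^ 2 / ‖c * (p 1 - p 0)‖ : ℝ) : ℂ) * ((c * (p 1 - p 0)) *
        Complex.exp (((Real.pi - β : ℝ) : ℂ) * Complex.I)) := by ring
    have h8 : ((‖c * (p 1 - p 0)‖ : ℝ) : ℂ) ≠ 0 := Complex.ofReal_ne_zero.2 hnorm.ne'
    rw [h7, hcp]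
    have h9 : (c * (p 1 - p 0)) * Complex.exp (((Real.pi - β : ℝ) : ℂ) * Complex.I) =
        -(‖c * (p 1 - p 0)‖ : ℂ) := by
      conv_lhs => rw [← h5]
      rw [mul_assoc, mul_comm (Complex.exp _), h6, mul_neg_one]
    rw [h9]
    push_cast
    field_simp
  have hang0 : ang (p 1 - p 0) (p 0) = Real.pi - β := by
    refine (congrArg (ang (p 1 - p 0)) hrep).trans (ang_eq hu0 hρ ?_ ?_) <;> linarith
  have hmem := (hsec.eventually_mem_iff h0).2 (by rw [hang0]; linarith)
  obtain ⟨t, ht, ht0⟩ := (hmem.and self_mem_nhdsWithin).exists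
  have ht0 : (0 : ℝ) < t := ht0
  have hFball : frontier O ⊆ Metric.closedBall 0 ‖p 0‖ := by
    rw [h.frontier_eq]
    refine iUnion_subset fun k => (convex_closedBall _ _).segment_subset ?_ ?_ <;>
      simpa using hmax _
  have hray : (fun t : ℝ => p 0 + t * p 0) '' Ioi 0 ⊆ O := by
    refine IsPreconnected.subset_of_disjoint_frontier
      (isPreconnected_Ioi.image _ (Continuous.continuousOn (by fun_prop))) ?_
      ⟨_, mem_image_of_mem _ ht0, ht⟩
    rw [Set.disjoint_left]
    rintro _ ⟨s, hs, rfl⟩ hF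
    have hs : (0 : ℝ) < s := hs
    have := hFball hF
    rw [mem_closedBall_zero_iff] at this
    have e : p 0 + s * p 0 = ((1 + s : ℝ) : ℂ) * p 0 := by push_cast; ring
    simp only [] at this
    rw [e, norm_mul, Complex.norm_real, Real.norm_eq_abs, abs_of_pos (by linarith)] at this
    have := norm_pos_iff.2 h0
    nlinarith
  obtain ⟨R, hR⟩ := h.bdd.subset_closedBall 0
  have hn0 := norm_pos_iff.2 h0
  have := hR (hray ⟨|R| / ‖p 0‖ + 1, by
    have : 0 ≤ |R| / ‖p 0‖ := by positivity
    exact mem_Ioi.2 (by linarith), rfl⟩)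
  rw [mem_closedBall_zero_iff] at this
  have e : p 0 + ((|R| / ‖p 0‖ + 1 : ℝ) : ℂ) * p 0 = ((|R| / ‖p 0‖ + 2 : ℝ) : ℂ) * p 0 := by
    push_cast; ring
  simp only [] at this
  rw [e, norm_mul, Complex.norm_real, Real.norm_eq_abs, abs_of_pos (by positivity), add_mul,
    div_mul_cancel₀ _ hn0.ne'] at this
  linarith [le_abs_self R]

lemma Bounds.exists_normalized (h : Bounds n p O) : ∃ q, Bounds n q O ∧ OnLeft q O 0 ∧
    ∑ k ∈ Finset.range n, ext q k = 2 * Real.pi := by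
  obtain ⟨q, hq, hql⟩ : ∃ q, Bounds n q O ∧ OnLeft q O 0 := by
    rcases h.onLeft_or with hl | hl
    · exact ⟨p, h, hl⟩
    · exact ⟨_, h.reverse, hl⟩
  have h3 := hq.loop.three_le
  obtain ⟨i, hi, hmax⟩ := Finset.exists_max_image (Finset.range n) (fun i : ℕ => ‖q i‖)
    ⟨0, Finset.mem_range.2 (by omega)⟩
  have hs := hq.shift i
  have hl : OnLeft (fun k => q (k + i)) O 0 := by
    have := (hq.onLeft_iff i).2 hql
    intro η hη
    have := this η hη
    simpa [add_comm] using this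
  refine ⟨_, hs, hl, hs.sum_ext_eq hl fun k => ?_⟩
  obtain ⟨j, hj, hkj⟩ := hq.loop.exists_nat_modEq (k + i)
  simp only [zero_add]
  rw [hq.loop.congr_modEq hkj]
  exact hmax j hj

lemma Bounds.exists_isSector (h : Bounds n p O) {z : ℂ} (hz : z ∈ frontier O) :
    ∃ u φ, IsSector O z u φ := by
  obtain ⟨q, hq, hl, -⟩ := h.exists_normalized
  rw [hq.frontier_eq] at hz
  obtain ⟨k, hk⟩ := mem_iUnion.1 hz
  rcases segment_endpoint_or hk with rfl | rfl | e
  · have := hq.isSector_vertex hl (k - 1)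
    rw [sub_add_cancel] at this
    exact ⟨_, _, this⟩
  · exact ⟨_, _, hq.isSector_vertex hl k⟩
  · exact ⟨_, _, hq.isSector_edge hl e⟩

/-- The corners of the polygon and the set `S` may differ, but both contain every frontier point
whose angle is not `π`. Both sums thus equal the sum over the union. -/
lemma Bounds.sum_pi_sub_angleIn (h : Bounds n p O) {S : Finset ℂ} (hS : (S : Set ℂ) ⊆ frontier O)
    (hS' : ∀ z ∈ frontier O, z ∉ S → angleIn O z = Real.pi) :
    ∑ z ∈ S, (Real.pi - angleIn O z) = 2 * Real.pi := by
  classical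
  obtain ⟨q, hq, hl, hsum⟩ := h.exists_normalized
  set T : Finset ℂ := (Finset.range n).image fun k : ℕ => q (k + 1) with hT
  have hTS : ∑ z ∈ T, (Real.pi - angleIn O z) = 2 * Real.pi := by
    rw [hT, Finset.sum_image, ← hsum]
    · refine Finset.sum_congr rfl fun k _ => ?_
      rw [(hq.isSector_vertex hl k).angleIn_eq]
      ring
    · intro i hi j hj hij
      have hi : i < n := by simpa using hi
      have hj : j < n := by simpa using hj
      have := Int.ModEq.add_right_cancel' 1 (hq.loop.inj _ _ hij)
      have := Int.natCast_modEq_iff.1 this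
      rwa [Nat.ModEq, Nat.mod_eq_of_lt hi, Nat.mod_eq_of_lt hj] at this
  have hTF : (T : Set ℂ) ⊆ frontier O := by
    intro z hz
    rw [hT, Finset.mem_coe, Finset.mem_image] at hz
    obtain ⟨k, -, rfl⟩ := hz
    rw [hq.frontier_eq]
    exact mem_iUnion.2 ⟨k, right_mem_segment ℝ _ _⟩
  have hT' : ∀ z ∈ frontier O, z ∉ T → angleIn O z = Real.pi := by
    intro z hz hzT
    rw [hq.frontier_eq] at hz
    obtain ⟨k, hk⟩ := mem_iUnion.1 hz
    have hv : ∀ k : ℤ, q k ∈ T := by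
      intro k
      obtain ⟨i, hi, hki⟩ := hq.loop.exists_nat_modEq (k - 1)
      rw [hT, Finset.mem_image]
      refine ⟨i, hi, ?_⟩
      have := hki.add_right 1
      rw [sub_add_cancel] at this
      exact (hq.loop.congr_modEq this).symm
    rcases segment_endpoint_or hk with rfl | rfl | e
    · exact absurd (hv _) hzT
    · exact absurd (hv _) hzT
    · exact (hq.isSector_edge hl e).angleIn_eq
  rw [← hTS]
  have e1 : ∑ z ∈ S, (Real.pi - angleIn O z) = ∑ z ∈ S ∪ T, (Real.pi - angleIn O z) := by
    refine Finset.sum_subset Finset.subset_union_left fun z hz hzS => ?_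
    rcases Finset.mem_union.1 hz with h' | h'
    · exact absurd h' hzS
    · rw [hS' z (hTF h') hzS, sub_self]
  have e2 : ∑ z ∈ T, (Real.pi - angleIn O z) = ∑ z ∈ S ∪ T, (Real.pi - angleIn O z) := by
    refine Finset.sum_subset Finset.subset_union_right fun z hz hzT => ?_
    rcases Finset.mem_union.1 hz with h' | h'
    · rw [hT' z (hS h') hzT, sub_self]
    · exact absurd h' hzT
  rw [e1, e2]

lemma Bounds.isPreconnected_frontier (h : Bounds n p O) : IsPreconnected (frontier O) := by
  rw [h.frontier_eq]
  refine IsPreconnected.iUnion_of_chain (fun k => (convex_segment _ _).isPreconnected) fun k => ?_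
  rw [Int.succ_eq_succ] 
  exact ⟨p (k + 1), right_mem_segment ℝ _ _, left_mem_segment ℝ _ _⟩

lemma Bounds.frontier_nonempty (h : Bounds n p O) : (frontier O).Nonempty := by
  rw [h.frontier_eq]
  exact ⟨p 0, mem_iUnion.2 ⟨0, left_mem_segment ℝ _ _⟩⟩

end SimpleLoop

lemma edgeSet_eq_segment {n : ℕ} (P : Polygon ℂ n) (i : Fin n) :
    P.edgeSet ℝ i = segment ℝ (P i) (P (finRotate n i)) := by
  rw [Polygon.edgeSet, affineSegment_eq_segment]

/-- Indices in `Fin n` become integers modulo `n`, so that neighbours of a vertex need no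
wrap-around. -/
theorem exists_bounds_of_polygon {n : ℕ} (hn : 3 ≤ n) {P : Polygon ℂ n} (hP : IsSimplePolygon P)
    {O : Set ℂ} (hO : IsClosed O) (hb : Bornology.IsBounded O) (hr : O ⊆ closure (interior O))
    (hF : frontier O = P.boundary ℝ) : ∃ p, SimpleLoop.Bounds n p O := by
  have : NeZero n := ⟨by omega⟩
  have hn3 : (3 : ℤ) ≤ n := by exact_mod_cast hn
  have hm : ∀ k : ℤ, (k % n).toNat < n := fun k => by
    have h0 : (0 : ℤ) ≤ k % n := Int.emod_nonneg _ (by linarith)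
    have h1 : k % n < n := Int.emod_lt_of_pos _ (by linarith)
    omega
  set ι : ℤ → Fin n := fun k => ⟨(k % n).toNat, hm k⟩ with hι
  have hιv : ∀ k : ℤ, ((ι k : ℕ) : ℤ) = k % n := fun k => by
    simp only [hι]
    exact Int.toNat_of_nonneg (Int.emod_nonneg _ (by linarith))
  have hιeq : ∀ i j, ι i = ι j ↔ i ≡ j [ZMOD n] := by
    intro i j
    rw [Fin.ext_iff, ← Nat.cast_inj (R := ℤ), hιv, hιv]; rfl
  have hrot : ∀ k, finRotate n (ι k) = ι (k + 1) := by
    intro k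
    obtain ⟨m, rfl⟩ : ∃ m, n = m + 1 := ⟨n - 1, by omega⟩
    rw [finRotate_apply, Fin.ext_iff, ← Nat.cast_inj (R := ℤ), hιv, Fin.val_add]
    push_cast
    rw [hιv, Fin.val_one']
    push_cast
    simp [Int.add_emod]
  have hsurj : ∀ i : Fin n, ∃ k, ι k = i := by
    intro i
    refine ⟨(i : ℕ), ?_⟩
    rw [Fin.ext_iff, ← Nat.cast_inj (R := ℤ), hιv]
    exact Int.emod_eq_of_lt (by positivity) (by exact_mod_cast i.2)
  refine ⟨fun k => P (ι k), ⟨hn, ?_, ?_, ?_⟩, hO, hb, hr, ?_⟩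
  · intro k
    rw [(hιeq (k + n) k).2 (by simp [Int.ModEq])]
  · intro i j h
    exact (hιeq i j).1 (hP.1 h)
  · intro i j hij z hz hz'
    have := hP.2 (ι i) (ι j) (fun h => hij ((hιeq i j).1 h))
    rw [edgeSet_eq_segment, edgeSet_eq_segment, hrot, hrot] at this
    have := this ⟨hz, hz'⟩
    simpa using this
  · rw [hF, Polygon.boundary]
    ext z
    simp only [mem_iUnion]
    constructor
    · rintro ⟨i, hi⟩
      obtain ⟨k, rfl⟩ := hsurj i
      rw [edgeSet_eq_segment, hrot] at hi
      exact ⟨k, hi⟩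
    · rintro ⟨k, hk⟩
      refine ⟨ι k, ?_⟩
      rwa [edgeSet_eq_segment, hrot]

end SoftDisc

/-! ### The boundary of `O` as part of the graph, and exterior wires -/

namespace SoftDisc

open Set Filter Topology

namespace PlaneGraph

variable {G : PlaneGraph}

lemma eventually_drawing (hG : G.IsPlanar) {x : ℂ} (hx : x ∈ G.verts) :
    ∀ᶠ y in 𝓝 x, y ∈ G.drawing → y = x ∨ ∃ b, G.graph.Adj x b ∧ y ∈ segment ℝ x b := by
  have h1 : ∀ᶠ y in 𝓝 x, ∀ v ∈ G.verts, y = v → v = x := by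
    rw [Filter.eventually_all_finset]
    intro v _
    by_cases hv : v = x
    · exact Eventually.of_forall fun _ _ => hv
    · filter_upwards [isOpen_compl_singleton.mem_nhds (show x ∈ ({v} : Set ℂ)ᶜ from fun h => hv h.symm)]
        with y hy hy'
      exact absurd hy' hy
  have h2 : ∀ᶠ y in 𝓝 x, ∀ e ∈ G.Ed, y ∈ seg e → x ∈ seg e := by
    rw [eventually_all_finite G.finite_Ed]
    intro e _
    by_cases hxe : x ∈ seg e
    · exact Eventually.of_forall fun _ _ => hxe
    · filter_upwards [(isCompact_seg e).isClosed.isOpen_compl.mem_nhds hxe] with y hy hy'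
      exact absurd hy' hy
  filter_upwards [h1, h2] with y hy1 hy2 hyD
  rcases hyD with h | h
  · exact Or.inl (hy1 y h rfl)
  · right
    simp only [mem_iUnion] at h
    obtain ⟨e, he, hye⟩ := h
    have hxe := hG.vert x hx e he (hy2 e he hye)
    obtain ⟨b, rfl⟩ := Sym2.mem_iff_exists.1 hxe
    exact ⟨b, he, hye⟩

lemma left_mem_faces_iff (hG : G.IsPlanar) {a b y : ℂ} {η : ℝ} (hab : G.graph.Adj a b)
    (hη : G.Thin a b η) (hy : y ∈ half a b η) : G.left a b ∈ G.faces ↔ y ∈ G.O := by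
  have hyl := half_subset_left hab.ne hη hy
  refine ⟨fun h => face_subset_O h hyl, fun h => ?_⟩
  by_contra hf
  exact Set.disjoint_left.1 (comp_disjoint_O hG (left_mem_comps hG hab) hf) hyl h

section Sector

variable {x u : ℂ} {φ : ℝ}

/-- Points just counterclockwise of the bond lie in its left half, and they belong to `O` exactly
when the bond points strictly before the end of the sector. -/
lemma left_mem_faces_iff_ang_lt (hG : G.IsPlanar) (hs : IsSector G.O x u φ) {b : ℂ}
    (hb : G.graph.Adj x b) : G.left x b ∈ G.faces ↔ ang u (b - x) < φ := by
  obtain ⟨r, hr, h1, h2⟩ := hs.exists_sector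
  obtain ⟨η, hη⟩ := exists_thin hG hb
  have hv : b - x ≠ 0 := sub_ne_zero.2 hb.ne.symm
  rcases lt_or_ge (ang u (b - x)) φ with h | h
  · obtain ⟨y, hy, hy'⟩ := exists_half_sector (z := x) hs.ne hv hr hη.1 h
    rw [add_sub_cancel] at hy'
    refine ⟨fun _ => h, fun _ => (left_mem_faces_iff hG hb hη hy').2 (h1 ?_)⟩
    exact ⟨hy.1, hy.2.1, (ang_nonneg _ _).trans_lt hy.2.2.1, hy.2.2.2⟩
  · obtain ⟨y, hy, hy'⟩ := exists_half_sector (z := x) hs.ne hv hr hη.1 (ang_lt u (b - x))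
    rw [add_sub_cancel] at hy'
    refine ⟨fun hf => ?_, fun h' => absurd h' (not_lt.2 h)⟩
    have := (left_mem_faces_iff hG hb hη hy').1 hf
    exact absurd this (Set.disjoint_left.1 h2 ⟨hy.1, hy.2.1, h.trans_lt hy.2.2.1, hy.2.2.2⟩)

/-- Now points just clockwise of the bond decide. For a bond in direction `u` their angles are
slightly below `2π`, outside the sector, so angle `0` is excluded and angle `φ` is included. -/
lemma left_mem_faces_iff_ang_pos (hG : G.IsPlanar) (hs : IsSector G.O x u φ) {b : ℂ}
    (hb : G.graph.Adj x b) :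
    G.left b x ∈ G.faces ↔ 0 < ang u (b - x) ∧ ang u (b - x) ≤ φ := by
  obtain ⟨r, hr, h1, h2⟩ := hs.exists_sector
  obtain ⟨η, hη⟩ := exists_thin hG hb.symm
  have hv : b - x ≠ 0 := sub_ne_zero.2 hb.ne.symm
  rcases eq_or_lt_of_le (ang_nonneg u (b - x)) with h | h
  · obtain ⟨y, hy, hy'⟩ := exists_half_sector_zero (z := x) hs.ne hv hr hη.1 h.symm hs.lt
    rw [add_sub_cancel] at hy'
    refine ⟨fun hf => ?_, fun h' => absurd h'.1 (by rw [← h]; exact lt_irrefl _)⟩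
    have := (left_mem_faces_iff hG hb.symm hη hy').1 hf
    exact absurd this (Set.disjoint_left.1 h2 hy)
  · rcases le_or_gt (ang u (b - x)) φ with h' | h'
    · obtain ⟨y, hy, hy'⟩ := exists_half_sector_rev (z := x) hs.ne hv hr hη.1 h h
      rw [add_sub_cancel] at hy'
      refine ⟨fun _ => ⟨h, h'⟩, fun _ => (left_mem_faces_iff hG hb.symm hη hy').2 (h1 ?_)⟩
      exact ⟨hy.1, hy.2.1, hy.2.2.1, hy.2.2.2.trans_le h'⟩
    · obtain ⟨y, hy, hy'⟩ := exists_half_sector_rev (z := x) hs.ne hv hr hη.1 h h'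
      rw [add_sub_cancel] at hy'
      refine ⟨fun hf => ?_, fun h'' => absurd h''.2 (not_le.2 h')⟩
      have := (left_mem_faces_iff hG hb.symm hη hy').1 hf
      exact absurd this (Set.disjoint_left.1 h2 ⟨hy.1, hy.2.1, hy.2.2.1, hy.2.2.2.trans (ang_lt _ _)⟩)

lemma mem_EdBd_iff_ang (hG : G.IsPlanar) (hs : IsSector G.O x u φ) {b : ℂ}
    (hb : G.graph.Adj x b) : s(x, b) ∈ G.EdBd ↔ ang u (b - x) = 0 ∨ ang u (b - x) = φ := by
  rw [mem_EdBd_iff hG hb, left_mem_faces_iff_ang_lt hG hs hb, left_mem_faces_iff_ang_pos hG hs hb]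
  have h0 := ang_nonneg u (b - x)
  have := hs.pos
  rcases eq_or_lt_of_le h0 with h | h
  · rw [← h]; simp [this]
  · rcases lt_trichotomy (ang u (b - x)) φ with h' | h' | h'
    · simp [h, h', h.ne', h'.ne, h'.le]
    · simp [h', this]
    · simp [h'.not_gt, h'.not_ge, h'.ne', h.ne']

lemma mem_EdWireExt_iff_ang (hG : G.IsPlanar) (hs : IsSector G.O x u φ) {b : ℂ}
    (hb : G.graph.Adj x b) : s(x, b) ∈ G.EdWireExt ↔ φ < ang u (b - x) := by
  rw [mem_EdWireExt_iff hG hb, left_mem_faces_iff_ang_lt hG hs hb, left_mem_faces_iff_ang_pos hG hs hb]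
  have := hs.pos
  constructor
  · rintro ⟨h1, h2⟩
    by_contra h3
    exact h2 ⟨this.trans_le (not_lt.1 h1), not_lt.1 h3⟩
  · intro h
    exact ⟨not_lt.2 h.le, fun h' => absurd h'.2 (not_le.2 h)⟩

/-- The frontier of `O` lies in the drawing, which near a vertex consists of edges at that vertex;
so both sides of the sector run along bonds. -/
lemma exists_adj_of_frontier (hG : G.IsPlanar) (hx : x ∈ G.verts) (hs : IsSector G.O x u φ) {θ : ℝ}
    (hθ : θ = 0 ∨ θ = φ) : ∃ b, G.graph.Adj x b ∧ ang u (b - x) = θ := by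
  obtain ⟨r, hr, hO⟩ := hs.ev
  obtain ⟨ε, hε, hball⟩ := Metric.eventually_nhds_iff.1 (eventually_drawing hG hx)
  have hp := hs.pos
  have hl := hs.lt
  obtain ⟨w, hw, hwr, hwa⟩ := exists_dir hs.ne (lt_min hr hε) (θ := θ)
    (by rcases hθ with rfl | rfl <;> linarith) (by rcases hθ with rfl | rfl <;> linarith)
  have h1 := lt_min_iff.1 hwr
  have hF := (hO w hw h1.1).2.2 (by rw [hwa]; exact hθ)
  rcases hball (by rw [dist_eq_norm, add_sub_cancel_left]; exact h1.2) (frontier_O_subset hG hF) with h | h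
  · exact absurd (by simpa using h) hw
  · obtain ⟨b, hb, hwb⟩ := h
    refine ⟨b, hb, ?_⟩
    obtain ⟨t, h0, -, ht⟩ := mem_segment_iff.1 hwb
    rw [add_right_inj] at ht
    rcases eq_or_lt_of_le h0 with rfl | h0
    · simp at ht; exact absurd ht hw
    · rw [← hwa, ht, ang_real_mul hs.ne h0]

lemma eq_of_ang_eq (hG : G.IsPlanar) (hu : u ≠ 0) {b c : ℂ} (hb : G.graph.Adj x b)
    (hc : G.graph.Adj x c) (h : ang u (b - x) = ang u (c - x)) : b = c := by
  wlog hle : ‖b - x‖ ≤ ‖c - x‖ generalizing b c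
  · exact (this hc hb h.symm (le_of_not_ge hle)).symm
  have hmem := (add_mem_segment_iff (z := x) hu (sub_ne_zero.2 hc.ne.symm) (sub_ne_zero.2 hb.ne.symm) hle).2 h
  rw [add_sub_cancel, add_sub_cancel] at hmem
  have := hG.vert b (adj_mem_right hb) s(x, c) hc hmem
  rcases Sym2.mem_iff.1 this with e | e
  · exact absurd e.symm hb.ne
  · exact e

end Sector

lemma isPreconnected_norm_gt (R : ℝ) : IsPreconnected {z : ℂ | R < ‖z‖} := by
  have : {z : ℂ | R < ‖z‖} = (fun q : ℝ × ℝ => (q.1 : ℂ) * Complex.exp ((q.2 : ℂ) * Complex.I)) ''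
      (Ioi R ×ˢ univ) := by
    ext z
    simp only [mem_ofPred_eq, mem_image, mem_prod, mem_Ioi, mem_univ, and_true, Prod.exists]
    constructor
    · intro h
      exact ⟨‖z‖, Complex.arg z, h, Complex.norm_mul_exp_arg_mul_I z⟩
    · rintro ⟨t, θ, h, rfl⟩
      rw [norm_mul, Complex.norm_exp_ofReal_mul_I, mul_one, Complex.norm_real, Real.norm_eq_abs]
      exact h.trans_le (le_abs_self t)
  rw [this]
  exact (isPreconnected_Ioi.prod isPreconnected_univ).image _ (Continuous.continuousOn (by fun_prop))

/-- The outside of a large disc is connected and free of the drawing, so it lies in every unbounded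
component. -/
lemma comps_eq_of_not_isBounded {f g : Set ℂ} (hf : f ∈ G.comps) (hg : g ∈ G.comps)
    (hf' : ¬ Bornology.IsBounded f) (hg' : ¬ Bornology.IsBounded g) : f = g := by
  obtain ⟨R, hR⟩ := G.isCompact_drawing.isBounded.subset_closedBall 0
  set K : Set ℂ := {z | |R| < ‖z‖} with hK
  have hKD : K ⊆ G.drawingᶜ := by
    intro z hz hzD
    have := hR hzD
    rw [mem_closedBall_zero_iff] at this
    have h1 : |R| < ‖z‖ := hz
    linarith [le_abs_self R]
  have key : ∀ f ∈ G.comps, ¬ Bornology.IsBounded f → K ⊆ f := by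
    intro f hf hf'
    refine comps_maximal hf (isPreconnected_norm_gt _) hKD ?_
    by_contra hne
    refine hf' ((Metric.isBounded_closedBall (x := (0 : ℂ)) (r := |R|)).subset fun z hz => ?_)
    rw [mem_closedBall_zero_iff]
    by_contra hlt
    exact hne ⟨z, not_le.1 hlt, hz⟩
  have hKne : (((|R| + 1 : ℝ)) : ℂ) ∈ K := by
    rw [hK, mem_ofPred_eq, Complex.norm_real, Real.norm_eq_abs,
      abs_of_pos (show 0 < |R| + 1 by positivity)]
    linarith
  exact comps_eq hf hg ⟨_, key f hf hf' hKne, key g hg hg' hKne⟩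

/-- The sides of a wire are not faces. As bounded components are faces, both sides are unbounded and
therefore equal, and the wire is a bridge. -/
lemma not_reachable_of_wire (hG : G.IsPlanar) (hc : G.Connected) {a b : ℂ} (hab : s(a, b) ∈ G.EdWireExt) :
    ¬ (G.graph.deleteEdges {s(a, b)}).Reachable a b := by
  have hadj : G.graph.Adj a b := hab.1
  have h := (mem_EdWireExt_iff hG hadj).1 hab
  refine not_reachable_of_left_eq hG hadj (comps_eq_of_not_isBounded (left_mem_comps hG hadj)
    (left_mem_comps hG hadj.symm) ?_ ?_)
  · exact fun hb => h.1 (mem_faces_of_isBounded hc (left_mem_comps hG hadj) hb)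
  · exact fun hb => h.2 (mem_faces_of_isBounded hc (left_mem_comps hG hadj.symm) hb)

lemma O_regular (hG : G.IsPlanar) : G.O ⊆ closure (interior G.O) := by
  conv_lhs => rw [O_eq hG]
  refine closure_mono (sUnion_subset fun f hf => ?_)
  exact interior_maximal (face_subset_O hf) (comps_isOpen hf.1)

lemma exists_bounds (hG : G.IsPlanar) (hbd : G.HasSimplePolygonalBoundary) :
    ∃ n p, SimpleLoop.Bounds n p G.O := by
  obtain ⟨n, hn, P, hP, hF⟩ := hbd
  exact ⟨n, exists_bounds_of_polygon hn hP (isClosed_O hG) (isBounded_O hG) (O_regular hG) hF⟩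

lemma mem_EdBd_of_mem_openSegment (hG : G.IsPlanar) {a b z : ℂ} (hab : G.graph.Adj a b)
    (hz : z ∈ openSegment ℝ a b) (hzF : z ∈ frontier G.O) : s(a, b) ∈ G.EdBd := by
  have h := openSegment_closure_sUnion hG hab faces_subset_comps hz
  rw [← O_eq hG] at h
  rw [mem_EdBd_iff hG hab, ← h.1, ← h.2]
  exact ⟨(isClosed_O hG).frontier_subset hzF, hzF.2⟩

/-- The boundary edges, as a graph. -/
def bdGraph (G : PlaneGraph) : SimpleGraph ℂ := SimpleGraph.fromEdgeSet G.EdBd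

lemma bdGraph_adj {a b : ℂ} : G.bdGraph.Adj a b ↔ s(a, b) ∈ G.EdBd := by
  rw [bdGraph, SimpleGraph.fromEdgeSet_adj]
  exact ⟨fun h => h.1, fun h => ⟨h, SimpleGraph.Adj.ne (G := G.graph) h.1⟩⟩

variable {n : ℕ} {p : ℤ → ℂ}

lemma exists_mem_EdBd (hG : G.IsPlanar) (hB : SimpleLoop.Bounds n p G.O) {x : ℂ} (hx : x ∈ G.verts)
    (hxF : x ∈ frontier G.O) : ∃ b, s(x, b) ∈ G.EdBd := by
  obtain ⟨u, φ, hs⟩ := hB.exists_isSector hxF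
  obtain ⟨b, hb, hb0⟩ := exists_adj_of_frontier hG hx hs (Or.inl rfl)
  exact ⟨b, (mem_EdBd_iff_ang hG hs hb).2 (Or.inl hb0)⟩

lemma frontier_O_eq (hG : G.IsPlanar) (hB : SimpleLoop.Bounds n p G.O) :
    frontier G.O = ⋃ e ∈ G.EdBd, seg e := by
  apply Set.Subset.antisymm
  · intro z hz
    rcases mem_drawing_iff.1 (frontier_O_subset hG hz) with h | ⟨a, b, hab, h⟩
    · obtain ⟨b, hb⟩ := exists_mem_EdBd hG hB h hz
      exact mem_biUnion (t := seg) hb (left_mem_segment ℝ _ _)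
    · exact mem_biUnion (t := seg) (mem_EdBd_of_mem_openSegment hG hab h hz)
        (openSegment_subset_segment ℝ _ _ h)
  · exact iUnion₂_subset fun e he => he.2

/-- Otherwise the connected frontier would be covered by two nonempty closed sets, the boundary
edges reachable from `x` and the others. These would share a point, which by planarity is a common
endpoint. -/
lemma bdGraph_reachable (hG : G.IsPlanar) (hB : SimpleLoop.Bounds n p G.O) {x y : ℂ}
    (hx : x ∈ G.verts) (hxF : x ∈ frontier G.O) (hy : y ∈ G.verts) (hyF : y ∈ frontier G.O) :
    G.bdGraph.Reachable x y := by
  by_contra hcon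
  set E₁ : Set (Sym2 ℂ) := {e ∈ G.EdBd | ∃ a ∈ e, G.bdGraph.Reachable x a} with hE₁
  set E₂ : Set (Sym2 ℂ) := {e ∈ G.EdBd | ¬ ∃ a ∈ e, G.bdGraph.Reachable x a} with hE₂
  have hfin : G.EdBd.Finite := G.finite_Ed.subset fun e he => he.1
  have hreach : ∀ e ∈ E₁, ∀ z ∈ e, G.bdGraph.Reachable x z := by
    rintro e ⟨he, a, hae, ha⟩ z hze
    rcases eq_or_ne a z with rfl | haz
    · exact ha
    · have : e = s(a, z) := by
        exact ((Sym2.mem_and_mem_iff haz).1 ⟨hae, hze⟩)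
      subst this
      exact ha.trans (SimpleGraph.Adj.reachable (bdGraph_adj.2 he))
  have hcl : ∀ E : Set (Sym2 ℂ), E ⊆ G.EdBd → IsClosed (⋃ e ∈ E, seg e) := fun E hE =>
    (hfin.subset hE).isClosed_biUnion fun e _ => (isCompact_seg e).isClosed
  have hpre := isPreconnected_closed_iff.1 hB.isPreconnected_frontier (⋃ e ∈ E₁, seg e) (⋃ e ∈ E₂, seg e)
    (hcl _ fun e he => he.1) (hcl _ fun e he => he.1) (by
      rw [frontier_O_eq hG hB]
      refine iUnion₂_subset fun e he z hz => ?_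
      by_cases h : ∃ a ∈ e, G.bdGraph.Reachable x a
      · exact Or.inl (mem_biUnion (t := seg) ⟨he, h⟩ hz)
      · exact Or.inr (mem_biUnion (t := seg) ⟨he, h⟩ hz))
    (by
      obtain ⟨b, hb⟩ := exists_mem_EdBd hG hB hx hxF
      exact ⟨x, hxF, mem_biUnion (t := seg) (x := s(x, b))
        ⟨hb, x, Sym2.mem_mk_left _ _, SimpleGraph.Reachable.refl _⟩ (left_mem_segment ℝ _ _)⟩)
    (by
      obtain ⟨b, hb⟩ := exists_mem_EdBd hG hB hy hyF
      refine ⟨y, hyF, mem_biUnion (t := seg) (x := s(y, b)) ⟨hb, fun h => hcon ?_⟩ (left_mem_segment ℝ _ _)⟩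
      exact hreach _ ⟨hb, h⟩ y (Sym2.mem_mk_left _ _))
  obtain ⟨z, -, hz1, hz2⟩ := hpre
  simp only [mem_iUnion] at hz1 hz2
  obtain ⟨e, he, hze⟩ := hz1
  obtain ⟨e', he', hze'⟩ := hz2
  have hne : e ≠ e' := fun h => he'.2 (h ▸ he.2)
  have h := hG.inter e he.1.1 e' he'.1.1 hne z hze hze'
  exact he'.2 ⟨z, h.2, hreach e he z h.1⟩

lemma exists_vertex_frontier (hG : G.IsPlanar) (hB : SimpleLoop.Bounds n p G.O) :
    ∃ x ∈ G.verts, x ∈ frontier G.O := by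
  obtain ⟨z, hz⟩ := hB.frontier_nonempty
  rw [frontier_O_eq hG hB] at hz
  simp only [mem_iUnion] at hz
  obtain ⟨e, he, -⟩ := hz
  induction e using Sym2.ind with
  | _ a b => exact ⟨a, adj_mem_left he.1, he.2 (left_mem_segment ℝ _ _)⟩

/-- The component beside a wire is not a face, so it is disjoint from `O`, and it accumulates at the
endpoint. -/
lemma wire_endpoint (hG : G.IsPlanar) {e : Sym2 ℂ} (he : e ∈ G.EdWireExt) {y : ℂ} (hy : y ∈ e)
    (hyO : y ∈ G.O) : y ∈ frontier G.O := by
  obtain ⟨b, rfl⟩ := Sym2.mem_iff_exists.1 hy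
  have hadj : G.graph.Adj y b := he.1
  refine ⟨subset_closure hyO, fun hyi => ?_⟩
  obtain ⟨η, hη⟩ := exists_thin hG hadj
  obtain ⟨w, hw1, hw2⟩ := mem_closure_iff.1 (segment_subset_closure_half hadj.ne hη.1
    (left_mem_segment ℝ y b)) _ isOpen_interior hyi
  exact ((mem_EdWireExt_iff hG hadj).1 he).1
    ((left_mem_faces_iff hG hadj hη hw2).2 (interior_subset hw1))

lemma mem_O_of_not_wire (hG : G.IsPlanar) {e : Sym2 ℂ} (he : e ∈ G.Ed) (hw : e ∉ G.EdWireExt) :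
    seg e ⊆ G.O := by
  induction e using Sym2.ind with
  | _ a b =>
    have hab : G.graph.Adj a b := he
    rw [mem_EdWireExt_iff hG hab] at hw
    have hsub : ∀ f ∈ G.faces, segment ℝ a b ⊆ frontier f → segment ℝ a b ⊆ G.O := fun f hf h =>
      h.trans (frontier_subset_closure.trans (closure_face_subset_O hf))
    by_cases h1 : G.left a b ∈ G.faces
    · exact hsub _ h1 ((segment_subset_frontier_comp hG hab h1.1).2 (Or.inl rfl))
    · by_cases h2 : G.left b a ∈ G.faces
      · exact hsub _ h2 ((segment_subset_frontier_comp hG hab h2.1).2 (Or.inr rfl))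
      · exact absurd ⟨h1, h2⟩ hw

open Classical in
-- Every wire is a bridge. Assign to it the endpoint that it cuts off from a fixed vertex `b₀` on
-- the frontier. This endpoint is outside `O`: otherwise it would lie on the frontier and be joined
-- to `b₀` by boundary edges, none of which is a wire. The assignment is injective, because a path
-- from `b₀` to a vertex uses every wire assigned to that vertex, but only one edge at its end.
lemma ncard_wire_le (hG : G.IsPlanar) (hc : G.Connected) (hB : SimpleLoop.Bounds n p G.O) :
    G.EdWireExt.ncard ≤ (G.verts.filter fun y => y ∉ G.O).card := by
  obtain ⟨b₀, hb₀, hb₀F⟩ := exists_vertex_frontier hG hB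
  have hex : ∀ e ∈ G.EdWireExt, ∃ y ∈ e, ¬ (G.graph.deleteEdges {e}).Reachable b₀ y := by
    intro e he
    by_contra hcon
    push Not at hcon
    induction e using Sym2.ind with
    | _ a b =>
      exact not_reachable_of_wire hG hc he ((hcon a (Sym2.mem_mk_left _ _)).symm.trans
        (hcon b (Sym2.mem_mk_right _ _)))
  choose! y hy hyr using hex
  have hverts : ∀ e ∈ G.EdWireExt, y e ∈ G.verts := by
    intro e he
    obtain ⟨b, hb⟩ := Sym2.mem_iff_exists.1 (hy e he)
    have : s(y e, b) ∈ G.Ed := hb ▸ he.1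
    exact adj_mem_left this
  have hfin : G.EdWireExt.Finite := G.finite_Ed.subset fun e he => he.1
  rw [← Set.ncard_coe_finset]
  refine Set.ncard_le_ncard_of_injOn y ?_ ?_ (Finset.finite_toSet _)
  · intro e he
    rw [Finset.mem_coe, Finset.mem_filter]
    refine ⟨hverts e he, fun hyO => hyr e he ?_⟩
    have hr := bdGraph_reachable hG hB hb₀ hb₀F (hverts e he) (wire_endpoint hG he (hy e he) hyO)
    refine hr.mono fun a b hab => ?_
    rw [bdGraph_adj] at hab
    rw [SimpleGraph.deleteEdges_adj]
    refine ⟨hab.1, fun h => ?_⟩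
    rw [mem_singleton_iff] at h
    have hadj : G.graph.Adj a b := hab.1
    have h1 := (mem_EdBd_iff hG hadj).1 hab
    have h2 := (mem_EdWireExt_iff hG hadj).1 (h ▸ he)
    tauto
  · intro e he e' he' hee
    obtain ⟨w, hw⟩ := (reachable_of_connected hc hb₀ (hverts e he)).exists_isPath
    have hmem : ∀ d ∈ G.EdWireExt, y d = y e → d ∈ w.edges := by
      intro d hd hde
      by_contra hdw
      refine hyr d hd ?_
      rw [hde]
      exact ⟨w.toDeleteEdges {d} (fun c hc hcd => hdw (by rw [mem_singleton_iff] at hcd; exact hcd ▸ hc))⟩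
    -- A path has only one edge at its first vertex; it is applied to the reversed path.
    have key : ∀ {a b : ℂ} (q : G.graph.Walk a b), q.IsPath → ∀ d ∈ q.edges, ∀ d' ∈ q.edges,
        a ∈ d → a ∈ d' → d = d' := by
      intro a b q hq d hd d' hd' had had'
      cases q with
      | nil => simp at hd
      | cons h q =>
        rw [SimpleGraph.Walk.cons_isPath_iff] at hq
        rw [SimpleGraph.Walk.edges_cons, List.mem_cons] at hd hd'
        have hno : ∀ d ∈ q.edges, a ∉ d := by
          intro d hd had
          obtain ⟨c, rfl⟩ := Sym2.mem_iff_exists.1 had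
          exact hq.2 (q.fst_mem_support_of_mem_edges hd)
        rcases hd with rfl | hd
        · rcases hd' with rfl | hd'
          · rfl
          · exact absurd had' (hno _ hd')
        · exact absurd had (hno _ hd)
    refine key w.reverse hw.reverse e ?_ e' ?_ (hy e he) (by rw [hee]; exact hy e' he')
    · rw [SimpleGraph.Walk.edges_reverse, List.mem_reverse]; exact hmem e he rfl
    · rw [SimpleGraph.Walk.edges_reverse, List.mem_reverse]; exact hmem e' he' hee.symm

/-- The boundary vertices are those on `∂O` together with those outside `O`. -/
lemma mem_bdry_iff (hG : G.IsPlanar) (hc : G.Connected) (hB : SimpleLoop.Bounds n p G.O) {x : ℂ} :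
    x ∈ G.bdry ↔ x ∈ G.verts ∧ (x ∈ frontier G.O ∨ x ∉ G.O) := by
  classical
  unfold bdry
  simp only [Finset.mem_filter]
  refine and_congr_right fun hx => ⟨?_, ?_⟩
  · rintro ⟨y, hy | hy⟩
    · exact Or.inl (hy.2 (left_mem_segment ℝ _ _))
    · by_cases hxO : x ∈ G.O
      · exact Or.inl (wire_endpoint hG hy (Sym2.mem_mk_left _ _) hxO)
      · exact Or.inr hxO
  · rintro (h | h)
    · obtain ⟨b, hb⟩ := exists_mem_EdBd hG hB hx h
      exact ⟨b, Or.inl hb⟩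
    · obtain ⟨b₀, hb₀, hb₀F⟩ := exists_vertex_frontier hG hB
      have hne : x ≠ b₀ := fun e => h (e ▸ (isClosed_O hG).frontier_subset hb₀F)
      obtain ⟨w⟩ := reachable_of_connected hc hx hb₀
      cases w with
      | nil => exact absurd rfl hne
      | @cons _ v _ hadj q =>
        refine ⟨v, Or.inr ?_⟩
        by_contra hw
        exact h (mem_O_of_not_wire hG hadj hw (left_mem_segment ℝ _ _))

lemma innerAngle_eq_angleIn (x : ℂ) : G.innerAngle x = angleIn G.O x := rfl

open Classical in
-- A frontier point that is not a vertex lies inside a boundary edge, which runs through it in both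
-- directions. Its angle is thus `π`, and the vertices on the frontier carry the whole angle sum.
lemma sum_pi_sub_innerAngle (hG : G.IsPlanar) (hB : SimpleLoop.Bounds n p G.O) :
    ∑ x ∈ G.verts.filter (fun x => x ∈ frontier G.O), (Real.pi - G.innerAngle x) = 2 * Real.pi := by
  refine hB.sum_pi_sub_angleIn ?_ fun z hz hzS => ?_
  · intro z hz
    exact (Finset.mem_filter.1 hz).2
  · obtain ⟨u, φ, hs⟩ := hB.exists_isSector hz
    rw [hs.angleIn_eq]
    rcases mem_drawing_iff.1 (frontier_O_subset hG hz) with h | ⟨a, b, hab, h⟩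
    · exact absurd (Finset.mem_filter.2 ⟨h, hz⟩) hzS
    · have he := mem_EdBd_of_mem_openSegment hG hab h hz
      have hsub : openSegment ℝ a b ⊆ frontier G.O := (openSegment_subset_segment ℝ _ _).trans he.2
      rw [openSegment_eq_image'] at h
      obtain ⟨s, ⟨hs0, hs1⟩, rfl⟩ := h
      have hd : b - a ≠ 0 := sub_ne_zero.2 hab.ne.symm
      refine hs.eq_pi hd ?_
      filter_upwards [Ioo_mem_nhdsGT (lt_min hs0 (sub_pos.2 hs1))] with t ht
      have h1 := lt_min_iff.1 ht.2
      have h0 := ht.1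
      constructor <;> apply hsub <;> rw [openSegment_eq_image']
      · refine ⟨s + t, ⟨by linarith, by linarith⟩, ?_⟩
        simp; ring
      · refine ⟨s - t, ⟨by linarith, by linarith⟩, ?_⟩
        simp; ring

end PlaneGraph

end SoftDisc

namespace SoftDisc

open Set Filter Topology

/-! ### Packing of angles -/

/-- Intervals of half-width `h i` around `θ i` do not overlap, and the two extreme ones count only
by their inner halves. The induction removes the topmost point. Equality forces every consecutive
gap to be tight, whence the tight neighbours above and below. -/
lemma packing {ι : Type*} [DecidableEq ι] (S : Finset ι) (θ h : ι → ℝ) {m : ι} (hm : m ∈ S) :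
    ∀ M ∈ S, (∀ i ∈ S, θ m ≤ θ i ∧ θ i ≤ θ M) → Set.InjOn θ S →
    (∀ i ∈ S, ∀ j ∈ S, θ i < θ j → h i + h j ≤ θ j - θ i) →
    ∑ i ∈ S, 2 * h i ≤ θ M - θ m + h m + h M ∧
    (∑ i ∈ S, 2 * h i = θ M - θ m + h m + h M →
      (∀ i ∈ S, i ≠ M → ∃ j ∈ S, θ i < θ j ∧ θ j - θ i = h i + h j) ∧
      (∀ j ∈ S, j ≠ m → ∃ i ∈ S, θ i < θ j ∧ θ j - θ i = h i + h j)) := by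
  induction S using Finset.strongInduction with
  | H S ih =>
    intro M hM hmM hinj hgap
    rcases eq_or_ne m M with rfl | hne
    · have hS : S = {m} := by
        refine Finset.eq_singleton_iff_unique_mem.2 ⟨hm, fun i hi => ?_⟩
        exact hinj hi hm (le_antisymm (hmM i hi).2 (hmM i hi).1)
      subst hS
      refine ⟨by simp; linarith, fun _ => ⟨fun i hi hne => ?_, fun i hi hne => ?_⟩⟩ <;>
        exact absurd (Finset.mem_singleton.1 hi) hne
    · have hmS : m ∈ S.erase M := Finset.mem_erase.2 ⟨hne, hm⟩
      obtain ⟨M', hM', hmax⟩ := Finset.exists_max_image (S.erase M) θ ⟨m, hmS⟩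
      have hM'S := Finset.mem_of_mem_erase hM'
      have hM'ne := Finset.ne_of_mem_erase hM'
      have hlt : θ M' < θ M :=
        lt_of_le_of_ne (hmM M' hM'S).2 fun e => hM'ne (hinj hM'S hM e)
      obtain ⟨h1, h2⟩ := ih (S.erase M) (Finset.erase_ssubset hM) hmS M' hM'
        (fun i hi => ⟨(hmM i (Finset.mem_of_mem_erase hi)).1, hmax i hi⟩)
        (hinj.mono (by exact_mod_cast Finset.erase_subset _ _))
        (fun i hi j hj => hgap i (Finset.mem_of_mem_erase hi) j (Finset.mem_of_mem_erase hj))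
      have h3 := hgap M' hM'S M hM hlt
      have h4 := Finset.sum_erase_add S (fun i => 2 * h i) hM
      refine ⟨by linarith, fun heq => ?_⟩
      obtain ⟨h5, h6⟩ := h2 (by linarith)
      have h7 : θ M - θ M' = h M' + h M := by linarith
      constructor
      · intro i hi hiM
        rcases eq_or_ne i M' with rfl | hiM'
        · exact ⟨M, hM, hlt, h7⟩
        · obtain ⟨j, hj, hj'⟩ := h5 i (Finset.mem_erase.2 ⟨hiM, hi⟩) hiM'
          exact ⟨j, Finset.mem_of_mem_erase hj, hj'⟩
      · intro j hj hjm
        rcases eq_or_ne j M with rfl | hjM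
        · exact ⟨M', hM'S, hlt, h7⟩
        · obtain ⟨i, hi, hi'⟩ := h6 j (Finset.mem_erase.2 ⟨hjM, hj⟩) hjm
          exact ⟨i, Finset.mem_of_mem_erase hi, hi'⟩

/-- The law of cosines, with both directions measured from `u`. -/
lemma dist_sq_eq_ang {u x b c : ℂ} (hu : u ≠ 0) :
    dist b c ^ 2 = dist x b ^ 2 + dist x c ^ 2
      - 2 * dist x b * dist x c * Real.cos (ang u (c - x) - ang u (b - x)) := by
  have hk : 0 < ‖u‖ := norm_pos_iff.2 hu
  have key : ∀ v : ℂ, v = (‖v‖ : ℂ) * ((u / ‖u‖) * Complex.exp ((ang u v : ℂ) * Complex.I)) := by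
    intro v
    conv_lhs => rw [ang_spec hu v]
    have : (‖u‖ : ℂ) ≠ 0 := Complex.ofReal_ne_zero.2 hk.ne'
    rw [norm_div]
    push_cast
    field_simp
  have hE : ‖u / (‖u‖ : ℂ)‖ = 1 := by
    rw [norm_div, Complex.norm_real, norm_norm, div_self hk.ne']
  set E := u / (‖u‖ : ℂ) with hEdef
  set R := ‖b - x‖ with hR
  set S := ‖c - x‖ with hS
  set α := ang u (b - x) with hα
  set β := ang u (c - x) with hβ
  have hb := key (b - x)
  have hc := key (c - x)
  have e1 : b - c = E * (R * Complex.exp ((α : ℂ) * Complex.I) - S * Complex.exp ((β : ℂ) * Complex.I)) := by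
    have : b - c = (b - x) - (c - x) := by ring
    rw [this, hb, hc]; ring
  rw [dist_eq_norm, dist_comm x b, dist_comm x c, dist_eq_norm b x, dist_eq_norm c x, ← hR, ← hS, e1, norm_mul, hE, one_mul,
    ← Complex.normSq_eq_norm_sq, Complex.normSq_apply]
  simp only [Complex.sub_re, Complex.sub_im, Complex.re_ofReal_mul, Complex.im_ofReal_mul,
    Complex.exp_ofReal_mul_I_re, Complex.exp_ofReal_mul_I_im, Real.cos_sub]
  have h1 := Real.sin_sq_add_cos_sq α
  have h2 := Real.sin_sq_add_cos_sq β
  linear_combination R ^ 2 * h1 + S ^ 2 * h2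

namespace PlaneGraph

variable {G : PlaneGraph}

open Classical in
/-- The neighbours of a vertex. -/
noncomputable def nbrs (G : PlaneGraph) (x : ℂ) : Finset ℂ := G.verts.filter fun y => G.graph.Adj x y

lemma mem_nbrs {x y : ℂ} : y ∈ G.nbrs x ↔ G.graph.Adj x y := by
  classical
  unfold nbrs
  simp only [Finset.mem_filter]
  exact ⟨fun h => h.2, fun h => ⟨adj_mem_right h, h⟩⟩

/-- The edges, as a finset. -/
noncomputable def edFinset (G : PlaneGraph) : Finset (Sym2 ℂ) := G.finite_Ed.toFinset

lemma mem_edFinset {e : Sym2 ℂ} : e ∈ G.edFinset ↔ e ∈ G.Ed := Set.Finite.mem_toFinset _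

open Classical in
lemma sum_nbrs (x : ℂ) (P : Sym2 ℂ → Prop) [DecidablePred P] (f : Sym2 ℂ → ℝ) :
    ∑ y ∈ (G.nbrs x).filter (fun y => P s(x, y)), f s(x, y) =
      ∑ e ∈ G.edFinset.filter (fun e => x ∈ e ∧ P e), f e := by
  refine Finset.sum_bij (fun y _ => s(x, y)) ?_ ?_ ?_ ?_
  · intro y hy
    rw [Finset.mem_filter, mem_nbrs] at hy
    exact Finset.mem_filter.2 ⟨mem_edFinset.2 hy.1, Sym2.mem_mk_left _ _, hy.2⟩
  · intro y _ z _ h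
    exact Sym2.congr_right.1 h
  · intro e he
    rw [Finset.mem_filter, mem_edFinset] at he
    obtain ⟨y, rfl⟩ := Sym2.mem_iff_exists.1 he.2.1
    exact ⟨y, Finset.mem_filter.2 ⟨mem_nbrs.2 he.1, he.2.2⟩, rfl⟩
  · intro _ _
    rfl

open Classical in
lemma sum_incidence (S : Finset ℂ) (P : Sym2 ℂ → Prop) [DecidablePred P] (f : Sym2 ℂ → ℝ) :
    ∑ x ∈ S, ∑ e ∈ G.edFinset.filter (fun e => x ∈ e ∧ P e), f e =
      ∑ e ∈ G.edFinset.filter P, ((S.filter fun x => x ∈ e).card : ℝ) * f e := by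
  have h1 : ∀ x ∈ S, ∑ e ∈ G.edFinset.filter (fun e => x ∈ e ∧ P e), f e =
      ∑ e ∈ G.edFinset.filter P, if x ∈ e then f e else 0 := by
    intro x _
    rw [← Finset.sum_filter, Finset.filter_filter]
    congr 1
    ext e
    simp only [Finset.mem_filter, and_comm (a := x ∈ e)]
  rw [Finset.sum_congr rfl h1, Finset.sum_comm]
  refine Finset.sum_congr rfl fun e _ => ?_
  rw [← Finset.sum_filter, Finset.sum_const, nsmul_eq_mul]

open Classical in
lemma sum_nbrs_all (x : ℂ) (f : Sym2 ℂ → ℝ) : ∑ y ∈ G.nbrs x, f s(x, y) =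
    ∑ e ∈ G.edFinset.filter (fun e => x ∈ e), f e := by
  simpa using G.sum_nbrs x (fun _ => True) f

open Classical in
lemma sum_incidence_all (S : Finset ℂ) (f : Sym2 ℂ → ℝ) :
    ∑ x ∈ S, ∑ e ∈ G.edFinset.filter (fun e => x ∈ e), f e =
      ∑ e ∈ G.edFinset, ((S.filter fun x => x ∈ e).card : ℝ) * f e := by
  simpa using G.sum_incidence S (fun _ => True) f

open Classical in
lemma card_filter_mem {S : Finset ℂ} {a b : ℂ} (hab : G.graph.Adj a b) (ha : a ∈ S) (hb : b ∈ S) :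
    (S.filter fun x => x ∈ s(a, b)).card = 2 := by
  have : (S.filter fun x => x ∈ s(a, b)) = {a, b} := by
    ext x
    rw [Finset.mem_filter, Sym2.mem_iff, Finset.mem_insert, Finset.mem_singleton]
    constructor
    · exact fun h => h.2
    · rintro (rfl | rfl)
      · exact ⟨ha, Or.inl rfl⟩
      · exact ⟨hb, Or.inr rfl⟩
  rw [this, Finset.card_pair hab.ne]

end PlaneGraph

/-! ### Bonds -/

/-- The binding energy of a bond, without its sign. -/
noncomputable def binding (δ : ℝ) (e : Sym2 ℂ) : ℝ := 1 - (len e - 1) / δ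

variable {δ : ℝ} {X : Finset ℂ}

lemma binding_nonneg (hδ₀ : 0 < δ) {e : Sym2 ℂ} (he : e ∈ (bondGraph δ X).Ed) : 0 ≤ binding δ e := by
  induction e using Sym2.ind with
  | _ a b =>
    obtain ⟨-, -, -, -, h⟩ := he
    rw [binding, len_mk, sub_nonneg, div_le_one hδ₀]
    linarith

lemma binding_le_one (hδ₀ : 0 < δ) {e : Sym2 ℂ} (he : e ∈ (bondGraph δ X).Ed) : binding δ e ≤ 1 := by
  induction e using Sym2.ind with
  | _ a b =>
    obtain ⟨-, -, -, h, -⟩ := he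
    rw [binding, len_mk, sub_le_self_iff]
    exact div_nonneg (by linarith) hδ₀.le

lemma one_add_V_toReal {r : ℝ} (h1 : 1 < r) (h2 : r ≤ 1 + δ) : (1 + V δ r).toReal = (r - 1) / δ := by
  have h : V δ r = ((-1 + (r - 1) / δ : ℝ) : EReal) := by
    unfold V
    rw [if_neg (not_lt.2 h1.le), if_pos h2]
  rw [h, ← EReal.coe_one, ← EReal.coe_add, EReal.toReal_coe]
  ring

/-- Each bond occurs as two ordered pairs, which the factor `1/2` compensates. Unit bonds, excluded
by `1 < dist x y`, would contribute `0`. -/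
lemma elastic_eq : elastic δ X = ∑ e ∈ (bondGraph δ X).edFinset, (1 - binding δ e) := by
  classical
  set G := bondGraph δ X with hG
  have h1 : ∀ x ∈ X, ∑ y ∈ X.filter (fun y => 1 < dist x y ∧ dist x y ≤ 1 + δ),
      (1 + V δ (dist x y)).toReal = ∑ e ∈ G.edFinset.filter (fun e => x ∈ e), (1 - binding δ e) := by
    intro x hx
    rw [← PlaneGraph.sum_nbrs_all x (fun e => 1 - binding δ e)]
    have h2 : ∀ y ∈ X.filter (fun y => 1 < dist x y ∧ dist x y ≤ 1 + δ),
        (1 + V δ (dist x y)).toReal = 1 - binding δ s(x, y) := by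
      intro y hy
      obtain ⟨-, h1, h2⟩ := Finset.mem_filter.1 hy
      rw [one_add_V_toReal h1 h2, binding, len_mk]; ring
    rw [Finset.sum_congr rfl h2]
    refine Finset.sum_subset ?_ ?_
    · intro y hy
      obtain ⟨hy, h1, h2⟩ := Finset.mem_filter.1 hy
      refine PlaneGraph.mem_nbrs.2 ⟨hx, hy, ?_, h1.le, h2⟩
      rintro rfl
      rw [dist_self] at h1; linarith
    · intro y hy hy'
      obtain ⟨-, hyX, -, h1, h2⟩ := PlaneGraph.mem_nbrs.1 hy
      rcases eq_or_lt_of_le h1 with h | h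
      · rw [binding, len_mk, ← h]; simp
      · exact absurd (Finset.mem_filter.2 ⟨hyX, h, h2⟩) hy'
  have h2 : elastic δ X = (1 / 2) * ∑ x ∈ X, ∑ y ∈ X.filter (fun y => 1 < dist x y ∧ dist x y ≤ 1 + δ),
    (1 + V δ (dist x y)).toReal := by
    unfold elastic
    congr!
  rw [h2, Finset.sum_congr rfl h1, PlaneGraph.sum_incidence_all, Finset.mul_sum]
  refine Finset.sum_congr rfl fun e he => ?_
  rw [PlaneGraph.mem_edFinset] at he
  induction e using Sym2.ind with
  | _ a b =>
    have he' : G.graph.Adj a b := he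
    rw [PlaneGraph.card_filter_mem he' he'.1 he'.2.1]
    push_cast
    ring

/-- The count `3 ♯X - ♯Ed` charges each bond `1`, and the elastic term gives back `1 - binding`. -/
lemma shape_eq (hδ : δ < 2 / 5) (hX : Separated X) :
    shape δ X = 3 * X.card - ∑ e ∈ (bondGraph δ X).edFinset, binding δ e := by
  have h := PlaneGraph.per_add_defect_add_chi (bondGraph_isPlanar hδ hX)
  have h' : ((bondGraph δ X).per : ℝ) + (bondGraph δ X).defect + 3 * (bondGraph δ X).chi =
      3 * X.card - (bondGraph δ X).Ed.ncard := by exact_mod_cast h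
  have hcard : ((bondGraph δ X).Ed.ncard : ℝ) = ∑ e ∈ (bondGraph δ X).edFinset, (1 : ℝ) := by
    rw [Set.ncard_eq_toFinset_card _ (bondGraph δ X).finite_Ed]
    simp [PlaneGraph.edFinset]
  unfold shape
  rw [elastic_eq, h', hcard, Finset.sum_sub_distrib]
  ring

open Classical in
lemma edFinset_mono {X' : Finset ℂ} (h : X' ⊆ X) : (bondGraph δ X').edFinset =
    (bondGraph δ X).edFinset.filter fun e => ∀ x ∈ e, x ∈ X' := by
  ext e
  rw [Finset.mem_filter, PlaneGraph.mem_edFinset, PlaneGraph.mem_edFinset]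
  induction e using Sym2.ind with
  | _ a b =>
    simp only [PlaneGraph.mk_mem_Ed, bondGraph_adj, Sym2.ball]
    constructor
    · rintro ⟨h1, h2, h3⟩
      exact ⟨⟨h h1, h h2, h3⟩, h1, h2⟩
    · rintro ⟨⟨-, -, h3⟩, h1, h2⟩
      exact ⟨h1, h2, h3⟩

open Classical in
/-- Removing points from a configuration. -/
lemma shape_sub_shape (hδ : δ < 2 / 5) (hX : Separated X) {B : Finset ℂ} (hB : B ⊆ X) :
    shape δ X - shape δ (X \ B) = 3 * B.card -
      ∑ e ∈ (bondGraph δ X).edFinset.filter (fun e => ∃ x ∈ e, x ∈ B), binding δ e := by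
  rw [shape_eq hδ hX, shape_eq hδ (hX.mono Finset.sdiff_subset), edFinset_mono Finset.sdiff_subset,
    ← Finset.sum_filter_add_sum_filter_not (bondGraph δ X).edFinset (fun e => ∃ x ∈ e, x ∈ B)]
  have h1 : ((X \ B).card : ℝ) = X.card - B.card := by
    rw [Finset.card_sdiff_of_subset hB, Nat.cast_sub (Finset.card_le_card hB)]
  have h2 : (bondGraph δ X).edFinset.filter (fun e => ∀ x ∈ e, x ∈ X \ B) =
      (bondGraph δ X).edFinset.filter (fun e => ¬ ∃ x ∈ e, x ∈ B) := by
    refine Finset.filter_congr fun e he => ?_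
    rw [PlaneGraph.mem_edFinset] at he
    push Not
    refine forall₂_congr fun x hx => ?_
    rw [Finset.mem_sdiff]
    refine ⟨fun h => h.2, fun h => ⟨?_, h⟩⟩
    obtain ⟨b, rfl⟩ := Sym2.mem_iff_exists.1 hx
    exact PlaneGraph.adj_mem_left (G := bondGraph δ X) he
  rw [h1, h2]
  ring

end SoftDisc

/-! ### The estimate for the bonds at the boundary -/

namespace SoftDisc

open Set Filter Topology

variable {δ : ℝ} {X : Finset ℂ}

/-- With excess lengths `s = 1 - b` and `t = 1 - b'` in units of `δ`, this is `gap_rigid`. A gap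
that is at most the bound is exactly `π/3` between unit bonds, so a smaller one is impossible. -/
lemma bond_gap (hδ₀ : 0 < δ) (hδ : δ < 2 / 5) (hX : Separated X) {x u b c : ℂ} (hu : u ≠ 0)
    (hb : (bondGraph δ X).graph.Adj x b) (hc : (bondGraph δ X).graph.Adj x c)
    (hlt : ang u (b - x) < ang u (c - x)) :
    Real.pi / 6 * binding δ s(x, b) + Real.pi / 6 * binding δ s(x, c) ≤
      ang u (c - x) - ang u (b - x) ∧
    (ang u (c - x) - ang u (b - x) =
      Real.pi / 6 * binding δ s(x, b) + Real.pi / 6 * binding δ s(x, c) →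
      dist x b = 1 ∧ dist x c = 1 ∧ ang u (c - x) - ang u (b - x) = Real.pi / 3) := by
  have hbc : b ≠ c := by rintro rfl; exact lt_irrefl _ hlt
  have hd := hX b hb.2.1 c hc.2.1 hbc
  have hrep : ∀ y, dist x y = 1 + δ * ((dist x y - 1) / δ) := by
    intro y; field_simp; ring
  have hw : ∀ y, (bondGraph δ X).graph.Adj x y → 0 ≤ (dist x y - 1) / δ ∧ (dist x y - 1) / δ ≤ 1 := by
    rintro y ⟨-, -, -, h1, h2⟩
    exact ⟨div_nonneg (by linarith) hδ₀.le, by rw [div_le_one hδ₀]; linarith⟩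
  have hcos := dist_sq_eq_ang (x := x) (b := b) (c := c) hu
  have h1 : 1 ≤ (1 + δ * ((dist x b - 1) / δ)) ^ 2 + (1 + δ * ((dist x c - 1) / δ)) ^ 2 -
      2 * (1 + δ * ((dist x b - 1) / δ)) * (1 + δ * ((dist x c - 1) / δ)) *
        Real.cos (ang u (c - x) - ang u (b - x)) := by
    rw [← hrep b, ← hrep c, ← hcos]
    exact one_le_pow₀ hd
  have key := gap_rigid hδ₀ hδ (hw b hb).1 (hw b hb).2 (hw c hc).1 (hw c hc).2 (sub_pos.2 hlt) h1
  have hone : ∀ y, (dist x y - 1) / δ = 0 → dist x y = 1 := by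
    intro y hy
    rw [hrep y, hy]; ring
  simp only [binding, len_mk]
  constructor
  · by_contra hcon
    push Not at hcon
    obtain ⟨e1, e2, e3⟩ := key hcon.le
    rw [e1, e2, e3] at hcon
    linarith
  · intro h
    obtain ⟨e1, e2, e3⟩ := key h.le
    exact ⟨hone b e1, hone c e2, e3⟩

/-- The bonds at `x` that point into `O` are unit bonds with mutual angles `π / 3`. -/
structure Rigid (G : PlaneGraph) (x u : ℂ) (φ : ℝ) : Prop where
  len : ∀ b, G.graph.Adj x b → ang u (b - x) ≤ φ → dist x b = 1
  succ : ∀ b, G.graph.Adj x b → ang u (b - x) < φ →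
    ∃ c, G.graph.Adj x c ∧ ang u (c - x) = ang u (b - x) + Real.pi / 3 ∧ ang u (c - x) ≤ φ
  pred : ∀ b, G.graph.Adj x b → 0 < ang u (b - x) → ang u (b - x) ≤ φ →
    ∃ c, G.graph.Adj x c ∧ ang u (b - x) = ang u (c - x) + Real.pi / 3
  angle : φ = (((G.nbrs x).filter fun b => ang u (b - x) ≤ φ).card - 1) * (Real.pi / 3)

open Classical in
-- The non-wire bonds at `x` are those with angle at most `φ`, and the boundary bonds are exactly
-- the two at angles `0` and `φ`. The estimate is the packing of these bonds into an angle `φ`.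
lemma vertex_bound (hδ₀ : 0 < δ) (hδ : δ < 2 / 5) (hX : Separated X) {x u : ℂ} {φ : ℝ} (hx : x ∈ X)
    (hs : IsSector (bondGraph δ X).O x u φ) :
    ∑ e ∈ (bondGraph δ X).edFinset.filter (fun e => x ∈ e ∧ e ∉ (bondGraph δ X).EdWireExt), binding δ e -
      1 / 2 * ∑ e ∈ (bondGraph δ X).edFinset.filter (fun e => x ∈ e ∧ e ∈ (bondGraph δ X).EdBd), binding δ e
      ≤ 3 * φ / Real.pi ∧
    (∑ e ∈ (bondGraph δ X).edFinset.filter (fun e => x ∈ e ∧ e ∉ (bondGraph δ X).EdWireExt), binding δ e -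
      1 / 2 * ∑ e ∈ (bondGraph δ X).edFinset.filter (fun e => x ∈ e ∧ e ∈ (bondGraph δ X).EdBd), binding δ e
      = 3 * φ / Real.pi → Rigid (bondGraph δ X) x u φ) := by
  set G := bondGraph δ X with hGdef
  have hG : G.IsPlanar := bondGraph_isPlanar hδ hX
  have hpi := Real.pi_pos
  have hφ := hs.pos
  obtain ⟨m, hm, hm0⟩ := PlaneGraph.exists_adj_of_frontier hG hx hs (Or.inl rfl)
  obtain ⟨M, hM, hMφ⟩ := PlaneGraph.exists_adj_of_frontier hG hx hs (Or.inr rfl)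
  have hmM : m ≠ M := by rintro rfl; linarith
  set N := (G.nbrs x).filter fun b => ang u (b - x) ≤ φ with hN
  have memN : ∀ b, b ∈ N ↔ G.graph.Adj x b ∧ ang u (b - x) ≤ φ := fun b => by
    rw [hN, Finset.mem_filter, PlaneGraph.mem_nbrs]
  have hmN : m ∈ N := (memN m).2 ⟨hm, by rw [hm0]; exact hφ.le⟩
  have hMN : M ∈ N := (memN M).2 ⟨hM, hMφ.le⟩
  have hA : ∑ e ∈ G.edFinset.filter (fun e => x ∈ e ∧ e ∉ G.EdWireExt), binding δ e =
      ∑ b ∈ N, binding δ s(x, b) := by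
    rw [← PlaneGraph.sum_nbrs x (fun e => e ∉ G.EdWireExt)]
    refine Finset.sum_congr ?_ fun _ _ => rfl
    rw [hN]
    refine Finset.filter_congr fun b hb => ?_
    rw [PlaneGraph.mem_EdWireExt_iff_ang hG hs (PlaneGraph.mem_nbrs.1 hb), not_lt]
  have hD : ∑ e ∈ G.edFinset.filter (fun e => x ∈ e ∧ e ∈ G.EdBd), binding δ e =
      binding δ s(x, m) + binding δ s(x, M) := by
    rw [← PlaneGraph.sum_nbrs x (fun e => e ∈ G.EdBd), ← Finset.sum_pair (f := fun b => binding δ s(x, b)) hmM]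
    refine Finset.sum_congr ?_ fun _ _ => rfl
    ext b
    rw [Finset.mem_filter, PlaneGraph.mem_nbrs, Finset.mem_insert, Finset.mem_singleton]
    constructor
    · rintro ⟨h1, h2⟩
      rcases (PlaneGraph.mem_EdBd_iff_ang hG hs h1).1 h2 with h | h
      · exact Or.inl (PlaneGraph.eq_of_ang_eq hG hs.ne h1 hm (h.trans hm0.symm))
      · exact Or.inr (PlaneGraph.eq_of_ang_eq hG hs.ne h1 hM (h.trans hMφ.symm))
    · rintro (rfl | rfl)
      · exact ⟨hm, (PlaneGraph.mem_EdBd_iff_ang hG hs hm).2 (Or.inl hm0)⟩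
      · exact ⟨hM, (PlaneGraph.mem_EdBd_iff_ang hG hs hM).2 (Or.inr hMφ)⟩
  -- Every bond claims `π/6` times its binding on either side. The extreme bonds claim only the
  -- inner side, whence the weight `1/2` of boundary bonds.
  obtain ⟨hle, heq⟩ := packing N (fun b => ang u (b - x)) (fun b => Real.pi / 6 * binding δ s(x, b)) hmN M hMN
    (fun b hb => ⟨by rw [hm0]; exact ang_nonneg _ _, by rw [hMφ]; exact ((memN b).1 hb).2⟩)
    (fun b hb c hc h => PlaneGraph.eq_of_ang_eq hG hs.ne ((memN b).1 hb).1 ((memN c).1 hc).1 h)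
    (fun b hb c hc h => (bond_gap hδ₀ hδ hX hs.ne ((memN b).1 hb).1 ((memN c).1 hc).1 h).1)
  have hsum : ∑ b ∈ N, 2 * (Real.pi / 6 * binding δ s(x, b)) = Real.pi / 3 * ∑ b ∈ N, binding δ s(x, b) := by
    rw [Finset.mul_sum]
    refine Finset.sum_congr rfl fun b _ => by ring
  rw [hsum] at hle heq
  simp only [hm0, hMφ] at hle heq
  rw [hA, hD]
  have hequiv : 3 * φ / Real.pi = (Real.pi / 3)⁻¹ * φ := by field_simp
  have hp3 : 0 < Real.pi / 3 := by positivity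
  refine ⟨?_, fun h => ?_⟩
  · rw [hequiv, ← div_eq_inv_mul, le_div_iff₀ hp3]
    linarith
  · rw [hequiv, ← div_eq_inv_mul, eq_div_iff hp3.ne'] at h
    obtain ⟨hsucc, hpred⟩ := heq (by linarith)
    have hlen : ∀ b, G.graph.Adj x b → ang u (b - x) ≤ φ → dist x b = 1 := by
      intro b hb hbφ
      have hbN := (memN b).2 ⟨hb, hbφ⟩
      rcases eq_or_ne b M with rfl | hbM
      · obtain ⟨c, hc, hlt, he⟩ := hpred b hbN hmM.symm
        exact ((bond_gap hδ₀ hδ hX hs.ne ((memN c).1 hc).1 hb hlt).2 he).2.1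
      · obtain ⟨c, hc, hlt, he⟩ := hsucc b hbN hbM
        exact ((bond_gap hδ₀ hδ hX hs.ne hb ((memN c).1 hc).1 hlt).2 he).1
    refine ⟨hlen, ?_, ?_, ?_⟩
    · intro b hb hbφ
      obtain ⟨c, hc, hlt, he⟩ := hsucc b ((memN b).2 ⟨hb, hbφ.le⟩) (by rintro rfl; linarith)
      have := ((bond_gap hδ₀ hδ hX hs.ne hb ((memN c).1 hc).1 hlt).2 he).2.2
      exact ⟨c, ((memN c).1 hc).1, by linarith, ((memN c).1 hc).2⟩
    · intro b hb hb0 hbφ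
      obtain ⟨c, hc, hlt, he⟩ := hpred b ((memN b).2 ⟨hb, hbφ⟩) (by rintro rfl; linarith)
      have := ((bond_gap hδ₀ hδ hX hs.ne ((memN c).1 hc).1 hb hlt).2 he).2.2
      exact ⟨c, ((memN c).1 hc).1, by linarith⟩
    · have hone : ∀ b ∈ N, binding δ s(x, b) = 1 := by
        intro b hb
        rw [binding, len_mk, hlen b ((memN b).1 hb).1 ((memN b).1 hb).2]; simp
      rw [Finset.sum_congr rfl hone, hone m hmN, hone M hMN] at h
      have hNc : (((G.nbrs x).filter fun b => ang u (b - x) ≤ φ).card : ℝ) = ∑ b ∈ N, (1 : ℝ) := by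
        rw [Finset.sum_const, nsmul_eq_mul, mul_one]
      rw [hNc]
      linarith

open Classical in
-- `∂X` consists of the set `B` of vertices on the frontier of `O` and the set `Y` of those outside
-- `O`. Non-wire bonds are charged to `B` through the angle sum, wires to `Y` through the bridge
-- count.
lemma touching_bound (hδ₀ : 0 < δ) (hδ : δ < 2 / 5) (hX : Separated X)
    (hc : (bondGraph δ X).Connected) {n : ℕ} {p : ℤ → ℂ} (hB : SimpleLoop.Bounds n p (bondGraph δ X).O) :
    ∑ e ∈ (bondGraph δ X).edFinset.filter (fun e => ∃ x ∈ e, x ∈ (bondGraph δ X).bdry), binding δ e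
      ≤ 3 * (bondGraph δ X).bdry.card - 6 ∧
    (∑ e ∈ (bondGraph δ X).edFinset.filter (fun e => ∃ x ∈ e, x ∈ (bondGraph δ X).bdry), binding δ e
      = 3 * (bondGraph δ X).bdry.card - 6 →
      (∀ e, e ∉ (bondGraph δ X).EdWireExt) ∧ (∀ x ∈ X, x ∈ (bondGraph δ X).O) ∧
      ∀ x ∈ X, ∀ u φ, IsSector (bondGraph δ X).O x u φ → x ∈ frontier (bondGraph δ X).O →
        Rigid (bondGraph δ X) x u φ) := by
  set G := bondGraph δ X with hGdef
  have hG : G.IsPlanar := bondGraph_isPlanar hδ hX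
  have hpi := Real.pi_pos
  set B := X.filter fun x => x ∈ frontier G.O with hBdef
  set Y := X.filter fun x => x ∉ G.O with hYdef
  have hcard : G.bdry.card = B.card + Y.card := by
    rw [← Finset.card_union_of_disjoint]
    · congr 1
      ext x
      rw [PlaneGraph.mem_bdry_iff hG hc hB, Finset.mem_union, Finset.mem_filter, Finset.mem_filter,
        ← and_or_left]
      rfl
    · rw [Finset.disjoint_left]
      intro x hx hx'
      exact (Finset.mem_filter.1 hx').2 ((PlaneGraph.isClosed_O hG).frontier_subset (Finset.mem_filter.1 hx).2)
  set A : ℂ → ℝ := fun x => ∑ e ∈ G.edFinset.filter (fun e => x ∈ e ∧ e ∉ G.EdWireExt), binding δ e -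
      1 / 2 * ∑ e ∈ G.edFinset.filter (fun e => x ∈ e ∧ e ∈ G.EdBd), binding δ e with hAdef
  have hAle : ∀ x ∈ B, A x ≤ 3 * G.innerAngle x / Real.pi := by
    intro x hx
    obtain ⟨hxX, hxF⟩ := Finset.mem_filter.1 hx
    obtain ⟨u, φ, hs⟩ := hB.exists_isSector hxF
    rw [PlaneGraph.innerAngle_eq_angleIn, hs.angleIn_eq]
    exact (vertex_bound hδ₀ hδ hX hxX hs).1
  have hang : ∑ x ∈ B, 3 * G.innerAngle x / Real.pi = 3 * B.card - 6 := by
    have h := PlaneGraph.sum_pi_sub_innerAngle hG hB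
    have h' : ∑ x ∈ B, (Real.pi - G.innerAngle x) = 2 * Real.pi := by rw [← h]; congr!
    rw [Finset.sum_sub_distrib, Finset.sum_const, nsmul_eq_mul] at h'
    have h2 : ∑ x ∈ B, 3 * G.innerAngle x / Real.pi = 3 / Real.pi * ∑ x ∈ B, G.innerAngle x := by
      rw [Finset.mul_sum]
      exact Finset.sum_congr rfl fun x _ => by ring
    have h3 : ∑ x ∈ B, G.innerAngle x = B.card * Real.pi - 2 * Real.pi := by linarith
    rw [h2, h3]
    field_simp
    ring
  have hwire : ∑ e ∈ G.edFinset.filter (fun e => e ∈ G.EdWireExt), binding δ e ≤ Y.card := by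
    have h1 : ∑ e ∈ G.edFinset.filter (fun e => e ∈ G.EdWireExt), binding δ e ≤
        ∑ e ∈ G.edFinset.filter (fun e => e ∈ G.EdWireExt), 1 :=
      Finset.sum_le_sum fun e he => binding_le_one hδ₀ (PlaneGraph.mem_edFinset.1 (Finset.mem_filter.1 he).1)
    rw [Finset.sum_const, nsmul_eq_mul, mul_one] at h1
    refine h1.trans ?_
    have h2 : (G.edFinset.filter (fun e => e ∈ G.EdWireExt)).card = G.EdWireExt.ncard := by
      rw [← Set.ncard_coe_finset]
      congr 1
      ext e
      rw [Finset.mem_coe, Finset.mem_filter, PlaneGraph.mem_edFinset]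
      exact ⟨fun h => h.2, fun h => ⟨h.1, h⟩⟩
    rw [h2]
    have h3 := PlaneGraph.ncard_wire_le hG hc hB
    have h4 : (G.verts.filter fun y => y ∉ G.O).card = Y.card := by congr!
    rw [h4] at h3
    exact_mod_cast h3
  -- A boundary edge has both ends in `B` and is counted `2 - 2 · (1/2) = 1` times. Any other
  -- non-wire edge touching `∂X` has at least one end in `B`.
  have hnonwire : ∑ e ∈ G.edFinset.filter (fun e => (∃ x ∈ e, x ∈ G.bdry) ∧ e ∉ G.EdWireExt), binding δ e ≤
      ∑ x ∈ B, A x := by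
    rw [hAdef, Finset.sum_sub_distrib, ← Finset.mul_sum,
      PlaneGraph.sum_incidence B (fun e => e ∉ G.EdWireExt), PlaneGraph.sum_incidence B (fun e => e ∈ G.EdBd)]
    have e1 : G.edFinset.filter (fun e => (∃ x ∈ e, x ∈ G.bdry) ∧ e ∉ G.EdWireExt) =
        (G.edFinset.filter fun e => e ∉ G.EdWireExt).filter (fun e => ∃ x ∈ e, x ∈ G.bdry) := by
      rw [Finset.filter_filter]
      refine Finset.filter_congr fun e _ => and_comm
    have e2 : G.edFinset.filter (fun e => e ∈ G.EdBd) =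
        (G.edFinset.filter fun e => e ∉ G.EdWireExt).filter (fun e => e ∈ G.EdBd) := by
      rw [Finset.filter_filter]
      refine Finset.filter_congr fun e he => ⟨fun h => ⟨fun hw => ?_, h⟩, fun h => h.2⟩
      induction e using Sym2.ind with
      | _ a b =>
        have h1 := (PlaneGraph.mem_EdBd_iff hG h.1).1 h
        have h2 := (PlaneGraph.mem_EdWireExt_iff hG h.1).1 hw
        tauto
    rw [e1, e2]
    have hD : ∀ e ∈ G.edFinset.filter (fun e => e ∉ G.EdWireExt), e ∈ G.Ed ∧ e ∉ G.EdWireExt := fun e he =>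
      ⟨PlaneGraph.mem_edFinset.1 (Finset.mem_filter.1 he).1, (Finset.mem_filter.1 he).2⟩
    generalize G.edFinset.filter (fun e => e ∉ G.EdWireExt) = D at hD ⊢
    rw [Finset.sum_filter, Finset.sum_filter, Finset.mul_sum, ← Finset.sum_sub_distrib]
    refine Finset.sum_le_sum fun e he => ?_
    obtain ⟨heE, hew⟩ := hD e he
    have hg := binding_nonneg hδ₀ heE
    have hsub := PlaneGraph.mem_O_of_not_wire hG heE hew
    induction e using Sym2.ind with
    | _ a b =>
      have hab : G.graph.Adj a b := heE
      by_cases hbd : s(a, b) ∈ G.EdBd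
      · have hcard2 : (B.filter fun x => x ∈ s(a, b)).card = 2 :=
          PlaneGraph.card_filter_mem hab (Finset.mem_filter.2 ⟨hab.1, hbd.2 (left_mem_segment ℝ _ _)⟩)
            (Finset.mem_filter.2 ⟨hab.2.1, hbd.2 (right_mem_segment ℝ _ _)⟩)
        rw [hcard2, if_pos hbd]
        push_cast
        split_ifs <;> linarith
      · rw [if_neg hbd, mul_zero, sub_zero]
        split_ifs with ht
        · obtain ⟨x, hxe, hxb⟩ := ht
          have hxX := (PlaneGraph.mem_bdry_iff hG hc hB).1 hxb
          have hxO : x ∈ G.O := by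
            rcases Sym2.mem_iff.1 hxe with rfl | rfl
            · exact hsub (left_mem_segment ℝ _ _)
            · exact hsub (right_mem_segment ℝ _ _)
          have hxB : x ∈ B := Finset.mem_filter.2 ⟨hxX.1, hxX.2.resolve_right (not_not.2 hxO)⟩
          have h1 : 1 ≤ (B.filter fun x => x ∈ s(a, b)).card :=
            Finset.card_pos.2 ⟨x, Finset.mem_filter.2 ⟨hxB, hxe⟩⟩
          have h1' : (1 : ℝ) ≤ (B.filter fun x => x ∈ s(a, b)).card := by exact_mod_cast h1
          nlinarith
        · positivity
  have hsplit : ∑ e ∈ G.edFinset.filter (fun e => ∃ x ∈ e, x ∈ G.bdry), binding δ e ≤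
      ∑ e ∈ G.edFinset.filter (fun e => (∃ x ∈ e, x ∈ G.bdry) ∧ e ∉ G.EdWireExt), binding δ e +
      ∑ e ∈ G.edFinset.filter (fun e => e ∈ G.EdWireExt), binding δ e := by
    rw [← Finset.sum_filter_add_sum_filter_not (G.edFinset.filter (fun e => ∃ x ∈ e, x ∈ G.bdry))
      (fun e => e ∉ G.EdWireExt), Finset.filter_filter]
    refine add_le_add le_rfl ?_
    refine Finset.sum_le_sum_of_subset_of_nonneg ?_ fun e he _ =>
      binding_nonneg hδ₀ (PlaneGraph.mem_edFinset.1 (Finset.mem_filter.1 he).1)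
    intro e he
    obtain ⟨h1, h2⟩ := Finset.mem_filter.1 he
    exact Finset.mem_filter.2 ⟨(Finset.mem_filter.1 h1).1, not_not.1 h2⟩
  have hAsum : ∑ x ∈ B, A x ≤ 3 * B.card - 6 := by rw [← hang]; exact Finset.sum_le_sum hAle
  have hcard' : (G.bdry.card : ℝ) = B.card + Y.card := by exact_mod_cast hcard
  have hYnn : (0 : ℝ) ≤ Y.card := by positivity
  -- The sum is at most `3 ♯B - 6 + ♯Y`, which is `2 ♯Y` below the claim. Equality therefore forces
  -- `Y = ∅`, and then equality at each vertex of `B`.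
  refine ⟨by rw [hcard']; linarith, fun heq => ?_⟩
  rw [hcard'] at heq
  have hY0 : (Y.card : ℝ) = 0 := by linarith
  have hY : Y = ∅ := Finset.card_eq_zero.1 (by exact_mod_cast hY0)
  refine ⟨fun e he => ?_, fun x hx => ?_, fun x hx u φ hs hxF => ?_⟩
  · have h3 := PlaneGraph.ncard_wire_le hG hc hB
    have h4 : (G.verts.filter fun y => y ∉ G.O).card = Y.card := by congr!
    rw [h4, hY, Finset.card_empty, Nat.le_zero,
      Set.ncard_eq_zero (G.finite_Ed.subset fun e he => he.1)] at h3
    rw [h3] at he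
    exact he
  · by_contra hxO
    have : x ∈ Y := Finset.mem_filter.2 ⟨hx, hxO⟩
    rw [hY] at this
    exact absurd this (Finset.notMem_empty x)
  · refine (vertex_bound hδ₀ hδ hX hx hs).2 ?_
    have h5 : ∑ x ∈ B, A x = ∑ x ∈ B, 3 * G.innerAngle x / Real.pi := by rw [hang]; linarith
    have h6 := (Finset.sum_eq_sum_iff_of_le hAle).1 h5 x (Finset.mem_filter.2 ⟨hx, hxF⟩)
    rw [PlaneGraph.innerAngle_eq_angleIn, hs.angleIn_eq] at h6
    exact h6

end SoftDisc

namespace SoftDisc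

open Set Filter Topology

/-! ### Equilateral triangles -/

/-- The third vertex of the equilateral triangle on the left of `[a, b]`. -/
noncomputable def apex (a b : ℂ) : ℂ := a + ⟨1 / 2, √3 / 2⟩ * (b - a)

/-- The closed equilateral triangle on the left of `[a, b]`. -/
def closedTriangle (a b : ℂ) : Set ℂ :=
  {z | 0 ≤ (coord a b z).im ∧ (coord a b z).im ≤ √3 * (coord a b z).re ∧
    (coord a b z).im ≤ √3 * (1 - (coord a b z).re)}

lemma sqrt_three_sq : √3 * √3 = (3 : ℝ) := Real.mul_self_sqrt (by norm_num)

lemma sixth_root_sq : (⟨1 / 2, √3 / 2⟩ : ℂ) * ⟨1 / 2, √3 / 2⟩ = ⟨1 / 2, √3 / 2⟩ - 1 := by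
  have h := sqrt_three_sq
  apply Complex.ext <;> simp
  · linear_combination (-1 / 4) * h
  · ring

lemma apex_apex (a b : ℂ) : apex b (apex a b) = a := by
  unfold apex
  linear_combination (b - a) * sixth_root_sq

lemma apex_ne {a b : ℂ} (hab : a ≠ b) : apex a b ≠ b := by
  intro h
  have h1 : ((⟨1 / 2, √3 / 2⟩ : ℂ) - 1) * (b - a) = 0 := by
    unfold apex at h
    linear_combination h
  rcases mul_eq_zero.1 h1 with h2 | h2
  · have := congrArg Complex.re h2
    norm_num at this
  · exact hab (sub_eq_zero.1 h2).symm

lemma coord_apex {a b : ℂ} (hab : a ≠ b) (z : ℂ) :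
    coord b (apex a b) z = (coord a b z - 1) * ⟨-1 / 2, -√3 / 2⟩ := by
  have hd : b - a ≠ 0 := sub_ne_zero.2 hab.symm
  have hne : apex a b - b ≠ 0 := sub_ne_zero.2 (apex_ne hab)
  have hinv : (((⟨1 / 2, √3 / 2⟩ : ℂ) - 1)) * ⟨-1 / 2, -√3 / 2⟩ = 1 := by
    have h := sqrt_three_sq
    apply Complex.ext <;> simp
    · linear_combination (1 / 4) * h
    · ring
  unfold coord
  rw [div_eq_iff hne]
  have e : apex a b - b = ((⟨1 / 2, √3 / 2⟩ : ℂ) - 1) * (b - a) := by unfold apex; ring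
  rw [e]
  have hq : (z - a) / (b - a) * (b - a) = z - a := div_mul_cancel₀ _ hd
  linear_combination (-((z - a) / (b - a) - 1) * (b - a)) * hinv - hq

lemma coord_apex_re {a b : ℂ} (hab : a ≠ b) (z : ℂ) : (coord b (apex a b) z).re =
    (1 - (coord a b z).re) / 2 + √3 / 2 * (coord a b z).im := by
  rw [coord_apex hab]; simp; ring

lemma coord_apex_im {a b : ℂ} (hab : a ≠ b) (z : ℂ) : (coord b (apex a b) z).im =
    √3 / 2 * (1 - (coord a b z).re) - (coord a b z).im / 2 := by
  rw [coord_apex hab]; simp; ring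

/-- For slope `√3` the half rhombus is the open equilateral triangle on `[a, b]`, and it does not
matter which side is taken as base. -/
lemma half_apex {a b : ℂ} (hab : a ≠ b) : half b (apex a b) √3 = half a b √3 := by
  have h := sqrt_three_sq
  ext z
  simp only [half, mem_ofPred_eq]
  rw [coord_apex_re hab, coord_apex_im hab]
  set p := (coord a b z).re
  set q := (coord a b z).im
  have e1 : √3 * ((1 - p) / 2 + √3 / 2 * q) = √3 / 2 * (1 - p) + 3 / 2 * q := by
    linear_combination (q / 2) * h
  have e2 : √3 * (1 - ((1 - p) / 2 + √3 / 2 * q)) = √3 - √3 / 2 * (1 - p) - 3 / 2 * q := by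
    linear_combination (-q / 2) * h
  rw [e1, e2]
  constructor <;> rintro ⟨h1, h2, h3⟩ <;> refine ⟨?_, ?_, ?_⟩ <;> linarith

lemma closedTriangle_apex {a b : ℂ} (hab : a ≠ b) :
    closedTriangle b (apex a b) = closedTriangle a b := by
  have h := sqrt_three_sq
  ext z
  simp only [closedTriangle, mem_ofPred_eq]
  rw [coord_apex_re hab, coord_apex_im hab]
  set p := (coord a b z).re
  set q := (coord a b z).im
  have e1 : √3 * ((1 - p) / 2 + √3 / 2 * q) = √3 / 2 * (1 - p) + 3 / 2 * q := by
    linear_combination (q / 2) * h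
  have e2 : √3 * (1 - ((1 - p) / 2 + √3 / 2 * q)) = √3 - √3 / 2 * (1 - p) - 3 / 2 * q := by
    linear_combination (-q / 2) * h
  rw [e1, e2]
  constructor <;> rintro ⟨h1, h2, h3⟩ <;> refine ⟨?_, ?_, ?_⟩ <;> linarith

lemma half_disjoint_segment {a b : ℂ} (hab : a ≠ b) (η : ℝ) : Disjoint (half a b η) (segment ℝ a b) := by
  rw [Set.disjoint_left]
  intro z hz hz'
  obtain ⟨t, -, -, rfl⟩ := mem_segment_iff.1 hz'
  have h1 := hz.1
  have : coord a b (a + t * (b - a)) = t := by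
    unfold coord
    have hd : b - a ≠ 0 := sub_ne_zero.2 hab.symm
    rw [add_sub_cancel_left, mul_div_cancel_right₀ _ hd]
  rw [this] at h1
  simp at h1

lemma mem_segment_of_mem_closedTriangle {a b z : ℂ} (hab : a ≠ b) (hz : z ∈ closedTriangle a b)
    (h : (coord a b z).im = 0) : z ∈ segment ℝ a b := by
  obtain ⟨h1, h2, h3⟩ := hz
  rw [h] at h2 h3
  have h4 : 0 < √3 := by positivity
  refine mem_segment_iff.2 ⟨(coord a b z).re, ?_, ?_, ?_⟩
  · exact nonneg_of_mul_nonneg_right h2 h4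
  · linarith [nonneg_of_mul_nonneg_right h3 h4]
  · conv_lhs => rw [eq_of_coord hab z]
    congr 2
    apply Complex.ext <;> simp [h]

lemma frontier_half_subset {a b : ℂ} (hab : a ≠ b) : frontier (half a b √3) ⊆
    segment ℝ a b ∪ (segment ℝ b (apex a b) ∪ segment ℝ (apex a b) a) := by
  have hcl : closure (half a b √3) ⊆ closedTriangle a b := by
    refine closure_minimal (fun z hz => ⟨hz.1.le, hz.2.1.le, hz.2.2.le⟩) ?_
    have hc := continuous_coord a b
    have hre := Complex.continuous_re.comp hc
    have him := Complex.continuous_im.comp hc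
    exact (isClosed_le continuous_const him).inter
      ((isClosed_le him (continuous_const.mul hre)).inter
        (isClosed_le him (continuous_const.mul (continuous_const.sub hre))))
  intro z hz
  have hzc := hcl hz.1
  have hzn : z ∉ half a b √3 := by
    have := hz.2
    rwa [(isOpen_half a b √3).interior_eq] at this
  have hbc := (apex_ne hab).symm
  have h3 := sqrt_three_sq
  by_cases e1 : (coord a b z).im = 0
  · exact Or.inl (mem_segment_of_mem_closedTriangle hab hzc e1)
  · by_cases e2 : (coord b (apex a b) z).im = 0
    · exact Or.inr (Or.inl (mem_segment_of_mem_closedTriangle hbc (by rwa [closedTriangle_apex hab]) e2))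
    · right; right
      have hca : apex a b ≠ a := by
        have := apex_ne hbc
        rw [apex_apex] at this
        exact this.symm
      have hzc' : z ∈ closedTriangle (apex a b) a := by
        have := closedTriangle_apex hbc
        rw [apex_apex] at this
        rwa [this, closedTriangle_apex hab]
      refine mem_segment_of_mem_closedTriangle hca hzc' ?_
      by_contra e3
      refine hzn ⟨lt_of_le_of_ne hzc.1 (Ne.symm e1), lt_of_le_of_ne hzc.2.1 fun e => e3 ?_,
        lt_of_le_of_ne hzc.2.2 fun e => e2 ?_⟩
      · have := coord_apex_im hbc z
        rw [apex_apex] at this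
        rw [this, coord_apex_re hab, coord_apex_im hab, e]
        linear_combination (-(coord a b z).re * √3 / 4 ) * h3
      · rw [coord_apex_im hab, e]; ring

lemma dist_lt_of_mem_half {a b z : ℂ} (hab : a ≠ b) (hz : z ∈ half a b √3) : dist a z < dist a b := by
  obtain ⟨h1, h2, h3⟩ := hz
  have hd : 0 < dist a b := dist_pos.2 hab
  have e : dist a z = ‖coord a b z‖ * dist a b := by
    rw [coord, norm_div, dist_comm a z, dist_comm a b, dist_eq_norm, dist_eq_norm,
      div_mul_cancel₀ _ (norm_ne_zero_iff.2 (sub_ne_zero.2 hab.symm))]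
  rw [e]
  have hs := sqrt_three_sq
  have hpos : 0 < √3 := by positivity
  set p := (coord a b z).re with hp
  set q := (coord a b z).im with hq
  have hp0 : 0 < p := pos_of_mul_pos_right (h1.trans h2) hpos.le
  have hp1 : 0 < 1 - p := pos_of_mul_pos_right (h1.trans h3) hpos.le
  have q1 : q * q < 3 * (p * p) := by
    have := mul_lt_mul'' h2 h2 h1.le h1.le
    nlinarith
  have q2 : q * q < 3 * ((1 - p) * (1 - p)) := by
    have := mul_lt_mul'' h3 h3 h1.le h1.le
    nlinarith
  have hlt : ‖coord a b z‖ ^ 2 < 1 := by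
    rw [← Complex.normSq_eq_norm_sq, Complex.normSq_apply, ← hp, ← hq]
    nlinarith
  have : ‖coord a b z‖ < 1 := by
    by_contra hcon
    push Not at hcon
    have := one_le_pow₀ hcon (n := 2)
    linarith
  nlinarith

/-- Both vectors have norm `1`, and rotation by `π/3` is multiplication by the sixth root of unity
in `apex`. -/
lemma eq_apex {x u b c : ℂ} (hu : u ≠ 0) (hb : dist x b = 1) (hc : dist x c = 1)
    (h : ang u (c - x) = ang u (b - x) + Real.pi / 3) : c = apex x b := by
  have h1 := ang_spec hu (b - x)
  have h2 := ang_spec hu (c - x)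
  rw [norm_div] at h1 h2
  rw [dist_comm, dist_eq_norm] at hb hc
  rw [hb] at h1
  rw [hc, h] at h2
  have hω : Complex.exp (((Real.pi / 3 : ℝ) : ℂ) * Complex.I) = ⟨1 / 2, √3 / 2⟩ := by
    apply Complex.ext
    · rw [Complex.exp_ofReal_mul_I_re, Real.cos_pi_div_three]
    · rw [Complex.exp_ofReal_mul_I_im, Real.sin_pi_div_three]
  rw [Complex.ofReal_add, add_mul, Complex.exp_add, hω] at h2
  unfold apex
  rw [← sub_eq_iff_eq_add', h2]
  conv_rhs => rw [h1]
  ring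

namespace PlaneGraph

variable {G : PlaneGraph}

/-- An edge of a triangle is not a bridge, as the other two edges join its ends. -/
lemma left_ne_of_triangle (hG : G.IsPlanar) {a b c : ℂ} (hab : G.graph.Adj a b) (hbc : G.graph.Adj b c)
    (hca : G.graph.Adj c a) : G.left a b ≠ G.left b a := by
  intro h
  refine not_reachable_of_left_eq hG hab h ?_
  have h1 : (G.graph.deleteEdges {s(a, b)}).Adj a c := by
    rw [SimpleGraph.deleteEdges_adj]
    refine ⟨hca.symm, fun e => ?_⟩
    rw [mem_singleton_iff, Sym2.congr_right] at e
    exact hbc.ne e.symm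
  have h2 : (G.graph.deleteEdges {s(a, b)}).Adj c b := by
    rw [SimpleGraph.deleteEdges_adj]
    refine ⟨hbc.symm, fun e => ?_⟩
    rw [mem_singleton_iff, Sym2.congr_left] at e
    exact hca.ne e
  exact h1.reachable.trans h2.reachable

/-- The components at a vertex are the sides of the edges at that vertex. -/
lemma eq_left_of_mem_closure (hG : G.IsPlanar) {x : ℂ} (hx : x ∈ G.verts) (hdeg : ∃ b, G.graph.Adj x b)
    {f : Set ℂ} (hf : f ∈ G.comps) (hxf : x ∈ closure f) : ∃ b, G.graph.Adj x b ∧ f = G.left b x := by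
  obtain ⟨ε, hε, hball⟩ := Metric.eventually_nhds_iff.1 (eventually_drawing hG hx)
  obtain ⟨b₀, hb₀⟩ := hdeg
  have hne : (G.nbrs x).Nonempty := ⟨b₀, mem_nbrs.2 hb₀⟩
  obtain ⟨b₁, hb₁, hmin₁⟩ := Finset.exists_min_image (G.nbrs x) (fun b => dist b x) hne
  have hd₁ : 0 < dist b₁ x := dist_pos.2 (mem_nbrs.1 hb₁).ne.symm
  set r := min ε (dist b₁ x) with hr
  have hrpos : 0 < r := lt_min hε hd₁
  obtain ⟨y, hyf, hyr⟩ := Metric.mem_closure_iff.1 hxf r hrpos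
  have hyx : y ≠ x := by
    rintro rfl
    exact comps_subset hf hyf (Or.inl hx)
  -- Directions are measured from a point `y` of `f` close to `x`. The sector from `y` up to the
  -- first bond counterclockwise is free of the drawing, so it lies in `f` and reaches the near side
  -- of that bond.
  set u := y - x with hudef
  have hu : u ≠ 0 := sub_ne_zero.2 hyx
  have hun : ‖u‖ < r := by rwa [dist_comm, dist_eq_norm] at hyr
  have hle : ∀ b, G.graph.Adj x b → ∀ w : ℂ, ‖w‖ < r → ‖w‖ ≤ ‖b - x‖ := by
    intro b hb w hw
    have := hmin₁ b (mem_nbrs.2 hb)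
    rw [dist_eq_norm b x] at this
    exact hw.le.trans ((min_le_right _ _).trans this)
  have hstar : ∀ w : ℂ, w ≠ 0 → ‖w‖ < r → x + w ∈ G.drawing → ∃ b, G.graph.Adj x b ∧ ang u w = ang u (b - x) := by
    intro w hw hwr hD
    rcases hball (by rw [dist_eq_norm, add_sub_cancel_left]; exact hwr.trans_le (min_le_left _ _)) hD with h | h
    · exact absurd (by simpa using h) hw
    · obtain ⟨b, hb, hwb⟩ := h
      have hv : b - x ≠ 0 := sub_ne_zero.2 hb.ne.symm
      refine ⟨b, hb, (add_mem_segment_iff (z := x) hu hv hw (hle b hb w hwr)).1 ?_⟩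
      rwa [add_sub_cancel]
  obtain ⟨b, hb, hmin⟩ := Finset.exists_min_image (G.nbrs x) (fun b => ang u (b - x)) hne
  have hb := mem_nbrs.1 hb
  have hv : b - x ≠ 0 := sub_ne_zero.2 hb.ne.symm
  have hpos : 0 < ang u (b - x) := by
    refine lt_of_le_of_ne (ang_nonneg _ _) fun h => ?_
    have := (add_mem_segment_iff (z := x) (w := u) hu hv hu (hle b hb u hun)).2 (by rw [ang_self hu]; exact h)
    rw [add_sub_cancel, hudef, add_sub_cancel] at this
    exact comps_subset hf hyf (segment_subset_drawing hb this)
  have hsecD : sector x u r 0 (ang u (b - x)) ⊆ G.drawingᶜ := by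
    rintro z ⟨h1, h2, h3, h4⟩ hzD
    obtain ⟨c, hc, hca⟩ := hstar (z - x) (sub_ne_zero.2 h1) h2 (by rwa [add_sub_cancel])
    have := hmin c (mem_nbrs.2 hc)
    linarith
  have hmeet : (sector x u r 0 (ang u (b - x)) ∩ f).Nonempty := by
    have hcont : Tendsto (fun t : ℝ => x + Complex.exp ((t : ℂ) * Complex.I) * u) (𝓝[>] 0) (𝓝 y) := by
      have : Tendsto (fun t : ℝ => x + Complex.exp ((t : ℂ) * Complex.I) * u) (𝓝 0)
          (𝓝 (x + Complex.exp (((0 : ℝ) : ℂ) * Complex.I) * u)) := Continuous.tendsto (by fun_prop) _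
      simp only [Complex.ofReal_zero, zero_mul, Complex.exp_zero, one_mul, hudef, add_sub_cancel] at this
      exact this.mono_left nhdsWithin_le_nhds
    obtain ⟨t, ht, ht0, ht1⟩ := ((hcont.eventually ((comps_isOpen hf).mem_nhds hyf)).and
      (Ioo_mem_nhdsGT hpos)).exists
    have hang : ang u (Complex.exp ((t : ℂ) * Complex.I) * u) = t := by
      have := ang_eq hu one_pos ht0.le (ht1.trans (ang_lt _ _))
      rwa [Complex.ofReal_one, one_mul, mul_comm u] at this
    refine ⟨_, ⟨?_, ?_, ?_, ?_⟩, ht⟩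
    · intro h; rw [add_eq_left] at h; exact mul_ne_zero (Complex.exp_ne_zero _) hu h
    · rw [add_sub_cancel_left, norm_mul, Complex.norm_exp_ofReal_mul_I, one_mul]; exact hun
    · rw [add_sub_cancel_left, hang]; exact ht0
    · rw [add_sub_cancel_left, hang]; exact ht1
  have hsub := comps_maximal hf (isPreconnected_sector hu x r le_rfl (ang_lt _ _).le) hsecD hmeet
  obtain ⟨η, hη⟩ := exists_thin hG hb.symm
  obtain ⟨z, hz, hz'⟩ := exists_half_sector_rev (z := x) hu hv hrpos hη.1 hpos hpos
  rw [add_sub_cancel] at hz'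
  exact ⟨b, hb, eq_left_of_inter_half hG hb.symm hη hf ⟨z, hsub hz, hz'⟩⟩

lemma eq_left_of_mem_openSegment (hG : G.IsPlanar) {a b z : ℂ} (hab : G.graph.Adj a b)
    (hz : z ∈ openSegment ℝ a b) {f : Set ℂ} (hf : f ∈ G.comps) (hzf : z ∈ closure f) :
    f = G.left a b ∨ f = G.left b a := by
  have := (openSegment_closure_sUnion hG hab (F := {f}) (by simpa using hf) hz).1
  rw [sUnion_singleton] at this
  simpa [eq_comm] using this.1 hzf

section Triangle

variable {a b : ℂ}

/-- An empty equilateral triangle of edges bounds a face. -/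
lemma half_mem_comps (hG : G.IsPlanar) (hab : G.graph.Adj a b) (hbc : G.graph.Adj b (apex a b))
    (hca : G.graph.Adj (apex a b) a) (hempty : Disjoint (half a b √3) G.verts) :
    half a b √3 ∈ G.comps := by
  have hsides : ∀ z ∈ frontier (half a b √3), ∃ e ∈ ({s(a, b), s(b, apex a b), s(apex a b, a)} : Set (Sym2 ℂ)),
      z ∈ seg e := by
    intro z hz
    rcases frontier_half_subset hab.ne hz with h | h | h
    · exact ⟨s(a, b), by simp, h⟩
    · exact ⟨s(b, apex a b), by simp, h⟩
    · exact ⟨s(apex a b, a), by simp, h⟩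
  have hEd : ∀ e ∈ ({s(a, b), s(b, apex a b), s(apex a b, a)} : Set (Sym2 ℂ)), e ∈ G.Ed := by
    rintro e (rfl | rfl | rfl)
    exacts [hab, hbc, hca]
  have hdisj : ∀ e ∈ ({s(a, b), s(b, apex a b), s(apex a b, a)} : Set (Sym2 ℂ)),
      Disjoint (half a b √3) (seg e) := by
    rintro e (rfl | rfl | rfl)
    · exact half_disjoint_segment hab.ne _
    · rw [← half_apex hab.ne]; exact half_disjoint_segment hbc.ne _
    · have := half_apex hbc.ne
      rw [apex_apex] at this
      rw [← half_apex hab.ne, ← this]; exact half_disjoint_segment hca.ne _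
  have hpos : 0 < √3 := by positivity
  refine comp_eq_of_open_preconnected (SoftDisc.half_nonempty hab.ne hpos)
    (convex_half _ _ _).isPreconnected ?_ ?_
  · intro z hz hzD
    rcases mem_drawing_iff.1 hzD with h | ⟨c, d, hcd, h⟩
    · exact Set.disjoint_left.1 hempty hz h
    · have hexit : ∀ c d : ℂ, G.graph.Adj c d → z ∈ openSegment ℝ c d →
          ∃ e ∈ ({s(a, b), s(b, apex a b), s(apex a b, a)} : Set (Sym2 ℂ)), c ∈ e := by
        intro c d hcd h
        have hcn : c ∉ half a b √3 := fun hc => Set.disjoint_left.1 hempty hc (adj_mem_left hcd)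
        obtain ⟨w, hw, hwF⟩ : ∃ w ∈ segment ℝ z c, w ∈ frontier (half a b √3) := by
          by_contra hcon
          push Not at hcon
          have := IsPreconnected.subset_of_disjoint_frontier (convex_segment z c).isPreconnected
            (Set.disjoint_left.2 hcon) ⟨z, left_mem_segment ℝ _ _, hz⟩
          exact hcn (this (right_mem_segment ℝ _ _))
        obtain ⟨e, he, hwe⟩ := hsides w hwF
        have hne : s(c, d) ≠ e := fun hce => Set.disjoint_left.1 (hdisj e he) hz
          (hce ▸ openSegment_subset_segment ℝ _ _ h)
        have hzs := openSegment_subset_segment ℝ _ _ h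
        have hwcd : w ∈ segment ℝ c d :=
          (convex_segment c d).segment_subset hzs (left_mem_segment ℝ _ _) hw
        have := hG.inter _ hcd _ (hEd e he) hne w hwcd hwe
        rcases Sym2.mem_iff.1 this.1 with rfl | rfl
        · exact ⟨e, he, this.2⟩
        · exfalso
          obtain ⟨t, ht0, ht1, ht⟩ := mem_segment_iff.1 hw
          rw [openSegment_eq_image'] at h
          obtain ⟨s, ⟨hs0, hs1⟩, rfl⟩ := h
          have hz2 : (c + s • (w - c)) = c + s * (w - c) := by simp
          simp only [hz2] at ht
          have : ((1 : ℂ) - s * (1 - t)) * (w - c) = 0 := by linear_combination ht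
          rcases mul_eq_zero.1 this with h1 | h1
          · have h1' : (1 : ℝ) - s * (1 - t) = 0 := by exact_mod_cast h1
            nlinarith
          · exact hcd.ne (sub_eq_zero.1 h1).symm
      have hmem : ∀ c, (∃ e ∈ ({s(a, b), s(b, apex a b), s(apex a b, a)} : Set (Sym2 ℂ)), c ∈ e) →
          c = a ∨ c = b ∨ c = apex a b := by
        rintro c ⟨e, (rfl | rfl | rfl), hc⟩ <;> rw [Sym2.mem_iff] at hc <;> tauto
      have h1 := hmem c (hexit c d hcd h)
      have h2 := hmem d (hexit d c hcd.symm (by rwa [openSegment_symm]))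
      have he : s(c, d) ∈ ({s(a, b), s(b, apex a b), s(apex a b, a)} : Set (Sym2 ℂ)) := by
        have := hcd.ne
        simp only [mem_insert_iff, mem_singleton_iff]
        rcases h1 with rfl | rfl | rfl <;> rcases h2 with rfl | rfl | rfl <;>
          first
          | exact absurd rfl this
          | exact Or.inl rfl
          | exact Or.inl Sym2.eq_swap
          | exact Or.inr (Or.inl rfl)
          | exact Or.inr (Or.inl Sym2.eq_swap)
          | exact Or.inr (Or.inr rfl)
          | exact Or.inr (Or.inr Sym2.eq_swap)
      exact Set.disjoint_left.1 (hdisj _ he) hz (openSegment_subset_segment ℝ _ _ h)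
  · intro z hz
    obtain ⟨e, he, hze⟩ := hsides z hz
    exact Or.inr (mem_biUnion (t := seg) (hEd e he) hze)

lemma left_eq_half (hG : G.IsPlanar) (hab : G.graph.Adj a b) (hT : half a b √3 ∈ G.comps) :
    G.left a b = half a b √3 := by
  obtain ⟨η, hη⟩ := exists_thin hG hab
  have hpos : 0 < √3 := by positivity
  have hm := lt_min hη.1 hpos
  obtain ⟨z, hz⟩ := SoftDisc.half_nonempty hab.ne hm
  exact (eq_left_of_inter_half hG hab hη hT ⟨z, half_mono hm (min_le_right _ _) hz,
    half_mono hm (min_le_left _ _) hz⟩).symm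

/-- All three sides have the triangle on their left and another component on their right. Each
counts once, and no other edge lies on the frontier. -/
lemma facePer_triangle (hG : G.IsPlanar) (hab : G.graph.Adj a b) (hbc : G.graph.Adj b (apex a b))
    (hca : G.graph.Adj (apex a b) a) (hempty : Disjoint (half a b √3) G.verts) :
    G.left b (apex a b) = G.left a b ∧ G.left (apex a b) a = G.left a b ∧
      G.facePer (G.left a b) = 3 := by
  have hT := half_mem_comps hG hab hbc hca hempty
  have e1 := left_eq_half hG hab hT
  have hh := half_apex hbc.ne
  rw [apex_apex] at hh
  have e2 : G.left b (apex a b) = half a b √3 := by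
    rw [left_eq_half hG hbc (by rwa [half_apex hab.ne]), half_apex hab.ne]
  have e3 : G.left (apex a b) a = half a b √3 := by
    rw [left_eq_half hG hca (by rwa [hh, half_apex hab.ne]), hh, half_apex hab.ne]
  refine ⟨e2.trans e1.symm, e3.trans e1.symm, ?_⟩
  rw [e1]
  set T := half a b √3 with hTdef
  have n1 := left_ne_of_triangle hG hab hbc hca
  have n2 := left_ne_of_triangle hG hbc hca hab
  have n3 := left_ne_of_triangle hG hca hab hbc
  have honly : ∀ c d, G.graph.Adj c d → (T = G.left c d ∨ T = G.left d c) →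
      s(c, d) ∈ ({s(a, b), s(b, apex a b), s(apex a b, a)} : Set (Sym2 ℂ)) := by
    intro c d hcd h
    have hsub := (segment_subset_frontier_comp hG hcd hT).2 h
    have hm : midpoint ℝ c d ∈ openSegment ℝ c d := by
      rw [openSegment_eq_image']
      refine ⟨1 / 2, by norm_num, ?_⟩
      simp [midpoint, AffineMap.lineMap_apply]
      ring
    have hms := openSegment_subset_segment ℝ _ _ hm
    have hnot : ∀ e ∈ G.Ed, midpoint ℝ c d ∈ seg e → s(c, d) = e := by
      intro e he hme
      by_contra hne
      have := (hG.inter _ hcd _ he hne _ hms hme).1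
      rcases Sym2.mem_iff.1 this with h' | h'
      · rw [h'] at hm; exact hcd.ne (left_mem_openSegment_iff.1 hm)
      · rw [h'] at hm; exact hcd.ne (right_mem_openSegment_iff.1 hm)
    simp only [mem_insert_iff, mem_singleton_iff]
    rcases frontier_half_subset hab.ne (hsub hms) with h' | h' | h'
    · exact Or.inl (hnot _ hab h')
    · exact Or.inr (Or.inl (hnot _ hbc h'))
    · exact Or.inr (Or.inr (hnot _ hca h'))
  have hbd : G.faceEdBd T = {s(a, b), s(b, apex a b), s(apex a b, a)} := by
    ext e
    constructor
    · intro he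
      induction e using Sym2.ind with
      | _ c d => exact honly c d he.1 ((mem_faceEdBd_iff hG he.1 hT).1 he).1
    · rintro (rfl | rfl | rfl)
      · rw [mem_faceEdBd_iff hG hab hT]
        exact ⟨Or.inl e1.symm, fun h => n1 (h.1.symm.trans h.2)⟩
      · rw [mem_faceEdBd_iff hG hbc hT]
        exact ⟨Or.inl e2.symm, fun h => n2 (h.1.symm.trans h.2)⟩
      · rw [mem_faceEdBd_iff hG hca hT]
        exact ⟨Or.inl e3.symm, fun h => n3 (h.1.symm.trans h.2)⟩
  have hwi : G.faceEdWireInt T = ∅ := by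
    rw [Set.eq_empty_iff_forall_notMem]
    intro e he
    have hmem : e ∈ ({s(a, b), s(b, apex a b), s(apex a b, a)} : Set (Sym2 ℂ)) := by
      induction e using Sym2.ind with
      | _ c d => exact honly c d he.1 (Or.inl ((mem_faceEdWireInt_iff hG he.1 hT).1 he).1)
    rw [← hbd] at hmem
    exact he.2.2 hmem.2
  have hcard : ({s(a, b), s(b, apex a b), s(apex a b, a)} : Set (Sym2 ℂ)).ncard = 3 := by
    rw [Set.ncard_eq_three]
    refine ⟨_, _, _, ?_, ?_, ?_, rfl⟩
    · intro h
      rw [Sym2.eq_swap (a := a), Sym2.congr_right] at h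
      exact hca.ne h.symm
    · intro h
      rw [Sym2.eq_swap (a := apex a b), Sym2.congr_right] at h
      exact hbc.ne h
    · intro h
      rw [Sym2.eq_swap (a := apex a b), Sym2.congr_left] at h
      exact hab.ne h.symm
  unfold facePer
  rw [hbd, hwi, hcard, Set.ncard_empty]

end Triangle

end PlaneGraph

end SoftDisc

/-! ### Rigid boundary vertices -/

namespace SoftDisc

open Set Filter Topology

variable {δ : ℝ} {X : Finset ℂ}

lemma unit_bond (hδ₀ : 0 < δ) {x u b c : ℂ} (hu : u ≠ 0)
    (hb : (bondGraph δ X).graph.Adj x b) (hc : (bondGraph δ X).graph.Adj x c) (hb1 : dist x b = 1)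
    (hc1 : dist x c = 1) (h : ang u (c - x) = ang u (b - x) + Real.pi / 3) :
    (bondGraph δ X).graph.Adj b c := by
  have hd := dist_sq_eq_ang (x := x) (b := b) (c := c) hu
  rw [hb1, hc1, h, add_sub_cancel_left, Real.cos_pi_div_three] at hd
  have h1 : dist b c = 1 := by
    have h0 : (0 : ℝ) ≤ dist b c := dist_nonneg
    nlinarith
  refine ⟨hb.2.1, hc.2.1, ?_, by rw [h1], by rw [h1]; linarith⟩
  rintro rfl
  rw [dist_self] at h1
  norm_num at h1

/-- The preceding bond encloses `π/3` with this one and both have length `1`, so their ends are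
bonded too and the face between them is an equilateral triangle. -/
lemma Rigid.facePer_left (hδ₀ : 0 < δ) (hδ : δ < 2 / 5) (hX : Separated X) {x u b : ℂ} {φ : ℝ}
    (hr : Rigid (bondGraph δ X) x u φ) (hu : u ≠ 0) (hb : (bondGraph δ X).graph.Adj x b)
    (h0 : 0 < ang u (b - x)) (hφ : ang u (b - x) ≤ φ) :
    (bondGraph δ X).facePer ((bondGraph δ X).left b x) = 3 := by
  have hG := bondGraph_isPlanar hδ hX
  obtain ⟨c, hc, hcb⟩ := hr.pred b hb h0 hφ
  have hb1 := hr.len b hb hφ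
  have hc1 := hr.len c hc (by linarith [Real.pi_pos])
  have hbc := unit_bond hδ₀ hu hc hb hc1 hb1 hcb
  have hap := eq_apex hu hc1 hb1 hcb
  -- Points of the open unit triangle have distance less than `1` from `x`, and `x` itself is not
  -- among them.
  have hempty : Disjoint (half x c √3) (bondGraph δ X).verts := by
    rw [Set.disjoint_left]
    intro v hv hvX
    have h1 := dist_lt_of_mem_half hc.ne hv
    rw [hc1] at h1
    have h2 : x = v := by
      by_contra hne
      exact absurd (hX x hb.1 v hvX hne) (not_le.2 h1)
    exact Set.disjoint_left.1 (half_disjoint_segment hc.ne _) hv (h2 ▸ left_mem_segment ℝ _ _)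
  obtain ⟨-, h1, h2⟩ := PlaneGraph.facePer_triangle hG hc (hap ▸ hbc) (hap ▸ hb.symm) hempty
  rw [← hap] at h1
  rw [h1, h2]

/-- A face at a rigid vertex lies on the clockwise side of one of its bonds, so its perimeter is
`3`. -/
lemma Rigid.notMem_closure (hδ₀ : 0 < δ) (hδ : δ < 2 / 5) (hX : Separated X) {x u : ℂ} {φ : ℝ}
    (hr : Rigid (bondGraph δ X) x u φ) (hx : x ∈ X) (hs : IsSector (bondGraph δ X).O x u φ)
    {f : Set ℂ} (hf : f ∈ (bondGraph δ X).faces) (hf3 : (bondGraph δ X).facePer f ≠ 3) :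
    x ∉ closure f := by
  have hG := bondGraph_isPlanar hδ hX
  intro hxf
  obtain ⟨m, hm, -⟩ := PlaneGraph.exists_adj_of_frontier hG hx hs (Or.inl rfl)
  obtain ⟨b, hb, rfl⟩ := PlaneGraph.eq_left_of_mem_closure hG hx ⟨m, hm⟩ hf.1 hxf
  obtain ⟨h0, h1⟩ := (PlaneGraph.left_mem_faces_iff_ang_pos hG hs hb).1 hf
  exact hf3 (hr.facePer_left hδ₀ hδ hX hs.ne hb h0 h1)

open Classical in
-- A bond strictly inside the sector has faces on both sides. They are distinct because rigidity
-- makes the bond an edge of a triangle, so the bond is interior.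
lemma Rigid.card_eq (hδ₀ : 0 < δ) (hδ : δ < 2 / 5) (hX : Separated X) {x u : ℂ} {φ : ℝ}
    (hr : Rigid (bondGraph δ X) x u φ) (hs : IsSector (bondGraph δ X).O x u φ) :
    (((bondGraph δ X).nbrs x).filter fun b => ang u (b - x) ≤ φ).card =
      ((bondGraph δ X).IInner x).ncard + ((bondGraph δ X).IBdry x).ncard := by
  have hG := bondGraph_isPlanar hδ hX
  set G := bondGraph δ X with hGdef
  have hφ := hs.pos
  have hfin : ∀ S : Set (Sym2 ℂ), S ⊆ G.Ed → S.Finite := fun S hS => G.finite_Ed.subset hS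
  have hdisj : Disjoint (G.IInner x) (G.IBdry x) := by
    rw [Set.disjoint_left]
    rintro e ⟨he, -⟩ ⟨he', -⟩
    induction e using Sym2.ind with
    | _ a b =>
      have h1 := (PlaneGraph.mem_EdInt_iff hG he.1).1 he
      have h2 := (PlaneGraph.mem_EdBd_iff hG he.1).1 he'
      exact h2.2 ⟨h1.1, h1.2.1⟩
  rw [← Set.ncard_union_eq hdisj (hfin _ fun e he => he.1.1) (hfin _ fun e he => he.1.1)]
  have himg : G.IInner x ∪ G.IBdry x =
      (((((G.nbrs x).filter fun b => ang u (b - x) ≤ φ).image fun b => s(x, b)) : Finset (Sym2 ℂ)) : Set (Sym2 ℂ)) := by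
    ext e
    simp only [Finset.coe_image, Finset.coe_filter, PlaneGraph.mem_nbrs, mem_image, mem_ofPred_eq]
    constructor
    · intro he
      have hxe : x ∈ e := he.elim (fun h => h.2) (fun h => h.2)
      obtain ⟨b, rfl⟩ := Sym2.mem_iff_exists.1 hxe
      rcases he with ⟨he, -⟩ | ⟨he, -⟩
      · have hb : G.graph.Adj x b := he.1
        have h1 := (PlaneGraph.mem_EdInt_iff hG hb).1 he
        exact ⟨b, ⟨hb, ((PlaneGraph.left_mem_faces_iff_ang_lt hG hs hb).1 h1.1).le⟩, rfl⟩
      · have hb : G.graph.Adj x b := he.1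
        refine ⟨b, ⟨hb, ?_⟩, rfl⟩
        rcases (PlaneGraph.mem_EdBd_iff_ang hG hs hb).1 he with h | h <;> rw [h]
        exact hφ.le
    · rintro ⟨b, ⟨hb, hbφ⟩, rfl⟩
      by_cases hbd : s(x, b) ∈ G.EdBd
      · exact Or.inr ⟨hbd, Sym2.mem_mk_left _ _⟩
      · left
        rw [PlaneGraph.mem_EdBd_iff_ang hG hs hb, not_or] at hbd
        have h0 : 0 < ang u (b - x) := lt_of_le_of_ne (ang_nonneg _ _) (Ne.symm hbd.1)
        have hlt : ang u (b - x) < φ := lt_of_le_of_ne hbφ hbd.2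
        refine ⟨(PlaneGraph.mem_EdInt_iff hG hb).2
          ⟨(PlaneGraph.left_mem_faces_iff_ang_lt hG hs hb).2 hlt,
            (PlaneGraph.left_mem_faces_iff_ang_pos hG hs hb).2 ⟨h0, hbφ⟩, ?_⟩, Sym2.mem_mk_left _ _⟩
        obtain ⟨c, hc, hcb, hcφ⟩ := hr.succ b hb hlt
        have hbc := unit_bond hδ₀ hs.ne hb hc (hr.len b hb hbφ) (hr.len c hc hcφ) hcb
        exact PlaneGraph.left_ne_of_triangle hG hb hbc hc.symm
  rw [himg, Set.ncard_coe_finset, Finset.card_image_of_injective _ fun b c h => Sym2.congr_right.1 h]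

/-! ### Removing the boundary layer -/

lemma bondGraph_adj_mono {X' : Finset ℂ} (h : X' ⊆ X) {a b : ℂ}
    (hab : (bondGraph δ X').graph.Adj a b) : (bondGraph δ X).graph.Adj a b :=
  ⟨h hab.1, h hab.2.1, hab.2.2⟩

lemma drawing_mono {X' : Finset ℂ} (h : X' ⊆ X) : (bondGraph δ X').drawing ⊆ (bondGraph δ X).drawing := by
  intro z hz
  rcases PlaneGraph.mem_drawing_iff.1 hz with hz | ⟨a, b, hab, hz⟩
  · exact Or.inl (h hz)
  · exact PlaneGraph.mem_drawing_iff.2 (Or.inr ⟨a, b, bondGraph_adj_mono h hab, hz⟩)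

/-- A face whose closure contains no removed vertex has the same perimeter before and after. -/
lemma facePer_eq_of_closure {X' : Finset ℂ} (h : X' ⊆ X) {f : Set ℂ}
    (hf : ∀ x ∈ X, x ∈ closure f → x ∈ X') :
    (bondGraph δ X).facePer f = (bondGraph δ X').facePer f := by
  have key : ∀ e, (seg e ⊆ closure f) → (e ∈ (bondGraph δ X).Ed ↔ e ∈ (bondGraph δ X').Ed) := by
    intro e he
    induction e using Sym2.ind with
    | _ a b =>
      refine ⟨fun hab => ?_, fun hab => bondGraph_adj_mono h hab⟩
      have hab : (bondGraph δ X).graph.Adj a b := hab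
      exact ⟨hf a hab.1 (he (left_mem_segment ℝ _ _)), hf b hab.2.1 (he (right_mem_segment ℝ _ _)), hab.2.2⟩
  have e1 : (bondGraph δ X).faceEdBd f = (bondGraph δ X').faceEdBd f := by
    ext e
    refine and_congr_left fun he => key e (he.trans ?_)
    exact isClosed_closure.frontier_subset
  have e2 : (bondGraph δ X).faceEdWireInt f = (bondGraph δ X').faceEdWireInt f := by
    ext e
    exact and_congr_left fun he => key e (he.1.trans frontier_subset_closure)
  unfold PlaneGraph.facePer
  rw [e1, e2]

/-- All vertices and edges on the frontier of `f` survive, so `f` remains a component of the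
complement. -/
lemma mem_faces_of_avoids (hδ : δ < 2 / 5) (hX : Separated X) {X' : Finset ℂ} (h : X' ⊆ X) {f : Set ℂ}
    (hff : f ∈ (bondGraph δ X).faces) (hf : ∀ x ∈ X, x ∈ closure f → x ∈ X') :
    f ∈ (bondGraph δ X').faces := by
  have hG := bondGraph_isPlanar hδ hX
  refine ⟨PlaneGraph.comp_eq_of_open_preconnected (PlaneGraph.comps_nonempty hff.1)
    (PlaneGraph.comps_isPreconnected hff.1)
    ((PlaneGraph.comps_subset hff.1).trans (compl_subset_compl.2 (drawing_mono h))) ?_, hff.2⟩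
  intro z hz
  rcases PlaneGraph.mem_drawing_iff.1 (PlaneGraph.frontier_comp_subset hff.1 hz) with hzX | ⟨a, b, hab, hzab⟩
  · exact Or.inl (hf z hzX (frontier_subset_closure hz))
  · have h1 := PlaneGraph.eq_left_of_mem_openSegment hG hab hzab hff.1 (frontier_subset_closure hz)
    have h2 := (PlaneGraph.segment_subset_frontier_comp hG hab hff.1).2 h1
    exact PlaneGraph.mem_drawing_iff.2 (Or.inr ⟨a, b,
      ⟨hf a hab.1 (frontier_subset_closure (h2 (left_mem_segment ℝ _ _))),
        hf b hab.2.1 (frontier_subset_closure (h2 (right_mem_segment ℝ _ _))), hab.2.2⟩, hzab⟩)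

/-- The removed vertices, and the edges at them, lie off the drawing of the remaining graph. -/
lemma segment_subset_compl_drawing (hδ : δ < 2 / 5) (hX : Separated X) {X' : Finset ℂ} (h : X' ⊆ X)
    {a b z : ℂ} (hab : (bondGraph δ X).graph.Adj a b) (ha : a ∉ X') (hz : z ∈ openSegment ℝ a b) :
    segment ℝ z a ⊆ ((bondGraph δ X').drawing)ᶜ := by
  have hG := bondGraph_isPlanar hδ hX
  intro y hy hyD
  have hyab : y ∈ segment ℝ a b := (convex_segment a b).segment_subset
    (openSegment_subset_segment ℝ _ _ hz) (left_mem_segment ℝ _ _) hy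
  have hyb : y ≠ b := by
    rintro rfl
    obtain ⟨t, ht0, ht1, ht⟩ := mem_segment_iff.1 hy
    rw [openSegment_eq_image'] at hz
    obtain ⟨s, ⟨hs0, hs1⟩, rfl⟩ := hz
    have hz2 : (a + s • (y - a)) = a + s * (y - a) := by simp
    simp only [hz2] at ht
    have : ((1 : ℂ) - s * (1 - t)) * (y - a) = 0 := by linear_combination ht
    rcases mul_eq_zero.1 this with h1 | h1
    · have h1' : (1 : ℝ) - s * (1 - t) = 0 := by exact_mod_cast h1
      nlinarith
    · exact hab.ne (sub_eq_zero.1 h1).symm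
  rcases PlaneGraph.mem_drawing_iff.1 hyD with hyX | ⟨c, d, hcd, hycd⟩
  · rcases Sym2.mem_iff.1 (hG.vert y (h hyX) s(a, b) hab hyab) with rfl | rfl
    · exact ha hyX
    · exact hyb rfl
  · have hne : s(a, b) ≠ s(c, d) := by
      intro e
      have : a ∈ s(c, d) := e ▸ Sym2.mem_mk_left _ _
      rcases Sym2.mem_iff.1 this with rfl | rfl
      · exact ha hcd.1
      · exact ha hcd.2.1
    have := (hG.inter _ hab _ (bondGraph_adj_mono h hcd) hne y hyab
      (openSegment_subset_segment ℝ _ _ hycd)).2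
    rcases Sym2.mem_iff.1 this with rfl | rfl
    · exact hcd.ne (left_mem_openSegment_iff.1 hycd)
    · exact hcd.ne (right_mem_openSegment_iff.1 hycd)

lemma notMem_drawing (hδ : δ < 2 / 5) (hX : Separated X) {X' : Finset ℂ} (h : X' ⊆ X) {x : ℂ}
    (hx : x ∈ X) (hx' : x ∉ X') : x ∉ (bondGraph δ X').drawing := by
  have hG := bondGraph_isPlanar hδ hX
  intro hD
  rcases PlaneGraph.mem_drawing_iff.1 hD with hyX | ⟨c, d, hcd, hxcd⟩
  · exact hx' hyX
  · rcases Sym2.mem_iff.1 (hG.vert x hx s(c, d) (bondGraph_adj_mono h hcd)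
      (openSegment_subset_segment ℝ _ _ hxcd)) with rfl | rfl
    · exact hx' hcd.1
    · exact hx' hcd.2.1

/-- Suppose a face `g` of the smaller graph contained a removed vertex. This vertex lies on the
frontier of `O`, so `g` meets the complement of `O`, whose points lie in unbounded components for
`X`. Such a component avoids the smaller drawing, hence lies in `g`, which is bounded. A removed
edge inside `g` would lead to a removed vertex in `g`. Thus `g` avoids the whole old drawing. Its
simple connectedness is inherited, so the smaller graph may be disconnected. -/
lemma faces_subset_of_remove (hδ : δ < 2 / 5) (hX : Separated X) {X' : Finset ℂ} (h : X' ⊆ X)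
    (hc : (bondGraph δ X).Connected) (hDO : (bondGraph δ X).drawing ⊆ (bondGraph δ X).O)
    (hfr : ∀ x ∈ X, x ∉ X' → x ∈ frontier (bondGraph δ X).O) {g : Set ℂ}
    (hg : g ∈ (bondGraph δ X').faces) :
    g ∈ (bondGraph δ X).faces ∧ ∀ x ∈ X, x ∈ closure g → x ∈ X' := by
  have hvert : ∀ x ∈ X, x ∉ X' → x ∉ g := by
    intro x hx hx' hxg
    have hxF := hfr x hx hx'
    rw [frontier_eq_closure_inter_closure] at hxF
    obtain ⟨y, hyg, hyO⟩ := mem_closure_iff.1 hxF.2 g (PlaneGraph.comps_isOpen hg.1) hxg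
    have hyD : y ∉ (bondGraph δ X).drawing := fun hD => hyO (hDO hD)
    obtain ⟨U, hU, hyU⟩ := PlaneGraph.exists_comp hyD
    have hUb : ¬ Bornology.IsBounded U := fun hb =>
      hyO (PlaneGraph.face_subset_O (PlaneGraph.mem_faces_of_isBounded hc hU hb) hyU)
    refine hUb (hg.2.1.subset (PlaneGraph.comps_maximal hg.1 (PlaneGraph.comps_isPreconnected hU) ?_
      ⟨y, hyU, hyg⟩))
    exact (PlaneGraph.comps_subset hU).trans (compl_subset_compl.2 (drawing_mono h))
  have hedge : ∀ a b z, (bondGraph δ X).graph.Adj a b → a ∉ X' → z ∈ openSegment ℝ a b → z ∉ g := by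
    intro a b z hab ha hz hzg
    have := PlaneGraph.comps_maximal hg.1 (convex_segment z a).isPreconnected
      (segment_subset_compl_drawing hδ hX h hab ha hz) ⟨z, left_mem_segment ℝ _ _, hzg⟩
    exact hvert a hab.1 ha (this (right_mem_segment ℝ _ _))
  have hgD : g ⊆ ((bondGraph δ X).drawing)ᶜ := by
    intro z hzg hzD
    have hzD' := PlaneGraph.comps_subset hg.1 hzg
    rcases PlaneGraph.mem_drawing_iff.1 hzD with hzX | ⟨a, b, hab, hzab⟩
    · exact hvert z hzX (fun hzX' => hzD' (Or.inl hzX')) hzg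
    · by_cases ha : a ∈ X'
      · by_cases hb : b ∈ X'
        · exact hzD' (PlaneGraph.mem_drawing_iff.2 (Or.inr ⟨a, b, ⟨ha, hb, hab.2.2⟩, hzab⟩))
        · exact hedge b a z hab.symm hb (by rwa [openSegment_symm]) hzg
      · exact hedge a b z hab ha hzab hzg
  refine ⟨⟨PlaneGraph.comp_eq_of_open_preconnected (PlaneGraph.comps_nonempty hg.1)
    (PlaneGraph.comps_isPreconnected hg.1) hgD
    ((PlaneGraph.frontier_comp_subset hg.1).trans (drawing_mono h)), hg.2⟩, fun x hx hxg => ?_⟩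
  by_contra hx'
  have hxF : x ∈ frontier g := ⟨hxg, fun hi => hvert x hx hx' (interior_subset hi)⟩
  exact notMem_drawing hδ hX h hx hx' (PlaneGraph.frontier_comp_subset hg.1 hxF)

lemma defect_eq_of_remove (hδ : δ < 2 / 5) (hX : Separated X) {X' : Finset ℂ} (h : X' ⊆ X)
    (hc : (bondGraph δ X).Connected) (hDO : (bondGraph δ X).drawing ⊆ (bondGraph δ X).O)
    (hfr : ∀ x ∈ X, x ∉ X' → x ∈ frontier (bondGraph δ X).O)
    (htri : ∀ f ∈ (bondGraph δ X).faces, (bondGraph δ X).facePer f ≠ 3 →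
      ∀ x ∈ X, x ∈ closure f → x ∈ X') :
    (bondGraph δ X).defect = (bondGraph δ X').defect := by
  unfold PlaneGraph.defect
  have hset : {f ∈ (bondGraph δ X).faces | (bondGraph δ X).facePer f ≠ 3} =
      {f ∈ (bondGraph δ X').faces | (bondGraph δ X').facePer f ≠ 3} := by
    ext f
    constructor
    · rintro ⟨hf, hf3⟩
      have ha := htri f hf hf3
      exact ⟨mem_faces_of_avoids hδ hX h hf ha, by rwa [← facePer_eq_of_closure h ha]⟩
    · rintro ⟨hf, hf3⟩
      obtain ⟨hf', ha⟩ := faces_subset_of_remove hδ hX h hc hDO hfr hf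
      exact ⟨hf', by rwa [facePer_eq_of_closure h ha]⟩
  refine finsum_mem_congr hset fun f hf => ?_
  rw [← hset] at hf
  rw [facePer_eq_of_closure h (htri f hf.1 hf.2)]

end SoftDisc

theorem lemma3p2 (δ : ℝ) (hδ₀ : 0 < δ) (hδ₁ : δ < 1 / (2 * Real.sin (Real.pi / 7)) - 1)
    (X X' : Finset ℂ)
    (hE : SoftDisc.energy δ X < ⊤)
    (hconn : (SoftDisc.bondGraph δ X).Connected)
    (hbd : (SoftDisc.bondGraph δ X).HasSimplePolygonalBoundary)
    (hX' : X' = X \ (SoftDisc.bondGraph δ X).bdry)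
    (hne : X'.Nonempty) :
    SoftDisc.shape δ X ≥ SoftDisc.shape δ X' + 6 ∧
    (SoftDisc.shape δ X = SoftDisc.shape δ X' + 6 →
      (∀ x ∈ (SoftDisc.bondGraph δ X).bdry,
        (SoftDisc.bondGraph δ X).innerAngle x =
          (((SoftDisc.bondGraph δ X).IInner x).ncard + ((SoftDisc.bondGraph δ X).IBdry x).ncard
            - 1 : ℝ) * (Real.pi / 3)) ∧
      (∀ x ∈ (SoftDisc.bondGraph δ X).bdry, ∀ e ∈ (SoftDisc.bondGraph δ X).Ed,
        x ∈ e → SoftDisc.len e = 1) ∧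
      (SoftDisc.bondGraph δ X).defect = (SoftDisc.bondGraph δ X').defect) := by
  classical
  open SoftDisc in
  have hδ := delta_lt hδ₁
  have hX := separated_of_energy_lt_top hE
  have hG := bondGraph_isPlanar hδ hX
  obtain ⟨n, p, hB⟩ := PlaneGraph.exists_bounds hG hbd
  have hbX : (bondGraph δ X).bdry ⊆ X := fun x hx => ((PlaneGraph.mem_bdry_iff hG hconn hB).1 hx).1
  have hshape := shape_sub_shape hδ hX hbX
  rw [← hX'] at hshape
  obtain ⟨hle, heq⟩ := touching_bound hδ₀ hδ hX hconn hB
  refine ⟨by linarith, fun h => ?_⟩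
  obtain ⟨hnw, hXO, hrig⟩ := heq (by linarith)
  have hbF : ∀ x ∈ (bondGraph δ X).bdry, x ∈ frontier (bondGraph δ X).O := fun x hx =>
    ((PlaneGraph.mem_bdry_iff hG hconn hB).1 hx).2.resolve_right (not_not.2 (hXO x (hbX hx)))
  refine ⟨fun x hx => ?_, fun x hx e he hxe => ?_, ?_⟩
  · obtain ⟨u, φ, hs⟩ := hB.exists_isSector (hbF x hx)
    have hr := hrig x (hbX hx) u φ hs (hbF x hx)
    have hcard := hr.card_eq hδ₀ hδ hX hs
    rw [PlaneGraph.innerAngle_eq_angleIn, hs.angleIn_eq, ← Nat.cast_add, ← hcard]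
    exact hr.angle
  · obtain ⟨u, φ, hs⟩ := hB.exists_isSector (hbF x hx)
    have hr := hrig x (hbX hx) u φ hs (hbF x hx)
    obtain ⟨b, rfl⟩ := Sym2.mem_iff_exists.1 hxe
    refine hr.len b he ?_
    by_contra hlt
    -- A bond outside the sector would be an exterior wire, and equality excludes wires; so every
    -- bond at `x` is covered by rigidity.
    exact hnw _ ((PlaneGraph.mem_EdWireExt_iff_ang hG hs he).2 (not_le.1 hlt))
  · have hXsub : X' ⊆ X := by rw [hX']; exact Finset.sdiff_subset
    have hmem : ∀ x ∈ X, x ∉ X' → x ∈ (bondGraph δ X).bdry := by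
      intro x hx hx'
      by_contra hb
      exact hx' (by rw [hX']; exact Finset.mem_sdiff.2 ⟨hx, hb⟩)
    refine defect_eq_of_remove hδ hX hXsub hconn ?_ (fun x hx hx' => hbF x (hmem x hx hx')) ?_
    · intro z hz
      rcases PlaneGraph.mem_drawing_iff.1 hz with hzX | ⟨a, b, hab, hzab⟩
      · exact hXO z hzX
      · exact PlaneGraph.mem_O_of_not_wire hG (e := s(a, b)) hab (hnw _)
          (openSegment_subset_segment ℝ _ _ hzab)
    · intro f hf hf3 x hx hxf
      by_contra hx'
      have hxF := hbF x (hmem x hx hx')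
      obtain ⟨u, φ, hs⟩ := hB.exists_isSector hxF
      exact (hrig x hx u φ hs hxF).notMem_closure hδ₀ hδ hX hx hs hf hf3 hxf
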